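/- **Setting.** Let $d\ge 1$ and let $\Omega\subset\mathbb R^d$ be a (bounded) open polytopal set, i.e. the interior of a finite union of convex hulls of finite sets. A *polytopal mesh* $\mathfrak T=(\mathcal M,\mathcal E,(x_K)_{K\in\mathcal M})$ of $\Omega$ consists of: - a finite family $\mathcal M$ of nonempty, pairwise disjoint open polytopal sets $K\subset\Omega$ (cells) with $\overline\Omega=\bigcup_{K}\overline K$; - a finite family $\mathcal E$ of pairwise disjoint faces, each one a nonempty relatively open polytopal subset of a hyperplane, such that $\partial K=\bigcup_{\sigma\in\mathcal E_K}\overline\sigma$ for every $K\in\mathcal M$, where $\mathcal E_K=\{\sigma\in\mathcal E:\sigma\subset\partial K\}$, and such that every $\sigma\in\mathcal E$ is either internal ($\sigma\subset\Omega$, and $\sigma\in\mathcal E_K$ for exactly two cells $K$) or contained in $\partial\Omega$ (and $\sigma\in\mathcal E_K$ for exactly one cell $K$); - a point $x_K\in K$ for each $K\in\mathcal M$ such that $K$ is star-shaped with respect to $x_K$ and $x_K$ lies on no hyperplane spanned by a face $\sigma\in\mathcal E_K$. For $\sigma\in\mathcal E_K$, $D_{K,\sigma}=\{(1-t)x_K+ty:\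 t\in(0,1),\,y\in\sigma\}$ is the open cone with vertex $x_K$ and base $\sigma$, and $d_{K,\sigma}$ is the orthogonal distance from $x_K$ to the hyperplane of $\sigma$. The regularity parameter is $$\varrho_{\mathfrak T}=\max_{K}\mathrm{Card}(\mathcal E_K)+\max_{K}\max_{\sigma\in\mathcal E_K}\frac{\mathrm{diam}(D_{K,\sigma})}{\mathrm{inrad}(D_{K,\sigma})},$$ where $\mathrm{inrad}(D)$ is the supremum of the radii of the balls included in $D$. For $f$ piecewise constant on $\mathcal M$, with value $f_K$ on $K$, set $$|f|_{\mathfrak T}=\Big(\sum_{\sigma\in\mathcal E_{\rm int}}|\sigma|\,d_\sigma\Big|\frac{f_K-f_L}{d_\sigma}\Big|^2\Big)^{1/2},\qquad d_\sigma=d_{K,\sigma}+d_{L,\sigma},$$ where $\mathcal E_{\rm int}$ is the set of internal faces, $K,L$ are the two cells having $\sigma$ as a face, and $|\sigma|$ is the $(d-1)$-dimensional measure of $\sigma$. Let $T>0$, let $\phi_*,\phi^*>0$ and $\Gamma_{\rm div}$ be real numbers, and let $\phi:\Omega\to\mathbb R$ and $V:\Omega\to\mathbb R^d$ satisfy: -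 $\phi_*\le\phi\le\phi^*$ on $\Omega$, and on each $D_{K,\sigma}$ the function $\phi$ is the restriction of a $C^\infty$ function on $\mathbb R^d$; - on each $D_{K,\sigma}$, $V$ is polynomial of degree at most $k$; - $V\in H_{\rm div}(\Omega)$, $|\mathrm{div} V|\le\Gamma_{\rm div}$ a.e. in $\Omega$, and $V\cdot n=0$ on $\partial\Omega$ in the sense of normal traces. A flow of $V/\phi$ is a family of maps $(F_t)_{t\in[-T,T]}$ such that, for a.e. $x\in\Omega$, the map $t\mapsto F_t(x)$ is Lipschitz-continuous from $[-T,T]$ to $\Omega$, $F_0(x)=x$, and, except for at most countably many $t$, $F_t(x)$ belongs to one of the sets $D_{K,\sigma}$ and $$\frac{dF_t(x)}{dt}=\frac{V(F_t(x))}{\phi(F_t(x))}.$$ **Lemma 5.5 (Translation estimate for piecewise-constant functions).** For all $d\ge1$, $k\in\mathbb N$ and $\varrho\in\mathbb R$ there exists $R>0$, depending only on $k$, $d$ and $\varrho$, such that for every polytopal mesh $\mathfrak T$ (of any $\Omega$) with $\varrho_{\mathfrak T}\le\varrho$, every $(\phi,V)$ as above, every $T>0$, every flow $F$ of $V/\phi$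 on $[-T,T]$, every $s\in[-T,T]$ and every $f$ that is piecewise constant on $\mathcal M$, the function $f(F_s)-f$ is integrable on $\Omega$ and $$\|f(F_s)-f\|_{L^1(\Omega)}\le R\,\frac{C_1(T)}{\phi_*}\,|s|\,\|V\|_{L^2(\Omega)}\,|f|_{\mathfrak T},\qquad C_1(T)=\frac{\phi^*}{\phi_*}\exp\Big(\frac{\Gamma_{\rm div}T}{\phi_*}\Big).$$ -/

import Mathlib

open MeasureTheory Set Filter Topology
open scoped ContDiff

noncomputable section

namespace EllamFlow

/-- The Euclidean space `ℝ^d`. -/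
abbrev Sp (d : ℕ) : Type := EuclideanSpace ℝ (Fin d)

/-! ### Polytopal sets and polytopal meshes -/

/-- A closed polytopal set (not necessarily convex): a finite union of convex hulls of finite sets
of points. -/
def IsClosedPolytope {d : ℕ} (P : Set (Sp d)) : Prop :=
  ∃ S : Finset (Finset (Sp d)), P = ⋃ s ∈ S, convexHull ℝ (s : Set (Sp d))

/-- A (bounded) open polytopal set: a polygon if `d = 2`, a polyhedron if `d = 3`. -/
def IsOpenPolytope {d : ℕ} (U : Set (Sp d)) : Prop :=
  ∃ P : Set (Sp d), IsClosedPolytope P ∧ U = interior P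

/-- The hyperplane `{x | n · x = c}`. -/
def hyperplane {d : ℕ} (n : Sp d) (c : ℝ) : Set (Sp d) := {x | inner ℝ n x = c}

/-- A flat polytopal face: a nonempty set which is the interior, relative to some hyperplane, of a
closed polytopal set contained in this hyperplane. -/
def IsPolytopalFace {d : ℕ} (σ : Set (Sp d)) : Prop :=
  σ.Nonempty ∧ ∃ (n : Sp d) (c : ℝ) (P : Set (Sp d)), ‖n‖ = 1 ∧ IsClosedPolytope P ∧
    P ⊆ hyperplane n c ∧ σ = {x | x ∈ hyperplane n c ∧ P ∈ 𝓝[hyperplane n c] x}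

open Classical in
/-- A polytopal mesh `(M, E, P)` of `Ω ⊆ ℝ^d`. The set `E_K` of the faces of a cell `K` is the set
of the faces `σ ∈ E` contained in the boundary of `K`. -/
structure PolytopalMesh {d : ℕ} (Ω : Set (Sp d)) where
  /-- the set `M` of the cells -/
  cells : Finset (Set (Sp d))
  /-- the set `E` of the faces -/
  faces : Finset (Set (Sp d))
  /-- the points `x_K` (the values at sets which are not cells are irrelevant) -/
  center : Set (Sp d) → Sp d
  domain_polytopal : IsOpenPolytope Ω
  cell_polytopal : ∀ K ∈ cells, IsOpenPolytope K
  cell_nonempty : ∀ K ∈ cells, K.Nonempty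
  cell_subset : ∀ K ∈ cells, K ⊆ Ω
  cell_disjoint : ∀ K ∈ cells, ∀ L ∈ cells, K ≠ L → Disjoint K L
  closure_domain : closure Ω = ⋃ K ∈ cells, closure K
  face_polytopal : ∀ σ ∈ faces, IsPolytopalFace σ
  face_disjoint : ∀ σ ∈ faces, ∀ τ ∈ faces, σ ≠ τ → Disjoint σ τ
  /-- the boundary of a cell is covered by its faces -/
  frontier_cell : ∀ K ∈ cells,
    frontier K = ⋃ σ ∈ faces.filter (fun σ => σ ⊆ frontier K), closure σ
  /-- a face is either internal and shared by exactly two cells, or contained in the boundary of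
  `Ω` and a face of exactly one cell -/
  face_location : ∀ σ ∈ faces,
    (σ ⊆ Ω ∧ (cells.filter (fun K => σ ⊆ frontier K)).card = 2) ∨
    (σ ⊆ frontier Ω ∧ (cells.filter (fun K => σ ⊆ frontier K)).card = 1)
  center_mem : ∀ K ∈ cells, center K ∈ K
  /-- each cell `K` is strictly star-shaped with respect to `x_K`: it is star-shaped, and `x_K` lies
  on none of the hyperplanes spanned by the faces of `K` -/
  starConvex : ∀ K ∈ cells, StarConvex ℝ (center K) K
  center_notMem : ∀ K ∈ cells, ∀ σ ∈ faces, σ ⊆ frontier K → center K ∉ affineSpan ℝ σ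

namespace PolytopalMesh

variable {d : ℕ} {Ω : Set (Sp d)} (𝔗 : PolytopalMesh Ω)

open Classical in
/-- The set `E_K` of the faces of `K`. -/
def facesOf (K : Set (Sp d)) : Finset (Set (Sp d)) :=
  𝔗.faces.filter (fun σ => σ ⊆ frontier K)

open Classical in
/-- The set of the cells of which `σ` is a face. -/
def cellsOf (σ : Set (Sp d)) : Finset (Set (Sp d)) :=
  𝔗.cells.filter (fun K => σ ⊆ frontier K)

open Classical in
/-- The set of the internal faces. -/
def interiorFaces : Finset (Set (Sp d)) := 𝔗.faces.filter (fun σ => σ ⊆ Ω)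

/-- `D_{K,σ}`: the open cone with vertex `x_K` and base `σ`. -/
def diamond (K σ : Set (Sp d)) : Set (Sp d) := ⋃ y ∈ σ, openSegment ℝ (𝔗.center K) y

/-- The union of all the (open) elements `D_{K,σ}` of the sub-mesh. -/
def diamondUnion : Set (Sp d) := ⋃ K ∈ 𝔗.cells, ⋃ σ ∈ 𝔗.facesOf K, 𝔗.diamond K σ

/-- `d_{K,σ}`: the orthogonal distance between `x_K` and (the hyperplane spanned by) `σ`. -/
def cellFaceDist (K σ : Set (Sp d)) : ℝ :=
  Metric.infDist (𝔗.center K) (affineSpan ℝ σ : Set (Sp d))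

/-- `d_σ = d_{K,σ} + d_{L,σ}` for an internal face `σ` between the cells `K` and `L`. -/
def faceDist (σ : Set (Sp d)) : ℝ := ∑ K ∈ 𝔗.cellsOf σ, 𝔗.cellFaceDist K σ

end PolytopalMesh

/-- The `(d-1)`-dimensional measure `|σ|` of a face. -/
def faceMeasure {d : ℕ} (σ : Set (Sp d)) : ℝ :=
  (Measure.euclideanHausdorffMeasure (d - 1) : Measure (Sp d)).real σ

/-- The supremum of the radii of the balls included in `D`. -/
def inradius {d : ℕ} (D : Set (Sp d)) : ℝ := sSup {r : ℝ | ∃ x, Metric.ball x r ⊆ D}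

namespace PolytopalMesh

variable {d : ℕ} {Ω : Set (Sp d)} (𝔗 : PolytopalMesh Ω)

/-- The regularity parameter
`max_K Card(E_K) + max_K max_{σ ∈ E_K} diam(D_{K,σ}) / inrad(D_{K,σ})`. -/
def regularity : ℝ :=
  (⨆ K : 𝔗.cells, ((𝔗.facesOf K).card : ℝ)) +
    ⨆ K : 𝔗.cells, ⨆ σ : 𝔗.facesOf K,
      Metric.diam (𝔗.diamond K σ) / inradius (𝔗.diamond K σ)

/-- The functions that are constant on each cell (values outside the cells are irrelevant). -/
def IsPiecewiseConstant (f : Sp d → ℝ) : Prop := ∀ K ∈ 𝔗.cells, ∃ c : ℝ, ∀ x ∈ K, f x = c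

/-- The constant value `f_K` of a piecewise-constant function on the cell `K`. -/
def cellValue (f : Sp d → ℝ) (K : Set (Sp d)) : ℝ := f (𝔗.center K)

/-- The discrete `H^1` seminorm
`(∑_{σ internal} |σ| d_σ |(f_K - f_L) / d_σ|^2)^(1/2)`, with `K`, `L` the two cells of which `σ` is
a face. In the inner double sum over the cells of `σ` the pair `{K, L}` is counted twice, and the
pairs `(K, K)` contribute zero. -/
def seminorm (f : Sp d → ℝ) : ℝ :=
  Real.sqrt (∑ σ ∈ 𝔗.interiorFaces, (1 / 2) * ∑ K ∈ 𝔗.cellsOf σ, ∑ L ∈ 𝔗.cellsOf σ,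
    faceMeasure σ * 𝔗.faceDist σ *
      |(𝔗.cellValue f K - 𝔗.cellValue f L) / 𝔗.faceDist σ| ^ 2)

/-- `φ` is piecewise smooth on the sub-mesh `(D_{K,σ})`, up to the boundary of each element. -/
def IsPiecewiseSmooth (φ : Sp d → ℝ) : Prop :=
  ∀ K ∈ 𝔗.cells, ∀ σ ∈ 𝔗.facesOf K,
    ∃ ψ : Sp d → ℝ, ContDiff ℝ ∞ ψ ∧ EqOn φ ψ (𝔗.diamond K σ)

/-- `V` is a piecewise polynomial vector field of degree at most `k` on the sub-mesh
`(D_{K,σ})`. -/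
def IsPiecewisePolynomial (k : ℕ) (V : Sp d → Sp d) : Prop :=
  ∀ K ∈ 𝔗.cells, ∀ σ ∈ 𝔗.facesOf K, ∃ p : Fin d → MvPolynomial (Fin d) ℝ,
    (∀ i, (p i).totalDegree ≤ k) ∧
    ∀ x ∈ 𝔗.diamond K σ, ∀ i, V x i = MvPolynomial.eval (fun j => x j) (p i)

end PolytopalMesh

/-! ### Vector fields in `H_div` -/

/-- `V ∈ H_div(Ω)` with divergence `g`: both are square integrable on `Ω`, and `g` is the
divergence of `V` in the sense of distributions (`fderiv ℝ ψ x (V x)` is `∇ψ(x) · V(x)`). -/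
def IsHdivWith {d : ℕ} (Ω : Set (Sp d)) (V : Sp d → Sp d) (g : Sp d → ℝ) : Prop :=
  MemLp V 2 (volume.restrict Ω) ∧ MemLp g 2 (volume.restrict Ω) ∧
  ∀ ψ : Sp d → ℝ, ContDiff ℝ ∞ ψ → HasCompactSupport ψ → tsupport ψ ⊆ Ω →
    ∫ x in Ω, fderiv ℝ ψ x (V x) = - ∫ x in Ω, ψ x * g x

/-- `V · n = 0` on `∂Ω` for a field `V ∈ H_div(Ω)` with divergence `g`: the normal trace, defined by
Green's formula with test functions that are smooth up to the boundary of `Ω`, vanishes. -/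
def HasZeroNormalTrace {d : ℕ} (Ω : Set (Sp d)) (V : Sp d → Sp d) (g : Sp d → ℝ) : Prop :=
  ∀ ψ : Sp d → ℝ, ContDiff ℝ ∞ ψ → HasCompactSupport ψ →
    (∫ x in Ω, fderiv ℝ ψ x (V x)) + ∫ x in Ω, ψ x * g x = 0

/-- The standing assumptions on `(φ, V)`, on the sub-mesh made of the `D_{K,σ}`: `φ` is piecewise
smooth with `φ_* ≤ φ ≤ φ^*`, and `V ∈ H_div(Ω)` is piecewise polynomial (of degree at most `k`) with
`|div V| ≤ Γ` and `V · n = 0` on `∂Ω`. -/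
structure IsAdmissible {d : ℕ} {Ω : Set (Sp d)} (𝔗 : PolytopalMesh Ω) (k : ℕ)
    (φlow φup Γ : ℝ) (φ : Sp d → ℝ) (V : Sp d → Sp d) : Prop where
  low_pos : 0 < φlow
  up_pos : 0 < φup
  bounds : ∀ x ∈ Ω, φlow ≤ φ x ∧ φ x ≤ φup
  smooth : 𝔗.IsPiecewiseSmooth φ
  polynomial : 𝔗.IsPiecewisePolynomial k V
  div : ∃ g : Sp d → ℝ, IsHdivWith Ω V g ∧ (∀ᵐ x ∂(volume.restrict Ω), |g x| ≤ Γ) ∧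
    HasZeroNormalTrace Ω V g

/-! ### The flow -/

/-- `F` is a flow of `V / φ` on `[-T, T]`: for almost every `x ∈ Ω`, `t ↦ F_t(x)` is a
Lipschitz-continuous curve in `Ω` with `F_0(x) = x` which solves `dF_t(x)/dt = V(F_t(x)) / φ(F_t(x))`
except at an at most countable number of times. `V` and `φ` being piecewise defined, the equation at
time `t` is meant with `F_t(x)` inside an element of the mesh; `G` is the union of the (open)
elements. -/
def IsFlow {d : ℕ} (Ω G : Set (Sp d)) (φ : Sp d → ℝ) (V : Sp d → Sp d) (T : ℝ)
    (F : ℝ → Sp d → Sp d) : Prop :=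
  ∀ᵐ x ∂(volume.restrict Ω),
    F 0 x = x ∧
    (∀ t ∈ Icc (-T) T, F t x ∈ Ω) ∧
    (∃ L, LipschitzOnWith L (fun t => F t x) (Icc (-T) T)) ∧
    ∃ N : Set ℝ, N.Countable ∧ ∀ t ∈ Ioo (-T) T \ N, F t x ∈ G ∧
      HasDerivAt (fun τ => F τ x) ((φ (F t x))⁻¹ • V (F t x)) t

/-- `C_1(T) = (φ^* / φ_*) exp(Γ T / φ_*)`. -/
def flowConst (φlow φup Γ T : ℝ) : ℝ := φup / φlow * Real.exp (Γ * T / φlow)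

end EllamFlow

end

noncomputable section

namespace EllamFlow

/-! ### Mean value inequalities with countably many exceptional points -/

section MeanValue

variable {E : Type*} [NormedAddCommGroup E] [NormedSpace ℝ E] [CompleteSpace E]

/-! Negative times reduce to positive ones by reversing V. For s > 0, the interval [0, s] is cut
into n steps of length h. The difference f(F_s) − f telescopes, and in one step the value of f
changes only if the trajectory crosses a face. If the normal speed near the face σ is at most v_σ, a
trajectory crossing σ within time h starts in the prism of half-height about h v_σ over σ, of volume
about 2 h v_σ |σ|. The points whose position at time jh lies in this prism have at most C_1(T) times
that measure. Adding the n steps bounds the L¹ norm by C_1(T) s times the sum over σ of 2 |f_K −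
f_L| v_σ |σ|, up to errors that vanish with h; this is
`PiecewiseField.Separates.lintegral_translation_le`. The argument fails only for starting points too
close to a hyperplane of the arrangement that cuts out the elements, or close to two of them; they
have measure at most ηh per step (`exists_volume_bad_le`), with η arbitrary.

Three facts carry this argument.

Compression. The set `reach t A` of the starting points of all trajectories that are in A at time t
has outer measure at most (φ^*/φ_*) exp(Γ t/φ_*) times that of A (`volume_reach_le`). Neither
uniqueness of trajectories nor measurability is used. For the measure of density φ it is enough that
one step multiplies the mass by at most 1 + (Γ/φ_* + η)h, up to an additive error ηh
(`exists_mass_reach_step_le`); the discrete Gronwall inequality does the rest. When the target lies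
inside a smooth piece, this is a first-order expansion of the backward flow, whose Jacobian and
change of density combine into the divergence of V. Targets within O(h) of the hyperplanes have
total mass O(h), so a factor 1 + θ with small θ suffices for them. It is obtained in a piecewise
affine chart (`shear`, `exists_chart`) in which nearby trajectories are almost translates of each
other even when they cross the interface. Continuity of the normal flux is the key: the shear which
carries the velocity on one side to the velocity on the other side has for Jacobian the ratio of the
two densities, so the same chart straightens the flow and turns the mass into almost a multiple of
Lebesgue measure. Where the normal velocity is too small to define this shear, trajectories starting
at distance more than δh from the interface do not cross it.

Normal velocities. V·n is continuous across interfaces, by a blow-up of Green's formula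
(`HasZeroNormalTrace.inner_eq`). It is polynomial on each element, so an inverse inequality bounds
it on σ by the L² norm of V on the two cones based on σ (`exists_flux_bound`).

Summation. |σ| d_σ is controlled by the volume of these cones, and the Cauchy–Schwarz inequality
produces the norm of V and the discrete seminorm (`sum_jump_mul_flux_le`). -/

theorem intervalIntegrable_deriv_of_bounded_off_countable {u : ℝ → E} {a b C : ℝ} (hab : a ≤ b)
    {N : Set ℝ} (hN : N.Countable)
    (hd : ∀ t ∈ Ioo a b \ N, DifferentiableAt ℝ u t ∧ ‖deriv u t‖ ≤ C) :
    IntervalIntegrable (deriv u) volume a b := by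
  rw [intervalIntegrable_iff_integrableOn_Ioo_of_le hab]
  refine ⟨(stronglyMeasurable_deriv u).aestronglyMeasurable, ?_⟩
  refine HasFiniteIntegral.restrict_of_bounded (C := C) measure_Ioo_lt_top ?_
  rw [ae_restrict_iff' measurableSet_Ioo]
  filter_upwards [hN.ae_notMem volume] with t ht htI using (hd t ⟨htI, ht⟩).2

theorem norm_sub_le_of_hasDerivAt_off_countable {u : ℝ → E} {a b C : ℝ} (hab : a ≤ b)
    (hu : ContinuousOn u (Icc a b)) {N : Set ℝ} (hN : N.Countable)
    (hd : ∀ t ∈ Ioo a b \ N, ∃ u', HasDerivAt u u' t ∧ ‖u'‖ ≤ C) :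
    ‖u b - u a‖ ≤ C * (b - a) := by
  have hd' : ∀ t ∈ Ioo a b \ N, DifferentiableAt ℝ u t ∧ ‖deriv u t‖ ≤ C := by
    intro t ht
    obtain ⟨u', h1, h2⟩ := hd t ht
    exact ⟨h1.differentiableAt, by rwa [h1.deriv]⟩
  rw [← integral_eq_of_hasDerivAt_off_countable_of_le u (deriv u) hab hN hu
    (fun t ht => (hd' t ht).1.hasDerivAt)
    (intervalIntegrable_deriv_of_bounded_off_countable hab hN hd')]
  have := intervalIntegral.norm_integral_le_of_norm_le_const_ae (a := a) (b := b) (f := deriv u)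
    (C := C) ?_
  · rwa [abs_of_nonneg (sub_nonneg.2 hab)] at this
  · filter_upwards [hN.ae_notMem volume, (countable_singleton b).ae_notMem volume] with t ht htb htI
    rw [uIoc_of_le hab] at htI
    exact (hd' t ⟨⟨htI.1, lt_of_le_of_ne htI.2 htb⟩, ht⟩).2

theorem mul_sub_le_of_hasDerivAt_off_countable {u : ℝ → ℝ} {a b c C : ℝ} (hab : a ≤ b)
    (hu : ContinuousOn u (Icc a b)) {N : Set ℝ} (hN : N.Countable)
    (hd : ∀ t ∈ Ioo a b \ N, ∃ u', HasDerivAt u u' t ∧ c ≤ u' ∧ u' ≤ C) :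
    c * (b - a) ≤ u b - u a := by
  -- Subtracting the mean slope (c + C)/2 turns the two-sided bound on the derivative into a bound
  -- (C − c)/2 on its absolute value.
  have key := norm_sub_le_of_hasDerivAt_off_countable (u := fun t => u t - (c + C) / 2 * t)
    (C := (C - c) / 2) hab (hu.sub (by fun_prop)) hN (by
      intro t ht
      obtain ⟨u', h1, h2, h3⟩ := hd t ht
      refine ⟨u' - (c + C) / 2, ?_, ?_⟩
      · have h4 := h1.sub ((hasDerivAt_id t).const_mul ((c + C) / 2))
        rw [mul_one] at h4
        exact h4
      · rw [Real.norm_eq_abs, abs_le]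
        constructor <;> linarith)
  rw [Real.norm_eq_abs, abs_le] at key
  nlinarith [key.1]

end MeanValue

/-- If the oscillation of `u` is at most a small multiple of its supremum, then `u` is nearly
constant compared with its endpoint values. -/
theorem norm_sub_le_of_osc_le {E : Type*} [NormedAddCommGroup E] {u : ℝ → E} {h θ : ℝ} (hh : 0 ≤ h) (hθ : θ ≤ 1 / 2)
    (hθ0 : 0 ≤ θ) (hu : ContinuousOn u (Icc 0 h))
    (hosc : ∀ S, 0 ≤ S → (∀ t ∈ Icc 0 h, ‖u t‖ ≤ S) → ∀ s ∈ Icc 0 h, ∀ t ∈ Icc 0 h, s ≤ t →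
      ‖u t - u s‖ ≤ θ * S) (r : ℝ) (hr : r ∈ Icc 0 h) :
    (∀ t ∈ Icc 0 h, ‖u t‖ ≤ 2 * ‖u r‖) ∧
    ∀ s ∈ Icc 0 h, ∀ t ∈ Icc 0 h, ‖u t - u s‖ ≤ 2 * θ * ‖u r‖ := by
  obtain ⟨t₀, ht₀, hmax⟩ := isCompact_Icc.exists_isMaxOn (nonempty_Icc.2 hh) hu.norm
  have hmax' : ∀ t ∈ Icc 0 h, ‖u t‖ ≤ ‖u t₀‖ := fun t ht => hmax ht
  have hosc' : ∀ s ∈ Icc 0 h, ∀ t ∈ Icc 0 h, ‖u t - u s‖ ≤ θ * ‖u t₀‖ := by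
    intro s hs t ht
    rcases le_total s t with h1 | h1
    · exact hosc _ (norm_nonneg _) hmax' s hs t ht h1
    · rw [norm_sub_rev]; exact hosc _ (norm_nonneg _) hmax' t ht s hs h1
  -- The oscillation hypothesis is applied with S equal to the maximum itself; since θ ≤ 1/2, the
  -- term θ‖u t₀‖ is absorbed.
  have h1 : ‖u t₀‖ ≤ 2 * ‖u r‖ := by
    have h2 := hosc' r hr t₀ ht₀
    have h3 : ‖u t₀‖ ≤ ‖u t₀ - u r‖ + ‖u r‖ := by
      simpa using norm_add_le (u t₀ - u r) (u r)
    have h4 : 0 ≤ ‖u t₀‖ := norm_nonneg _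
    nlinarith
  refine ⟨fun t ht => (hmax' t ht).trans h1, fun s hs t ht => (hosc' s hs t ht).trans ?_⟩
  nlinarith

/-! ### Lebesgue measure of images, slabs and prisms -/

section Volume

variable {d : ℕ}

/-- The hypothesis makes the relation the graph of a K-Lipschitz function of the second coordinate,
and such a function multiplies d-dimensional Hausdorff measure by at most K^d. This is an inequality
of outer measures: sets of endpoints of trajectories are not known to be measurable. -/
theorem volume_fst_image_le (Rel : Set (Sp d × Sp d)) {K : ℝ}
    (hRel : ∀ p ∈ Rel, ∀ q ∈ Rel, ‖p.1 - q.1‖ ≤ K * ‖p.2 - q.2‖) :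
    volume (Prod.fst '' Rel) ≤ ENNReal.ofReal K ^ d * volume (Prod.snd '' Rel) := by
  classical
  have hch : ∀ z : Sp d, ∃ y : Sp d, z ∈ Prod.snd '' Rel → (y, z) ∈ Rel := by
    intro z
    by_cases hz : z ∈ Prod.snd '' Rel
    · obtain ⟨p, hp, rfl⟩ := hz
      exact ⟨p.1, fun _ => hp⟩
    · exact ⟨0, fun h => (hz h).elim⟩
  choose f hf using hch
  have himg : Prod.fst '' Rel ⊆ f '' (Prod.snd '' Rel) := by
    rintro _ ⟨p, hp, rfl⟩
    refine ⟨p.2, ⟨p, hp, rfl⟩, ?_⟩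
    have h1 := hRel _ (hf p.2 ⟨p, hp, rfl⟩) _ hp
    simp only [sub_self, norm_zero, mul_zero, norm_le_zero_iff, sub_eq_zero] at h1
    exact h1
  have hlip : LipschitzOnWith K.toNNReal f (Prod.snd '' Rel) := by
    refine LipschitzOnWith.of_dist_le_mul fun x hx y hy => ?_
    rw [dist_eq_norm, dist_eq_norm]
    refine (hRel _ (hf x hx) _ (hf y hy)).trans ?_
    gcongr
    exact Real.le_coe_toNNReal K
  refine (measure_mono himg).trans ?_
  rw [← EuclideanSpace.euclideanHausdorffMeasure_eq_volume,
    Measure.euclideanHausdorffMeasure_def, Measure.smul_apply, Measure.smul_apply]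
  have := hlip.hausdorffMeasure_image_le (d := d) (by positivity)
  rw [ENNReal.rpow_natCast] at this
  rw [ENNReal.smul_def, ENNReal.smul_def, smul_eq_mul, smul_eq_mul, mul_left_comm]
  gcongr
  exact this

/-- Fubini for the translates S + te, 0 ≤ t ≤ 1: all of them lie in S', and since n·e = 1 a given
point belongs to the translates for a set of times t of length at most 2a. -/
theorem volume_le_of_slab {S S' : Set (Sp d)} (hS : MeasurableSet S)
    {n e : Sp d} (hne : inner ℝ n e = (1 : ℝ)) {c a : ℝ}
    (hSc : ∀ x ∈ S, |inner ℝ n x - c| ≤ a)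
    (hS' : ∀ x ∈ S, ∀ t ∈ Icc (0 : ℝ) 1, x + t • e ∈ S') :
    volume S ≤ ENNReal.ofReal (2 * a) * volume S' := by
  have h1 : volume S = ∫⁻ t in Icc (0 : ℝ) 1, volume {x | x - t • e ∈ S} := by
    have : ∀ t : ℝ, volume {x : Sp d | x - t • e ∈ S} = volume S := by
      intro t
      have := measure_preimage_add_right volume (-(t • e)) S
      simp only [← sub_eq_add_neg] at this
      exact this
    simp [this]
  have hm : MeasurableSet {p : ℝ × Sp d | p.2 - p.1 • e ∈ S} :=
    hS.preimage (by fun_prop)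
  have h2 : ∫⁻ t in Icc (0 : ℝ) 1, volume {x : Sp d | x - t • e ∈ S} =
      ∫⁻ x, (volume.restrict (Icc (0 : ℝ) 1)) {t : ℝ | x - t • e ∈ S} :=
    (Measure.prod_apply hm).symm.trans (Measure.prod_apply_symm hm)
  rw [h1, h2]
  have h3 : ∀ x : Sp d, (volume.restrict (Icc (0 : ℝ) 1)) {t : ℝ | x - t • e ∈ S} ≤
      (toMeasurable volume S').indicator (fun _ => ENNReal.ofReal (2 * a)) x := by
    intro x
    have hmt : MeasurableSet {t : ℝ | x - t • e ∈ S} := hS.preimage (by fun_prop)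
    rw [Measure.restrict_apply hmt]
    by_cases hx : x ∈ toMeasurable volume S'
    · rw [indicator_of_mem hx]
      have : {t : ℝ | x - t • e ∈ S} ∩ Icc 0 1 ⊆
          Icc (inner ℝ n x - c - a) (inner ℝ n x - c + a) := by
        rintro t ⟨ht, -⟩
        have := hSc _ ht
        rw [inner_sub_right, inner_smul_right, hne, mul_one, abs_le] at this
        constructor <;> linarith [this.1, this.2]
      refine (measure_mono this).trans ?_
      rw [Real.volume_Icc]
      apply ENNReal.ofReal_le_ofReal
      linarith
    · rw [indicator_of_notMem hx]
      have : {t : ℝ | x - t • e ∈ S} ∩ Icc 0 1 = ∅ := by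
        by_contra hne
        obtain ⟨t, ht, htI⟩ := nonempty_iff_ne_empty.2 hne
        apply hx
        apply subset_toMeasurable
        have := hS' _ ht t htI
        simpa using this
      rw [this]; simp
  refine (lintegral_mono h3).trans ?_
  rw [lintegral_indicator (measurableSet_toMeasurable _ _), setLIntegral_const,
    measure_toMeasurable]

/-- Fubini in the direction n: the slice at a level in [c − a, c + a] is a translate of σ, the other
slices are empty. -/
theorem volume_prism {n : Sp d} (hn : ‖n‖ = 1) {c : ℝ} {σ : Set (Sp d)}
    (hσ : MeasurableSet σ) (hσc : σ ⊆ hyperplane n c) (a : ℝ) :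
    volume {x : Sp d | |inner ℝ n x - c| ≤ a ∧ x - (inner ℝ n x - c) • n ∈ σ} =
      ENNReal.ofReal (2 * a) * (Measure.euclideanHausdorffMeasure (d - 1) : Measure (Sp d)) σ := by
  have hn0 : n ≠ 0 := by rintro rfl; simp at hn
  set t := {x : Sp d | |inner ℝ n x - c| ≤ a ∧ x - (inner ℝ n x - c) • n ∈ σ} with ht
  have hnn : inner ℝ n n = (1 : ℝ) := by rw [real_inner_self_eq_norm_sq, hn]; norm_num
  have htm : MeasurableSet t := by
    refine MeasurableSet.inter ?_ ?_
    · exact measurableSet_le (f := fun x : Sp d => |inner ℝ n x - c|) (g := fun _ => a)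
        (by fun_prop) measurable_const
    · exact hσ.preimage (by fun_prop)
  have key := EuclideanGeometry.euclideanHausdorffMeasure_eq_lintegral (V := Sp d) (P := Sp d) 0 hn0 htm
  rw [finrank_euclideanSpace_fin, EuclideanSpace.euclideanHausdorffMeasure_eq_volume] at key
  rw [key]
  have hsec : ∀ x : ℝ, (Measure.euclideanHausdorffMeasure (d - 1) : Measure (Sp d))
      (t ∩ (AffineSubspace.mk' (x • n +ᵥ (0 : Sp d)) (ℝ ∙ n)ᗮ : Set (Sp d))) =
      (Icc (c - a) (c + a)).indicator
        (fun _ => (Measure.euclideanHausdorffMeasure (d - 1) : Measure (Sp d)) σ) x := by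
    intro x
    have hmem : ∀ y : Sp d, y ∈ AffineSubspace.mk' (x • n +ᵥ (0 : Sp d)) (ℝ ∙ n)ᗮ ↔
        inner ℝ n y = x := by
      intro y
      rw [AffineSubspace.mem_mk', Submodule.mem_orthogonal_singleton_iff_inner_right]
      simp only [vadd_eq_add, add_zero, vsub_eq_sub, inner_sub_right, inner_smul_right, hnn, mul_one]
      exact sub_eq_zero
    by_cases hx : x ∈ Icc (c - a) (c + a)
    · rw [indicator_of_mem hx]
      have : t ∩ (AffineSubspace.mk' (x • n +ᵥ (0 : Sp d)) (ℝ ∙ n)ᗮ : Set (Sp d)) =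
          (fun y => y + (x - c) • n) '' σ := by
        ext y
        simp only [mem_inter_iff, SetLike.mem_coe, hmem, ht, mem_ofPred_eq, mem_image]
        constructor
        · rintro ⟨⟨h1, h2⟩, h3⟩
          exact ⟨_, h2, by rw [h3]; abel⟩
        · rintro ⟨z, hz, rfl⟩
          have hzc : inner ℝ n z = c := hσc hz
          have h3 : inner ℝ n (z + (x - c) • n) = x := by
            rw [inner_add_right, inner_smul_right, hnn, hzc]; ring
          refine ⟨⟨?_, ?_⟩, h3⟩
          · rw [h3, abs_le]; constructor <;> linarith [hx.1, hx.2]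
          · rw [h3]; simpa using hz
      rw [this]
      exact (isometry_add_right ((x - c) • n)).euclideanHausdorffMeasure_image σ
    · rw [indicator_of_notMem hx]
      have : t ∩ (AffineSubspace.mk' (x • n +ᵥ (0 : Sp d)) (ℝ ∙ n)ᗮ : Set (Sp d)) = ∅ := by
        ext y
        simp only [mem_inter_iff, SetLike.mem_coe, hmem, ht, mem_ofPred_eq, mem_empty_iff_false,
          iff_false]
        rintro ⟨⟨h1, h2⟩, h3⟩
        apply hx
        rw [h3, abs_le] at h1
        constructor <;> linarith [h1.1, h1.2]
      rw [this]; simp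
  have h1 : ‖n‖ₑ = 1 := by
    rw [← ofReal_norm, hn]; simp
  simp_rw [hsec]
  rw [lintegral_indicator measurableSet_Icc, setLIntegral_const, Real.volume_Icc, h1, one_mul, mul_comm]
  congr 2
  ring

end Volume
end EllamFlow

namespace EllamFlow

/-! ### Volumes of slabs around hyperplanes -/

section Slabs

variable {d : ℕ}

theorem measurableSet_slab (n : Sp d) (c a : ℝ) :
    MeasurableSet {x : Sp d | |inner ℝ n x - c| ≤ a} :=
  measurableSet_le (f := fun x : Sp d => |inner ℝ n x - c|) (g := fun _ => a)
    (by fun_prop) measurable_const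

theorem measurableSet_below (n : Sp d) (c : ℝ) : MeasurableSet {x : Sp d | inner ℝ n x < c} :=
  measurableSet_lt (f := fun x : Sp d => inner ℝ n x) (g := fun _ => c)
    (by fun_prop) measurable_const

theorem exists_volume_slab_le {n : Sp d} (hn : ‖n‖ = 1) (R : ℝ) :
    ∃ C, 0 ≤ C ∧ ∀ c a : ℝ, volume (Metric.ball (0 : Sp d) R ∩ {x | |inner ℝ n x - c| ≤ a}) ≤
      ENNReal.ofReal (C * a) := by
  have hnn : inner ℝ n n = (1 : ℝ) := by rw [real_inner_self_eq_norm_sq, hn]; norm_num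
  refine ⟨2 * volume.real (Metric.ball (0 : Sp d) (R + 1)), by positivity, fun c a => ?_⟩
  refine (volume_le_of_slab (S' := Metric.ball (0 : Sp d) (R + 1))
    (Metric.isOpen_ball.measurableSet.inter (measurableSet_slab n c a)) hnn (c := c) (a := a)
    (fun x hx => hx.2) ?_).trans ?_
  · intro x hx t ht
    have h1 : ‖x‖ < R := by simpa using hx.1
    have h2 : ‖t • n‖ ≤ 1 := by
      rw [norm_smul, hn, mul_one, Real.norm_eq_abs, abs_of_nonneg ht.1]; exact ht.2
    have := norm_add_le x (t • n)
    simp only [Metric.mem_ball, dist_zero_right]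
    linarith
  · rw [mul_right_comm, ENNReal.ofReal_mul' measureReal_nonneg, measureReal_def,
      ENNReal.ofReal_toReal (Metric.isBounded_ball.measure_lt_top.ne)]

theorem volume_hyperplane {n : Sp d} (hn : ‖n‖ = 1) (c : ℝ) : volume (hyperplane n c) = 0 := by
  have h : hyperplane n c ⊆ ⋃ k : ℕ, (Metric.ball (0 : Sp d) k ∩ {x | |inner ℝ n x - c| ≤ 0}) := by
    intro x hx
    obtain ⟨k, hk⟩ := exists_nat_gt ‖x‖
    refine mem_iUnion.2 ⟨k, by simpa using hk, ?_⟩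
    have hx' : inner ℝ n x = c := hx
    simp [hx']
  refine measure_mono_null h (measure_iUnion_null fun k => ?_)
  obtain ⟨C, -, hC⟩ := exists_volume_slab_le hn (k : ℝ)
  simpa using hC c 0

/-- Parallel distinct hyperplanes have disjoint slabs once the widths are less than a third of the
gap or so. Otherwise there is e with n·e = 1 and n'·e = 0: sliding along e stays in the second slab,
and `volume_le_of_slab` gains the factor a on top of the volume O(b) of that slab. The product ab is
what makes the neighbourhoods of intersections negligible compared with one width. -/
theorem exists_volume_double_slab_le {n n' : Sp d} (hn : ‖n‖ = 1) (hn' : ‖n'‖ = 1) {c c' : ℝ}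
    (hne : hyperplane n c ≠ hyperplane n' c') (R : ℝ) :
    ∃ C a₀, 0 ≤ C ∧ 0 < a₀ ∧ ∀ a b : ℝ, 0 ≤ a → 0 ≤ b → a ≤ a₀ → b ≤ a₀ →
      volume (Metric.ball (0 : Sp d) R ∩ {x | |inner ℝ n x - c| ≤ a} ∩
        {x | |inner ℝ n' x - c'| ≤ b}) ≤ ENNReal.ofReal (C * a * b) := by
  have hnn : inner ℝ n n = (1 : ℝ) := by rw [real_inner_self_eq_norm_sq, hn]; norm_num
  have hnn' : inner ℝ n' n' = (1 : ℝ) := by rw [real_inner_self_eq_norm_sq, hn']; norm_num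
  have hcomm : inner ℝ n' n = (inner ℝ n n' : ℝ) := real_inner_comm _ _
  set t : ℝ := inner ℝ n n' with ht
  by_cases ht1 : t = 1
  · have hnn2 : n = n' := (inner_eq_one_iff_of_norm_eq_one hn hn').1 ht1
    subst hnn2
    have hcc : c ≠ c' := by rintro rfl; exact hne rfl
    have hpos : 0 < |c - c'| := abs_pos.2 (sub_ne_zero.2 hcc)
    refine ⟨0, |c - c'| / 3, le_rfl, by positivity, fun a b ha hb ha' hb' => ?_⟩
    rw [show (Metric.ball (0 : Sp d) R ∩ {x | |inner ℝ n x - c| ≤ a} ∩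
        {x | |inner ℝ n x - c'| ≤ b}) = ∅ from ?_]
    · simp
    · refine eq_empty_of_forall_notMem fun x hx => ?_
      have h1 : |inner ℝ n x - c| ≤ a := hx.1.2
      have h2 : |inner ℝ n x - c'| ≤ b := hx.2
      have h3 := abs_sub ((inner ℝ n x : ℝ) - c') ((inner ℝ n x : ℝ) - c)
      rw [show (inner ℝ n x : ℝ) - c' - ((inner ℝ n x : ℝ) - c) = c - c' by ring] at h3
      linarith
  by_cases ht2 : t = -1
  · have hnn2 : n = -n' := by
      refine (inner_eq_one_iff_of_norm_eq_one (𝕜 := ℝ) hn (by rwa [norm_neg])).1 ?_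
      rw [inner_neg_right, ← ht, ht2]; norm_num
    have hcc : c ≠ -c' := by
      rintro rfl
      apply hne
      ext x
      simp [hyperplane, hnn2, inner_neg_left]
    have hpos : 0 < |c + c'| := abs_pos.2 (by contrapose! hcc; linarith)
    refine ⟨0, |c + c'| / 3, le_rfl, by positivity, fun a b ha hb ha' hb' => ?_⟩
    rw [show (Metric.ball (0 : Sp d) R ∩ {x | |inner ℝ n x - c| ≤ a} ∩
        {x | |inner ℝ n' x - c'| ≤ b}) = ∅ from ?_]
    · simp
    · refine eq_empty_of_forall_notMem fun x hx => ?_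
      have h1 : |inner ℝ n x - c| ≤ a := hx.1.2
      have h2 : |inner ℝ n' x - c'| ≤ b := hx.2
      rw [hnn2, inner_neg_left] at h1
      have h3 := abs_add_le (-(inner ℝ n' x : ℝ) - c) ((inner ℝ n' x : ℝ) - c')
      rw [show -(inner ℝ n' x : ℝ) - c + ((inner ℝ n' x : ℝ) - c') = -(c + c') by ring, abs_neg] at h3
      linarith
  have ht3 : 1 - t ^ 2 ≠ 0 := by
    intro h
    have : (t - 1) * (t + 1) = 0 := by linarith
    rcases mul_eq_zero.1 this with h | h
    · exact ht1 (by linarith)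
    · exact ht2 (by linarith)
  set e : Sp d := (1 - t ^ 2)⁻¹ • (n - t • n') with he
  have hne1 : inner ℝ n e = (1 : ℝ) := by
    rw [he, inner_smul_right, inner_sub_right, inner_smul_right, hnn, ← ht,
      show 1 - t * t = 1 - t ^ 2 by ring, inv_mul_cancel₀ ht3]
  have hne2 : inner ℝ n' e = (0 : ℝ) := by
    rw [he, inner_smul_right, inner_sub_right, inner_smul_right, hnn', hcomm]
    ring
  obtain ⟨C, hC0, hC⟩ := exists_volume_slab_le hn' (R + ‖e‖)
  refine ⟨2 * C, 1, by positivity, one_pos, fun a b ha hb _ _ => ?_⟩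
  refine (volume_le_of_slab (S' := Metric.ball (0 : Sp d) (R + ‖e‖) ∩
      {x | |inner ℝ n' x - c'| ≤ b})
    ((Metric.isOpen_ball.measurableSet.inter (measurableSet_slab n c a)).inter
      (measurableSet_slab n' c' b)) hne1 (c := c) (a := a) (fun x hx => hx.1.2) ?_).trans ?_
  · intro x hx s hs
    have h1 : ‖x‖ < R := by simpa using hx.1.1
    have h2 : ‖s • e‖ ≤ ‖e‖ := by
      rw [norm_smul, Real.norm_eq_abs, abs_of_nonneg hs.1]
      exact mul_le_of_le_one_left (norm_nonneg _) hs.2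
    have := norm_add_le x (s • e)
    refine ⟨?_, ?_⟩
    · simp only [Metric.mem_ball, dist_zero_right]
      linarith
    · have h3 : |inner ℝ n' x - c'| ≤ b := hx.2
      simpa [inner_add_right, inner_smul_right, hne2] using h3
  · calc ENNReal.ofReal (2 * a) * _ ≤ ENNReal.ofReal (2 * a) * ENNReal.ofReal (C * b) := by
          gcongr; exact hC c' b
      _ = _ := by rw [← ENNReal.ofReal_mul (by positivity)]; congr 1; ring

end Slabs

/-! ### A piecewise affine change of variables -/

section Shear

variable {d : ℕ}

/-- The piecewise affine map which is the identity on the half-space `{c ≤ n · x}`, and a shear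
followed by a translation by `-K n` on the half-space `{n · x < c}`. -/
def shear (n : Sp d) (c : ℝ) (v : Sp d) (K : ℝ) (x : Sp d) : Sp d :=
  open Classical in if inner ℝ n x < c then x + (inner ℝ n x - c) • v - K • n else x

variable {n : Sp d} {c : ℝ} {v : Sp d} {K : ℝ}

theorem shear_of_lt {x : Sp d} (hx : inner ℝ n x < c) :
    shear n c v K x = x + (inner ℝ n x - c) • v - K • n := if_pos hx

theorem shear_of_le {x : Sp d} (hx : c ≤ inner ℝ n x) : shear n c v K x = x := if_neg hx.not_gt

theorem inner_shear_of_lt (hn : ‖n‖ = 1) {x : Sp d} (hx : inner ℝ n x < c) :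
    inner ℝ n (shear n c v K x) - c = (1 + inner ℝ n v) * (inner ℝ n x - c) - K := by
  have hnn : inner ℝ n n = (1 : ℝ) := by rw [real_inner_self_eq_norm_sq, hn]; norm_num
  rw [shear_of_lt hx, inner_sub_right, inner_add_right, inner_smul_right, inner_smul_right, hnn]
  ring

theorem inner_shear_lt_iff (hn : ‖n‖ = 1) (hq : 0 < 1 + (inner ℝ n v : ℝ)) (hK : 0 ≤ K)
    {x : Sp d} : inner ℝ n (shear n c v K x) < c ↔ inner ℝ n x < c := by
  by_cases hx : inner ℝ n x < c
  · have := inner_shear_of_lt (v := v) (K := K) hn hx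
    simp only [hx, iff_true]
    nlinarith
  · rw [shear_of_le (not_lt.1 hx)]

/-- Below the hyperplane the map is a transvection of determinant 1 + n·v followed by a translation,
above it is the identity; as 1 + n·v > 0 and K ≥ 0, both half-spaces are preserved and the two
images can be measured separately. -/
theorem volume_image_shear (hn : ‖n‖ = 1) (hq : 0 < 1 + (inner ℝ n v : ℝ)) (hK : 0 ≤ K)
    (Y : Set (Sp d)) :
    volume (shear n c v K '' Y) =
      ENNReal.ofReal (1 + inner ℝ n v) * volume (Y ∩ {x | inner ℝ n x < c}) +
        volume (Y \ {x | inner ℝ n x < c}) := by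
  rw [← measure_inter_add_sdiff (shear n c v K '' Y) (measurableSet_below n c)]
  congr 1
  · have h1 : shear n c v K '' Y ∩ {x | inner ℝ n x < c} =
        (fun x => x + (-(c • v + K • n))) ''
          (LinearMap.transvection (innerₛₗ ℝ n) v '' (Y ∩ {x | inner ℝ n x < c})) := by
      rw [← image_comp]
      ext y
      constructor
      · rintro ⟨⟨x, hx, rfl⟩, hy⟩
        have hx' : inner ℝ n x < c := (inner_shear_lt_iff hn hq hK).1 hy
        refine ⟨x, ⟨hx, hx'⟩, ?_⟩
        rw [shear_of_lt hx']
        simp only [Function.comp, LinearMap.transvection.apply, innerₛₗ_apply_apply, sub_smul]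
        abel
      · rintro ⟨x, ⟨hx, hx'⟩, rfl⟩
        have : (fun x => x + (-(c • v + K • n))) (LinearMap.transvection (innerₛₗ ℝ n) v x) =
            shear n c v K x := by
          rw [shear_of_lt hx']
          simp only [LinearMap.transvection.apply, innerₛₗ_apply_apply, sub_smul]
          abel
        beta_reduce at this
        rw [Function.comp_apply, this]
        exact ⟨⟨x, hx, rfl⟩, (inner_shear_lt_iff hn hq hK).2 hx'⟩
    rw [h1, image_add_right, measure_preimage_add_right, Measure.addHaar_image_linearMap,
      LinearMap.transvection.det]
    congr 2
    exact abs_of_pos hq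
  · congr 1
    ext y
    constructor
    · rintro ⟨⟨x, hx, rfl⟩, hy⟩
      have hx' : ¬ inner ℝ n x < c := fun h => hy ((inner_shear_lt_iff hn hq hK).2 h)
      rw [shear_of_le (not_lt.1 hx')]
      exact ⟨hx, hx'⟩
    · rintro ⟨hx, hx'⟩
      have hx'' : ¬ inner ℝ n y < c := hx'
      exact ⟨⟨y, hx, shear_of_le (not_lt.1 hx'')⟩, hx'⟩

/-- A left inverse of `shear`. -/
def shearInv (n : Sp d) (c : ℝ) (v : Sp d) (K : ℝ) (x : Sp d) : Sp d :=
  open Classical in if inner ℝ n x < c then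
    x - ((inner ℝ n x - c + K) / (1 + inner ℝ n v)) • v + K • n else x

theorem shearInv_shear (hn : ‖n‖ = 1) (hq : 0 < 1 + (inner ℝ n v : ℝ)) (hK : 0 ≤ K) (x : Sp d) :
    shearInv n c v K (shear n c v K x) = x := by
  unfold shearInv
  by_cases hx : inner ℝ n x < c
  · rw [if_pos ((inner_shear_lt_iff hn hq hK).2 hx), inner_shear_of_lt hn hx, sub_add_cancel,
      mul_div_cancel_left₀ _ hq.ne', shear_of_lt hx]
    abel
  · rw [if_neg (fun h => hx ((inner_shear_lt_iff hn hq hK).1 h)), shear_of_le (not_lt.1 hx)]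

theorem measurable_shear : Measurable (shear n c v K) := by
  classical
  refine Measurable.ite (measurableSet_below n c) ?_ measurable_id
  fun_prop

theorem measurable_shearInv : Measurable (shearInv n c v K) := by
  classical
  refine Measurable.ite (measurableSet_below n c) ?_ measurable_id
  fun_prop

theorem abs_inner_sub_le (hn : ‖n‖ = 1) (x y : Sp d) :
    |inner ℝ n x - inner ℝ n y| ≤ ‖x - y‖ := by
  rw [← inner_sub_right]
  simpa [hn] using abs_real_inner_le_norm n (x - y)

/-- On each side of the hyperplane, and globally if `K = 0`, the inverse of `shear` is Lipschitz. -/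
theorem norm_sub_le_shear (hn : ‖n‖ = 1) (hq : 0 < 1 + (inner ℝ n v : ℝ)) {x y : Sp d}
    (hxy : K = 0 ∨ (inner ℝ n x < c ↔ inner ℝ n y < c)) :
    ‖x - y‖ ≤ (1 + ‖v‖ / (1 + inner ℝ n v)) * ‖shear n c v K x - shear n c v K y‖ := by
  set q := 1 + (inner ℝ n v : ℝ) with hqdef
  -- In each case x − y differs from the difference of the images by a multiple a of v, and q|a| is
  -- controlled by the normal component of the difference of the images.
  have hgen : ∀ a : ℝ, ‖x - y‖ ≤ ‖shear n c v K x - shear n c v K y‖ + |a| * ‖v‖ →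
      q * |a| ≤ ‖shear n c v K x - shear n c v K y‖ →
      ‖x - y‖ ≤ (1 + ‖v‖ / q) * ‖shear n c v K x - shear n c v K y‖ := by
    intro a h1 h2
    have h3 : |a| ≤ ‖shear n c v K x - shear n c v K y‖ / q := by
      rw [le_div_iff₀ hq]; linarith
    calc ‖x - y‖ ≤ _ := h1
      _ ≤ ‖shear n c v K x - shear n c v K y‖ +
          ‖shear n c v K x - shear n c v K y‖ / q * ‖v‖ := by gcongr
      _ = _ := by ring
  have hN := abs_inner_sub_le hn (shear n c v K x) (shear n c v K y)
  by_cases hx : inner ℝ n x < c <;> by_cases hy : inner ℝ n y < c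
  · refine hgen (inner ℝ n x - inner ℝ n y) ?_ ?_
    · have : x - y = (shear n c v K x - shear n c v K y) -
          (inner ℝ n x - inner ℝ n y : ℝ) • v := by
        rw [shear_of_lt hx, shear_of_lt hy]
        simp only [sub_smul]; abel
      rw [this, ← Real.norm_eq_abs, ← norm_smul]
      exact norm_sub_le _ _
    · refine le_trans (le_of_eq ?_) hN
      have h1 := inner_shear_of_lt (v := v) (K := K) hn hx
      have h2 := inner_shear_of_lt (v := v) (K := K) hn hy
      rw [show inner ℝ n (shear n c v K x) - inner ℝ n (shear n c v K y) =
        q * (inner ℝ n x - inner ℝ n y) by linarith, abs_mul, abs_of_pos hq]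
  · have hK : K = 0 := hxy.resolve_right (fun h => hy (h.1 hx))
    subst hK
    refine hgen (inner ℝ n x - c) ?_ ?_
    · have : x - y = (shear n c v 0 x - shear n c v 0 y) - (inner ℝ n x - c : ℝ) • v := by
        rw [shear_of_lt hx, shear_of_le (not_lt.1 hy)]
        simp only [sub_smul, zero_smul]; abel
      rw [this, ← Real.norm_eq_abs, ← norm_smul]
      exact norm_sub_le _ _
    · refine le_trans ?_ hN
      have h1 := inner_shear_of_lt (v := v) (K := 0) hn hx
      rw [shear_of_le (not_lt.1 hy), abs_of_neg (by linarith), abs_sub_comm]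
      refine le_trans ?_ (le_abs_self _)
      linarith [not_lt.1 hy]
  · have hK : K = 0 := hxy.resolve_right (fun h => hx (h.2 hy))
    subst hK
    refine hgen (inner ℝ n y - c) ?_ ?_
    · have : x - y = (shear n c v 0 x - shear n c v 0 y) + (inner ℝ n y - c : ℝ) • v := by
        rw [shear_of_lt hy, shear_of_le (not_lt.1 hx)]
        simp only [sub_smul, zero_smul]; abel
      rw [this, ← Real.norm_eq_abs, ← norm_smul]
      exact norm_add_le _ _
    · refine le_trans ?_ hN
      have h1 := inner_shear_of_lt (v := v) (K := 0) hn hy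
      rw [shear_of_le (not_lt.1 hx), abs_of_neg (by linarith)]
      refine le_trans ?_ (le_abs_self _)
      linarith [not_lt.1 hx]
  · rw [shear_of_le (not_lt.1 hx), shear_of_le (not_lt.1 hy)]
    have : 0 ≤ ‖v‖ / q := by positivity
    nlinarith [norm_nonneg (x - y)]

end Shear

/-! ### Expansion of the determinant near the identity -/

section Det

/-- X ↦ det(1 + X) is a polynomial in the entries, hence differentiable, and differentiating along
the lines t ↦ tX shows that its derivative at 0 is the trace; the estimate is the definition of this
derivative. -/
theorem exists_det_one_add_le {d : ℕ} {η : ℝ} (hη : 0 < η) :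
    ∃ δ > 0, ∀ X : Sp d →L[ℝ] Sp d, ‖X‖ ≤ δ →
      |LinearMap.det (LinearMap.id + (X : Sp d →ₗ[ℝ] Sp d)) - 1 -
        LinearMap.trace ℝ (Sp d) (X : Sp d →ₗ[ℝ] Sp d)| ≤ η * ‖X‖ := by
  classical
  let b := (EuclideanSpace.basisFun (Fin d) ℝ).toBasis
  let M : (Sp d →L[ℝ] Sp d) →ₗ[ℝ] Matrix (Fin d) (Fin d) ℝ :=
    (LinearMap.toMatrix b b).toLinearMap ∘ₗ ContinuousLinearMap.coeLM ℝ
  let D : (Sp d →L[ℝ] Sp d) → ℝ := fun X => LinearMap.det (LinearMap.id + (X : Sp d →ₗ[ℝ] Sp d))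
  have hDM : ∀ X, D X = (1 + M X).det := by
    intro X
    simp only [D, M]
    rw [← LinearMap.det_toMatrix b, map_add, LinearMap.toMatrix_id]
    rfl
  have hentry : ∀ i j, Differentiable ℝ fun X => M X i j := by
    intro i j
    let l : (Sp d →L[ℝ] Sp d) →ₗ[ℝ] ℝ := (Matrix.entryLinearMap ℝ ℝ i j) ∘ₗ M
    exact (LinearMap.toContinuousLinearMap l).differentiable
  have hdiff : Differentiable ℝ D := by
    have : D = fun X => ∑ s : Equiv.Perm (Fin d), (Equiv.Perm.sign s : ℤ) •
        ∏ i, ((1 : Matrix (Fin d) (Fin d) ℝ) (s i) i + M X (s i) i) := by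
      ext X
      rw [hDM, Matrix.det_apply]
      rfl
    rw [this]
    fun_prop
  have hder : ∀ X, fderiv ℝ D 0 X = LinearMap.trace ℝ (Sp d) (X : Sp d →ₗ[ℝ] Sp d) := by
    intro X
    have h1 : HasDerivAt (fun t : ℝ => D (t • X)) (fderiv ℝ D 0 X) 0 := by
      have h2 : HasDerivAt (fun t : ℝ => t • X) X 0 := by
        simpa using (hasDerivAt_id (0 : ℝ)).smul_const X
      have h3 : HasFDerivAt D (fderiv ℝ D 0) ((0 : ℝ) • X) := by
        rw [show (0 : ℝ) • X = 0 by ext; simp]; exact (hdiff 0).hasFDerivAt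
      exact h3.comp_hasDerivAt (0 : ℝ) h2
    have h4 : HasDerivAt (fun t : ℝ => D (t • X)) (M X).trace 0 := by
      have : (fun t : ℝ => D (t • X)) = fun t => 1 + (M X).trace * t +
          (Polynomial.eval t (Matrix.det (1 + (Polynomial.X : Polynomial ℝ) •
            (M X).map Polynomial.C)).divX.divX) * t ^ 2 := by
        ext t
        rw [hDM, map_smul, Matrix.det_one_add_smul]
      rw [this]
      have h5 := ((hasDerivAt_id (0 : ℝ)).const_mul (M X).trace).const_add 1
      have h6 := (Polynomial.hasDerivAt (Matrix.det (1 + (Polynomial.X : Polynomial ℝ) •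
            (M X).map Polynomial.C)).divX.divX (0 : ℝ)).mul ((hasDerivAt_id (0 : ℝ)).pow 2)
      have h7 := h5.add h6
      convert! h7 using 1
      simp
    rw [h1.unique h4, LinearMap.trace_eq_matrix_trace ℝ b]
    rfl
  have h0 := (hdiff 0).hasFDerivAt.isLittleO
  have h1 := h0.def hη
  obtain ⟨δ, hδ, hball⟩ := Metric.eventually_nhds_iff.1 h1
  refine ⟨δ / 2, by positivity, fun X hX => ?_⟩
  have h2 := hball (y := X) (by rw [dist_zero_right]; linarith)
  have hD0 : D 0 = 1 := by simp [D]
  rw [hD0, sub_zero, hder] at h2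
  simpa [D] using h2

end Det

/-! ### Partitions into small pieces -/

theorem exists_small_partition {E : Type*} [PseudoMetricSpace E] [MeasurableSpace E]
    [OpensMeasurableSpace E] [TopologicalSpace.SeparableSpace E] [Nonempty E]
    {r : ℝ} (hr : 0 < r) :
    ∃ P : ℕ → Set E, (∀ k, MeasurableSet (P k)) ∧ Pairwise (Function.onFun Disjoint P) ∧
      (⋃ k, P k) = univ ∧ ∀ k, ∀ x ∈ P k, ∀ y ∈ P k, dist x y ≤ r := by
  refine ⟨disjointed fun k => Metric.ball (TopologicalSpace.denseSeq E k) (r / 2),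
    fun k => MeasurableSet.disjointed (fun _ => Metric.isOpen_ball.measurableSet) k,
    disjoint_disjointed _, ?_, ?_⟩
  · rw [iUnion_disjointed, eq_univ_iff_forall]
    intro x
    obtain ⟨k, hk⟩ := (TopologicalSpace.denseRange_denseSeq E).exists_dist_lt x (half_pos hr)
    exact mem_iUnion.2 ⟨k, by simpa using hk⟩
  · intro k x hx y hy
    have h1 := disjointed_subset _ _ hx
    have h2 := disjointed_subset _ _ hy
    rw [Metric.mem_ball] at h1 h2
    have := dist_triangle_right x y (TopologicalSpace.denseSeq E k)
    linarith

/-- A need not be measurable: the restriction of μ to A is countably additive on the measurable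
pieces. -/
theorem measure_eq_tsum_inter {E ι : Type*} [MeasurableSpace E] [Countable ι] (μ : Measure E)
    {P : ι → Set E} (hP : ∀ k, MeasurableSet (P k)) (hd : Pairwise (Function.onFun Disjoint P))
    (hU : (⋃ k, P k) = univ) (A : Set E) : μ A = ∑' k, μ (A ∩ P k) := by
  have h := measure_iUnion (μ := μ.restrict A) hd hP
  rw [hU, Measure.restrict_apply_univ] at h
  rw [h]
  congr with k
  rw [Measure.restrict_apply (hP k), inter_comm]

end EllamFlow

/-! ### Piecewise smooth fields and their trajectories -/

namespace EllamFlow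

/-- This serves to choose small parameters: finitely many constraints of this kind hold together for
all small r > 0, so a common r exists. -/
theorem eventually_mul_le (A : ℝ) {B : ℝ} (hB : 0 < B) : ∀ᶠ r in 𝓝[>] (0 : ℝ), A * r ≤ B := by
  have h : Tendsto (fun r : ℝ => A * r) (𝓝[>] 0) (𝓝 (A * 0)) :=
    (tendsto_id.const_mul A).mono_left nhdsWithin_le_nhds
  rw [mul_zero] at h
  exact (h.eventually (gt_mem_nhds hB)).mono fun r hr => hr.le

/-- A velocity field which is smooth on finitely many disjoint open pieces of a bounded domain,
cut out by finitely many hyperplanes, together with a density `wt` such that the flux of `wt • vel`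
is continuous across the interfaces and its divergence is bounded below by `-Γ`. -/
structure PiecewiseField (d : ℕ) (ι κ : Type) where
  dom : Set (Sp d)
  piece : ι → Set (Sp d)
  vel : ι → Sp d → Sp d
  wt : ι → Sp d → ℝ
  nrm : κ → Sp d
  lev : κ → ℝ
  lo : ℝ
  up : ℝ
  Γ : ℝ
  dom_bounded : Bornology.IsBounded dom
  piece_open : ∀ i, IsOpen (piece i)
  piece_subset : ∀ i, piece i ⊆ dom
  piece_disjoint : Pairwise (Function.onFun Disjoint piece)
  frontier_piece : ∀ i, frontier (piece i) ⊆ ⋃ j, hyperplane (nrm j) (lev j)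
  dom_subset : dom ⊆ (⋃ i, piece i) ∪ ⋃ j, hyperplane (nrm j) (lev j)
  norm_nrm : ∀ j, ‖nrm j‖ = 1
  vel_contDiff : ∀ i, ContDiff ℝ 1 (vel i)
  vel_compact : ∀ i, HasCompactSupport (vel i)
  wt_contDiff : ∀ i, ContDiff ℝ 1 (wt i)
  wt_compact : ∀ i, HasCompactSupport (wt i)
  lo_pos : 0 < lo
  up_pos : 0 < up
  Γ_nonneg : 0 ≤ Γ
  wt_mem : ∀ i, ∀ x ∈ piece i, lo ≤ wt i x ∧ wt i x ≤ up
  div_ge : ∀ i, ∀ x ∈ piece i, -Γ ≤ fderiv ℝ (wt i) x (vel i x) +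
    wt i x * LinearMap.trace ℝ (Sp d) (fderiv ℝ (vel i) x : Sp d →ₗ[ℝ] Sp d)
  flux_eq : ∀ j a b p r, 0 < r → p ∈ hyperplane (nrm j) (lev j) →
    (∀ x ∈ Metric.ball p r, inner ℝ (nrm j) x < lev j → x ∈ piece a) →
    (∀ x ∈ Metric.ball p r, lev j < inner ℝ (nrm j) x → x ∈ piece b) →
    wt a p * inner ℝ (nrm j) (vel a p) = wt b p * inner ℝ (nrm j) (vel b p)

namespace PiecewiseField

variable {d : ℕ} {ι κ : Type} (P : PiecewiseField d ι κ)

/-- The hyperplanes of the arrangement. -/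
def hyp (j : κ) : Set (Sp d) := hyperplane (P.nrm j) (P.lev j)

/-- The signed distance to a hyperplane of the arrangement. -/
def sd (j : κ) (x : Sp d) : ℝ := inner ℝ (P.nrm j) x - P.lev j

theorem mem_hyp {j : κ} {x : Sp d} : x ∈ P.hyp j ↔ P.sd j x = 0 := sub_eq_zero.symm

theorem abs_sd_sub_le (j : κ) (x y : Sp d) : |P.sd j x - P.sd j y| ≤ ‖x - y‖ := by
  simpa [sd] using abs_inner_sub_le (P.norm_nrm j) x y

/-- Trajectories of the piecewise field on `[0, h]`. -/
def IsTraj (h : ℝ) (γ : ℝ → Sp d) : Prop :=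
  ContinuousOn γ (Icc 0 h) ∧ (∀ t ∈ Icc 0 h, γ t ∈ P.dom) ∧
    ∃ N : Set ℝ, N.Countable ∧ ∀ t ∈ Ioo 0 h \ N, ∃ i, γ t ∈ P.piece i ∧
      HasDerivAt γ (P.vel i (γ t)) t

/-- Uniform bounds and Lipschitz constants for the velocities and the densities. -/
structure Bounds (M L : ℝ) : Prop where
  M_pos : 0 < M
  L_pos : 0 < L
  vel_le : ∀ i x, ‖P.vel i x‖ ≤ M
  vel_lip : ∀ i x y, ‖P.vel i x - P.vel i y‖ ≤ L * ‖x - y‖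
  wt_lip : ∀ i x y, |P.wt i x - P.wt i y| ≤ L * ‖x - y‖
  fderiv_vel_le : ∀ i x, ‖fderiv ℝ (P.vel i) x‖ ≤ L
  fderiv_wt_le : ∀ i x, ‖fderiv ℝ (P.wt i) x‖ ≤ L

theorem exists_norm_le_of_compact {E F : Type*} [NormedAddCommGroup E] [NormedAddCommGroup F]
    {f : E → F} (hf : Continuous f) (hc : HasCompactSupport f) : ∃ C, 0 ≤ C ∧ ∀ x, ‖f x‖ ≤ C := by
  obtain ⟨C, hC⟩ := hc.exists_bound_of_continuous hf
  exact ⟨max C 0, le_max_right _ _, fun x => (hC x).trans (le_max_left _ _)⟩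

theorem exists_bounds [Finite ι] : ∃ M L, P.Bounds M L := by
  choose A hA0 hA using fun i => exists_norm_le_of_compact (P.vel_contDiff i).continuous
    (P.vel_compact i)
  choose B hB0 hB using fun i => exists_norm_le_of_compact
    ((P.vel_contDiff i).continuous_fderiv one_ne_zero) ((P.vel_compact i).fderiv ℝ)
  choose D hD0 hD using fun i => exists_norm_le_of_compact
    ((P.wt_contDiff i).continuous_fderiv one_ne_zero) ((P.wt_compact i).fderiv ℝ)
  cases nonempty_fintype ι
  set L := 1 + ∑ i, (B i + D i) with hL
  have hBL : ∀ i, B i ≤ L ∧ D i ≤ L := by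
    intro i
    have := Finset.single_le_sum (f := fun i => B i + D i)
      (fun i _ => add_nonneg (hB0 i) (hD0 i)) (Finset.mem_univ i)
    have h1 := hB0 i
    have h2 := hD0 i
    constructor <;> linarith
  refine ⟨1 + ∑ i, A i, L, ⟨?_, ?_, ?_, ?_, ?_, fun i x => (hB i x).trans (hBL i).1,
    fun i x => (hD i x).trans (hBL i).2⟩⟩
  · have := Finset.sum_nonneg fun i (_ : i ∈ Finset.univ) => hA0 i
    linarith
  · have := Finset.sum_nonneg fun i (_ : i ∈ Finset.univ) => add_nonneg (hB0 i) (hD0 i)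
    linarith
  · intro i x
    have := Finset.single_le_sum (f := A) (fun i _ => hA0 i) (Finset.mem_univ i)
    linarith [hA i x]
  · intro i x y
    exact convex_univ.norm_image_sub_le_of_norm_fderiv_le (𝕜 := ℝ)
      (fun z _ => (P.vel_contDiff i).differentiable one_ne_zero z)
      (fun z _ => (hB i z).trans (hBL i).1) (mem_univ y) (mem_univ x)
  · intro i x y
    exact convex_univ.norm_image_sub_le_of_norm_fderiv_le (𝕜 := ℝ)
      (fun z _ => (P.wt_contDiff i).differentiable one_ne_zero z)
      (fun z _ => (hD i z).trans (hBL i).2) (mem_univ y) (mem_univ x)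

theorem wt_mem_closure (i : ι) {x : Sp d} (hx : x ∈ closure (P.piece i)) :
    P.lo ≤ P.wt i x ∧ P.wt i x ≤ P.up := by
  have hc : IsClosed {x | P.lo ≤ P.wt i x ∧ P.wt i x ≤ P.up} :=
    (isClosed_le continuous_const (P.wt_contDiff i).continuous).inter
      (isClosed_le (P.wt_contDiff i).continuous continuous_const)
  exact closure_minimal (fun x hx => P.wt_mem i x hx) hc hx

section Traj

variable {P} {M L h : ℝ} {γ γ' : ℝ → Sp d}

theorem IsTraj.norm_sub_le (hB : P.Bounds M L) (hγ : P.IsTraj h γ) {s t : ℝ} (hs : s ∈ Icc 0 h)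
    (ht : t ∈ Icc 0 h) : ‖γ t - γ s‖ ≤ M * |t - s| := by
  wlog hst : s ≤ t generalizing s t
  · rw [norm_sub_rev, abs_sub_comm]
    exact this ht hs (le_of_not_ge hst)
  obtain ⟨hc, -, N, hN, hd⟩ := hγ
  rw [abs_of_nonneg (sub_nonneg.2 hst)]
  refine norm_sub_le_of_hasDerivAt_off_countable hst (hc.mono (Icc_subset_Icc hs.1 ht.2)) hN ?_
  intro τ hτ
  obtain ⟨i, -, hi⟩ := hd τ ⟨⟨hs.1.trans_lt hτ.1.1, hτ.1.2.trans_le ht.2⟩, hτ.2⟩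
  exact ⟨_, hi, hB.vel_le _ _⟩

theorem IsTraj.norm_sub_le_mul (hB : P.Bounds M L) (hγ : P.IsTraj h γ) {s t : ℝ}
    (hs : s ∈ Icc 0 h) (ht : t ∈ Icc 0 h) : ‖γ t - γ s‖ ≤ M * h := by
  refine (hγ.norm_sub_le hB hs ht).trans (mul_le_mul_of_nonneg_left ?_ hB.M_pos.le)
  rw [abs_le]; constructor <;> linarith [hs.1, hs.2, ht.1, ht.2]

theorem IsTraj.exists_mem_piece (hγ : P.IsTraj h γ) (hh : 0 < h) :
    ∃ t ∈ Icc 0 h, ∃ i, γ t ∈ P.piece i := by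
  obtain ⟨-, -, N, hN, hd⟩ := hγ
  have : (Ioo 0 h \ N).Nonempty := by
    by_contra hne
    rw [not_nonempty_iff_eq_empty, sdiff_eq_empty] at hne
    have h1 := measure_mono_null hne (hN.measure_zero (volume : Measure ℝ))
    rw [Real.volume_Ioo] at h1
    simp only [sub_zero, ENNReal.ofReal_eq_zero] at h1
    linarith
  obtain ⟨t, ht⟩ := this
  obtain ⟨i, hi, -⟩ := hd t ht
  exact ⟨t, Ioo_subset_Icc_self ht.1, i, hi⟩

theorem IsTraj.shift {a b : ℝ} (ha : 0 ≤ a) (hγ : P.IsTraj h γ) (hb : a + b ≤ h) :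
    P.IsTraj b fun t => γ (a + t) := by
  obtain ⟨hc, hm, N, hN, hd⟩ := hγ
  refine ⟨hc.comp (by fun_prop) fun t ht => ⟨add_nonneg ha ht.1, by linarith [ht.2]⟩,
    fun t ht => hm _ ⟨add_nonneg ha ht.1, by linarith [ht.2]⟩, (fun t => a + t) ⁻¹' N,
    hN.preimage (add_right_injective a), fun t ht => ?_⟩
  obtain ⟨i, hi, hi'⟩ := hd (a + t) ⟨⟨by linarith [ht.1.1], by linarith [ht.1.2]⟩, ht.2⟩
  exact ⟨i, hi, hi'.comp_const_add a t⟩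

/-- Two trajectories of the same smooth field. -/
theorem IsTraj.osc_single (hB : P.Bounds M L) (hγ : P.IsTraj h γ) (hγ' : P.IsTraj h γ')
    (hh : 0 ≤ h) (hL : L * h ≤ 1 / 2) {i : ι}
    (hi : ∀ t ∈ Icc 0 h, ∀ k, γ t ∈ P.piece k → k = i)
    (hi' : ∀ t ∈ Icc 0 h, ∀ k, γ' t ∈ P.piece k → k = i) {r : ℝ} (hr : r ∈ Icc 0 h) :
    (∀ t ∈ Icc 0 h, ‖γ t - γ' t‖ ≤ 2 * ‖γ r - γ' r‖) ∧
    ∀ s ∈ Icc 0 h, ∀ t ∈ Icc 0 h, ‖(γ t - γ' t) - (γ s - γ' s)‖ ≤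
      2 * (L * h) * ‖γ r - γ' r‖ := by
  obtain ⟨hc, -, N, hN, hd⟩ := hγ
  obtain ⟨hc', -, N', hN', hd'⟩ := hγ'
  have hLpos := hB.L_pos
  -- Both trajectories only see the velocity of the piece i, so the derivative of γ − γ' is at most
  -- L times the supremum of its norm, and its oscillation at most Lh times that supremum.
  refine norm_sub_le_of_osc_le (u := fun t => γ t - γ' t) hh hL (by positivity) (hc.sub hc') ?_ r hr
  intro S hS hSb s hs t ht hst
  refine (norm_sub_le_of_hasDerivAt_off_countable (C := L * S) hst
    ((hc.sub hc').mono (Icc_subset_Icc hs.1 ht.2)) (hN.union hN') ?_).trans ?_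
  · intro τ hτ
    have hτI : τ ∈ Ioo 0 h := ⟨hs.1.trans_lt hτ.1.1, hτ.1.2.trans_le ht.2⟩
    obtain ⟨k, hk, hk'⟩ := hd τ ⟨hτI, fun hh => hτ.2 (Or.inl hh)⟩
    obtain ⟨l, hl, hl'⟩ := hd' τ ⟨hτI, fun hh => hτ.2 (Or.inr hh)⟩
    have hτI' := Ioo_subset_Icc_self hτI
    obtain rfl := hi τ hτI' k hk
    obtain rfl := hi' τ hτI' l hl
    exact ⟨_, hk'.sub hl', (hB.vel_lip _ _ _).trans
      (mul_le_mul_of_nonneg_left (hSb τ hτI') hLpos.le)⟩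
  · have : t - s ≤ h := by linarith [hs.1, ht.2]
    have : L * S * (t - s) ≤ L * S * h := mul_le_mul_of_nonneg_left this (by positivity)
    linarith

theorem continuous_shear {n : Sp d} {c : ℝ} {v : Sp d} : Continuous (shear n c v 0) := by
  have : shear n c v 0 = fun x => x + (min (inner ℝ n x - c) 0 : ℝ) • v := by
    ext1 x
    by_cases hx : inner ℝ n x < c
    · rw [shear_of_lt hx, min_eq_left (by linarith)]; simp
    · rw [shear_of_le (not_lt.1 hx), min_eq_right (by linarith [not_lt.1 hx])]; simp
  rw [this]
  fun_prop

/-- A function whose derivative is large only on a level band of a strictly increasing function. -/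
theorem norm_sub_le_of_band {E : Type*} [NormedAddCommGroup E] [NormedSpace ℝ E] [CompleteSpace E]
    {u : ℝ → E} {G : ℝ → ℝ} {s t A B c δ : ℝ} (hst : s ≤ t) (hB : 0 ≤ B) (hc : 0 < c) (hδ : 0 ≤ δ)
    (hu : ContinuousOn u (Icc s t)) (hG : ContinuousOn G (Icc s t))
    (hmono : ∀ x ∈ Icc s t, ∀ y ∈ Icc s t, x ≤ y → c * (y - x) ≤ G y - G x)
    {N : Set ℝ} (hN : N.Countable)
    (hd : ∀ τ ∈ Ioo s t \ N, ∃ u', HasDerivAt u u' τ ∧ ‖u'‖ ≤ A + B ∧ (δ < |G τ| → ‖u'‖ ≤ A)) :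
    ‖u t - u s‖ ≤ A * (t - s) + B * (2 * δ / c) := by
  have hpart : ∀ a b C, s ≤ a → a ≤ b → b ≤ t →
      (∀ τ ∈ Ioo a b \ N, ∃ u', HasDerivAt u u' τ ∧ ‖u'‖ ≤ C) → ‖u b - u a‖ ≤ C * (b - a) :=
    fun a b C h1 h2 h3 h4 => norm_sub_le_of_hasDerivAt_off_countable h2
      (hu.mono (Icc_subset_Icc h1 h3)) hN h4
  set J := Icc s t ∩ G ⁻¹' (Icc (-δ) δ) with hJ
  have hJc : IsCompact J := isCompact_Icc.of_isClosed_subset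
    (hG.preimage_isClosed_of_isClosed isClosed_Icc isClosed_Icc) inter_subset_left
  have hgood : ∀ a b, s ≤ a → b ≤ t → (∀ τ ∈ Ioo a b, τ ∉ J) →
      ∀ τ ∈ Ioo a b \ N, ∃ u', HasDerivAt u u' τ ∧ ‖u'‖ ≤ A := by
    intro a b ha hb hno τ hτ
    have hτI : τ ∈ Ioo s t := ⟨ha.trans_lt hτ.1.1, hτ.1.2.trans_le hb⟩
    obtain ⟨u', h1, -, h3⟩ := hd τ ⟨hτI, hτ.2⟩
    refine ⟨u', h1, h3 ?_⟩
    by_contra hcon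
    exact hno τ hτ.1 ⟨Ioo_subset_Icc_self hτI, abs_le.1 (not_lt.1 hcon)⟩
  rcases J.eq_empty_or_nonempty with hJe | hJne
  · have h1 := hpart s t A le_rfl hst le_rfl (hgood s t le_rfl le_rfl (by simp [hJe]))
    have : 0 ≤ B * (2 * δ / c) := by positivity
    linarith
  -- Outside [τ₁, τ₂] the function G is outside the band. As G increases at rate at least c and runs
  -- from at least −δ to at most δ, this interval has length at most 2δ/c; only there is the larger
  -- bound A + B used.
  · obtain ⟨τ₁, hτ₁, hmin⟩ := hJc.exists_isLeast hJne
    obtain ⟨τ₂, hτ₂, hmax⟩ := hJc.exists_isGreatest hJne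
    have h12 : τ₁ ≤ τ₂ := hmin hτ₂
    have e1 := hpart s τ₁ A le_rfl hτ₁.1.1 hτ₁.1.2
      (hgood s τ₁ le_rfl hτ₁.1.2 fun τ hτ hτJ => absurd (hmin hτJ) (not_le.2 hτ.2))
    have e2 := hpart τ₁ τ₂ (A + B) hτ₁.1.1 h12 hτ₂.1.2 (fun τ hτ => by
      obtain ⟨u', h1, h2, -⟩ := hd τ ⟨⟨hτ₁.1.1.trans_lt hτ.1.1, hτ.1.2.trans_le hτ₂.1.2⟩, hτ.2⟩
      exact ⟨u', h1, h2⟩)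
    have e3 := hpart τ₂ t A hτ₂.1.1 hτ₂.1.2 le_rfl
      (hgood τ₂ t hτ₂.1.1 le_rfl fun τ hτ hτJ => absurd (hmax hτJ) (not_le.2 hτ.1))
    have e4 : τ₂ - τ₁ ≤ 2 * δ / c := by
      rw [le_div_iff₀ hc]
      have := hmono τ₁ hτ₁.1 τ₂ hτ₂.1 h12
      have h5 := hτ₁.2.1
      have h6 := hτ₂.2.2
      linarith
    have e5 : ‖u t - u s‖ ≤ ‖u t - u τ₂‖ + ‖u τ₂ - u τ₁‖ + ‖u τ₁ - u s‖ := by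
      have : u t - u s = (u t - u τ₂) + (u τ₂ - u τ₁) + (u τ₁ - u s) := by abel
      rw [this]
      exact norm_add₃_le
    have e6 : B * (τ₂ - τ₁) ≤ B * (2 * δ / c) := mul_le_mul_of_nonneg_left e4 hB
    linarith

end Traj

end PiecewiseField

end EllamFlow

/-! ### Transversal crossing of an interface -/

namespace EllamFlow

namespace PiecewiseField

variable {d : ℕ} {ι κ : Type} {P : PiecewiseField d ι κ}

section Transversal

variable {M L h : ℝ} {γ γ' : ℝ → Sp d} {n : Sp d} {c : ℝ} {v : Sp d}

theorem hasDerivAt_shear_of_lt {τ : ℝ} {w : Sp d} (hγ : HasDerivAt γ w τ)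
    (hs : inner ℝ n (γ τ) < c) :
    HasDerivAt (fun t => shear n c v 0 (γ t)) (w + (inner ℝ n w : ℝ) • v) τ := by
  have h1 : HasDerivAt (fun t => γ t + ((inner ℝ n (γ t) : ℝ) - c) • v)
      (w + (inner ℝ n w : ℝ) • v) τ := by
    have h2 : HasDerivAt (fun t => (inner ℝ n (γ t) : ℝ)) (inner ℝ n w) τ := by
      exact (innerSL ℝ n).hasFDerivAt.comp_hasDerivAt τ hγ
    exact hγ.add ((h2.sub_const c).smul_const v)
  refine h1.congr_of_eventuallyEq ?_
  have : ∀ᶠ t in 𝓝 τ, inner ℝ n (γ t) < c := by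
    have hcont : ContinuousAt (fun t => (inner ℝ n (γ t) : ℝ)) τ :=
      continuousAt_const.inner hγ.continuousAt
    exact hcont.eventually (gt_mem_nhds hs)
  filter_upwards [this] with t ht
  rw [shear_of_lt ht, zero_smul, sub_zero]

theorem hasDerivAt_shear_of_gt {τ : ℝ} {w : Sp d} (hγ : HasDerivAt γ w τ)
    (hs : c < inner ℝ n (γ τ)) :
    HasDerivAt (fun t => shear n c v 0 (γ t)) w τ := by
  refine hγ.congr_of_eventuallyEq ?_
  have : ∀ᶠ t in 𝓝 τ, c < inner ℝ n (γ t) := by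
    have hcont : ContinuousAt (fun t => (inner ℝ n (γ t) : ℝ)) τ :=
      continuousAt_const.inner hγ.continuousAt
    exact hcont.eventually (lt_mem_nhds hs)
  filter_upwards [this] with t ht
  rw [shear_of_le ht.le]

theorem norm_add_inner_smul_le (hn : ‖n‖ = 1) {V : ℝ} (hV : ‖v‖ ≤ V) (w : Sp d) :
    ‖w + (inner ℝ n w : ℝ) • v‖ ≤ (1 + V) * ‖w‖ := by
  have h1 : |(inner ℝ n w : ℝ)| ≤ ‖w‖ := by simpa [hn] using abs_real_inner_le_norm n w
  calc ‖w + (inner ℝ n w : ℝ) • v‖ ≤ ‖w‖ + |(inner ℝ n w : ℝ)| * ‖v‖ := by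
        rw [← Real.norm_eq_abs, ← norm_smul]; exact norm_add_le _ _
    _ ≤ ‖w‖ + ‖w‖ * V := by gcongr
    _ = _ := by ring

/-- Two trajectories crossing transversally an interface. -/
theorem IsTraj.osc_transversal (hB : P.Bounds M L) (hγ : P.IsTraj h γ) (hγ' : P.IsTraj h γ')
    (hh : 0 ≤ h) (hn : ‖n‖ = 1) {a b : ι}
    (hs : ∀ t ∈ Icc 0 h, ∀ k, γ t ∈ P.piece k →
      (k = a ∧ inner ℝ n (γ t) < c) ∨ (k = b ∧ c < inner ℝ n (γ t)))
    (hs' : ∀ t ∈ Icc 0 h, ∀ k, γ' t ∈ P.piece k →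
      (k = a ∧ inner ℝ n (γ' t) < c) ∨ (k = b ∧ c < inner ℝ n (γ' t)))
    {wa wb : Sp d} (hv : wa + (inner ℝ n wa : ℝ) • v = wb) {ε c₀ V C θ : ℝ}
    (hε : ∀ t ∈ Icc 0 h, ‖P.vel a (γ t) - wa‖ ≤ ε ∧ ‖P.vel b (γ t) - wb‖ ≤ ε)
    (hε' : ∀ t ∈ Icc 0 h, ‖P.vel a (γ' t) - wa‖ ≤ ε ∧ ‖P.vel b (γ' t) - wb‖ ≤ ε)
    (hε0 : 0 ≤ ε) (hc₀ : 0 < c₀) (ha : c₀ ≤ inner ℝ n wa) (hb : c₀ ≤ inner ℝ n wb)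
    (hεc : ε ≤ c₀ / 2) (hV : ‖v‖ ≤ V) (hq : 0 < 1 + (inner ℝ n v : ℝ))
    (hC : 1 + ‖v‖ / (1 + inner ℝ n v) ≤ C)
    (hθ : (1 + V) * L * C * h + 2 * (1 + V) * ε * (4 * C / c₀) ≤ θ) (hθ2 : θ ≤ 1 / 2)
    {r : ℝ} (hr : r ∈ Icc 0 h) :
    ∀ s ∈ Icc 0 h, ∀ t ∈ Icc 0 h,
      ‖(shear n c v 0 (γ t) - shear n c v 0 (γ' t)) - (shear n c v 0 (γ s) - shear n c v 0 (γ' s))‖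
        ≤ 2 * θ * ‖shear n c v 0 (γ r) - shear n c v 0 (γ' r)‖ := by
  obtain ⟨hcont, -, N, hN, hd⟩ := hγ
  obtain ⟨hcont', -, N', hN', hd'⟩ := hγ'
  have hLpos := hB.L_pos
  have hV0 : 0 ≤ V := (norm_nonneg _).trans hV
  have hC0 : 0 ≤ C := le_trans (by positivity) hC
  have hθ0 : 0 ≤ θ := le_trans (by positivity) hθ
  have hucont : ContinuousOn (fun t => shear n c v 0 (γ t) - shear n c v 0 (γ' t)) (Icc 0 h) :=
    (continuous_shear.comp_continuousOn hcont).sub (continuous_shear.comp_continuousOn hcont')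
  have hGcont : ContinuousOn (fun t => (inner ℝ n (γ t) : ℝ) - c) (Icc 0 h) :=
    (continuousOn_const.inner hcont).sub continuousOn_const
  refine (norm_sub_le_of_osc_le (u := fun t => shear n c v 0 (γ t) - shear n c v 0 (γ' t))
    hh hθ2 hθ0 hucont ?_ r hr).2
  intro S hS hSb s hs1 t ht hst
  -- On both sides the velocity is within c₀/2 of a vector with normal component at least c₀, so the
  -- level of γ increases at rate at least c₀/2.
  have hslope : ∀ x ∈ Icc s t, ∀ y ∈ Icc s t, x ≤ y →
      c₀ / 2 * (y - x) ≤ ((inner ℝ n (γ y) : ℝ) - c) - ((inner ℝ n (γ x) : ℝ) - c) := by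
    intro x hx y hy hxy
    refine mul_sub_le_of_hasDerivAt_off_countable (u := fun t => (inner ℝ n (γ t) : ℝ) - c)
      (C := M) hxy
      (hGcont.mono (Icc_subset_Icc (hs1.1.trans hx.1) (hy.2.trans ht.2))) hN ?_
    intro τ hτ
    have hτI : τ ∈ Ioo 0 h := ⟨(hs1.1.trans hx.1).trans_lt hτ.1.1, hτ.1.2.trans_le (hy.2.trans ht.2)⟩
    have hτI' := Ioo_subset_Icc_self hτI
    obtain ⟨k, hk, hk'⟩ := hd τ ⟨hτI, hτ.2⟩
    refine ⟨inner ℝ n (P.vel k (γ τ)), ?_, ?_, ?_⟩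
    · have h2 : HasDerivAt (fun t => (inner ℝ n (γ t) : ℝ)) (inner ℝ n (P.vel k (γ τ))) τ := by
        exact (innerSL ℝ n).hasFDerivAt.comp_hasDerivAt τ hk'
      exact h2.sub_const c
    · have hgen : ∀ w w0 : Sp d, ‖w - w0‖ ≤ ε → c₀ ≤ inner ℝ n w0 → c₀ / 2 ≤ inner ℝ n w := by
        intro w w0 h1 h2
        have := (abs_le.1 ((abs_inner_sub_le hn w w0).trans h1)).1
        linarith
      rcases hs τ hτI' k hk with ⟨rfl, -⟩ | ⟨rfl, -⟩
      · exact hgen _ _ (hε τ hτI').1 ha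
      · exact hgen _ _ (hε τ hτI').2 hb
    · refine (le_abs_self _).trans ((abs_real_inner_le_norm _ _).trans ?_)
      rw [hn, one_mul]; exact hB.vel_le _ _
  -- In the sheared coordinates, two points on the same side have velocities differing by at most (1
  -- + V)LCS. On opposite sides both velocities are only known to be within (1 + V)ε of wb, since
  -- the shear carries wa to wb; but then γ is within CS of the hyperplane, and by the lower bound
  -- on its normal speed this lasts a time at most 4CS/c₀. Both contributions are multiples of S,
  -- with small coefficients.
  have hband := norm_sub_le_of_band (u := fun t => shear n c v 0 (γ t) - shear n c v 0 (γ' t))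
    (G := fun t => (inner ℝ n (γ t) : ℝ) - c) (A := (1 + V) * L * C * S) (B := 2 * (1 + V) * ε)
    (c := c₀ / 2) (δ := C * S) hst (by positivity) (by positivity) (by positivity)
    (hucont.mono (Icc_subset_Icc hs1.1 ht.2)) (hGcont.mono (Icc_subset_Icc hs1.1 ht.2)) hslope
    (hN.union hN') ?_
  · refine hband.trans ?_
    have h1 : (1 + V) * L * C * S * (t - s) ≤ (1 + V) * L * C * S * h :=
      mul_le_mul_of_nonneg_left (by linarith [hs1.1, ht.2]) (by positivity)
    have h2 : 2 * (C * S) / (c₀ / 2) = 4 * C / c₀ * S := by field_simp; ring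
    rw [h2]
    have h3 : ((1 + V) * L * C * h + 2 * (1 + V) * ε * (4 * C / c₀)) * S ≤ θ * S :=
      mul_le_mul_of_nonneg_right hθ hS
    linarith
  · intro τ hτ
    have hτI : τ ∈ Ioo 0 h := ⟨hs1.1.trans_lt hτ.1.1, hτ.1.2.trans_le ht.2⟩
    have hτI' := Ioo_subset_Icc_self hτI
    obtain ⟨k, hk, hk'⟩ := hd τ ⟨hτI, fun hh => hτ.2 (Or.inl hh)⟩
    obtain ⟨l, hl, hl'⟩ := hd' τ ⟨hτI, fun hh => hτ.2 (Or.inr hh)⟩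
    have hdist : ‖γ τ - γ' τ‖ ≤ C * S := by
      refine (norm_sub_le_shear (c := c) (K := 0) hn hq (Or.inl rfl)).trans ?_
      exact mul_le_mul hC (hSb τ hτI') (norm_nonneg _) hC0
    have hsame : ∀ i, ‖P.vel i (γ τ) - P.vel i (γ' τ)‖ ≤ L * (C * S) := fun i =>
      (hB.vel_lip _ _ _).trans (mul_le_mul_of_nonneg_left hdist hLpos.le)
    have hA0 : 0 ≤ (1 + V) * L * C * S := by positivity
    have hB0 : 0 ≤ 2 * (1 + V) * ε := by positivity
    have hdiff : |((inner ℝ n (γ τ) : ℝ) - c) - ((inner ℝ n (γ' τ) : ℝ) - c)| ≤ C * S := by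
      rw [sub_sub_sub_cancel_right]
      exact (abs_inner_sub_le hn _ _).trans hdist
    have hfar : ∀ x : Sp d, ‖P.vel a x - wa‖ ≤ ε →
        ‖P.vel a x + (inner ℝ n (P.vel a x) : ℝ) • v - wb‖ ≤ (1 + V) * ε := by
      intro x hx
      have : P.vel a x + (inner ℝ n (P.vel a x) : ℝ) • v - wb =
          (P.vel a x - wa) + (inner ℝ n (P.vel a x - wa) : ℝ) • v := by
        rw [← hv, inner_sub_right, sub_smul]; abel
      rw [this]
      exact (norm_add_inner_smul_le hn hV _).trans (mul_le_mul_of_nonneg_left hx (by positivity))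
    have hfarb : ∀ x : Sp d, ‖P.vel b x - wb‖ ≤ ε → ‖P.vel b x - wb‖ ≤ (1 + V) * ε := by
      intro x hx
      refine hx.trans ?_
      nlinarith
    rcases hs τ hτI' k hk with ⟨rfl, h1⟩ | ⟨rfl, h1⟩ <;>
      rcases hs' τ hτI' l hl with ⟨rfl, h2⟩ | ⟨rfl, h2⟩
    · have hbd : ‖(P.vel l (γ τ) + (inner ℝ n (P.vel l (γ τ)) : ℝ) • v) -
          (P.vel l (γ' τ) + (inner ℝ n (P.vel l (γ' τ)) : ℝ) • v)‖ ≤ (1 + V) * L * C * S := by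
        have : (P.vel l (γ τ) + (inner ℝ n (P.vel l (γ τ)) : ℝ) • v) -
          (P.vel l (γ' τ) + (inner ℝ n (P.vel l (γ' τ)) : ℝ) • v) =
          (P.vel l (γ τ) - P.vel l (γ' τ)) +
            (inner ℝ n (P.vel l (γ τ) - P.vel l (γ' τ)) : ℝ) • v := by
          rw [inner_sub_right, sub_smul]; abel
        rw [this]
        refine (norm_add_inner_smul_le hn hV _).trans ?_
        have := mul_le_mul_of_nonneg_left (hsame l) (show 0 ≤ 1 + V by positivity)
        linarith
      exact ⟨_, (hasDerivAt_shear_of_lt hk' h1).sub (hasDerivAt_shear_of_lt hl' h2),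
        by linarith, fun _ => hbd⟩
    · refine ⟨_, (hasDerivAt_shear_of_lt hk' h1).sub (hasDerivAt_shear_of_gt hl' h2), ?_, ?_⟩
      · have h3 := hfar _ (hε τ hτI').1
        have h4 := hfarb _ (hε' τ hτI').2
        have := norm_sub_le_norm_sub_add_norm_sub
          (P.vel k (γ τ) + (inner ℝ n (P.vel k (γ τ)) : ℝ) • v) wb (P.vel l (γ' τ))
        rw [norm_sub_rev wb] at this
        linarith
      · intro hlt
        rw [abs_of_neg (by linarith)] at hlt
        linarith [(abs_le.1 hdiff).1]
    · refine ⟨_, (hasDerivAt_shear_of_gt hk' h1).sub (hasDerivAt_shear_of_lt hl' h2), ?_, ?_⟩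
      · have h3 := hfar _ (hε' τ hτI').1
        have h4 := hfarb _ (hε τ hτI').2
        have := norm_sub_le_norm_sub_add_norm_sub (P.vel k (γ τ)) wb
          (P.vel l (γ' τ) + (inner ℝ n (P.vel l (γ' τ)) : ℝ) • v)
        rw [norm_sub_rev wb] at this
        linarith
      · intro hlt
        rw [abs_of_pos (by linarith)] at hlt
        linarith [(abs_le.1 hdiff).2]
    · have hbd : ‖P.vel l (γ τ) - P.vel l (γ' τ)‖ ≤ (1 + V) * L * C * S := by
        refine (hsame l).trans ?_
        have : 0 ≤ V * (L * (C * S)) := by positivity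
        linarith
      exact ⟨_, (hasDerivAt_shear_of_gt hk' h1).sub (hasDerivAt_shear_of_gt hl' h2),
        by linarith, fun _ => hbd⟩

end Transversal

/-! ### Local structure of the pieces and the weighted measure -/

section Local

/-- The frontier of a piece is covered by the hyperplanes, so a connected set that avoids them
cannot leave the piece. -/
theorem subset_piece_of_inter {Q : Set (Sp d)} (hQ : IsPreconnected Q) {i : ι}
    (hne : (Q ∩ P.piece i).Nonempty) (hQH : ∀ x ∈ Q, ∀ j, x ∉ P.hyp j) : Q ⊆ P.piece i := by
  refine hQ.subset_left_of_subset_union (P.piece_open i) isClosed_closure.isOpen_compl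
    (disjoint_compl_right_iff_subset.2 subset_closure) (fun x hx => ?_) hne
  by_contra hcon
  rw [mem_union, mem_compl_iff, not_or, not_not] at hcon
  have hfr : x ∈ frontier (P.piece i) := by
    rw [(P.piece_open i).frontier_eq]; exact ⟨hcon.2, hcon.1⟩
  obtain ⟨j, hj⟩ := mem_iUnion.1 (P.frontier_piece i hfr)
  exact hQH x hx j hj

theorem piece_unique {i k : ι} {x : Sp d} (hi : x ∈ P.piece i) (hk : x ∈ P.piece k) : i = k := by
  by_contra hne
  exact disjoint_left.1 (P.piece_disjoint hne) hi hk

/-- The half-balls cut out by an interface. -/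
theorem convex_half_ball (p n : Sp d) (c ρ : ℝ) :
    Convex ℝ (Metric.ball p ρ ∩ {x | inner ℝ n x < c}) ∧
    Convex ℝ (Metric.ball p ρ ∩ {x | c < inner ℝ n x}) := by
  constructor
  · exact (convex_ball p ρ).inter (convex_halfSpace_lt (innerₛₗ ℝ n).isLinear c)
  · exact (convex_ball p ρ).inter (convex_halfSpace_gt (innerₛₗ ℝ n).isLinear c)

/-- Near a point of a single hyperplane of the arrangement, there are at most two pieces, one on
each side. -/
theorem local_structure {j : κ} {p : Sp d} {ρ : ℝ}
    (hρ : ∀ x ∈ Metric.ball p ρ, ∀ k, x ∈ P.hyp k → x ∈ P.hyp j) :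
    (∀ k l, ∀ x ∈ Metric.ball p ρ, ∀ y ∈ Metric.ball p ρ, x ∈ P.piece k → y ∈ P.piece l → k = l) ∨
    ∃ a b, (∀ x ∈ Metric.ball p ρ, inner ℝ (P.nrm j) x < P.lev j → x ∈ P.piece a) ∧
      (∀ x ∈ Metric.ball p ρ, P.lev j < inner ℝ (P.nrm j) x → x ∈ P.piece b) ∧
      ∀ k, ∀ x ∈ Metric.ball p ρ, x ∈ P.piece k →
        (k = a ∧ inner ℝ (P.nrm j) x < P.lev j) ∨ (k = b ∧ P.lev j < inner ℝ (P.nrm j) x) := by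
  set n := P.nrm j with hn
  set c := P.lev j with hc
  have hnn : inner ℝ n n = (1 : ℝ) := by
    rw [real_inner_self_eq_norm_sq, P.norm_nrm]; norm_num
  set Qm := Metric.ball p ρ ∩ {x | inner ℝ n x < c} with hQm
  set Qp := Metric.ball p ρ ∩ {x | c < inner ℝ n x} with hQp
  have hm : ∀ k, (Qm ∩ P.piece k).Nonempty → Qm ⊆ P.piece k := fun k hk =>
    subset_piece_of_inter (convex_half_ball p n c ρ).1.isPreconnected hk fun x hx l hl =>
      (ne_of_lt hx.2) (show inner ℝ n x = c from hρ x hx.1 l hl)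
  have hp : ∀ k, (Qp ∩ P.piece k).Nonempty → Qp ⊆ P.piece k := fun k hk =>
    subset_piece_of_inter (convex_half_ball p n c ρ).2.isPreconnected hk fun x hx l hl =>
      (ne_of_gt hx.2) (show inner ℝ n x = c from hρ x hx.1 l hl)
  -- a point on the hyperplane lying in a piece forces both half-balls to lie in it
  have hon : ∀ k, ∀ x ∈ Metric.ball p ρ, x ∈ P.piece k → inner ℝ n x = c →
      (Qm ∩ P.piece k).Nonempty ∧ (Qp ∩ P.piece k).Nonempty := by
    intro k x hx hxk hxc
    obtain ⟨ε, hε, hball⟩ := Metric.isOpen_iff.1 (Metric.isOpen_ball.inter (P.piece_open k)) x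
      ⟨hx, hxk⟩
    have hin : ∀ s : ℝ, |s| ≤ ε / 2 → x + s • n ∈ Metric.ball p ρ ∩ P.piece k := by
      intro s hs
      apply hball
      rw [Metric.mem_ball, dist_eq_norm, add_sub_cancel_left, norm_smul, P.norm_nrm, mul_one,
        Real.norm_eq_abs]
      linarith
    have hval : ∀ s : ℝ, inner ℝ n (x + s • n) = c + s := by
      intro s; rw [inner_add_right, inner_smul_right, hnn, hxc, mul_one]
    have h1 := hin (-(ε / 2)) (by rw [abs_neg, abs_of_pos (by positivity)])
    have h2 := hin (ε / 2) (by rw [abs_of_pos (by positivity)])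
    refine ⟨⟨_, ⟨h1.1, ?_⟩, h1.2⟩, ⟨_, ⟨h2.1, ?_⟩, h2.2⟩⟩
    · change inner ℝ n (x + (-(ε / 2)) • n) < c
      rw [hval]; linarith
    · change c < inner ℝ n (x + (ε / 2) • n)
      rw [hval]; linarith
  have hmeet : ∀ k, ∀ x ∈ Metric.ball p ρ, x ∈ P.piece k →
      (Qm ∩ P.piece k).Nonempty ∨ (Qp ∩ P.piece k).Nonempty := by
    intro k x hx hxk
    rcases lt_trichotomy (inner ℝ n x) c with h | h | h
    · exact Or.inl ⟨x, ⟨hx, h⟩, hxk⟩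
    · exact Or.inl (hon k x hx hxk h).1
    · exact Or.inr ⟨x, ⟨hx, h⟩, hxk⟩
  have hum : ∀ k l, (Qm ∩ P.piece k).Nonempty → (Qm ∩ P.piece l).Nonempty → k = l := by
    rintro k l ⟨x, hx, hxk⟩ hl
    exact piece_unique hxk (hm l hl hx)
  have hup : ∀ k l, (Qp ∩ P.piece k).Nonempty → (Qp ∩ P.piece l).Nonempty → k = l := by
    rintro k l ⟨x, hx, hxk⟩ hl
    exact piece_unique hxk (hp l hl hx)
  by_cases hab : ∃ a b, a ≠ b ∧ (Qm ∩ P.piece a).Nonempty ∧ (Qp ∩ P.piece b).Nonempty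
  · right
    obtain ⟨a, b, hne, ha, hb⟩ := hab
    refine ⟨a, b, fun x hx h => hm a ha ⟨hx, h⟩, fun x hx h => hp b hb ⟨hx, h⟩, ?_⟩
    intro k x hx hxk
    rcases lt_trichotomy (inner ℝ n x) c with h | h | h
    · exact Or.inl ⟨hum k a ⟨x, ⟨hx, h⟩, hxk⟩ ha, h⟩
    · obtain ⟨h1, h2⟩ := hon k x hx hxk h
      exact absurd ((hum k a h1 ha).symm.trans (hup k b h2 hb)) hne
    · exact Or.inr ⟨hup k b ⟨x, ⟨hx, h⟩, hxk⟩ hb, h⟩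
  · left
    push Not at hab
    intro k l x hx y hy hxk hyl
    rcases hmeet k x hx hxk with h1 | h1 <;> rcases hmeet l y hy hyl with h2 | h2
    · exact hum k l h1 h2
    · by_contra hne
      exact (h2.ne_empty) (hab k l hne h1)
    · by_contra hne
      exact (h1.ne_empty) (hab l k (Ne.symm hne) h2)
    · exact hup k l h1 h2

/-- The measure with density `wt` on the pieces. -/
def mass [Fintype ι] (P : PiecewiseField d ι κ) : Measure (Sp d) :=
  ∑ i, (volume.restrict (P.piece i)).withDensity fun x => ENNReal.ofReal (P.wt i x)

theorem measurable_wt (i : ι) : Measurable fun x => ENNReal.ofReal (P.wt i x) :=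
  ENNReal.measurable_ofReal.comp (P.wt_contDiff i).continuous.measurable

variable [Fintype ι]

/-- Valid for every set, measurable or not, because restricted Lebesgue measure is s-finite. This
matters since the formula is applied to sets of starting points of trajectories. -/
theorem mass_apply (A : Set (Sp d)) :
    P.mass A = ∑ i, ∫⁻ x in A ∩ P.piece i, ENNReal.ofReal (P.wt i x) := by
  rw [mass, Measure.finsetSum_apply]
  refine Finset.sum_congr rfl fun i _ => ?_
  rw [withDensity_apply', Measure.restrict_restrict' (P.piece_open i).measurableSet]

theorem volume_le_sum_piece [Countable κ] {A : Set (Sp d)} (hA : A ⊆ P.dom) :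
    volume A ≤ ∑ i, volume (A ∩ P.piece i) := by
  have h1 : A ⊆ (⋃ i, A ∩ P.piece i) ∪ ⋃ j, hyperplane (P.nrm j) (P.lev j) := by
    intro x hx
    rcases P.dom_subset (hA hx) with h | h
    · obtain ⟨i, hi⟩ := mem_iUnion.1 h
      exact Or.inl (mem_iUnion.2 ⟨i, hx, hi⟩)
    · exact Or.inr h
  have h2 : volume (⋃ j, hyperplane (P.nrm j) (P.lev j)) = 0 :=
    measure_iUnion_null fun j => volume_hyperplane (P.norm_nrm j) _
  refine (measure_mono h1).trans ((measure_union_le _ _).trans ?_)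
  rw [h2, add_zero]
  exact measure_iUnion_fintype_le _ _

theorem sum_piece_le_volume (A : Set (Sp d)) : ∑ i, volume (A ∩ P.piece i) ≤ volume A := by
  have := measure_iUnion (μ := volume.restrict A) P.piece_disjoint
    (fun i => (P.piece_open i).measurableSet)
  simp only [Measure.restrict_apply (P.piece_open _).measurableSet, tsum_fintype] at this
  calc ∑ i, volume (A ∩ P.piece i) = volume.restrict A (⋃ i, P.piece i) := by
        rw [this]; simp only [inter_comm]
    _ ≤ volume.restrict A univ := measure_mono (subset_univ _)
    _ = volume A := by simp

theorem mass_le_of_wt_le {A : Set (Sp d)} {s : ℝ}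
    (h : ∀ i, ∀ x ∈ A, x ∈ P.piece i → P.wt i x ≤ s) :
    P.mass A ≤ ENNReal.ofReal s * volume A := by
  rw [mass_apply]
  calc ∑ i, ∫⁻ x in A ∩ P.piece i, ENNReal.ofReal (P.wt i x)
      ≤ ∑ i, ENNReal.ofReal s * volume (A ∩ P.piece i) := by
        refine Finset.sum_le_sum fun i _ => ?_
        rw [← setLIntegral_const]
        refine lintegral_mono_ae ?_
        -- The domain of integration may fail to be measurable; measurability of the set where the
        -- inequality holds is enough.
        refine (ae_restrict_iff (measurableSet_le (measurable_wt i) measurable_const)).2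
          (Eventually.of_forall fun x hx => ENNReal.ofReal_le_ofReal (h i x hx.1 hx.2))
    _ ≤ _ := by rw [← Finset.mul_sum]; gcongr; exact sum_piece_le_volume A

theorem mul_volume_le_mass [Countable κ] {A : Set (Sp d)} (hA : A ⊆ P.dom) {s : ℝ}
    (h : ∀ i, ∀ x ∈ A, x ∈ P.piece i → s ≤ P.wt i x) :
    ENNReal.ofReal s * volume A ≤ P.mass A := by
  rw [mass_apply]
  calc ENNReal.ofReal s * volume A ≤ ENNReal.ofReal s * ∑ i, volume (A ∩ P.piece i) := by
        gcongr; exact volume_le_sum_piece hA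
    _ = ∑ i, ENNReal.ofReal s * volume (A ∩ P.piece i) := Finset.mul_sum _ _ _
    _ ≤ _ := by
        refine Finset.sum_le_sum fun i _ => ?_
        rw [← setLIntegral_const]
        refine lintegral_mono_ae ?_
        refine (ae_restrict_iff (measurableSet_le measurable_const (measurable_wt i))).2
          (Eventually.of_forall fun x hx => ENNReal.ofReal_le_ofReal (h i x hx.1 hx.2))

theorem mass_le_up (A : Set (Sp d)) : P.mass A ≤ ENNReal.ofReal P.up * volume A :=
  mass_le_of_wt_le fun i x _ hx => (P.wt_mem i x hx).2

theorem lo_le_mass [Countable κ] {A : Set (Sp d)} (hA : A ⊆ P.dom) :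
    ENNReal.ofReal P.lo * volume A ≤ P.mass A :=
  mul_volume_le_mass hA fun i x _ hx => (P.wt_mem i x hx).1

/-- Comparison of `mass` with the Lebesgue measure of the image under `shear`. -/
theorem mass_shear [Countable κ] {n : Sp d} {c : ℝ} {v : Sp d} {K s θ : ℝ} (hn : ‖n‖ = 1)
    (hq : 0 < 1 + (inner ℝ n v : ℝ)) (hK : 0 ≤ K) (hs : 0 < s) (hθ : 0 ≤ θ) {Y : Set (Sp d)}
    (hY : Y ⊆ P.dom)
    (h1 : ∀ i, ∀ x ∈ Y, x ∈ P.piece i → inner ℝ n x < c →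
      P.wt i x ≤ (1 + θ) * (s * (1 + inner ℝ n v)) ∧
        s * (1 + inner ℝ n v) ≤ (1 + θ) * P.wt i x)
    (h2 : ∀ i, ∀ x ∈ Y, x ∈ P.piece i → c ≤ inner ℝ n x →
      P.wt i x ≤ (1 + θ) * s ∧ s ≤ (1 + θ) * P.wt i x) :
    P.mass Y ≤ ENNReal.ofReal ((1 + θ) * s) * volume (shear n c v K '' Y) ∧
    ENNReal.ofReal s * volume (shear n c v K '' Y) ≤ ENNReal.ofReal (1 + θ) * P.mass Y := by
  set q := 1 + (inner ℝ n v : ℝ) with hqd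
  have hθ1 : 0 < 1 + θ := by positivity
  have hms := measurableSet_below n c
  rw [volume_image_shear hn hq hK, ← measure_inter_add_sdiff (μ := P.mass) Y hms]
  constructor
  · rw [mul_add, ← mul_assoc, ← ENNReal.ofReal_mul (by positivity)]
    refine add_le_add ?_ ?_
    · refine mass_le_of_wt_le fun i x hx hxi => ?_
      rw [mul_assoc]
      exact (h1 i x hx.1 hxi hx.2).1
    · exact mass_le_of_wt_le fun i x hx hxi => (h2 i x hx.1 hxi (not_lt.1 hx.2)).1
  · have hsplit : ∀ s' : ℝ, 0 ≤ s' → ENNReal.ofReal s' = ENNReal.ofReal (1 + θ) *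
        ENNReal.ofReal (s' / (1 + θ)) := by
      intro s' hs'
      rw [← ENNReal.ofReal_mul hθ1.le, mul_div_cancel₀ _ hθ1.ne']
    rw [mul_add, mul_add, ← mul_assoc, ← ENNReal.ofReal_mul hs.le, hsplit (s * q) (by positivity),
      hsplit s hs.le, mul_assoc, mul_assoc]
    refine add_le_add ?_ ?_
    · gcongr
      refine mul_volume_le_mass (inter_subset_left.trans hY) fun i x hx hxi => ?_
      rw [div_le_iff₀ hθ1, mul_comm]
      linarith [(h1 i x hx.1 hxi hx.2).2]
    · gcongr
      refine mul_volume_le_mass (sdiff_subset.trans hY) fun i x hx hxi => ?_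
      rw [div_le_iff₀ hθ1]
      linarith [(h2 i x hx.1 hxi (not_lt.1 hx.2)).2]

end Local

end PiecewiseField

end EllamFlow

/-! ### Charts that straighten the flow near an interface -/

namespace EllamFlow

namespace PiecewiseField

variable {d : ℕ} {ι κ : Type} {P : PiecewiseField d ι κ}

section Chart

variable {M L : ℝ}

/-- In the coordinates `shear n c v K`, the displacements during a time `h` of two trajectories
which stay in `ball p r` and start away from the hyperplane `{n · x = c}` nearly coincide. -/
def NearIsometric (P : PiecewiseField d ι κ) (h δ θ r : ℝ) (p n : Sp d) (c : ℝ) (v : Sp d)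
    (K : ℝ) : Prop :=
  ∀ γ γ', P.IsTraj h γ → P.IsTraj h γ' → (∀ t ∈ Icc 0 h, γ t ∈ Metric.ball p r) →
    (∀ t ∈ Icc 0 h, γ' t ∈ Metric.ball p r) →
    δ * h < |inner ℝ n (γ 0) - c| → δ * h < |inner ℝ n (γ' 0) - c| →
    ∀ τ ∈ Icc 0 h, ‖(shear n c v K (γ 0) - shear n c v K (γ' 0)) -
      (shear n c v K (γ h) - shear n c v K (γ' h))‖ ≤
        θ * ‖shear n c v K (γ τ) - shear n c v K (γ' τ)‖

/-- The pieces near `p` are `a`, on the side `n · x < c`, and `b`, on the side `c < n · x`. -/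
def TwoSided (P : PiecewiseField d ι κ) (p : Sp d) (ρ : ℝ) (n : Sp d) (c : ℝ) (a b : ι) : Prop :=
  ∀ k, ∀ x ∈ Metric.ball p ρ, x ∈ P.piece k →
    (k = a ∧ inner ℝ n x < c) ∨ (k = b ∧ c < inner ℝ n x)

theorem norm_sub_le_of_mem_ball {p x : Sp d} {r : ℝ} (hx : x ∈ Metric.ball p r) : ‖x - p‖ ≤ r := by
  rw [← dist_eq_norm]; exact (Metric.mem_ball.1 hx).le

/-- When a single piece meets the ball, the identity chart (v = 0, K = 0) is enough: the difference
of two trajectories of a Lipschitz field changes by a fraction 2Lh. -/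
theorem near_isometric_single (hB : P.Bounds M L) {h r θ δ : ℝ} {p : Sp d} {n : Sp d} {c : ℝ}
    (hh : 0 < h) (hone : ∀ k l, ∀ x ∈ Metric.ball p r, ∀ y ∈ Metric.ball p r,
      x ∈ P.piece k → y ∈ P.piece l → k = l) (hL : L * h ≤ 1 / 2) (hθ : 2 * (L * h) ≤ θ) :
    P.NearIsometric h δ θ r p n c 0 0 := by
  intro γ γ' hγ hγ' hb hb' _ _ τ hτ
  have hsh : ∀ x : Sp d, shear n c 0 0 x = x := by
    intro x; unfold shear; split_ifs <;> simp
  simp only [hsh]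
  obtain ⟨t₀, ht₀, i, hi⟩ := hγ.exists_mem_piece hh
  have h1 := (hγ.osc_single hB hγ' hh.le hL (i := i)
    (fun t ht k hk => hone k i _ (hb t ht) _ (hb t₀ ht₀) hk hi)
    (fun t ht k hk => hone k i _ (hb' t ht) _ (hb t₀ ht₀) hk hi) hτ).2 h ⟨hh.le, le_rfl⟩ 0
    ⟨le_rfl, hh.le⟩
  exact h1.trans (mul_le_mul_of_nonneg_right hθ (norm_nonneg _))

/-- The normal speed in the ball is at most 3δ/4, so a trajectory starting at distance more than δh
from the hyperplane stays on its side. Two trajectories on the same side follow the same smooth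
field. On opposite sides, the translation by −n (K = 1) keeps the images at distance at least 1, and
displacements of size O(Mh) are negligible compared with it. -/
theorem near_isometric_of_small_flux (hB : P.Bounds M L) {h r ρ θ δ V C : ℝ} {p n v : Sp d}
    {c : ℝ} {a b : ι} (hh : 0 < h) (hn : ‖n‖ = 1) (htwo : P.TwoSided p ρ n c a b) (hr : r ≤ ρ)
    (hδ : 0 < δ) (ha : |inner ℝ n (P.vel a p)| ≤ δ / 2) (hb : |inner ℝ n (P.vel b p)| ≤ δ / 2)
    (hq : 0 < 1 + (inner ℝ n v : ℝ)) (hV : ‖v‖ ≤ V) (hC : 1 + ‖v‖ / (1 + inner ℝ n v) ≤ C)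
    (hLr : L * r ≤ δ / 4) (hL : L * h ≤ 1 / 2) (hθ1 : 2 * (1 + V) * C * L * h ≤ θ)
    (hθ2 : (2 + V) * M * h ≤ θ) :
    P.NearIsometric h δ θ r p n c v 1 := by
  have hV0 : 0 ≤ V := (norm_nonneg _).trans hV
  have hLpos := hB.L_pos
  have hMpos := hB.M_pos
  have hC1 : 1 ≤ C := le_trans (by have : 0 ≤ ‖v‖ / (1 + inner ℝ n v) := by positivity
                                   linarith) hC
  have h0 : (0 : ℝ) ∈ Icc 0 h := ⟨le_rfl, hh.le⟩
  have hh' : h ∈ Icc 0 h := ⟨hh.le, le_rfl⟩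
  -- trajectories do not cross
  have hside : ∀ γ, P.IsTraj h γ → (∀ t ∈ Icc 0 h, γ t ∈ Metric.ball p r) →
      δ * h < |inner ℝ n (γ 0) - c| → ∀ t ∈ Icc 0 h,
      |(inner ℝ n (γ t) : ℝ) - inner ℝ n (γ 0)| < |inner ℝ n (γ 0) - c| := by
    intro γ hγ hγb hγ0 t ht
    obtain ⟨hcont, -, N, hN, hd⟩ := hγ
    have h1 := norm_sub_le_of_hasDerivAt_off_countable (u := fun t => (inner ℝ n (γ t) : ℝ))
      (C := 3 / 4 * δ) ht.1 ((continuousOn_const.inner hcont).mono (Icc_subset_Icc le_rfl ht.2)) hN (by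
        intro τ hτ
        have hτI : τ ∈ Ioo 0 h := ⟨hτ.1.1, hτ.1.2.trans_le ht.2⟩
        obtain ⟨k, hk, hk'⟩ := hd τ ⟨hτI, hτ.2⟩
        have hτb := hγb τ (Ioo_subset_Icc_self hτI)
        refine ⟨inner ℝ n (P.vel k (γ τ)), (innerSL ℝ n).hasFDerivAt.comp_hasDerivAt τ hk', ?_⟩
        have h2 : |(inner ℝ n (P.vel k (γ τ)) : ℝ) - inner ℝ n (P.vel k p)| ≤ δ / 4 := by
          refine (abs_inner_sub_le hn _ _).trans ((hB.vel_lip _ _ _).trans (le_trans ?_ hLr))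
          exact mul_le_mul_of_nonneg_left (norm_sub_le_of_mem_ball hτb) hLpos.le
        have h3 : |(inner ℝ n (P.vel k p) : ℝ)| ≤ δ / 2 := by
          rcases htwo k _ (Metric.ball_subset_ball hr hτb) hk with ⟨rfl, -⟩ | ⟨rfl, -⟩ <;> assumption
        rw [Real.norm_eq_abs]
        rw [abs_le] at h2 h3 ⊢
        constructor <;> linarith [h2.1, h2.2, h3.1, h3.2])
    rw [Real.norm_eq_abs, sub_zero] at h1
    have h2 : 3 / 4 * δ * t ≤ 3 / 4 * δ * h := mul_le_mul_of_nonneg_left ht.2 (by positivity)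
    have h3 : 0 < δ * h := by positivity
    calc _ ≤ _ := h1
      _ < _ := by linarith
  have hneg : ∀ γ, P.IsTraj h γ → (∀ t ∈ Icc 0 h, γ t ∈ Metric.ball p r) →
      δ * h < |inner ℝ n (γ 0) - c| → inner ℝ n (γ 0) < c → ∀ t ∈ Icc 0 h,
      inner ℝ n (γ t) < c := by
    intro γ hγ hγb hγ0 hs t ht
    have := hside γ hγ hγb hγ0 t ht
    rw [abs_of_neg (by linarith : (inner ℝ n (γ 0) : ℝ) - c < 0)] at this
    linarith [(abs_lt.1 this).2]
  have hpos : ∀ γ, P.IsTraj h γ → (∀ t ∈ Icc 0 h, γ t ∈ Metric.ball p r) →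
      δ * h < |inner ℝ n (γ 0) - c| → ¬ inner ℝ n (γ 0) < c → ∀ t ∈ Icc 0 h,
      c < inner ℝ n (γ t) := by
    intro γ hγ hγb hγ0 hs t ht
    have := hside γ hγ hγb hγ0 t ht
    have hs' : 0 ≤ (inner ℝ n (γ 0) : ℝ) - c := by linarith [not_lt.1 hs]
    rw [abs_of_nonneg hs'] at this
    linarith [(abs_lt.1 this).1]
  -- trajectories on opposite sides
  have hopp : ∀ γ γ', P.IsTraj h γ → P.IsTraj h γ' → (∀ t ∈ Icc 0 h, inner ℝ n (γ t) < c) →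
      (∀ t ∈ Icc 0 h, c < inner ℝ n (γ' t)) → ∀ τ ∈ Icc 0 h,
      ‖(shear n c v 1 (γ 0) - shear n c v 1 (γ' 0)) - (shear n c v 1 (γ h) - shear n c v 1 (γ' h))‖
        ≤ θ * ‖shear n c v 1 (γ τ) - shear n c v 1 (γ' τ)‖ := by
    intro γ γ' hγ hγ' hs hs' τ hτ
    have h1 : 1 ≤ ‖shear n c v 1 (γ τ) - shear n c v 1 (γ' τ)‖ := by
      refine le_trans ?_ (abs_inner_sub_le hn _ _)
      have h2 := inner_shear_of_lt (v := v) (K := 1) hn (hs τ hτ)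
      rw [shear_of_le (hs' τ hτ).le, abs_sub_comm]
      refine le_trans ?_ (le_abs_self _)
      have h3 := hs τ hτ
      have h4 := hs' τ hτ
      nlinarith
    have h2 : (shear n c v 1 (γ 0) - shear n c v 1 (γ' 0)) -
        (shear n c v 1 (γ h) - shear n c v 1 (γ' h)) =
        ((γ 0 - γ h) + (inner ℝ n (γ 0 - γ h) : ℝ) • v) - (γ' 0 - γ' h) := by
      rw [shear_of_lt (hs 0 h0), shear_of_lt (hs h hh'), shear_of_le (hs' 0 h0).le,
        shear_of_le (hs' h hh').le, inner_sub_right]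
      simp only [sub_smul]
      abel
    rw [h2]
    have h3 := (norm_add_inner_smul_le hn hV (γ 0 - γ h)).trans
      (mul_le_mul_of_nonneg_left (hγ.norm_sub_le_mul hB hh' h0) (by positivity))
    have h4 := hγ'.norm_sub_le_mul hB hh' h0
    have h5 := norm_sub_le ((γ 0 - γ h) + (inner ℝ n (γ 0 - γ h) : ℝ) • v) (γ' 0 - γ' h)
    have hθ0 : 0 ≤ θ := le_trans (by positivity) hθ2
    nlinarith
  intro γ γ' hγ hγ' hb1 hb1' hγ0 hγ0' τ hτ
  by_cases hs : inner ℝ n (γ 0) < c <;> by_cases hs' : inner ℝ n (γ' 0) < c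
  · have e1 := hneg γ hγ hb1 hγ0 hs
    have e2 := hneg γ' hγ' hb1' hγ0' hs'
    have hosc := (hγ.osc_single hB hγ' hh.le hL (i := a)
      (fun t ht k hk => by
        rcases htwo k _ (Metric.ball_subset_ball hr (hb1 t ht)) hk with h | h
        · exact h.1
        · linarith [e1 t ht, h.2])
      (fun t ht k hk => by
        rcases htwo k _ (Metric.ball_subset_ball hr (hb1' t ht)) hk with h | h
        · exact h.1
        · linarith [e2 t ht, h.2]) hτ).2 h hh' 0 h0
    have h2 : (shear n c v 1 (γ 0) - shear n c v 1 (γ' 0)) -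
        (shear n c v 1 (γ h) - shear n c v 1 (γ' h)) =
        ((γ 0 - γ' 0) - (γ h - γ' h)) +
          (inner ℝ n ((γ 0 - γ' 0) - (γ h - γ' h)) : ℝ) • v := by
      rw [shear_of_lt (e1 0 h0), shear_of_lt (e1 h hh'), shear_of_lt (e2 0 h0),
        shear_of_lt (e2 h hh')]
      simp only [inner_sub_right, sub_smul]
      abel
    rw [h2]
    have h3 := norm_sub_le_shear (K := 1) hn hq (x := γ τ) (y := γ' τ) (c := c)
      (Or.inr ⟨fun _ => e2 τ hτ, fun _ => e1 τ hτ⟩)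
    have h4 : ‖γ τ - γ' τ‖ ≤ C * ‖shear n c v 1 (γ τ) - shear n c v 1 (γ' τ)‖ :=
      h3.trans (mul_le_mul_of_nonneg_right hC (norm_nonneg _))
    calc _ ≤ (1 + V) * ‖(γ 0 - γ' 0) - (γ h - γ' h)‖ := norm_add_inner_smul_le hn hV _
      _ ≤ (1 + V) * (2 * (L * h) * (C * ‖shear n c v 1 (γ τ) - shear n c v 1 (γ' τ)‖)) := by
          gcongr
          exact hosc.trans (mul_le_mul_of_nonneg_left h4 (by positivity))
      _ = 2 * (1 + V) * C * L * h * ‖shear n c v 1 (γ τ) - shear n c v 1 (γ' τ)‖ := by ring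
      _ ≤ _ := mul_le_mul_of_nonneg_right hθ1 (norm_nonneg _)
  · exact hopp γ γ' hγ hγ' (hneg γ hγ hb1 hγ0 hs) (hpos γ' hγ' hb1' hγ0' hs') τ hτ
  · have := hopp γ' γ hγ' hγ (hneg γ' hγ' hb1' hγ0' hs') (hpos γ hγ hb1 hγ0 hs) τ hτ
    rw [norm_sub_rev (shear n c v 1 (γ' τ))] at this
    have h2 : (shear n c v 1 (γ 0) - shear n c v 1 (γ' 0)) -
        (shear n c v 1 (γ h) - shear n c v 1 (γ' h)) =
        -((shear n c v 1 (γ' 0) - shear n c v 1 (γ 0)) -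
        (shear n c v 1 (γ' h) - shear n c v 1 (γ h))) := by abel
    rw [h2, norm_neg]
    exact this
  · have e1 := hpos γ hγ hb1 hγ0 hs
    have e2 := hpos γ' hγ' hb1' hγ0' hs'
    have hosc := (hγ.osc_single hB hγ' hh.le hL (i := b)
      (fun t ht k hk => by
        rcases htwo k _ (Metric.ball_subset_ball hr (hb1 t ht)) hk with h | h
        · linarith [e1 t ht, h.2]
        · exact h.1)
      (fun t ht k hk => by
        rcases htwo k _ (Metric.ball_subset_ball hr (hb1' t ht)) hk with h | h
        · linarith [e2 t ht, h.2]
        · exact h.1) hτ).2 h hh' 0 h0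
    rw [shear_of_le (e1 0 h0).le, shear_of_le (e1 h hh').le, shear_of_le (e2 0 h0).le,
        shear_of_le (e2 h hh').le, shear_of_le (e1 τ hτ).le, shear_of_le (e2 τ hτ).le]
    refine hosc.trans (mul_le_mul_of_nonneg_right (le_trans ?_ hθ1) (norm_nonneg _))
    have : 1 ≤ (1 + V) * C := by nlinarith
    have h5 : 0 ≤ L * h := by positivity
    nlinarith

/-- The vector v is such that the shear carries the velocity of the piece a at p to that of b, and
velocities in the ball are within ε = Lr of their values at p; `IsTraj.osc_transversal` then applies
with θ/2. -/
theorem near_isometric_transversal (hB : P.Bounds M L) {h r ρ θ δ c₀ V C : ℝ} {p n v : Sp d}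
    {c : ℝ} {a b : ι} (hh : 0 < h) (hr0 : 0 ≤ r) (hn : ‖n‖ = 1) (htwo : P.TwoSided p ρ n c a b)
    (hr : r ≤ ρ) (hc₀ : 0 < c₀) (ha : c₀ ≤ inner ℝ n (P.vel a p)) (hb : c₀ ≤ inner ℝ n (P.vel b p))
    (hv : P.vel a p + (inner ℝ n (P.vel a p) : ℝ) • v = P.vel b p)
    (hq : 0 < 1 + (inner ℝ n v : ℝ)) (hV : ‖v‖ ≤ V) (hC : 1 + ‖v‖ / (1 + inner ℝ n v) ≤ C)
    (hLr : L * r ≤ c₀ / 2)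
    (hθ : 2 * ((1 + V) * L * C * h + 2 * (1 + V) * (L * r) * (4 * C / c₀)) ≤ θ) (hθ1 : θ ≤ 1) :
    P.NearIsometric h δ θ r p n c v 0 := by
  intro γ γ' hγ hγ' hb1 hb1' _ _ τ hτ
  have hLpos := hB.L_pos
  have hcl : ∀ i x, x ∈ Metric.ball p r → ‖P.vel i x - P.vel i p‖ ≤ L * r := fun i x hx =>
    (hB.vel_lip _ _ _).trans (mul_le_mul_of_nonneg_left (norm_sub_le_of_mem_ball hx) hLpos.le)
  have := hγ.osc_transversal hB hγ' hh.le hn (a := a) (b := b) (c := c)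
    (fun t ht k hk => htwo k _ (Metric.ball_subset_ball hr (hb1 t ht)) hk)
    (fun t ht k hk => htwo k _ (Metric.ball_subset_ball hr (hb1' t ht)) hk) hv (ε := L * r)
    (fun t ht => ⟨hcl _ _ (hb1 t ht), hcl _ _ (hb1 t ht)⟩)
    (fun t ht => ⟨hcl _ _ (hb1' t ht), hcl _ _ (hb1' t ht)⟩) (by positivity) hc₀ ha hb hLr hV hq hC
    (θ := θ / 2) (by linarith) (by linarith) hτ h ⟨hh.le, le_rfl⟩ 0 ⟨le_rfl, hh.le⟩
  calc _ ≤ _ := this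
    _ = _ := by ring

/-- The conclusion of `mass_shear` on a ball. -/
def MassComparable [Fintype ι] (P : PiecewiseField d ι κ) (θ r : ℝ) (p n : Sp d) (c : ℝ) (v : Sp d)
    (K s : ℝ) : Prop :=
  ∀ Y ⊆ P.dom, Y ⊆ Metric.ball p r →
    P.mass Y ≤ ENNReal.ofReal ((1 + θ) * s) * volume (shear n c v K '' Y) ∧
    ENNReal.ofReal s * volume (shear n c v K '' Y) ≤ ENNReal.ofReal (1 + θ) * P.mass Y

variable [Fintype ι] [Countable κ]

/-- Pulled back by the shear, the multiple `wt b p` of Lebesgue measure has density `wt a p` below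
the hyperplane, because the Jacobian there is `wt a p / wt b p`, and `wt b p` above. In a small ball
these are the true weights up to a factor 1 + θ. -/
theorem mass_comparable_two (hB : P.Bounds M L) {r ρ θ K : ℝ} {p n v : Sp d} {c : ℝ} {a b : ι}
    (hn : ‖n‖ = 1) (htwo : P.TwoSided p ρ n c a b) (hr : r ≤ ρ) (hθ : 0 ≤ θ) (hK : 0 ≤ K)
    (ha : P.lo ≤ P.wt a p) (hb : P.lo ≤ P.wt b p)
    (hq : 1 + (inner ℝ n v : ℝ) = P.wt a p / P.wt b p) (hLr : L * r ≤ θ * P.lo) :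
    P.MassComparable θ r p n c v K (P.wt b p) := by
  intro Y hY hYb
  have hlo := P.lo_pos
  have hapos : 0 < P.wt a p := hlo.trans_le ha
  have hbpos : 0 < P.wt b p := hlo.trans_le hb
  have hclose : ∀ i, P.lo ≤ P.wt i p → ∀ x ∈ Y, x ∈ P.piece i →
      P.wt i x ≤ (1 + θ) * P.wt i p ∧ P.wt i p ≤ (1 + θ) * P.wt i x := by
    intro i hi x hx hxi
    have h1 : |P.wt i x - P.wt i p| ≤ θ * P.lo :=
      (hB.wt_lip _ _ _).trans ((mul_le_mul_of_nonneg_left (norm_sub_le_of_mem_ball (hYb hx))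
        hB.L_pos.le).trans hLr)
    have h2 := (P.wt_mem i x hxi).1
    rw [abs_le] at h1
    constructor <;> nlinarith [h1.1, h1.2]
  refine mass_shear hn (by rw [hq]; positivity) hK hbpos hθ hY ?_ ?_
  · intro i x hx hxi hlt
    rw [hq, mul_div_cancel₀ _ hbpos.ne']
    rcases htwo i x (Metric.ball_subset_ball hr (hYb hx)) hxi with ⟨rfl, -⟩ | ⟨-, h⟩
    · exact hclose i ha x hx hxi
    · linarith
  · intro i x hx hxi hle
    rcases htwo i x (Metric.ball_subset_ball hr (hYb hx)) hxi with ⟨-, h⟩ | ⟨rfl, -⟩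
    · linarith
    · exact hclose i hb x hx hxi

set_option maxHeartbeats 1000000 in
-- Write α_a, α_b for the normal velocities at p. If they are not small, v = (vel b − vel a)/α_a
-- makes the velocities match, and its Jacobian 1 + n·v = α_b/α_a equals wt a/wt b by continuity of
-- the flux, which is exactly what the masses require. If both are at most δ/2 in absolute value, v
-- = (wt a/wt b − 1)n with K = 1 has the same Jacobian, and trajectories do not cross. The radius
-- and the time step do not depend on p or j.
theorem exists_chart (hB : P.Bounds M L) {δ ρ θ : ℝ} (hδ : 0 < δ) (hρ : 0 < ρ) (hθ : 0 < θ)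
    (hθ1 : θ ≤ 1) : ∃ r > 0, ∃ h₀ > 0, ∀ h, 0 < h → h ≤ h₀ → ∀ j p, p ∈ P.hyp j →
      (∀ x ∈ Metric.ball p ρ, ∀ k, x ∈ P.hyp k → x ∈ P.hyp j) →
      ∃ (n : Sp d) (c : ℝ) (v : Sp d) (K s : ℝ), ‖n‖ = 1 ∧ 0 < 1 + (inner ℝ n v : ℝ) ∧ 0 ≤ K ∧
        0 < s ∧ (∀ x, |inner ℝ n x - c| = |P.sd j x|) ∧
        P.NearIsometric h δ θ r p n c v K ∧ P.MassComparable θ r p n c v K s := by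
  have hLpos := hB.L_pos
  have hMpos := hB.M_pos
  have hlo := P.lo_pos
  have hup := P.up_pos
  -- By continuity of the flux, a normal velocity above δ/2 on one side forces at least c₀, with the
  -- same sign, on the other side. So the two regimes exhaust all cases.
  set c₀ : ℝ := δ / 2 * (P.lo / P.up) with hc₀d
  have hc₀ : 0 < c₀ := by positivity
  -- V bounds ‖v‖ in both regimes: by 2M/c₀ in the transversal one, by up/lo + 1 in the other. C
  -- bounds 1 + ‖v‖/(1 + n·v), as the inverse Jacobian is at most up/lo.
  set V : ℝ := P.up / P.lo + 1 + 2 * M / c₀ with hVd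
  have hV0 : 0 < V := by positivity
  set C : ℝ := 1 + V * (P.up / P.lo) with hCd
  have hC0 : 0 < C := by positivity
  obtain ⟨r, hr, hrρ, hr1, hr2, hr3, hr4⟩ : ∃ r : ℝ, 0 < r ∧ r ≤ ρ ∧ L * r ≤ c₀ / 2 ∧
      L * r ≤ δ / 4 ∧ L * 2 * r ≤ θ * P.lo ∧ 16 * (1 + V) * L * C / c₀ * r ≤ θ / 2 := by
    have h1 := eventually_mul_le 1 hρ
    have h2 := eventually_mul_le L (half_pos hc₀)
    have h3 := eventually_mul_le L (show 0 < δ / 4 by positivity)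
    have h4 := eventually_mul_le (L * 2) (show 0 < θ * P.lo by positivity)
    have h5 := eventually_mul_le (16 * (1 + V) * L * C / c₀) (half_pos hθ)
    obtain ⟨r, hr⟩ := ((((h1.and h2).and h3).and h4).and (h5.and self_mem_nhdsWithin)).exists
    exact ⟨r, hr.2.2, by linarith [hr.1.1.1.1], hr.1.1.1.2, hr.1.1.2, hr.1.2, hr.2.1⟩
  obtain ⟨h₀, hh₀, e1, e2, e3⟩ : ∃ h₀ : ℝ, 0 < h₀ ∧ L * h₀ ≤ 1 / 2 ∧
      4 * (1 + V) * C * L * h₀ ≤ θ ∧ (2 + V) * M * h₀ ≤ θ := by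
    have h1 := eventually_mul_le L (show (0 : ℝ) < 1 / 2 by norm_num)
    have h2 := eventually_mul_le (4 * (1 + V) * C * L) hθ
    have h3 := eventually_mul_le ((2 + V) * M) hθ
    obtain ⟨r, hr⟩ := ((h1.and h2).and (h3.and self_mem_nhdsWithin)).exists
    exact ⟨r, hr.2.2, hr.1.1, hr.1.2, hr.2.1⟩
  refine ⟨r, hr, h₀, hh₀, fun h hh hhh₀ j p hp hpρ => ?_⟩
  have e1' : L * h ≤ 1 / 2 := (mul_le_mul_of_nonneg_left hhh₀ hLpos.le).trans e1
  have e2' : 4 * (1 + V) * C * L * h ≤ θ :=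
    (mul_le_mul_of_nonneg_left hhh₀ (by positivity)).trans e2
  have e3' : (2 + V) * M * h ≤ θ := (mul_le_mul_of_nonneg_left hhh₀ (by positivity)).trans e3
  have hC1 : 1 ≤ C := by
    have : 0 ≤ V * (P.up / P.lo) := by positivity
    linarith
  have hVC : 1 ≤ (1 + V) * C := by nlinarith
  have hLh : 2 * (L * h) ≤ θ := by
    have : 0 ≤ L * h := by positivity
    nlinarith
  have hpc : inner ℝ (P.nrm j) p = P.lev j := hp
  have hnj := P.norm_nrm j
  rcases P.local_structure hpρ with hone | ⟨a, b, hA, hBb, htwo⟩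
  · -- a single field
    have hone' : ∀ k l, ∀ x ∈ Metric.ball p r, ∀ y ∈ Metric.ball p r,
        x ∈ P.piece k → y ∈ P.piece l → k = l := fun k l x hx y hy =>
      hone k l x (Metric.ball_subset_ball hrρ hx) y (Metric.ball_subset_ball hrρ hy)
    have hni := near_isometric_single hB (n := P.nrm j) (c := P.lev j) (δ := δ) hh hone' e1' hLh
    have hq0 : 1 + (inner ℝ (P.nrm j) (0 : Sp d) : ℝ) = 1 := by simp
    by_cases hne : ∃ i, ∃ x, x ∈ P.piece i ∧ x ∈ Metric.ball p r
    · obtain ⟨i, x₀, hx₀i, hx₀⟩ := hne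
      have hw := P.wt_mem i x₀ hx₀i
      refine ⟨P.nrm j, P.lev j, 0, 0, P.wt i x₀, hnj, by rw [hq0]; exact one_pos, le_rfl,
        hlo.trans_le hw.1, fun x => rfl, hni, fun Y hY hYb => ?_⟩
      have hclose : ∀ k, ∀ x ∈ Y, x ∈ P.piece k →
          P.wt k x ≤ (1 + θ) * P.wt i x₀ ∧ P.wt i x₀ ≤ (1 + θ) * P.wt k x := by
        intro k x hx hxk
        obtain rfl := hone' k i x (hYb hx) x₀ hx₀ hxk hx₀i
        have h1 : |P.wt k x - P.wt k x₀| ≤ θ * P.lo := by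
          refine (hB.wt_lip _ _ _).trans (le_trans ?_ hr3)
          rw [mul_assoc]
          refine mul_le_mul_of_nonneg_left ?_ hLpos.le
          have h2 := norm_sub_le_of_mem_ball (hYb hx)
          have h3 := norm_sub_le_of_mem_ball hx₀
          have h4 := norm_sub_le (x - p) (x₀ - p)
          rw [sub_sub_sub_cancel_right] at h4
          linarith
        have h2 := (P.wt_mem k x hxk).1
        rw [abs_le] at h1
        constructor <;> nlinarith [h1.1, h1.2, hw.1]
      refine mass_shear hnj (by rw [hq0]; exact one_pos) le_rfl (hlo.trans_le hw.1) hθ.le hY ?_ ?_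
      · intro k x hx hxk _
        rw [hq0, mul_one]
        exact hclose k x hx hxk
      · intro k x hx hxk _
        exact hclose k x hx hxk
    -- No piece meets the ball: the conditions on the weights are void, and s = 1 is arbitrary.
    · push Not at hne
      refine ⟨P.nrm j, P.lev j, 0, 0, 1, hnj, by rw [hq0]; exact one_pos, le_rfl,
        one_pos, fun x => rfl, hni, fun Y hY hYb => ?_⟩
      exact mass_shear hnj (by rw [hq0]; exact one_pos) le_rfl one_pos hθ.le hY
        (fun k x hx hxk _ => absurd (hYb hx) (hne k x hxk))
        (fun k x hx hxk _ => absurd (hYb hx) (hne k x hxk))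
  · -- two fields
    have hnn : inner ℝ (P.nrm j) (P.nrm j) = (1 : ℝ) := by
      rw [real_inner_self_eq_norm_sq, hnj]; norm_num
    have hcl : ∀ s : ℝ, s ≠ 0 → ∀ ε > 0, ∃ t : ℝ, 0 < t ∧
        p + (t * s) • P.nrm j ∈ Metric.ball p (min ε ρ) := by
      intro s hs ε hε
      have hmin : 0 < min ε ρ := lt_min hε hρ
      have hs' : 0 < |s| := abs_pos.2 hs
      refine ⟨min ε ρ / 2 / |s|, by positivity, ?_⟩
      rw [Metric.mem_ball, dist_eq_norm, add_sub_cancel_left, norm_smul, hnj, mul_one,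
        Real.norm_eq_abs, abs_mul, abs_of_pos (by positivity : 0 < min ε ρ / 2 / |s|),
        div_mul_cancel₀ _ hs'.ne']
      linarith
    have hval : ∀ s : ℝ, inner ℝ (P.nrm j) (p + s • P.nrm j) = P.lev j + s := by
      intro s; rw [inner_add_right, inner_smul_right, hnn, hpc, mul_one]
    have hpa : p ∈ closure (P.piece a) := by
      rw [Metric.mem_closure_iff]
      intro ε hε
      obtain ⟨t, ht, htm⟩ := hcl (-1) (by norm_num) ε hε
      refine ⟨_, hA _ (Metric.ball_subset_ball (min_le_right _ _) htm) ?_,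
        (dist_comm _ _).trans_lt (Metric.ball_subset_ball (min_le_left _ _) htm)⟩
      rw [hval]; linarith
    have hpb : p ∈ closure (P.piece b) := by
      rw [Metric.mem_closure_iff]
      intro ε hε
      obtain ⟨t, ht, htm⟩ := hcl 1 (by norm_num) ε hε
      refine ⟨_, hBb _ (Metric.ball_subset_ball (min_le_right _ _) htm) ?_,
        (dist_comm _ _).trans_lt (Metric.ball_subset_ball (min_le_left _ _) htm)⟩
      rw [hval]; linarith
    have hwa := P.wt_mem_closure a hpa
    have hwb := P.wt_mem_closure b hpb
    have hflux := P.flux_eq j a b p ρ hρ hp hA hBb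
    have hwa0 : 0 < P.wt a p := hlo.trans_le hwa.1
    have hwb0 : 0 < P.wt b p := hlo.trans_le hwb.1
    have hLr' : L * r ≤ θ * P.lo := by
      have : 0 ≤ L * r := by positivity
      linarith
    -- the transversal case, for a suitable orientation of the normal
    have htrans : ∀ (n : Sp d) (c : ℝ) (a b : ι), ‖n‖ = 1 → P.TwoSided p ρ n c a b →
        (∀ x, |inner ℝ n x - c| = |P.sd j x|) →
        P.lo ≤ P.wt a p → P.wt a p ≤ P.up → P.lo ≤ P.wt b p → P.wt b p ≤ P.up →
        P.wt a p * inner ℝ n (P.vel a p) = P.wt b p * inner ℝ n (P.vel b p) →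
        c₀ ≤ inner ℝ n (P.vel a p) → c₀ ≤ inner ℝ n (P.vel b p) →
        ∃ (n : Sp d) (c : ℝ) (v : Sp d) (K s : ℝ), ‖n‖ = 1 ∧ 0 < 1 + (inner ℝ n v : ℝ) ∧ 0 ≤ K ∧
        0 < s ∧ (∀ x, |inner ℝ n x - c| = |P.sd j x|) ∧
        P.NearIsometric h δ θ r p n c v K ∧ P.MassComparable θ r p n c v K s := by
      intro n c a b hn htwo hsd ha1 ha2 hb1 hb2 hfl hca hcb
      set αa : ℝ := inner ℝ n (P.vel a p) with hαa
      set αb : ℝ := inner ℝ n (P.vel b p) with hαb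
      have hαa0 : 0 < αa := hc₀.trans_le hca
      have hwa0 : 0 < P.wt a p := hlo.trans_le ha1
      have hwb0 : 0 < P.wt b p := hlo.trans_le hb1
      set v : Sp d := αa⁻¹ • (P.vel b p - P.vel a p) with hv
      have hnv : 1 + (inner ℝ n v : ℝ) = P.wt a p / P.wt b p := by
        rw [hv, inner_smul_right, inner_sub_right, ← hαa, ← hαb]
        field_simp
        linarith
      have hqle : P.lo / P.up ≤ P.wt a p / P.wt b p := by gcongr
      have hq0 : 0 < 1 + (inner ℝ n v : ℝ) := by rw [hnv]; positivity
      have hvV : ‖v‖ ≤ V := by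
        have h1 : ‖v‖ ≤ 2 * M / c₀ := by
          rw [hv, norm_smul, norm_inv, Real.norm_eq_abs, abs_of_pos hαa0, inv_mul_le_iff₀ hαa0]
          have h2 := norm_sub_le (P.vel b p) (P.vel a p)
          have h3 := hB.vel_le b p
          have h4 := hB.vel_le a p
          calc ‖P.vel b p - P.vel a p‖ ≤ 2 * M := by linarith
            _ = c₀ * (2 * M / c₀) := by field_simp
            _ ≤ _ := by gcongr
        have : 0 ≤ P.up / P.lo := by positivity
        linarith
      have hvC : 1 + ‖v‖ / (1 + inner ℝ n v) ≤ C := by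
        rw [hnv, hCd]
        gcongr 1 + ?_
        rw [div_eq_mul_inv]
        refine mul_le_mul hvV ?_ (by positivity) hV0.le
        rw [inv_div]
        gcongr
      refine ⟨n, c, v, 0, P.wt b p, hn, hq0, le_rfl, hwb0, hsd, ?_,
        mass_comparable_two hB hn htwo hrρ hθ.le le_rfl ha1 hb1 hnv hLr'⟩
      refine near_isometric_transversal hB hh hr.le hn htwo hrρ hc₀ hca hcb ?_ hq0 hvV hvC hr1 ?_ hθ1
      · rw [hv, ← hαa, smul_smul, mul_inv_cancel₀ hαa0.ne', one_smul]; abel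
      · have : 2 * ((1 + V) * L * C * h + 2 * (1 + V) * (L * r) * (4 * C / c₀)) =
          4 * (1 + V) * C * L * h / 2 + 16 * (1 + V) * L * C / c₀ * r := by ring
        rw [this]
        linarith
    have htwo' : P.TwoSided p ρ (-P.nrm j) (-P.lev j) b a := by
      intro k x hx hxk
      rw [inner_neg_left]
      rcases htwo k x hx hxk with h | h
      · exact Or.inr ⟨h.1, by linarith [h.2]⟩
      · exact Or.inl ⟨h.1, by linarith [h.2]⟩
    set αa : ℝ := inner ℝ (P.nrm j) (P.vel a p) with hαa
    set αb : ℝ := inner ℝ (P.nrm j) (P.vel b p) with hαb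
    have hratio : ∀ (wa wb x y : ℝ), P.lo ≤ wa → wb ≤ P.up → 0 < wb → wa * x = wb * y →
        δ / 2 < x → c₀ ≤ y := by
      intro wa wb x y h1 h2 h3 h4 h5
      have h6 : y = wa / wb * x := by field_simp; linarith
      have hwa' : 0 < wa := hlo.trans_le h1
      rw [h6, hc₀d, mul_comm (δ / 2)]
      exact mul_le_mul (div_le_div₀ hwa'.le h1 h3 h2) h5.le (by positivity) (by positivity)
    have hc₀δ : c₀ ≤ δ / 2 := by
      have : P.lo / P.up ≤ 1 := (div_le_one hup).2 (hwa.1.trans hwa.2)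
      rw [hc₀d]
      exact mul_le_of_le_one_right (by positivity) this
    have hα : (|αa| ≤ δ / 2 ∧ |αb| ≤ δ / 2) ∨ (c₀ ≤ αa ∧ c₀ ≤ αb) ∨ (c₀ ≤ -αa ∧ c₀ ≤ -αb) := by
      by_contra hcon
      push Not at hcon
      obtain ⟨f1, f2, f3⟩ := hcon
      have g1 : ¬ δ / 2 < αa := fun hx => absurd
        (hratio _ _ _ _ hwa.1 hwb.2 hwb0 hflux hx) (not_le.2 (f2 (hc₀δ.trans hx.le)))
      have g2 : ¬ δ / 2 < -αa := fun hx => absurd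
        (hratio _ _ _ (-αb) hwa.1 hwb.2 hwb0 (by linarith) hx) (not_le.2 (f3 (hc₀δ.trans hx.le)))
      have g3 : |αa| ≤ δ / 2 := abs_le.2 ⟨by linarith [not_lt.1 g2], not_lt.1 g1⟩
      rcases lt_abs.1 (f1 g3) with hx | hx
      · exact absurd (f2 (hratio _ _ _ _ hwb.1 hwa.2 hwa0 hflux.symm hx))
          (not_lt.2 (hc₀δ.trans hx.le))
      · exact absurd (f3 (hratio _ _ _ (-αa) hwb.1 hwa.2 hwa0 (by linarith) hx))
          (not_lt.2 (hc₀δ.trans hx.le))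
    rcases hα with ⟨h1, h2⟩ | ⟨h1, h2⟩ | ⟨h1, h2⟩
    · set v : Sp d := (P.wt a p / P.wt b p - 1) • P.nrm j with hv
      have hnv : 1 + (inner ℝ (P.nrm j) v : ℝ) = P.wt a p / P.wt b p := by
        rw [hv, inner_smul_right, hnn]; ring
      have hq0 : 0 < 1 + (inner ℝ (P.nrm j) v : ℝ) := by rw [hnv]; positivity
      have hvV : ‖v‖ ≤ V := by
        rw [hv, norm_smul, hnj, mul_one, Real.norm_eq_abs]
        have h3 : P.wt a p / P.wt b p ≤ P.up / P.lo :=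
          div_le_div₀ hup.le hwa.2 hlo hwb.1
        have h4 : 0 < P.wt a p / P.wt b p := by positivity
        have h5 : 0 ≤ 2 * M / c₀ := by positivity
        rw [abs_le]; constructor <;> linarith
      have hvC : 1 + ‖v‖ / (1 + inner ℝ (P.nrm j) v) ≤ C := by
        rw [hnv, hCd]
        gcongr 1 + ?_
        rw [div_eq_mul_inv]
        refine mul_le_mul hvV ?_ (by positivity) hV0.le
        rw [inv_div]
        exact div_le_div₀ hup.le hwb.2 hlo hwa.1
      refine ⟨P.nrm j, P.lev j, v, 1, P.wt b p, hnj, hq0, zero_le_one, hwb0, fun x => rfl, ?_,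
        mass_comparable_two hB hnj htwo hrρ hθ.le zero_le_one hwa.1 hwb.1 hnv hLr'⟩
      refine near_isometric_of_small_flux hB hh hnj htwo hrρ hδ h1 h2 hq0 hvV hvC hr2 e1' ?_ e3'
      have : 0 ≤ (1 + V) * C * L * h := by positivity
      linarith
    · exact htrans (P.nrm j) (P.lev j) a b hnj htwo (fun x => rfl) hwa.1 hwa.2 hwb.1 hwb.2 hflux h1 h2
    · refine htrans (-P.nrm j) (-P.lev j) b a (by rwa [norm_neg]) htwo' (fun x => ?_)
        hwb.1 hwb.2 hwa.1 hwa.2 ?_ ?_ ?_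
      · rw [inner_neg_left, ← abs_neg, sd]; congr 1; ring
      · rw [inner_neg_left, inner_neg_left]; linarith
      · rw [inner_neg_left]; exact h2
      · rw [inner_neg_left]; exact h1

end Chart

end PiecewiseField

end EllamFlow

/-! ### One time step near the hyperplanes -/

namespace EllamFlow

theorem one_add_pow_le_one_add_mul {x : ℝ} (hx : 0 ≤ x) (hx1 : x ≤ 1) (n : ℕ) :
    (1 + x) ^ n ≤ 1 + 2 ^ n * x := by
  -- The induction closes only with the sharper constant 2^n − 1.
  have h : (1 + x) ^ n ≤ 1 + (2 ^ n - 1) * x := by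
    induction n with
    | zero => simp
    | succ n ih =>
      have h2 : (1 : ℝ) ≤ 2 ^ n := one_le_pow₀ (by norm_num)
      have h3 : (2 ^ n - 1) * (x * x) ≤ (2 ^ n - 1) * x :=
        mul_le_mul_of_nonneg_left (by nlinarith) (by linarith)
      calc (1 + x) ^ (n + 1) = (1 + x) ^ n * (1 + x) := pow_succ _ _
        _ ≤ (1 + (2 ^ n - 1) * x) * (1 + x) := by gcongr
        _ ≤ _ := by rw [pow_succ]; linarith
  linarith

theorem exists_abs_trace_le (d : ℕ) : ∃ C, 0 ≤ C ∧ ∀ X : Sp d →L[ℝ] Sp d,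
    |LinearMap.trace ℝ (Sp d) (X : Sp d →ₗ[ℝ] Sp d)| ≤ C * ‖X‖ := by
  let T : (Sp d →L[ℝ] Sp d) →ₗ[ℝ] ℝ := LinearMap.trace ℝ (Sp d) ∘ₗ ContinuousLinearMap.coeLM ℝ
  refine ⟨‖LinearMap.toContinuousLinearMap T‖, ContinuousLinearMap.opNorm_nonneg _, fun X => ?_⟩
  exact (LinearMap.toContinuousLinearMap T).le_opNorm X

theorem uniform_continuity_fderiv {E F : Type*} [NormedAddCommGroup E] [NormedSpace ℝ E]
    [NormedAddCommGroup F] [NormedSpace ℝ F] {f : E → F} (hf : ContDiff ℝ 1 f)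
    (hc : HasCompactSupport f) {ε : ℝ} (hε : 0 < ε) :
    ∃ s > 0, ∀ x y, ‖x - y‖ ≤ s → ‖fderiv ℝ f x - fderiv ℝ f y‖ ≤ ε := by
  have h := (hc.fderiv ℝ).uniformContinuous_of_continuous (hf.continuous_fderiv one_ne_zero)
  obtain ⟨s, hs, h⟩ := Metric.uniformContinuous_iff.1 h ε hε
  refine ⟨s / 2, by positivity, fun x y hxy => ?_⟩
  have := h (a := x) (b := y) (by rw [dist_eq_norm]; linarith)
  rw [dist_eq_norm] at this
  exact this.le

theorem norm_taylor_le {E F : Type*} [NormedAddCommGroup E] [NormedSpace ℝ E]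
    [NormedAddCommGroup F] [NormedSpace ℝ F] {f : E → F} (hf : ContDiff ℝ 1 f)
    {p : E} {s ε : ℝ} (h : ∀ x, ‖x - p‖ ≤ s → ‖fderiv ℝ f x - fderiv ℝ f p‖ ≤ ε) {x y : E}
    (hx : ‖x - p‖ ≤ s) (hy : ‖y - p‖ ≤ s) :
    ‖f x - f y - fderiv ℝ f p (x - y)‖ ≤ ε * ‖x - y‖ := by
  have hconv : Convex ℝ (Metric.closedBall p s) := convex_closedBall p s
  refine hconv.norm_image_sub_le_of_norm_hasFDerivWithin_le' (𝕜 := ℝ) (f' := fderiv ℝ f)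
    (fun z _ => (hf.differentiable one_ne_zero z).hasFDerivAt.hasFDerivWithinAt) (fun z hz => ?_)
    (mem_closedBall_iff_norm.2 hy) (mem_closedBall_iff_norm.2 hx)
  exact h z (mem_closedBall_iff_norm.1 hz)

namespace PiecewiseField

variable {d : ℕ} {ι κ : Type} {P : PiecewiseField d ι κ}

/-- The points from which a trajectory reaches `A` at time `h`. -/
def reach (P : PiecewiseField d ι κ) (h : ℝ) (A : Set (Sp d)) : Set (Sp d) :=
  {y | ∃ γ, P.IsTraj h γ ∧ γ 0 = y ∧ γ h ∈ A}

/-- A neighborhood of the hyperplanes of the arrangement. -/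
def near (P : PiecewiseField d ι κ) (M h : ℝ) : Set (Sp d) := {x | ∃ j, |P.sd j x| ≤ 2 * M * h}

/-- The points which are too close to one, or to the intersection of two, of the hyperplanes. -/
def bad (P : PiecewiseField d ι κ) (M δ ρ h : ℝ) : Set (Sp d) :=
  {y | y ∈ P.dom ∧ ((∃ j, |P.sd j y| ≤ δ * h) ∨
    ∃ j k, P.hyp j ≠ P.hyp k ∧ |P.sd j y| ≤ 4 * M * h ∧ |P.sd k y| ≤ ρ)}

theorem measurableSet_sd_le (j : κ) (a : ℝ) : MeasurableSet {x | |P.sd j x| ≤ a} :=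
  measurableSet_slab _ _ _

theorem measurableSet_near [Countable κ] (M h : ℝ) : MeasurableSet (P.near M h) := by
  have : P.near M h = ⋃ j, {x | |P.sd j x| ≤ 2 * M * h} := by ext x; simp [near]
  rw [this]
  exact MeasurableSet.iUnion fun j => measurableSet_sd_le j _

theorem exists_dom_subset_ball : ∃ R, P.dom ⊆ Metric.ball (0 : Sp d) R := by
  obtain ⟨R, hR⟩ := P.dom_bounded.subset_ball (0 : Sp d)
  exact ⟨R, hR⟩

theorem exists_volume_near_le [Fintype κ] (P : PiecewiseField d ι κ) {M : ℝ} (hM : 0 ≤ M) :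
    ∃ C, 0 ≤ C ∧ ∀ h, 0 ≤ h → volume (P.dom ∩ P.near M h) ≤ ENNReal.ofReal (C * h) := by
  obtain ⟨R, hR⟩ := P.exists_dom_subset_ball
  choose C hC0 hC using fun j => exists_volume_slab_le (P.norm_nrm j) R
  have hSC : 0 ≤ ∑ j, C j := Finset.sum_nonneg fun j _ => hC0 j
  refine ⟨(∑ j, C j) * (2 * M), by positivity, fun h hh => ?_⟩
  have hsub : P.dom ∩ P.near M h ⊆
      ⋃ j, Metric.ball (0 : Sp d) R ∩ {x | |P.sd j x| ≤ 2 * M * h} := by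
    rintro x ⟨hx, j, hj⟩
    exact mem_iUnion.2 ⟨j, hR hx, hj⟩
  calc volume (P.dom ∩ P.near M h)
      ≤ ∑ j, volume (Metric.ball (0 : Sp d) R ∩ {x | |P.sd j x| ≤ 2 * M * h}) :=
        (measure_mono hsub).trans (measure_iUnion_fintype_le _ _)
    _ ≤ ∑ j, ENNReal.ofReal (C j * (2 * M * h)) := Finset.sum_le_sum fun j _ => hC j _ _
    _ = ENNReal.ofReal (∑ j, C j * (2 * M * h)) :=
        (ENNReal.ofReal_sum_of_nonneg fun j _ => mul_nonneg (hC0 j) (by positivity)).symm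
    _ = _ := by rw [← Finset.sum_mul, ← mul_assoc]

/-- The layers of width δh have volume O(δh). The points within 4Mh of one hyperplane and within ρ
of a different one have volume O(hρ), by `exists_volume_double_slab_le`. Small δ and ρ make each
contribution at most ηh/2, so that the bad points remain negligible after a number of steps of order
1/h. -/
theorem exists_volume_bad_le [Fintype κ] {M : ℝ} (hM : 0 < M) {η : ℝ} (hη : 0 < η) :
    ∃ δ > 0, ∃ ρ > 0, ∃ h₀ > 0, ∀ h, 0 < h → h ≤ h₀ →
      volume (P.bad M δ ρ h) ≤ ENNReal.ofReal (η * h) := by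
  obtain ⟨R, hR⟩ := P.exists_dom_subset_ball
  choose C hC0 hC using fun j => exists_volume_slab_le (P.norm_nrm j) R
  have hpair : ∀ j k, ∃ D a, 0 ≤ D ∧ 0 < a ∧ (P.hyp j ≠ P.hyp k → ∀ s t : ℝ, 0 ≤ s → 0 ≤ t →
      s ≤ a → t ≤ a → volume (Metric.ball (0 : Sp d) R ∩ {x | |P.sd j x| ≤ s} ∩
        {x | |P.sd k x| ≤ t}) ≤ ENNReal.ofReal (D * s * t)) := by
    intro j k
    by_cases hjk : P.hyp j = P.hyp k
    · exact ⟨0, 1, le_rfl, one_pos, fun h => absurd hjk h⟩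
    · obtain ⟨D, a, hD, ha, h⟩ := exists_volume_double_slab_le (P.norm_nrm j) (P.norm_nrm k) hjk R
      exact ⟨D, a, hD, ha, fun _ => h⟩
  choose D a hD0 ha0 hD using hpair
  have hSC : 0 ≤ ∑ j, C j := Finset.sum_nonneg fun j _ => hC0 j
  have hSD : 0 ≤ ∑ j, ∑ k, D j k := Finset.sum_nonneg fun j _ => Finset.sum_nonneg fun k _ => hD0 j k
  obtain ⟨δ, hδ1, hδ0⟩ := ((eventually_mul_le (∑ j, C j) (half_pos hη)).and
    self_mem_nhdsWithin).exists
  obtain ⟨ρ, ⟨hρ1, hρ2⟩, hρ0⟩ := (((eventually_mul_le (4 * M * ∑ j, ∑ k, D j k)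
    (half_pos hη)).and (eventually_all.2 fun j => eventually_all.2 fun k =>
      eventually_mul_le 1 (ha0 j k))).and self_mem_nhdsWithin).exists
  obtain ⟨h₀, hh1, hh0⟩ := ((eventually_all.2 fun j => eventually_all.2 fun k =>
      eventually_mul_le (4 * M) (ha0 j k)).and self_mem_nhdsWithin).exists
  have hδ0' : 0 < δ := hδ0
  have hρ0' : 0 < ρ := hρ0
  refine ⟨δ, hδ0, ρ, hρ0, h₀, hh0, fun h hh hhh => ?_⟩
  have hsub : P.bad M δ ρ h ⊆
      (⋃ j, Metric.ball (0 : Sp d) R ∩ {x | |P.sd j x| ≤ δ * h}) ∪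
      ⋃ j, ⋃ k, ⋃ _ : P.hyp j ≠ P.hyp k, Metric.ball (0 : Sp d) R ∩ {x | |P.sd j x| ≤ 4 * M * h} ∩
        {x | |P.sd k x| ≤ ρ} := by
    rintro y ⟨hy, ⟨j, hj⟩ | ⟨j, k, hjk, hj, hk⟩⟩
    · exact Or.inl (mem_iUnion.2 ⟨j, hR hy, hj⟩)
    · exact Or.inr (mem_iUnion.2 ⟨j, mem_iUnion.2 ⟨k, mem_iUnion.2 ⟨hjk, ⟨hR hy, hj⟩, hk⟩⟩⟩)
  refine (measure_mono hsub).trans ((measure_union_le _ _).trans ?_)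
  have e1 : volume (⋃ j, Metric.ball (0 : Sp d) R ∩ {x | |P.sd j x| ≤ δ * h}) ≤
      ENNReal.ofReal (η / 2 * h) := by
    refine (measure_iUnion_fintype_le _ _).trans ?_
    calc ∑ j, volume (Metric.ball (0 : Sp d) R ∩ {x | |P.sd j x| ≤ δ * h})
        ≤ ∑ j, ENNReal.ofReal (C j * (δ * h)) := Finset.sum_le_sum fun j _ => hC j _ _
      _ = ENNReal.ofReal (∑ j, C j * (δ * h)) :=
          (ENNReal.ofReal_sum_of_nonneg fun j _ => mul_nonneg (hC0 j) (by positivity)).symm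
      _ ≤ _ := by
          apply ENNReal.ofReal_le_ofReal
          rw [← Finset.sum_mul, ← mul_assoc]
          exact mul_le_mul_of_nonneg_right hδ1 hh.le
  have e2 : volume (⋃ j, ⋃ k, ⋃ _ : P.hyp j ≠ P.hyp k, Metric.ball (0 : Sp d) R ∩
      {x | |P.sd j x| ≤ 4 * M * h} ∩ {x | |P.sd k x| ≤ ρ}) ≤ ENNReal.ofReal (η / 2 * h) := by
    have h4 : 0 ≤ 4 * M * h := by positivity
    calc _ ≤ ∑ j, ∑ k, ENNReal.ofReal (D j k * (4 * M * h) * ρ) := by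
          refine (measure_iUnion_fintype_le _ _).trans (Finset.sum_le_sum fun j _ =>
            (measure_iUnion_fintype_le _ _).trans (Finset.sum_le_sum fun k _ => ?_))
          by_cases hjk : P.hyp j ≠ P.hyp k
          · simp only [hjk, ne_eq, not_false_eq_true, iUnion_true]
            exact hD j k hjk _ _ h4 hρ0'.le ((mul_le_mul_of_nonneg_left hhh (by positivity)).trans
              (hh1 j k)) (by linarith [hρ2 j k])
          · rw [not_not] at hjk
            simp [hjk]
      _ = ENNReal.ofReal (∑ j, ∑ k, D j k * (4 * M * h) * ρ) := by
          rw [ENNReal.ofReal_sum_of_nonneg fun j _ => Finset.sum_nonneg fun k _ => by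
            have := hD0 j k; positivity]
          refine Finset.sum_congr rfl fun j _ => ?_
          rw [ENNReal.ofReal_sum_of_nonneg fun k _ => by have := hD0 j k; positivity]
      _ ≤ _ := by
          apply ENNReal.ofReal_le_ofReal
          simp only [← Finset.sum_mul]
          have : (∑ j, ∑ k, D j k) * (4 * M * h) * ρ = (4 * M * ∑ j, ∑ k, D j k) * ρ * h := by ring
          rw [this]
          exact mul_le_mul_of_nonneg_right hρ1 hh.le
  calc _ ≤ ENNReal.ofReal (η / 2 * h) + ENNReal.ofReal (η / 2 * h) := add_le_add e1 e2
    _ = _ := by rw [← ENNReal.ofReal_add (by positivity) (by positivity)]; congr 1; ring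

section Local

variable {M L : ℝ}

theorem isolated_of_notMem_bad {δ ρ h : ℝ} {j : κ} {y : Sp d} (hy : y ∈ P.dom)
    (hbad : y ∉ P.bad M δ ρ h) (hj : |P.sd j y| ≤ 4 * M * h) {x : Sp d} (hx : ‖y - x‖ ≤ ρ) {k : κ}
    (hxk : x ∈ P.hyp k) : x ∈ P.hyp j := by
  by_cases hjk : P.hyp j = P.hyp k
  · rwa [hjk]
  · refine absurd ⟨hy, Or.inr ⟨j, k, hjk, hj, ?_⟩⟩ hbad
    have h1 := P.abs_sd_sub_le k y x
    rw [P.mem_hyp.1 hxk, sub_zero] at h1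
    exact h1.trans hx

/-- The foot of the perpendicular to a hyperplane of the arrangement. -/
theorem foot_mem_hyp (j : κ) (z : Sp d) :
    z - P.sd j z • P.nrm j ∈ P.hyp j ∧ ‖z - (z - P.sd j z • P.nrm j)‖ = |P.sd j z| := by
  have hnn : inner ℝ (P.nrm j) (P.nrm j) = (1 : ℝ) := by
    rw [real_inner_self_eq_norm_sq, P.norm_nrm]; norm_num
  constructor
  · rw [P.mem_hyp, sd, inner_sub_right, inner_smul_right, hnn, sd]; ring
  · rw [sub_sub_cancel, norm_smul, P.norm_nrm, mul_one, Real.norm_eq_abs]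

variable [Fintype ι] [Countable κ]

/-- In the chart at the foot of one endpoint, the starting point is a (1 + θ)-Lipschitz function of
the endpoint, which costs (1 + θ)^d in volume; passing from mass to volume and back costs one more
factor 1 + θ each way. The gain does not improve with h, which is harmless since the targets near
the hyperplanes have mass O(h). -/
theorem exists_mass_reach_near_le (hB : P.Bounds M L) {δ ρ θ : ℝ} (hδ : 0 < δ) (hρ : 0 < ρ)
    (hθ : 0 < θ) (hθ1 : θ ≤ 1) : ∃ r > 0, ∃ h₀ > 0, ∀ h, 0 < h → h ≤ h₀ → ∀ A ⊆ P.dom,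
      A ⊆ P.near M h → (∀ x ∈ A, ∀ y ∈ A, dist x y ≤ r) →
      P.mass (P.reach h A \ P.bad M δ ρ h) ≤ ENNReal.ofReal ((1 + θ) ^ (d + 2)) * P.mass A := by
  obtain ⟨r, hr, h₁, hh₁, hchart⟩ := exists_chart hB hδ (half_pos hρ) hθ hθ1
  have hM := hB.M_pos
  obtain ⟨h₀, hh₀, e1, e2, e3⟩ : ∃ h₀ : ℝ, 0 < h₀ ∧ h₀ ≤ h₁ ∧ M * h₀ ≤ r / 8 ∧ M * h₀ ≤ ρ / 8 := by
    have h1 := eventually_mul_le 1 hh₁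
    have h2 := eventually_mul_le M (show 0 < r / 8 by positivity)
    have h3 := eventually_mul_le M (show 0 < ρ / 8 by positivity)
    obtain ⟨s, hs⟩ := ((h1.and h2).and (h3.and self_mem_nhdsWithin)).exists
    exact ⟨s, hs.2.2, by linarith [hs.1.1], hs.1.2, hs.2.1⟩
  refine ⟨r / 4, by positivity, h₀, hh₀, fun h hh hhh A hA hAn hdiam => ?_⟩
  have hMh1 : M * h ≤ r / 8 := (mul_le_mul_of_nonneg_left hhh hM.le).trans e2
  have hMh2 : M * h ≤ ρ / 8 := (mul_le_mul_of_nonneg_left hhh hM.le).trans e3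
  have hMh0 : 0 < M * h := by positivity
  have h0 : (0 : ℝ) ∈ Icc 0 h := ⟨le_rfl, hh.le⟩
  have hh' : h ∈ Icc 0 h := ⟨hh.le, le_rfl⟩
  rcases (P.reach h A \ P.bad M δ ρ h).eq_empty_or_nonempty with he | ⟨y₀, ⟨γ₀, hγ₀, rfl, hγA⟩, hbad₀⟩
  · rw [he]; simp
  obtain ⟨j, hj⟩ := hAn hγA
  obtain ⟨hp, hpd⟩ := P.foot_mem_hyp j (γ₀ h)
  set z₀ := γ₀ h with hz₀
  set p := z₀ - P.sd j z₀ • P.nrm j with hpdef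
  have hyz₀ : ‖γ₀ 0 - z₀‖ ≤ M * h := hγ₀.norm_sub_le_mul hB hh' h0
  have hzp : ‖z₀ - p‖ ≤ 2 * (M * h) := by rw [hpd]; linarith
  have hy₀ : |P.sd j (γ₀ 0)| ≤ 4 * M * h := by
    have h1 := P.abs_sd_sub_le j (γ₀ 0) z₀
    have h2 := abs_sub_abs_le_abs_sub (P.sd j (γ₀ 0)) (P.sd j z₀)
    linarith
  have hiso : ∀ x ∈ Metric.ball p (ρ / 2), ∀ k, x ∈ P.hyp k → x ∈ P.hyp j := by
    intro x hx k hxk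
    refine isolated_of_notMem_bad (hγ₀.2.1 0 h0) hbad₀ hy₀ ?_ hxk
    have h1 := norm_sub_le_of_mem_ball hx
    have h2 : γ₀ 0 - x = (γ₀ 0 - z₀) + (z₀ - p) + (p - x) := by abel
    have h3 := norm_add₃_le (a := γ₀ 0 - z₀) (b := z₀ - p) (c := p - x)
    rw [← h2, norm_sub_rev p x] at h3
    linarith
  obtain ⟨n, c, v, K, s, hn, hq, hK, hs, hsd, hni, hmc⟩ := hchart h hh (hhh.trans e1) j p hp hiso
  have hin : ∀ γ, P.IsTraj h γ → γ h ∈ A → ∀ t ∈ Icc 0 h, γ t ∈ Metric.ball p r := by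
    intro γ hγ hγA' t ht
    have h1 := hγ.norm_sub_le_mul hB hh' ht
    have h2 := hdiam _ hγA' _ hγA
    rw [dist_eq_norm] at h2
    have h3 := norm_add₃_le (a := γ t - γ h) (b := γ h - z₀) (c := z₀ - p)
    rw [mem_ball_iff_norm]
    have h4 : γ t - p = (γ t - γ h) + (γ h - z₀) + (z₀ - p) := by abel
    rw [h4]
    linarith
  set Y := P.reach h A \ P.bad M δ ρ h with hY
  have hYdom : Y ⊆ P.dom := by
    rintro y ⟨⟨γ, hγ, rfl, -⟩, -⟩
    exact hγ.2.1 0 h0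
  have hYb : Y ⊆ Metric.ball p r := by
    rintro y ⟨⟨γ, hγ, rfl, hγA'⟩, -⟩
    exact hin γ hγ hγA' 0 h0
  have hAb : A ⊆ Metric.ball p r := by
    intro z hz
    have h2 := hdiam _ hz _ hγA
    rw [dist_eq_norm] at h2
    rw [mem_ball_iff_norm]
    have h3 := norm_add_le (z - z₀) (z₀ - p)
    rw [sub_add_sub_cancel] at h3
    linarith
  have hfar : ∀ γ, P.IsTraj h γ → γ 0 ∉ P.bad M δ ρ h → δ * h < |inner ℝ n (γ 0) - c| := by
    intro γ hγ hb
    rw [hsd]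
    by_contra hcon
    exact hb ⟨hγ.2.1 0 h0, Or.inl ⟨j, not_lt.1 hcon⟩⟩
  have hvol : volume (shear n c v K '' Y) ≤
      ENNReal.ofReal (1 + θ) ^ d * volume (shear n c v K '' A) := by
    set Rel : Set (Sp d × Sp d) := {q | ∃ γ, P.IsTraj h γ ∧ γ h ∈ A ∧ γ 0 ∉ P.bad M δ ρ h ∧
      q = (shear n c v K (γ 0), shear n c v K (γ h))} with hRel
    have h1 := volume_fst_image_le Rel (K := 1 + θ) (by
      rintro _ ⟨γ, hγ, hγA', hγb, rfl⟩ _ ⟨γ', hγ', hγA'', hγb', rfl⟩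
      have h2 := hni γ γ' hγ hγ' (hin γ hγ hγA') (hin γ' hγ' hγA'') (hfar γ hγ hγb)
        (hfar γ' hγ' hγb') h hh'
      have h3 := norm_sub_norm_le (shear n c v K (γ 0) - shear n c v K (γ' 0))
        (shear n c v K (γ h) - shear n c v K (γ' h))
      simp only
      linarith)
    have h2 : shear n c v K '' Y ⊆ Prod.fst '' Rel := by
      rintro _ ⟨y, ⟨⟨γ, hγ, rfl, hγA'⟩, hb⟩, rfl⟩
      exact ⟨_, ⟨γ, hγ, hγA', hb, rfl⟩, rfl⟩
    have h3 : Prod.snd '' Rel ⊆ shear n c v K '' A := by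
      rintro _ ⟨_, ⟨γ, hγ, hγA', hb, rfl⟩, rfl⟩
      exact ⟨_, hγA', rfl⟩
    exact (measure_mono h2).trans (h1.trans (by gcongr))
  calc P.mass Y ≤ ENNReal.ofReal ((1 + θ) * s) * volume (shear n c v K '' Y) := (hmc Y hYdom hYb).1
    _ ≤ ENNReal.ofReal ((1 + θ) * s) *
        (ENNReal.ofReal (1 + θ) ^ d * volume (shear n c v K '' A)) := by gcongr
    _ = ENNReal.ofReal (1 + θ) ^ (d + 1) *
        (ENNReal.ofReal s * volume (shear n c v K '' A)) := by
        rw [ENNReal.ofReal_mul (by positivity)]; ring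
    _ ≤ ENNReal.ofReal (1 + θ) ^ (d + 1) * (ENNReal.ofReal (1 + θ) * P.mass A) := by
        exact mul_le_mul' le_rfl (hmc A hA hAb).2
    _ = _ := by rw [← mul_assoc, ← pow_succ, ENNReal.ofReal_pow (by positivity)]

end Local

end PiecewiseField

end EllamFlow

/-! ### One time step inside a piece -/

namespace EllamFlow

/-- Scalar form of the mass balance, with ρ the density, β its derivative along the velocity and τ
the divergence of the velocity. The density ρ − hβ at the starting point times the backward Jacobian
1 − hτ is ρ − h(β + ρτ) + O(h²), at most ρ + Γh and thus at most ρ(1 + hΓ/lo) up to higher order;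
the errors of size εh and h² ≤ εh are absorbed by ηh. -/
theorem exists_first_order_growth_le {lo up B Γ η : ℝ} (hlo : 0 < lo) (hup : 0 < up) (hB : 0 ≤ B)
    (hΓ : 0 ≤ Γ) (hη : 0 < η) : ∃ e > 0, ∀ ε h ρ β τ : ℝ, 0 < ε → ε ≤ e → 0 < h → h ≤ ε →
      lo ≤ ρ → ρ ≤ up → |β| ≤ B → |τ| ≤ B → -Γ ≤ β + ρ * τ →
      (ρ - h * β + h * ε) * (1 + ε * h) * (1 - h * τ + ε * h) ≤
        (1 + (Γ / lo + η) * h) * (ρ - ε * h) := by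
  set C := (B + 1) + (B + 1) ^ 2 + up * (B + 1) + (B + 1) ^ 2 with hC
  obtain ⟨e, ⟨h1, h2⟩, h3⟩ := (((eventually_mul_le (1 + 2 * up + C + 1 + Γ / lo + η)
    (mul_pos hη hlo)).and (eventually_mul_le 1 one_pos)).and self_mem_nhdsWithin).exists
  refine ⟨e, h3, fun ε h ρ β τ hε hεe hh hhε hρ hρ' hβ hτ hdiv => ?_⟩
  have hε1 : ε ≤ 1 := by linarith
  have hh1 : h ≤ 1 := by linarith
  have hΓlo : 0 ≤ Γ / lo := by positivity
  have hkey : ε * (1 + 2 * up + C + 1 + Γ / lo + η) ≤ η * lo := by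
    have hC0 : 0 ≤ C := by positivity
    calc _ ≤ e * (1 + 2 * up + C + 1 + Γ / lo + η) :=
          mul_le_mul_of_nonneg_right hεe (by positivity)
      _ ≤ _ := by linarith
  set a := -β + ε with ha
  set c := -τ + ε with hc
  have ha' : |a| ≤ B + 1 := (abs_add_le _ _).trans (by rw [abs_neg, abs_of_pos hε]; linarith)
  have hc' : |c| ≤ B + 1 := (abs_add_le _ _).trans (by rw [abs_neg, abs_of_pos hε]; linarith)
  have hac : |a * c| ≤ (B + 1) ^ 2 := by rw [abs_mul, sq]; gcongr
  have hquad : a * ε + a * c + ρ * ε * c + h * (a * ε * c) ≤ C := by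
    have e1 : a * ε ≤ (B + 1) * 1 := mul_le_mul (le_of_abs_le ha') hε1 hε.le (by linarith)
    have e3 : ρ * ε * c ≤ up * (B + 1) := by
      have hρ0 : 0 ≤ ρ := hlo.le.trans hρ
      have : ρ * ε ≤ up := (mul_le_of_le_one_right hρ0 hε1).trans hρ'
      have h0 : 0 ≤ ρ * ε := by positivity
      calc ρ * ε * c ≤ ρ * ε * (B + 1) := mul_le_mul_of_nonneg_left (le_of_abs_le hc') h0
        _ ≤ _ := mul_le_mul_of_nonneg_right this (by linarith)
    have e4 : h * (a * ε * c) ≤ (B + 1) ^ 2 := by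
      have h0 : h * ε ≤ 1 := mul_le_one₀ hh1 hε.le hε1
      have h0' : 0 ≤ h * ε := by positivity
      calc h * (a * ε * c) = (h * ε) * (a * c) := by ring
        _ ≤ (h * ε) * (B + 1) ^ 2 := mul_le_mul_of_nonneg_left (le_of_abs_le hac) h0'
        _ ≤ _ := mul_le_of_le_one_left (sq_nonneg _) h0
    have := le_of_abs_le hac
    linarith
  have hsq : h * (a * ε + a * c + ρ * ε * c + h * (a * ε * c)) ≤ ε * C := by
    have hC0 : 0 ≤ C := by positivity
    calc _ ≤ h * C := mul_le_mul_of_nonneg_left hquad hh.le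
      _ ≤ _ := mul_le_mul_of_nonneg_right hhε hC0
  have hlin : a + ρ * ε + ρ * c ≤ Γ + ε * (1 + 2 * up) := by
    have : ρ * ε ≤ up * ε := mul_le_mul_of_nonneg_right hρ' hε.le
    rw [ha, hc]; linarith
  have hr : Γ + η * lo ≤ (Γ / lo + η) * ρ := by
    have : Γ = Γ / lo * lo := by field_simp
    calc Γ + η * lo = (Γ / lo + η) * lo := by rw [add_mul, ← this]
      _ ≤ _ := by gcongr
  have hr2 : (Γ / lo + η) * h * ε ≤ (Γ / lo + η) * ε := by
    have : 0 ≤ Γ / lo + η := by positivity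
    exact mul_le_mul_of_nonneg_right (mul_le_of_le_one_right this hh1) hε.le
  have hmain : (a + ρ * ε + ρ * c) + h * (a * ε + a * c + ρ * ε * c + h * (a * ε * c)) ≤
      (Γ / lo + η) * ρ - ε - (Γ / lo + η) * h * ε := by linarith
  have := mul_le_mul_of_nonneg_left hmain hh.le
  calc _ = ρ + h * ((a + ρ * ε + ρ * c) +
        h * (a * ε + a * c + ρ * ε * c + h * (a * ε * c))) := by rw [ha, hc]; ring
    _ ≤ ρ + h * ((Γ / lo + η) * ρ - ε - (Γ / lo + η) * h * ε) := by linarith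
    _ = _ := by ring

namespace PiecewiseField

variable {d : ℕ} {ι κ : Type} {P : PiecewiseField d ι κ} {M L : ℝ}

/-- A trajectory ending far from the hyperplanes stays in a single piece. -/
theorem IsTraj.mem_piece_of_notMem_near (hB : P.Bounds M L) {h : ℝ} (hh : 0 < h) {γ : ℝ → Sp d}
    (hγ : P.IsTraj h γ) {i : ι} (hi : γ h ∈ P.piece i) (hn : γ h ∉ P.near M h) :
    ∀ t ∈ Icc 0 h, γ t ∈ P.piece i := by
  have hM := hB.M_pos
  have hMh : 0 < M * h := by positivity
  have hsub : Metric.ball (γ h) (2 * M * h) ⊆ P.piece i := by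
    refine subset_piece_of_inter (convex_ball _ _).isPreconnected
      ⟨γ h, Metric.mem_ball_self (by linarith), hi⟩ fun x hx j hj => hn ⟨j, ?_⟩
    have h1 := P.abs_sd_sub_le j x (γ h)
    rw [P.mem_hyp.1 hj, zero_sub, abs_neg] at h1
    rw [mem_ball_iff_norm] at hx
    linarith
  intro t ht
  apply hsub
  rw [mem_ball_iff_norm]
  have := hγ.norm_sub_le_mul hB ⟨hh.le, le_rfl⟩ ht
  linarith

/-- The linearization of the one-step map inside a piece. -/
theorem IsTraj.norm_linearization_le (hB : P.Bounds M L) {h : ℝ} (hh : 0 < h) (hL : L * h ≤ 1 / 2)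
    {γ γ' : ℝ → Sp d} (hγ : P.IsTraj h γ) (hγ' : P.IsTraj h γ') {i : ι}
    (hi : ∀ t ∈ Icc 0 h, γ t ∈ P.piece i) (hi' : ∀ t ∈ Icc 0 h, γ' t ∈ P.piece i) {p : Sp d}
    {s ε : ℝ} (hε : 0 ≤ ε)
    (hs : ∀ x, ‖x - p‖ ≤ s → ‖fderiv ℝ (P.vel i) x - fderiv ℝ (P.vel i) p‖ ≤ ε)
    (hp : ∀ t ∈ Icc 0 h, ‖γ t - p‖ ≤ s) (hp' : ∀ t ∈ Icc 0 h, ‖γ' t - p‖ ≤ s) :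
    ‖(γ 0 - γ' 0) - (γ h - γ' h - h • fderiv ℝ (P.vel i) p (γ h - γ' h))‖ ≤
      (2 * ε + 2 * L ^ 2 * h) * h * ‖γ h - γ' h‖ := by
  have hLpos := hB.L_pos
  obtain ⟨h1, h2⟩ := hγ.osc_single hB hγ' hh.le hL (i := i)
    (fun t ht k hk => piece_unique hk (hi t ht)) (fun t ht k hk => piece_unique hk (hi' t ht))
    (r := h) ⟨hh.le, le_rfl⟩
  set X := fderiv ℝ (P.vel i) p with hX
  set u := γ h - γ' h with hu
  obtain ⟨hc, -, N, hN, hd⟩ := hγ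
  obtain ⟨hc', -, N', hN', hd'⟩ := hγ'
  -- The derivative of the remainder is the Taylor error of the velocity at p, plus X applied to the
  -- drift of γ − γ' away from its final value u.
  have key := norm_sub_le_of_hasDerivAt_off_countable (u := fun t => γ t - γ' t - t • X u)
    (C := (2 * ε + 2 * L ^ 2 * h) * ‖u‖) hh.le ((hc.sub hc').sub (by fun_prop)) (hN.union hN') (by
      intro τ hτ
      have hτI := Ioo_subset_Icc_self hτ.1
      obtain ⟨k, hk, hk'⟩ := hd τ ⟨hτ.1, fun hh => hτ.2 (Or.inl hh)⟩
      obtain ⟨l, hl, hl'⟩ := hd' τ ⟨hτ.1, fun hh => hτ.2 (Or.inr hh)⟩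
      obtain rfl := piece_unique hk (hi τ hτI)
      obtain rfl := piece_unique hl (hi' τ hτI)
      refine ⟨_, (hk'.sub hl').sub ((hasDerivAt_id τ).smul_const (X u)), ?_⟩
      have e1 := norm_taylor_le (P.vel_contDiff l) hs (hp τ hτI) (hp' τ hτI)
      have e2 : ‖X (γ τ - γ' τ - u)‖ ≤ L * (2 * (L * h) * ‖u‖) :=
        (X.le_of_opNorm_le (hB.fderiv_vel_le l p) _).trans (mul_le_mul_of_nonneg_left
          (h2 h ⟨hh.le, le_rfl⟩ τ hτI) hLpos.le)
      have e3 : ε * ‖γ τ - γ' τ‖ ≤ ε * (2 * ‖u‖) := mul_le_mul_of_nonneg_left (h1 τ hτI) hε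
      have e4 : P.vel l (γ τ) - P.vel l (γ' τ) - (1 : ℝ) • X u =
          (P.vel l (γ τ) - P.vel l (γ' τ) - X (γ τ - γ' τ)) + X (γ τ - γ' τ - u) := by
        rw [map_sub X (γ τ - γ' τ) u, one_smul]; abel
      rw [e4]
      refine (norm_add_le _ _).trans ?_
      calc _ ≤ ε * (2 * ‖u‖) + L * (2 * (L * h) * ‖u‖) := add_le_add (e1.trans e3) e2
        _ = _ := by ring)
  have e5 : (γ 0 - γ' 0) - (u - h • X u) =
      -((γ h - γ' h - h • X u) - (γ 0 - γ' 0 - (0 : ℝ) • X u)) := by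
    rw [zero_smul, ← hu]; abel
  rw [e5, norm_neg]
  refine key.trans_eq ?_
  ring

theorem IsTraj.norm_sub_add_smul_le (hB : P.Bounds M L) {h : ℝ} (hh : 0 < h)
    {γ : ℝ → Sp d} (hγ : P.IsTraj h γ) {i : ι} (hi : ∀ t ∈ Icc 0 h, γ t ∈ P.piece i) {p : Sp d}
    {s : ℝ} (hp : ∀ t ∈ Icc 0 h, ‖γ t - p‖ ≤ s) :
    ‖γ 0 - γ h + h • P.vel i p‖ ≤ L * s * h := by
  obtain ⟨hc, -, N, hN, hd⟩ := hγ
  have key := norm_sub_le_of_hasDerivAt_off_countable (u := fun t => γ t - t • P.vel i p)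
    (C := L * s) hh.le (hc.sub (by fun_prop)) hN (by
      intro τ hτ
      have hτI := Ioo_subset_Icc_self hτ.1
      obtain ⟨k, hk, hk'⟩ := hd τ hτ
      obtain rfl := piece_unique hk (hi τ hτI)
      refine ⟨_, hk'.sub ((hasDerivAt_id τ).smul_const (P.vel k p)), ?_⟩
      rw [one_smul]
      exact (hB.vel_lip _ _ _).trans (mul_le_mul_of_nonneg_left (hp τ hτI) hB.L_pos.le))
  have e5 : γ 0 - γ h + h • P.vel i p =
      -((γ h - h • P.vel i p) - (γ 0 - (0 : ℝ) • P.vel i p)) := by rw [zero_smul]; abel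
  rw [e5, norm_neg]
  simpa using key

end PiecewiseField

end EllamFlow

namespace EllamFlow

namespace PiecewiseField

variable {d : ℕ} {ι κ : Type} {P : PiecewiseField d ι κ} {M L : ℝ}

theorem exists_uniform_modulus [Finite ι] (P : PiecewiseField d ι κ) {ε : ℝ} (hε : 0 < ε) :
    ∃ s > 0, ∀ i x y, ‖x - y‖ ≤ s → ‖fderiv ℝ (P.vel i) x - fderiv ℝ (P.vel i) y‖ ≤ ε ∧
      ‖fderiv ℝ (P.wt i) x - fderiv ℝ (P.wt i) y‖ ≤ ε := by
  choose a ha0 ha using fun i => uniform_continuity_fderiv (P.vel_contDiff i) (P.vel_compact i) hε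
  choose b hb0 hb using fun i => uniform_continuity_fderiv (P.wt_contDiff i) (P.wt_compact i) hε
  obtain ⟨s, hs, hs0⟩ := ((eventually_all.2 fun i => (eventually_mul_le 1 (ha0 i)).and
    (eventually_mul_le 1 (hb0 i))).and self_mem_nhdsWithin).exists
  exact ⟨s, hs0, fun i x y hxy => ⟨ha i x y (by linarith [(hs i).1]),
    hb i x y (by linarith [(hs i).2])⟩⟩

theorem norm_le_two_mul_norm_sub_smul {X : Sp d →L[ℝ] Sp d} {h L : ℝ} (hh : 0 ≤ h) (hX : ‖X‖ ≤ L)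
    (hL : L * h ≤ 1 / 2) (u : Sp d) : ‖u‖ ≤ 2 * ‖u - h • X u‖ := by
  have h1 : ‖h • X u‖ ≤ h * (L * ‖u‖) := by
    rw [norm_smul, Real.norm_eq_abs, abs_of_nonneg hh]
    exact mul_le_mul_of_nonneg_left (X.le_of_opNorm_le hX u) hh
  have h2 := norm_sub_norm_le u (h • X u)
  nlinarith [norm_nonneg u]

theorem volume_image_sub_smul {X : Sp d →L[ℝ] Sp d} {h η δ C L : ℝ} (hh : 0 ≤ h) (hX : ‖X‖ ≤ L)
    (hη : 0 ≤ η) (hδ : h * L ≤ δ) (hC : |LinearMap.trace ℝ (Sp d) (X : Sp d →ₗ[ℝ] Sp d)| ≤ C * ‖X‖)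
    (hC0 : 0 ≤ C) (hCL : h * (C * L) ≤ 1)
    (hdet : ∀ X : Sp d →L[ℝ] Sp d, ‖X‖ ≤ δ →
      |LinearMap.det (LinearMap.id + (X : Sp d →ₗ[ℝ] Sp d)) - 1 -
        LinearMap.trace ℝ (Sp d) (X : Sp d →ₗ[ℝ] Sp d)| ≤ η * ‖X‖) (A : Set (Sp d)) :
    volume ((fun u => u - h • X u) '' A) ≤ ENNReal.ofReal
      (1 - h * LinearMap.trace ℝ (Sp d) (X : Sp d →ₗ[ℝ] Sp d) + η * (h * L)) * volume A := by
  set Y : Sp d →L[ℝ] Sp d := (-h) • X with hY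
  set B : Sp d →ₗ[ℝ] Sp d := LinearMap.id + (Y : Sp d →ₗ[ℝ] Sp d) with hBdef
  have himg : (fun u => u - h • X u) = B := by
    ext1 u
    simp [hBdef, hY, sub_eq_add_neg]
  rw [himg, Measure.addHaar_image_linearMap]
  gcongr
  have hYn : ‖Y‖ ≤ h * L := by
    rw [hY, norm_smul, Real.norm_eq_abs, abs_neg, abs_of_nonneg hh]
    exact mul_le_mul_of_nonneg_left hX hh
  have htr : LinearMap.trace ℝ (Sp d) (Y : Sp d →ₗ[ℝ] Sp d) =
      -(h * LinearMap.trace ℝ (Sp d) (X : Sp d →ₗ[ℝ] Sp d)) := by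
    have : (Y : Sp d →ₗ[ℝ] Sp d) = (-h) • (X : Sp d →ₗ[ℝ] Sp d) := by rw [hY]; rfl
    rw [this, map_smul]; simp
  have h1 := hdet Y (hYn.trans hδ)
  have h2 : η * ‖Y‖ ≤ η * (h * L) := mul_le_mul_of_nonneg_left hYn hη
  rw [htr] at h1
  set τ := LinearMap.trace ℝ (Sp d) (X : Sp d →ₗ[ℝ] Sp d) with hτ
  -- Needed because the volume involves the absolute value of the determinant.
  have h3 : 0 ≤ 1 - h * τ := by
    have : τ ≤ C * L := (le_of_abs_le hC).trans (mul_le_mul_of_nonneg_left hX hC0)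
    nlinarith
  rw [abs_le] at h1
  rw [abs_le]
  constructor <;> linarith [h1.1, h1.2]

variable [Fintype ι] [Countable κ]

/-- The trajectories that end in A stay in the piece, so the starting point is, up to a relative
error o(h), the image of the endpoint under the affine map 1 − hX with X the derivative of the
velocity at a point p of A. The diameter h² makes every variation over A, relative to p, of order
o(h); `exists_first_order_growth_le` then combines Jacobian and densities. -/
theorem exists_mass_reach_far_le (hB : P.Bounds M L) {η : ℝ} (hη : 0 < η) :
    ∃ h₀ > 0, ∀ h, 0 < h → h ≤ h₀ → ∀ i, ∀ A ⊆ P.piece i, Disjoint A (P.near M h) →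
      (∀ x ∈ A, ∀ y ∈ A, dist x y ≤ h ^ 2) →
      P.mass (P.reach h A) ≤ ENNReal.ofReal (1 + (P.Γ / P.lo + η) * h) * P.mass A := by
  have hM := hB.M_pos
  have hLpos := hB.L_pos
  have hlo := P.lo_pos
  obtain ⟨C, hC0, hC⟩ := exists_abs_trace_le d
  obtain ⟨e, he, hscal⟩ := exists_first_order_growth_le hlo P.up_pos
    (show 0 ≤ L * M + C * L by positivity) P.Γ_nonneg hη
  obtain ⟨ε, ⟨hε1, hε2, hε3⟩, hε⟩ := (((eventually_mul_le (2 ^ d * 6) he).and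
    ((eventually_mul_le L he).and (eventually_mul_le (M + 2) he))).and self_mem_nhdsWithin).exists
  have hε' : 0 < ε := hε
  obtain ⟨s, hs, hmod⟩ := P.exists_uniform_modulus hε'
  obtain ⟨δ, hδ, hdet⟩ := exists_det_one_add_le (d := d) hε'
  obtain ⟨h₀, ⟨⟨⟨a1, a2⟩, ⟨a3, a4⟩⟩, ⟨⟨a5, a6⟩, ⟨a7, a8⟩⟩⟩, hh₀⟩ :=
    ((((((eventually_mul_le 1 he).and (eventually_mul_le L he)).and
    ((eventually_mul_le L (half_pos one_pos)).and (eventually_mul_le (M + 1) hs))).and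
    (((eventually_mul_le (2 * L ^ 2) hε').and (eventually_mul_le L hδ)).and
    ((eventually_mul_le (C * L) one_pos).and (eventually_mul_le (L * (L * (M + 1) + 1)) hε'))))).and
    (((eventually_mul_le (6 * ε) one_pos).and (eventually_mul_le 1 one_pos)).and
      self_mem_nhdsWithin)).exists
  obtain ⟨⟨a9, a10⟩, hh₀⟩ := hh₀
  refine ⟨h₀, hh₀, fun h hh hhh i A hA hAn hdiam => ?_⟩
  have hmul : ∀ {c b : ℝ}, 0 ≤ c → c * h₀ ≤ b → c * h ≤ b := fun hc hb =>
    (mul_le_mul_of_nonneg_left hhh hc).trans hb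
  replace a1 := hmul zero_le_one a1
  replace a2 := hmul hLpos.le a2
  replace a3 := hmul hLpos.le a3
  replace a4 := hmul (by positivity) a4
  replace a5 := hmul (by positivity) a5
  replace a6 := hmul hLpos.le a6
  replace a7 := hmul (by positivity) a7
  replace a8 := hmul (by positivity) a8
  replace a9 := hmul (by positivity) a9
  replace a10 := hmul zero_le_one a10
  rcases A.eq_empty_or_nonempty with rfl | ⟨p, hpA⟩
  · have : P.reach h ∅ = ∅ := eq_empty_of_forall_notMem fun y ⟨γ, _, _, h⟩ => h
    rw [this]; simp
  have h0 : (0 : ℝ) ∈ Icc 0 h := ⟨le_rfl, hh.le⟩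
  have hh' : h ∈ Icc 0 h := ⟨hh.le, le_rfl⟩
  have hhsq : h ^ 2 ≤ h := by nlinarith
  have hpc : ∀ γ, P.IsTraj h γ → γ h ∈ A → ∀ t ∈ Icc 0 h, γ t ∈ P.piece i := fun γ hγ hγA =>
    hγ.mem_piece_of_notMem_near hB hh (hA hγA) (disjoint_left.1 hAn hγA)
  have hcl : ∀ γ, P.IsTraj h γ → γ h ∈ A → ∀ t ∈ Icc 0 h, ‖γ t - p‖ ≤ (M + 1) * h := by
    intro γ hγ hγA t ht
    have h1 := hγ.norm_sub_le_mul hB hh' ht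
    have h2 := hdiam _ hγA _ hpA
    rw [dist_eq_norm] at h2
    have h3 := norm_add_le (γ t - γ h) (γ h - p)
    rw [sub_add_sub_cancel] at h3
    linarith
  set w := P.vel i p with hw
  set X := fderiv ℝ (P.vel i) p with hX
  set τ := LinearMap.trace ℝ (Sp d) (X : Sp d →ₗ[ℝ] Sp d) with hτ
  set β := fderiv ℝ (P.wt i) p w with hβ
  set ρ := P.wt i p with hρ
  have hXL : ‖X‖ ≤ L := hB.fderiv_vel_le i p
  -- volume
  have hvol : volume (P.reach h A) ≤ ENNReal.ofReal (1 + e * h) *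
      (ENNReal.ofReal (1 - h * τ + e * h) * volume A) := by
    -- Pairing the start with (1 − hX)γ(h), not with γ(h), makes the Lipschitz constant 1 + O(εh);
    -- the first-order volume change is then carried by the linear map alone.
    set Rel : Set (Sp d × Sp d) := {q | ∃ γ, P.IsTraj h γ ∧ γ h ∈ A ∧
      q = (γ 0, γ h - h • X (γ h))} with hRel
    have h1 := volume_fst_image_le Rel (K := 1 + 6 * ε * h) (by
      rintro _ ⟨γ, hγ, hγA, rfl⟩ _ ⟨γ', hγ', hγA', rfl⟩
      have h1 := hγ.norm_linearization_le hB hh (by linarith) hγ' (hpc γ hγ hγA) (hpc γ' hγ' hγA')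
        hε'.le (fun x hx => (hmod i x p hx).1) (fun t ht => (hcl γ hγ hγA t ht).trans a4)
        (fun t ht => (hcl γ' hγ' hγA' t ht).trans a4)
      have h2 := norm_le_two_mul_norm_sub_smul hh.le hXL (by linarith) (γ h - γ' h)
      rw [← hX] at h1
      set u := γ h - γ' h with hu
      have h3 : (γ h - h • X (γ h)) - (γ' h - h • X (γ' h)) = u - h • X u := by
        rw [hu, map_sub, smul_sub]; abel
      simp only [h3]
      have h4 := norm_sub_norm_le (γ 0 - γ' 0) (u - h • X u)
      have h5 : (2 * ε + 2 * L ^ 2 * h) * h * ‖u‖ ≤ 3 * ε * h * (2 * ‖u - h • X u‖) := by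
        gcongr; linarith
      linarith)
    have h2 : P.reach h A = Prod.fst '' Rel := by
      ext y
      constructor
      · rintro ⟨γ, hγ, rfl, hγA⟩; exact ⟨_, ⟨γ, hγ, hγA, rfl⟩, rfl⟩
      · rintro ⟨_, ⟨γ, hγ, hγA, rfl⟩, rfl⟩; exact ⟨γ, hγ, rfl, hγA⟩
    have h3 : Prod.snd '' Rel ⊆ (fun u => u - h • X u) '' A := by
      rintro _ ⟨_, ⟨γ, hγ, hγA, rfl⟩, rfl⟩
      exact ⟨_, hγA, rfl⟩
    have h4 := volume_image_sub_smul (η := ε) (δ := δ) (C := C) (h := h) hh.le hXL hε'.le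
      (by linarith) (hC X) hC0 (by linarith) hdet A
    rw [h2]
    refine h1.trans ?_
    gcongr ?_ * ?_
    · rw [← ENNReal.ofReal_pow (by positivity)]
      apply ENNReal.ofReal_le_ofReal
      refine (one_add_pow_le_one_add_mul (by positivity) a9 d).trans ?_
      have : 2 ^ d * 6 * ε * h ≤ e * h := mul_le_mul_of_nonneg_right hε1 hh.le
      linarith
    · refine (measure_mono h3).trans (h4.trans ?_)
      have : L * ε * h ≤ e * h := mul_le_mul_of_nonneg_right hε2 hh.le
      exact mul_le_mul' (ENNReal.ofReal_le_ofReal (by linarith)) le_rfl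
  -- density at the starting points
  have hwt : ∀ k, ∀ y ∈ P.reach h A, y ∈ P.piece k → P.wt k y ≤ ρ - h * β + h * e := by
    rintro k _ ⟨γ, hγ, rfl, hγA⟩ hk
    obtain rfl := piece_unique hk (hpc γ hγ hγA 0 h0)
    have e1 := hγ.norm_sub_add_smul_le hB hh (hpc γ hγ hγA) (hcl γ hγ hγA)
    have e2 : ‖γ 0 - p + h • w‖ ≤ L * ((M + 1) * h) * h + h ^ 2 := by
      have h2 := hdiam _ hγA _ hpA
      rw [dist_eq_norm] at h2
      have h3 := norm_add_le (γ 0 - γ h + h • w) (γ h - p)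
      have h4 : (γ 0 - γ h + h • w) + (γ h - p) = γ 0 - p + h • w := by abel
      rw [h4] at h3
      linarith
    have e3 := norm_taylor_le (P.wt_contDiff k) (fun x hx => (hmod k x p hx).2)
      ((hcl γ hγ hγA 0 h0).trans a4) (y := p) (by simpa using hs.le)
    have e4 : ε * ‖γ 0 - p‖ ≤ ε * ((M + 1) * h) :=
      mul_le_mul_of_nonneg_left (hcl γ hγ hγA 0 h0) hε'.le
    have e5 : fderiv ℝ (P.wt k) p (γ 0 - p) = fderiv ℝ (P.wt k) p (γ 0 - p + h • w) - h * β := by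
      rw [map_add, map_smul, smul_eq_mul, hβ]; ring
    have e6 : fderiv ℝ (P.wt k) p (γ 0 - p + h • w) ≤ L * (L * ((M + 1) * h) * h + h ^ 2) :=
      (Real.le_norm_self _).trans (((fderiv ℝ (P.wt k) p).le_of_opNorm_le
        (hB.fderiv_wt_le k p) _).trans (mul_le_mul_of_nonneg_left e2 hLpos.le))
    have e7 := (Real.le_norm_self _).trans (e3.trans e4)
    have e8 : L * (L * ((M + 1) * h) * h + h ^ 2) ≤ ε * h := by
      have := mul_le_mul_of_nonneg_right a8 hh.le
      calc _ = L * (L * (M + 1) + 1) * h * h := by ring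
        _ ≤ _ := this
    have e9 := mul_le_mul_of_nonneg_right hε3 hh.le
    linarith
  have hwt' : ∀ k, ∀ x ∈ A, x ∈ P.piece k → ρ - e * h ≤ P.wt k x := by
    intro k x hx hk
    obtain rfl := piece_unique hk (hA hx)
    have h1 := hB.wt_lip k p x
    have h2 := hdiam _ hpA _ hx
    rw [dist_eq_norm] at h2
    have h3 : L * ‖p - x‖ ≤ L * h * h := by
      calc _ ≤ L * h ^ 2 := mul_le_mul_of_nonneg_left h2 hLpos.le
        _ = _ := by ring
    have h4 := mul_le_mul_of_nonneg_right a2 hh.le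
    have h5 := le_of_abs_le h1
    linarith
  have hβ' : |β| ≤ L * M + C * L := by
    have := (fderiv ℝ (P.wt i) p).le_of_opNorm_le (hB.fderiv_wt_le i p) w
    have h1 : L * ‖w‖ ≤ L * M := mul_le_mul_of_nonneg_left (hB.vel_le i p) hLpos.le
    rw [Real.norm_eq_abs] at this
    have h2 : 0 ≤ C * L := by positivity
    linarith
  have hτ' : |τ| ≤ L * M + C * L := by
    have h2 : C * ‖X‖ ≤ C * L := mul_le_mul_of_nonneg_left hXL hC0
    have h3 : 0 ≤ L * M := by positivity
    linarith [hC X]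
  have hfin := hscal e h ρ β τ he le_rfl hh (by linarith) (P.wt_mem i p (hA hpA)).1
    (P.wt_mem i p (hA hpA)).2 hβ' hτ' (P.div_ge i p (hA hpA))
  have hAdom : A ⊆ P.dom := hA.trans (P.piece_subset i)
  have hg : 0 ≤ 1 + (P.Γ / P.lo + η) * h := by
    have := P.Γ_nonneg
    positivity
  -- If the bound on the starting density is negative, the mass is at most `ENNReal.ofReal` of it
  -- times a volume, that is zero.
  rcases lt_or_ge (ρ - h * β + h * e) 0 with hneg | hpos
  · refine (mass_le_of_wt_le hwt).trans ?_
    rw [ENNReal.ofReal_of_nonpos hneg.le]; simp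
  have hpos1 : 0 ≤ 1 + e * h := by positivity
  calc P.mass (P.reach h A) ≤ ENNReal.ofReal (ρ - h * β + h * e) * volume (P.reach h A) :=
        mass_le_of_wt_le hwt
    _ ≤ ENNReal.ofReal (ρ - h * β + h * e) * (ENNReal.ofReal (1 + e * h) *
        (ENNReal.ofReal (1 - h * τ + e * h) * volume A)) := by gcongr
    _ = ENNReal.ofReal ((ρ - h * β + h * e) * (1 + e * h) * (1 - h * τ + e * h)) * volume A := by
        rw [ENNReal.ofReal_mul (by positivity), ENNReal.ofReal_mul hpos]; ring
    _ ≤ ENNReal.ofReal ((1 + (P.Γ / P.lo + η) * h) * (ρ - e * h)) * volume A := by gcongr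
    _ = ENNReal.ofReal (1 + (P.Γ / P.lo + η) * h) * (ENNReal.ofReal (ρ - e * h) * volume A) := by
        rw [ENNReal.ofReal_mul hg]; ring
    _ ≤ _ := mul_le_mul' le_rfl (mul_volume_le_mass hAdom hwt')

end PiecewiseField

end EllamFlow

/-! ### Growth of the mass along the flow -/

namespace EllamFlow

namespace PiecewiseField

variable {d : ℕ} {ι κ : Type} {P : PiecewiseField d ι κ} {M L : ℝ}

theorem reach_subset_dom {h : ℝ} (hh : 0 ≤ h) (A : Set (Sp d)) : P.reach h A ⊆ P.dom := by
  rintro _ ⟨γ, hγ, rfl, -⟩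
  exact hγ.2.1 0 ⟨le_rfl, hh⟩

theorem reach_iUnion {α : Type*} {h : ℝ} (A : α → Set (Sp d)) :
    P.reach h (⋃ a, A a) = ⋃ a, P.reach h (A a) := by
  ext y
  simp only [reach, mem_iUnion, mem_ofPred_eq]
  constructor
  · rintro ⟨γ, hγ, h0, a, ha⟩; exact ⟨a, γ, hγ, h0, ha⟩
  · rintro ⟨a, γ, hγ, h0, ha⟩; exact ⟨γ, hγ, h0, a, ha⟩

/-- A trajectory is cut in two; this inclusion is all that the iteration needs, and no gluing of
trajectories is required. -/
theorem reach_add_subset {s t : ℝ} (hs : 0 ≤ s) (ht : 0 ≤ t) (A : Set (Sp d)) :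
    P.reach (s + t) A ⊆ P.reach s (P.reach t A) := by
  rintro y ⟨γ, hγ, rfl, hA⟩
  refine ⟨γ, ?_, rfl, fun r => γ (s + r), hγ.shift hs le_rfl, by simp, hA⟩
  simpa using hγ.shift le_rfl (b := s) (by linarith)

variable [Fintype ι]

theorem sum_mass_piece_le (A : Set (Sp d)) : ∑ i, P.mass (A ∩ P.piece i) ≤ P.mass A := by
  have := measure_iUnion (μ := P.mass.restrict A) P.piece_disjoint
    (fun i => (P.piece_open i).measurableSet)
  simp only [Measure.restrict_apply (P.piece_open _).measurableSet, tsum_fintype] at this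
  calc ∑ i, P.mass (A ∩ P.piece i) = P.mass.restrict A (⋃ i, P.piece i) := by
        rw [this]; simp only [inter_comm]
    _ ≤ P.mass.restrict A univ := measure_mono (subset_univ _)
    _ = P.mass A := by simp

/-- A bound for small sets extends to all sets. -/
theorem mass_reach_le_of_small {h r : ℝ} (hr : 0 < r) {c : ENNReal} {B : Set (Sp d)}
    {A : Set (Sp d)} (hA : ∀ A' ⊆ A, (∀ x ∈ A', ∀ y ∈ A', dist x y ≤ r) →
      P.mass (P.reach h A' \ B) ≤ c * P.mass A') :
    P.mass (P.reach h A \ B) ≤ c * P.mass A := by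
  obtain ⟨Q, hQm, hQd, hQU, hQ⟩ := exists_small_partition (E := Sp d) hr
  have hAU : A = ⋃ k, A ∩ Q k := by rw [← inter_iUnion, hQU, inter_univ]
  calc P.mass (P.reach h A \ B) = P.mass (⋃ k, P.reach h (A ∩ Q k) \ B) := by
        rw [← iUnion_sdiff, ← reach_iUnion, ← hAU]
    _ ≤ ∑' k, P.mass (P.reach h (A ∩ Q k) \ B) := measure_iUnion_le _
    _ ≤ ∑' k, c * P.mass (A ∩ Q k) := ENNReal.tsum_le_tsum fun k =>
        hA _ inter_subset_left fun x hx y hy => hQ k x hx.2 y hy.2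
    _ = c * P.mass A := by rw [ENNReal.tsum_mul_left, ← measure_eq_tsum_inter _ hQm hQd hQU]

/-- Bad starting points cost ηh/2. Targets near the hyperplanes have mass O(h), so the factor (1 +
θ)^(d+2) costs O(θh), which is made at most ηh/2. The other targets are divided among the pieces,
then into sets of diameter h², each of which contributes the factor 1 + (Γ/lo + η)h. -/
theorem exists_mass_reach_step_le [Fintype κ] (hB : P.Bounds M L) {η : ℝ} (hη : 0 < η) :
    ∃ h₀ > 0, ∀ h, 0 < h → h ≤ h₀ → ∀ A ⊆ P.dom, P.mass (P.reach h A) ≤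
      ENNReal.ofReal (1 + (P.Γ / P.lo + η) * h) * P.mass A + ENNReal.ofReal (η * h) := by
  have hM := hB.M_pos
  have hlo := P.lo_pos
  have hup := P.up_pos
  obtain ⟨C, hC0, hC⟩ := P.exists_volume_near_le hM.le
  obtain ⟨δ, hδ, ρ, hρ, h₁, hh₁, hbad⟩ := P.exists_volume_bad_le hM
    (show 0 < η / 2 / P.up by positivity)
  obtain ⟨θ, ⟨hθ1, hθ2⟩, hθ⟩ := (((eventually_mul_le 1 one_pos).and (eventually_mul_le
    (2 ^ (d + 2) * (P.up * C)) (half_pos hη))).and self_mem_nhdsWithin).exists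
  have hθ' : 0 < θ := hθ
  rw [one_mul] at hθ1
  obtain ⟨r, hr, h₂, hh₂, hnear⟩ := exists_mass_reach_near_le hB hδ hρ hθ' hθ1
  obtain ⟨h₃, hh₃, hfar⟩ := exists_mass_reach_far_le hB hη
  refine ⟨min h₁ (min h₂ h₃), by positivity, fun h hh hhh A hA => ?_⟩
  have hn := measurableSet_near (P := P) M h
  have hg : 0 ≤ (P.Γ / P.lo + η) * h := by have := P.Γ_nonneg; positivity
  set c := ENNReal.ofReal (1 + (P.Γ / P.lo + η) * h) with hc
  have hc1 : 1 ≤ c := by rw [hc, ENNReal.one_le_ofReal]; linarith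
  have hmb : P.mass (P.bad M δ ρ h) ≤ ENNReal.ofReal (η / 2 * h) := by
    refine (P.mass_le_up _).trans ?_
    calc _ ≤ ENNReal.ofReal P.up * ENNReal.ofReal (η / 2 / P.up * h) := by
          gcongr; exact hbad h hh (hhh.trans (min_le_left _ _))
      _ = _ := by rw [← ENNReal.ofReal_mul hup.le]; congr 1; field_simp
  -- the three parts of the target
  have hN : P.mass (P.reach h (A ∩ P.near M h) \ P.bad M δ ρ h) ≤
      P.mass (A ∩ P.near M h) + ENNReal.ofReal (η / 2 * h) := by
    have h1 := mass_reach_le_of_small (P := P) (h := h) (B := P.bad M δ ρ h)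
      (A := A ∩ P.near M h) hr (fun A' hA' hd => hnear h hh
        (hhh.trans ((min_le_right _ _).trans (min_le_left _ _))) A'
        (hA'.trans (inter_subset_left.trans hA)) (hA'.trans inter_subset_right) hd)
    have h2 : ENNReal.ofReal ((1 + θ) ^ (d + 2)) ≤ 1 + ENNReal.ofReal (2 ^ (d + 2) * θ) := by
      rw [← ENNReal.ofReal_one, ← ENNReal.ofReal_add zero_le_one (by positivity)]
      exact ENNReal.ofReal_le_ofReal (one_add_pow_le_one_add_mul hθ'.le hθ1 _)
    have h3 : P.mass (A ∩ P.near M h) ≤ ENNReal.ofReal (P.up * (C * h)) := by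
      rw [ENNReal.ofReal_mul hup.le]
      refine (P.mass_le_up _).trans (mul_le_mul' le_rfl ?_)
      exact (measure_mono (inter_subset_inter_left _ hA)).trans (hC h hh.le)
    calc _ ≤ _ := h1
      _ ≤ (1 + ENNReal.ofReal (2 ^ (d + 2) * θ)) * P.mass (A ∩ P.near M h) := by gcongr
      _ = P.mass (A ∩ P.near M h) +
          ENNReal.ofReal (2 ^ (d + 2) * θ) * P.mass (A ∩ P.near M h) := by ring
      _ ≤ P.mass (A ∩ P.near M h) +
          ENNReal.ofReal (2 ^ (d + 2) * θ) * ENNReal.ofReal (P.up * (C * h)) := by gcongr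
      _ ≤ _ := by
          rw [← ENNReal.ofReal_mul (by positivity)]
          refine add_le_add le_rfl (ENNReal.ofReal_le_ofReal ?_)
          have := mul_le_mul_of_nonneg_right hθ2 hh.le
          calc _ = 2 ^ (d + 2) * (P.up * C) * θ * h := by ring
            _ ≤ _ := this
  have hF : ∀ i, P.mass (P.reach h ((A \ P.near M h) ∩ P.piece i)) ≤
      c * P.mass ((A \ P.near M h) ∩ P.piece i) := by
    intro i
    have h1 := mass_reach_le_of_small (P := P) (h := h) (B := ∅) (c := c)
      (A := (A \ P.near M h) ∩ P.piece i) (r := h ^ 2) (by positivity) (fun A' hA' hd => by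
        rw [sdiff_empty]
        exact hfar h hh (hhh.trans ((min_le_right _ _).trans (min_le_right _ _))) i A'
          (hA'.trans inter_subset_right) (disjoint_left.2 fun x hx => (hA' hx).1.2) hd)
    rwa [sdiff_empty] at h1
  have hcover : P.reach h A ⊆ P.bad M δ ρ h ∪ (P.reach h (A ∩ P.near M h) \ P.bad M δ ρ h) ∪
      ⋃ i, P.reach h ((A \ P.near M h) ∩ P.piece i) := by
    rintro y ⟨γ, hγ, rfl, hγA⟩
    by_cases hb : γ 0 ∈ P.bad M δ ρ h
    · exact Or.inl (Or.inl hb)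
    by_cases hnr : γ h ∈ P.near M h
    · exact Or.inl (Or.inr ⟨⟨γ, hγ, rfl, hγA, hnr⟩, hb⟩)
    · rcases P.dom_subset (hA hγA) with hG | hH
      · obtain ⟨i, hi⟩ := mem_iUnion.1 hG
        exact Or.inr (mem_iUnion.2 ⟨i, γ, hγ, rfl, ⟨hγA, hnr⟩, hi⟩)
      · obtain ⟨j, hj⟩ := mem_iUnion.1 hH
        refine absurd ⟨j, ?_⟩ hnr
        rw [show P.sd j (γ h) = 0 from P.mem_hyp.1 hj, abs_zero]
        positivity
  calc P.mass (P.reach h A) ≤ P.mass (P.bad M δ ρ h) +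
        P.mass (P.reach h (A ∩ P.near M h) \ P.bad M δ ρ h) +
        ∑ i, P.mass (P.reach h ((A \ P.near M h) ∩ P.piece i)) :=
        (measure_mono hcover).trans ((measure_union_le _ _).trans
          (add_le_add (measure_union_le _ _) (measure_iUnion_fintype_le _ _)))
    _ ≤ ENNReal.ofReal (η / 2 * h) + (P.mass (A ∩ P.near M h) + ENNReal.ofReal (η / 2 * h)) +
        ∑ i, c * P.mass ((A \ P.near M h) ∩ P.piece i) := by gcongr with i; exact hF i
    _ ≤ ENNReal.ofReal (η / 2 * h) + (c * P.mass (A ∩ P.near M h) + ENNReal.ofReal (η / 2 * h)) +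
        c * P.mass (A \ P.near M h) := by
        rw [← Finset.mul_sum]
        gcongr
        · exact le_mul_of_one_le_left' hc1
        · exact sum_mass_piece_le _
    _ = c * (P.mass (A ∩ P.near M h) + P.mass (A \ P.near M h)) +
        (ENNReal.ofReal (η / 2 * h) + ENNReal.ofReal (η / 2 * h)) := by ring
    _ = _ := by
        rw [measure_inter_add_sdiff _ hn, ← ENNReal.ofReal_add (by positivity) (by positivity)]
        congr 2; ring

/-- A trajectory of length `s` splits into `n` trajectories of length `s / n`. -/
theorem mass_reach_nat_mul_le {h a : ℝ} (hh : 0 < h) (ha : 0 ≤ a) {b : ENNReal}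
    (hstep : ∀ A ⊆ P.dom, P.mass (P.reach h A) ≤ ENNReal.ofReal (1 + a) * P.mass A + b)
    (A : Set (Sp d)) (n : ℕ) :
    P.mass (P.reach (n * h) A) ≤ ENNReal.ofReal ((1 + a) ^ n) * (P.mass A + n * b) := by
  have h1 : 1 ≤ ENNReal.ofReal (1 + a) := by rw [ENNReal.one_le_ofReal]; linarith
  simp only [ENNReal.ofReal_pow (show 0 ≤ 1 + a by linarith)]
  induction n with
  | zero =>
    simp only [Nat.cast_zero, zero_mul, pow_zero, one_mul, add_zero]
    refine measure_mono ?_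
    rintro _ ⟨γ, -, rfl, h⟩
    exact h
  | succ n ih =>
    have h2 : P.reach ((n + 1 : ℕ) * h) A ⊆ P.reach h (P.reach (n * h) A) := by
      rw [show ((n + 1 : ℕ) : ℝ) * h = h + n * h by push_cast; ring]
      exact reach_add_subset hh.le (by positivity) A
    calc _ ≤ P.mass (P.reach h (P.reach (n * h) A)) := measure_mono h2
      _ ≤ ENNReal.ofReal (1 + a) * P.mass (P.reach (n * h) A) + b :=
          hstep _ (reach_subset_dom (by positivity) A)
      _ ≤ ENNReal.ofReal (1 + a) * (ENNReal.ofReal (1 + a) ^ n * (P.mass A + n * b)) +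
          ENNReal.ofReal (1 + a) ^ (n + 1) * b := by
          gcongr
          exact le_mul_of_one_le_left' (one_le_pow₀ h1)
      _ = _ := by push_cast; ring

/-- Discrete Gronwall inequality with n steps of length t/n: the factors multiply to at most an
exponential, the additive errors sum to ηt, and finally η tends to 0. -/
theorem mass_reach_le [Fintype κ] (hB : P.Bounds M L) {t : ℝ} (ht : 0 ≤ t) {A : Set (Sp d)} (hA : A ⊆ P.dom) :
    P.mass (P.reach t A) ≤ ENNReal.ofReal (Real.exp (P.Γ / P.lo * t)) * P.mass A := by
  rcases ht.eq_or_lt with rfl | ht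
  · simp only [mul_zero, Real.exp_zero, ENNReal.ofReal_one, one_mul]
    refine measure_mono ?_
    rintro _ ⟨γ, -, rfl, h⟩
    exact h
  have hΓ := P.Γ_nonneg
  have hlo := P.lo_pos
  have key : ∀ η : ℝ, 0 < η → P.mass (P.reach t A) ≤
      ENNReal.ofReal (Real.exp ((P.Γ / P.lo + η) * t)) * (P.mass A + ENNReal.ofReal (η * t)) := by
    intro η hη
    obtain ⟨h₀, hh₀, hstep⟩ := exists_mass_reach_step_le hB hη
    obtain ⟨n, hn⟩ := exists_nat_gt (t / h₀)
    have hn0 : (0 : ℝ) < n := lt_trans (by positivity) hn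
    set h := t / n with hh
    have hhpos : 0 < h := by positivity
    have hnh : (n : ℝ) * h = t := by rw [hh]; field_simp
    have hle : h ≤ h₀ := by
      rw [hh, div_le_iff₀ hn0]
      rw [div_lt_iff₀ hh₀] at hn
      linarith
    have h1 := mass_reach_nat_mul_le hhpos (a := (P.Γ / P.lo + η) * h) (by positivity)
      (hstep h hhpos hle) A n
    rw [hnh] at h1
    refine h1.trans ?_
    gcongr
    · calc (1 + (P.Γ / P.lo + η) * h) ^ n ≤ Real.exp ((P.Γ / P.lo + η) * h) ^ n := by
            gcongr; rw [add_comm]; exact Real.add_one_le_exp _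
        _ = _ := by rw [← Real.exp_nat_mul, ← hnh]; congr 1; ring
    · rw [← hnh, ← ENNReal.ofReal_natCast, ← ENNReal.ofReal_mul hn0.le]
      apply ENNReal.ofReal_le_ofReal
      linarith
  have hfin : P.mass A ≠ ⊤ := by
    refine ((P.mass_le_up A).trans_lt (ENNReal.mul_lt_top ENNReal.ofReal_lt_top ?_)).ne
    exact (P.dom_bounded.subset hA).measure_lt_top
  have hlim : Tendsto (fun η : ℝ => ENNReal.ofReal (Real.exp ((P.Γ / P.lo + η) * t)) *
      (P.mass A + ENNReal.ofReal (η * t))) (𝓝[>] 0)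
      (𝓝 (ENNReal.ofReal (Real.exp ((P.Γ / P.lo + 0) * t)) *
        (P.mass A + ENNReal.ofReal (0 * t)))) := by
    refine Tendsto.mono_left ?_ nhdsWithin_le_nhds
    refine ENNReal.Tendsto.mul ?_ (Or.inr (by finiteness)) ?_ (Or.inr ENNReal.ofReal_ne_top)
    · exact (ENNReal.continuous_ofReal.comp (by fun_prop)).tendsto 0
    · exact tendsto_const_nhds.add ((ENNReal.continuous_ofReal.comp
        (continuous_id.mul continuous_const)).tendsto 0)
  simp only [add_zero, zero_mul, ENNReal.ofReal_zero] at hlim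
  exact ge_of_tendsto hlim (eventually_nhdsWithin_of_forall fun η hη => key η hη)

/-- The densities lie between `lo` and `up`, so passing from mass to Lebesgue measure costs the
quotient up/lo. This is the origin of the constant C_1. -/
theorem volume_reach_le [Fintype κ] {t : ℝ} (ht : 0 ≤ t) {A : Set (Sp d)} (hA : A ⊆ P.dom) :
    volume (P.reach t A) ≤
      ENNReal.ofReal (P.up / P.lo * Real.exp (P.Γ / P.lo * t)) * volume A := by
  obtain ⟨M, L, hB⟩ := P.exists_bounds
  have hlo := P.lo_pos
  have hup := P.up_pos
  have h1 := P.lo_le_mass (reach_subset_dom ht A)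
  have h2 := (h1.trans (mass_reach_le hB ht hA)).trans (mul_le_mul' le_rfl (P.mass_le_up A))
  calc volume (P.reach t A) = ENNReal.ofReal (P.lo⁻¹) *
        (ENNReal.ofReal P.lo * volume (P.reach t A)) := by
        rw [← mul_assoc, ← ENNReal.ofReal_mul (by positivity), inv_mul_cancel₀ hlo.ne']; simp
    _ ≤ ENNReal.ofReal (P.lo⁻¹) * (ENNReal.ofReal (Real.exp (P.Γ / P.lo * t)) *
        (ENNReal.ofReal P.up * volume A)) := by gcongr
    _ = _ := by
        rw [← mul_assoc, ← mul_assoc, ← ENNReal.ofReal_mul (by positivity),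
          ← ENNReal.ofReal_mul (by positivity)]
        congr 2; ring

end PiecewiseField

end EllamFlow

/-! ### Measurability of the flow -/

namespace EllamFlow

/-- The relation is the graph of a Lipschitz function on its possibly non-measurable domain; a
Lipschitz extension to the whole space is continuous. -/
theorem exists_measurable_of_lipschitz_rel {d : ℕ} (Rel : Set (Sp d × Sp d)) {K : ℝ}
    (hRel : ∀ p ∈ Rel, ∀ q ∈ Rel, ‖p.2 - q.2‖ ≤ K * ‖p.1 - q.1‖) :
    ∃ g : Sp d → Sp d, Measurable g ∧ ∀ q ∈ Rel, g q.1 = q.2 := by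
  classical
  have hch : ∀ y : Sp d, ∃ z : Sp d, y ∈ Prod.fst '' Rel → (y, z) ∈ Rel := by
    intro y
    by_cases hy : y ∈ Prod.fst '' Rel
    · obtain ⟨p, hp, rfl⟩ := hy
      exact ⟨p.2, fun _ => hp⟩
    · exact ⟨0, fun h => (hy h).elim⟩
  choose f hf using hch
  have hlip : LipschitzOnWith K.toNNReal f (Prod.fst '' Rel) := by
    refine LipschitzOnWith.of_dist_le_mul fun x hx y hy => ?_
    rw [dist_eq_norm, dist_eq_norm]
    refine (hRel _ (hf x hx) _ (hf y hy)).trans ?_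
    gcongr
    exact Real.le_coe_toNNReal K
  obtain ⟨g, hg, hfg⟩ := hlip.extend_finite_dimension
  refine ⟨g, hg.continuous.measurable, fun q hq => ?_⟩
  have hq' : q.1 ∈ Prod.fst '' Rel := ⟨q, hq, rfl⟩
  rw [← hfg hq']
  have h1 := hRel _ (hf q.1 hq') _ hq
  simp only [sub_self, norm_zero, mul_zero, norm_le_zero_iff, sub_eq_zero] at h1
  exact h1

/-- A function which agrees with measurable functions up to sets of arbitrarily small measure is
almost everywhere measurable. -/
theorem aemeasurable_of_forall_exists_measurable {α β : Type*} [MeasurableSpace α]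
    [MeasurableSpace β] [Nonempty β] {μ : Measure α} {f : α → β}
    (h : ∀ ε : ENNReal, 0 < ε → ∃ g, Measurable g ∧ μ {x | f x ≠ g x} ≤ ε) : AEMeasurable f μ := by
  classical
  choose g hg hfg using fun n : ℕ => h ((n : ENNReal) + 1)⁻¹ (by simp)
  set B : ℕ → Set α := fun n => (toMeasurable μ {x | f x ≠ g n x})ᶜ with hB
  have hBm : ∀ n, MeasurableSet (B n) := fun n => (measurableSet_toMeasurable _ _).compl
  have hBe : ∀ n, ∀ x ∈ B n, f x = g n x := by
    intro n x hx
    by_contra hne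
    exact hx (subset_toMeasurable _ _ hne)
  obtain ⟨G, hG, hGB⟩ := exists_measurable_piecewise B hBm g hg (fun i j _ x hx => by
    rw [← hBe i x hx.1, hBe j x hx.2])
  refine ⟨G, hG, ?_⟩
  refine measure_mono_null (t := ⋂ n, (B n)ᶜ) (fun x hx => mem_iInter.2 fun n hxB => hx ?_) ?_
  · change f x = G x
    rw [hGB n hxB, hBe n x hxB]
  · refine le_antisymm (ge_of_tendsto' (f := fun n : ℕ => ((n : ENNReal) + 1)⁻¹) (x := atTop) ?_ fun n => ?_) bot_le
    · have := ENNReal.tendsto_inv_nat_nhds_zero.comp (tendsto_add_atTop_nat 1)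
      refine this.congr fun n => by simp
    · refine (measure_mono (iInter_subset _ n)).trans ?_
      rw [hB, compl_compl, measure_toMeasurable]
      exact hfg n

namespace PiecewiseField

variable {d : ℕ} {ι κ : Type} {P : PiecewiseField d ι κ} {M L : ℝ} [Fintype ι] [Countable κ]

/-- Away from the bad points, the one-step map is well defined and measurable. -/
theorem exists_measurable_step (hB : P.Bounds M L) {δ ρ : ℝ} (hδ : 0 < δ) (hρ : 0 < ρ) :
    ∃ h₀ > 0, ∀ h, 0 < h → h ≤ h₀ → ∃ Φ : Sp d → Sp d, Measurable Φ ∧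
      ∀ γ, P.IsTraj h γ → γ 0 ∉ P.bad M δ ρ h → γ h = Φ (γ 0) := by
  -- Only some Lipschitz bound is needed here, so θ = 1 is enough: in the chart the step is
  -- 2-Lipschitz.
  obtain ⟨r, hr, h₁, hh₁, hchart⟩ := exists_chart hB hδ (half_pos hρ) one_pos le_rfl
  have hM := hB.M_pos
  have hLpos := hB.L_pos
  obtain ⟨h₀, hh₀, e1, e2, e3, e4⟩ : ∃ h₀ : ℝ, 0 < h₀ ∧ h₀ ≤ h₁ ∧ M * h₀ ≤ r / 16 ∧
      M * h₀ ≤ ρ / 16 ∧ L * h₀ ≤ 1 / 2 := by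
    have h1 := eventually_mul_le 1 hh₁
    have h2 := eventually_mul_le M (show 0 < r / 16 by positivity)
    have h3 := eventually_mul_le M (show 0 < ρ / 16 by positivity)
    have h4 := eventually_mul_le L (half_pos one_pos)
    obtain ⟨s, hs⟩ := ((h1.and h2).and ((h3.and h4).and self_mem_nhdsWithin)).exists
    exact ⟨s, hs.2.2, by linarith [hs.1.1], hs.1.2, hs.2.1.1, hs.2.1.2⟩
  refine ⟨h₀, hh₀, fun h hh hhh => ?_⟩
  have hMh1 : M * h ≤ r / 16 := (mul_le_mul_of_nonneg_left hhh hM.le).trans e2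
  have hMh2 : M * h ≤ ρ / 16 := (mul_le_mul_of_nonneg_left hhh hM.le).trans e3
  have hLh : L * h ≤ 1 / 2 := (mul_le_mul_of_nonneg_left hhh hLpos.le).trans e4
  have hMh0 : 0 < M * h := by positivity
  have h0 : (0 : ℝ) ∈ Icc 0 h := ⟨le_rfl, hh.le⟩
  have hh' : h ∈ Icc 0 h := ⟨hh.le, le_rfl⟩
  have hlocal : ∀ A : Set (Sp d), (∀ x ∈ A, ∀ y ∈ A, dist x y ≤ M * h) →
      ∃ Φ : Sp d → Sp d, Measurable Φ ∧
        ∀ γ, P.IsTraj h γ → γ 0 ∈ A → γ 0 ∉ P.bad M δ ρ h → γ h = Φ (γ 0) := by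
    intro A hA
    by_cases hex : ∃ γ, P.IsTraj h γ ∧ γ 0 ∈ A ∧ γ 0 ∉ P.bad M δ ρ h
    swap
    · push Not at hex
      exact ⟨id, measurable_id, fun γ hγ hγA hb => absurd (hex γ hγ hγA) hb⟩
    obtain ⟨γ₀, hγ₀, hγ₀A, hbad₀⟩ := hex
    set y₀ := γ₀ 0 with hy₀
    have hcl : ∀ γ, P.IsTraj h γ → γ 0 ∈ A → ∀ t ∈ Icc 0 h, ‖γ t - y₀‖ ≤ 2 * (M * h) := by
      intro γ hγ hγA t ht
      have h1 := hγ.norm_sub_le_mul hB h0 ht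
      have h2 := hA _ hγA _ hγ₀A
      rw [dist_eq_norm] at h2
      have h3 := norm_add_le (γ t - γ 0) (γ 0 - y₀)
      rw [sub_add_sub_cancel] at h3
      linarith
    by_cases hj : ∃ j, |P.sd j y₀| ≤ 4 * M * h
    · obtain ⟨j, hj⟩ := hj
      obtain ⟨hp, hpd⟩ := P.foot_mem_hyp j y₀
      set p := y₀ - P.sd j y₀ • P.nrm j with hpdef
      have hyp : ‖y₀ - p‖ ≤ 4 * (M * h) := by rw [hpd]; linarith
      have hiso : ∀ x ∈ Metric.ball p (ρ / 2), ∀ k, x ∈ P.hyp k → x ∈ P.hyp j := by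
        intro x hx k hxk
        refine isolated_of_notMem_bad (hγ₀.2.1 0 h0) hbad₀ hj ?_ hxk
        have h1 := norm_sub_le_of_mem_ball hx
        have h3 := norm_add_le (y₀ - p) (p - x)
        rw [sub_add_sub_cancel, norm_sub_rev p x] at h3
        change ‖y₀ - x‖ ≤ ρ
        linarith
      obtain ⟨n, c, v, K, s, hn, hq, hK, hs, hsd, hni, -⟩ := hchart h hh (hhh.trans e1) j p hp hiso
      have hin : ∀ γ, P.IsTraj h γ → γ 0 ∈ A → ∀ t ∈ Icc 0 h, γ t ∈ Metric.ball p r := by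
        intro γ hγ hγA t ht
        have h1 := hcl γ hγ hγA t ht
        have h3 := norm_add_le (γ t - y₀) (y₀ - p)
        rw [sub_add_sub_cancel] at h3
        rw [mem_ball_iff_norm]
        linarith
      have hfar : ∀ γ, P.IsTraj h γ → γ 0 ∉ P.bad M δ ρ h → δ * h < |inner ℝ n (γ 0) - c| := by
        intro γ hγ hb
        rw [hsd]
        by_contra hcon
        exact hb ⟨hγ.2.1 0 h0, Or.inl ⟨j, not_lt.1 hcon⟩⟩
      obtain ⟨g, hg, hgR⟩ := exists_measurable_of_lipschitz_rel
        {q | ∃ γ, P.IsTraj h γ ∧ γ 0 ∈ A ∧ γ 0 ∉ P.bad M δ ρ h ∧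
          q = (shear n c v K (γ 0), shear n c v K (γ h))} (K := 2) (by
        rintro _ ⟨γ, hγ, hγA, hγb, rfl⟩ _ ⟨γ', hγ', hγA', hγb', rfl⟩
        have h2 := hni γ γ' hγ hγ' (hin γ hγ hγA) (hin γ' hγ' hγA') (hfar γ hγ hγb)
          (hfar γ' hγ' hγb') 0 h0
        rw [norm_sub_rev] at h2
        have h3 := norm_sub_norm_le (shear n c v K (γ h) - shear n c v K (γ' h))
          (shear n c v K (γ 0) - shear n c v K (γ' 0))
        simp only
        linarith)
      refine ⟨fun y => shearInv n c v K (g (shear n c v K y)),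
        measurable_shearInv.comp (hg.comp measurable_shear), fun γ hγ hγA hγb => ?_⟩
      have h1 := hgR _ ⟨γ, hγ, hγA, hγb, rfl⟩
      simp only at h1
      simp only [h1, shearInv_shear hn hq hK]
    · push Not at hj
      have hball : ∀ x ∈ Metric.ball y₀ (4 * M * h), ∀ j, x ∉ P.hyp j := by
        intro x hx j hxj
        have h1 := P.abs_sd_sub_le j y₀ x
        rw [P.mem_hyp.1 hxj, sub_zero] at h1
        rw [mem_ball_iff_norm, norm_sub_rev] at hx
        linarith [hj j]
      have hin : ∀ γ, P.IsTraj h γ → γ 0 ∈ A → ∀ t ∈ Icc 0 h, γ t ∈ Metric.ball y₀ (4 * M * h) := by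
        intro γ hγ hγA t ht
        rw [mem_ball_iff_norm]
        linarith [hcl γ hγ hγA t ht]
      obtain ⟨t, ht, i, hi⟩ := hγ₀.exists_mem_piece hh
      have hsub : Metric.ball y₀ (4 * M * h) ⊆ P.piece i :=
        subset_piece_of_inter (convex_ball _ _).isPreconnected ⟨_, hin γ₀ hγ₀ hγ₀A t ht, hi⟩ hball
      obtain ⟨g, hg, hgR⟩ := exists_measurable_of_lipschitz_rel
        {q | ∃ γ, P.IsTraj h γ ∧ γ 0 ∈ A ∧ q = (γ 0, γ h)} (K := 2) (by
        rintro _ ⟨γ, hγ, hγA, rfl⟩ _ ⟨γ', hγ', hγA', rfl⟩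
        exact (hγ.osc_single hB hγ' hh.le hLh (i := i)
          (fun t ht k hk => piece_unique hk (hsub (hin γ hγ hγA t ht)))
          (fun t ht k hk => piece_unique hk (hsub (hin γ' hγ' hγA' t ht))) h0).1 h hh')
      exact ⟨g, hg, fun γ hγ hγA _ => (hgR _ ⟨γ, hγ, hγA, rfl⟩).symm⟩
  obtain ⟨Q, hQm, hQd, hQU, hQ⟩ := exists_small_partition (E := Sp d) hMh0
  choose g hg hgQ using fun k => hlocal (Q k) (hQ k)
  obtain ⟨Φ, hΦ, hΦg⟩ := exists_measurable_piecewise Q hQm g hg (fun i j hij x hx =>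
    absurd hx.2 (disjoint_left.1 (hQd hij) hx.1))
  refine ⟨Φ, hΦ, fun γ hγ hb => ?_⟩
  obtain ⟨k, hk⟩ := mem_iUnion.1 (hQU.symm ▸ mem_univ (γ 0))
  rw [hΦg k hk, hgQ k γ hγ hk hb]

end PiecewiseField

namespace PiecewiseField

variable {d : ℕ} {ι κ : Type} {P : PiecewiseField d ι κ} [Fintype ι] [Fintype κ]

/-- The points whose trajectory meets a given set at one of the times `j * h`, `j < n`. -/
theorem volume_iUnion_reach_le {h T c : ℝ} (hh : 0 ≤ h) {n : ℕ} (hn : n * h ≤ T)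
    (hc : P.up / P.lo * Real.exp (P.Γ / P.lo * T) ≤ c) {B : Set (Sp d)} (hB : B ⊆ P.dom) :
    volume (⋃ j ∈ Finset.range n, P.reach (j * h) B) ≤ n * (ENNReal.ofReal c * volume B) := by
  refine (measure_biUnion_finset_le _ _).trans ?_
  refine (Finset.sum_le_card_nsmul _ _ (ENNReal.ofReal c * volume B) fun j hj => ?_).trans_eq
    (by simp)
  have hΓ := P.Γ_nonneg
  have hlo := P.lo_pos
  have hup := P.up_pos
  refine (volume_reach_le (by positivity) hB).trans ?_
  gcongr
  refine le_trans ?_ hc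
  have h1 : (j : ℝ) * h ≤ T := le_trans
    (mul_le_mul_of_nonneg_right (by exact_mod_cast (Finset.mem_range.1 hj).le) hh) hn
  gcongr

/-- The time-`s` map of a family of trajectories is almost everywhere measurable. -/
theorem aemeasurable_flow {s : ℝ} (hs : 0 ≤ s) (F : ℝ → Sp d → Sp d)
    (hF : ∀ᵐ x ∂(volume.restrict P.dom), F 0 x = x ∧ P.IsTraj s fun t => F t x) :
    AEMeasurable (F s) (volume.restrict P.dom) := by
  rcases hs.eq_or_lt with rfl | hs
  · exact ⟨id, measurable_id, hF.mono fun x hx => hx.1⟩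
  obtain ⟨M, L, hB⟩ := P.exists_bounds
  have hlo := P.lo_pos
  have hup := P.up_pos
  set c := P.up / P.lo * Real.exp (P.Γ / P.lo * s) with hc
  have hc0 : 0 < c := by positivity
  refine aemeasurable_of_forall_exists_measurable fun ε hε => ?_
  obtain ⟨ε', hε', hεε⟩ : ∃ ε' : ℝ, 0 < ε' ∧ ENNReal.ofReal ε' ≤ ε := by
    by_cases h : ε = ⊤
    · exact ⟨1, one_pos, by simp [h]⟩
    · exact ⟨ε.toReal, ENNReal.toReal_pos hε.ne' h, (ENNReal.ofReal_toReal h).le⟩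
  obtain ⟨δ, hδ, ρ, hρ, h₁, hh₁, hbad⟩ := P.exists_volume_bad_le hB.M_pos
    (show 0 < ε' / (c * s) by positivity)
  obtain ⟨h₂, hh₂, hstep⟩ := exists_measurable_step hB hδ hρ
  obtain ⟨n, hn⟩ := exists_nat_gt (s / min h₁ h₂)
  have hmin : 0 < min h₁ h₂ := lt_min hh₁ hh₂
  have hn0 : (0 : ℝ) < n := lt_trans (by positivity) hn
  set h := s / n with hh
  have hhpos : 0 < h := by positivity
  have hnh : (n : ℝ) * h = s := by rw [hh]; field_simp
  have hle : h ≤ min h₁ h₂ := by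
    rw [hh, div_le_iff₀ hn0]
    rw [div_lt_iff₀ hmin] at hn
    linarith
  obtain ⟨Φ, hΦ, hΦγ⟩ := hstep h hhpos (hle.trans (min_le_right _ _))
  refine ⟨Φ^[n], hΦ.iterate n, ?_⟩
  -- Off E no position at a time jh with j < n is bad, so the trajectory follows the iterates of Φ.
  -- Each of the n sets has measure at most c · (ε'/(cs)) h, and nh = s.
  set E := ⋃ j ∈ Finset.range n, P.reach (j * h) (P.bad M δ ρ h) with hE
  have hbd : P.bad M δ ρ h ⊆ P.dom := fun y hy => hy.1
  have hEvol : volume E ≤ ε := by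
    refine (volume_iUnion_reach_le hhpos.le hnh.le le_rfl hbd).trans (le_trans ?_ hεε)
    calc (n : ENNReal) * (ENNReal.ofReal c * volume (P.bad M δ ρ h))
        ≤ ENNReal.ofReal n * (ENNReal.ofReal c * ENNReal.ofReal (ε' / (c * s) * h)) := by
          rw [ENNReal.ofReal_natCast]
          gcongr
          exact hbad h hhpos (hle.trans (min_le_left _ _))
      _ = ENNReal.ofReal ε' := by
          rw [← ENNReal.ofReal_mul hc0.le, ← ENNReal.ofReal_mul hn0.le]
          congr 1
          rw [← hnh]; field_simp
  have hsub : ∀ᵐ x ∂(volume.restrict P.dom), x ∈ {x | F s x ≠ Φ^[n] x} → x ∈ E := by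
    filter_upwards [hF] with x hx hne
    by_contra hxE
    refine hne ?_
    have hj : ∀ j : ℕ, j ≤ n → F (j * h) x = Φ^[j] x := by
      intro j
      induction j with
      | zero => intro _; simpa using hx.1
      | succ j ih =>
        intro hjn
        have hjn' : ((j : ℝ) + 1) * h ≤ s := by
          rw [← hnh]
          exact mul_le_mul_of_nonneg_right (by exact_mod_cast hjn) hhpos.le
        have hsh := hx.2.shift (a := j * h) (b := h) (by positivity) (by linarith)
        have h3 := hΦγ _ hsh (by
          intro hb
          refine hxE (mem_biUnion (Finset.mem_range.2 (Nat.lt_of_succ_le hjn)) ?_)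
          refine ⟨fun t => F t x, ?_, hx.1, by simpa using hb⟩
          have := hx.2.shift le_rfl (b := j * h) (by linarith)
          simpa using this)
        simp only [add_zero] at h3
        rw [Function.iterate_succ_apply', ← ih (by omega), ← h3]
        congr 1; push_cast; ring
    have := hj n le_rfl
    rwa [hnh] at this
  calc volume.restrict P.dom {x | F s x ≠ Φ^[n] x} ≤ volume.restrict P.dom E :=
        measure_mono_ae hsub
    _ ≤ volume E := Measure.restrict_apply_le _ _
    _ ≤ ε := hEvol

end PiecewiseField

end EllamFlow

/-! ### Crossing a face in one time step -/

namespace EllamFlow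

theorem eq_or_eq_neg_of_hyperplane_eq {d : ℕ} {n m : Sp d} {c e : ℝ} (hn : ‖n‖ = 1) (hm : ‖m‖ = 1)
    (h : hyperplane n c = hyperplane m e) : (m = n ∧ e = c) ∨ (m = -n ∧ e = -c) := by
  have hnn : inner ℝ n n = (1 : ℝ) := by rw [real_inner_self_eq_norm_sq, hn]; norm_num
  have hmm : inner ℝ m m = (1 : ℝ) := by rw [real_inner_self_eq_norm_sq, hm]; norm_num
  have hmem : ∀ u : Sp d, inner ℝ n u = (0 : ℝ) → inner ℝ m (c • n + u) = e := by
    intro u hu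
    have : c • n + u ∈ hyperplane n c := by
      change inner ℝ n (c • n + u) = c
      rw [inner_add_right, inner_smul_right, hnn, hu]; ring
    rw [h] at this
    exact this
  set a : ℝ := inner ℝ n m with ha
  have h0 := hmem 0 (by simp)
  have h1 := hmem (m - a • n) (by rw [inner_sub_right, inner_smul_right, hnn, ← ha]; ring)
  have hmn : inner ℝ m n = a := real_inner_comm _ _
  rw [add_zero, inner_smul_right, hmn] at h0
  rw [inner_add_right, inner_smul_right, inner_sub_right, inner_smul_right, hmn, hmm, h0] at h1
  have ha2 : a * a = 1 := by linarith
  have hz : m - a • n = 0 := by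
    rw [← inner_self_eq_zero (𝕜 := ℝ), inner_sub_left, inner_sub_right, inner_sub_right,
      inner_smul_left, inner_smul_right, inner_smul_left, inner_smul_right, hmn, hnn, hmm, ← ha]
    simp only [conj_trivial]
    linarith
  rcases mul_self_eq_one_iff.1 ha2 with h2 | h2
  · left
    rw [h2] at hz h0
    exact ⟨by rw [one_smul] at hz; exact sub_eq_zero.1 hz, by linarith⟩
  · right
    rw [h2] at hz h0
    exact ⟨by rw [neg_one_smul, sub_neg_eq_add] at hz; exact eq_neg_of_add_eq_zero_left hz, by linarith⟩

namespace PiecewiseField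

variable {d : ℕ} {ι κ : Type} {P : PiecewiseField d ι κ} {M L : ℝ}

/-- The prism of half-height `a` over a subset of a hyperplane of the arrangement. -/
def prism (P : PiecewiseField d ι κ) (j : κ) (σ : Set (Sp d)) (a : ℝ) : Set (Sp d) :=
  {x | |P.sd j x| ≤ a ∧ x - P.sd j x • P.nrm j ∈ σ}

/-- The arrangement may contain the same hyperplane several times, with either orientation; the
prism depends only on the hyperplane. -/
theorem prism_congr {j k : κ} (h : P.hyp j = P.hyp k) (σ : Set (Sp d)) (a : ℝ) :
    P.prism j σ a = P.prism k σ a := by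
  have : ∀ x, |P.sd j x| = |P.sd k x| ∧ P.sd j x • P.nrm j = P.sd k x • P.nrm k := by
    intro x
    rcases eq_or_eq_neg_of_hyperplane_eq (P.norm_nrm j) (P.norm_nrm k) h with ⟨h1, h2⟩ | ⟨h1, h2⟩
    · simp only [sd, h1, h2, and_self]
    · have : P.sd k x = -P.sd j x := by simp only [sd, h1, h2, inner_neg_left]; ring
      rw [this, h1, abs_neg, smul_neg, neg_smul, neg_neg]
      exact ⟨rfl, rfl⟩
  ext x
  simp only [prism, mem_ofPred_eq, (this x).1, (this x).2]

/-- A family of faces separating the pieces on which a piecewise constant function takes different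
values, with bounds for the jumps of this function and for the normal velocities. -/
structure Separates (P : PiecewiseField d ι κ) (val : ι → ℝ) {α : Type} (σ : α → Set (Sp d))
    (idx : α → κ) (Δ v : α → ℝ) : Prop where
  jump_nonneg : ∀ e, 0 ≤ Δ e
  speed_nonneg : ∀ e, 0 ≤ v e
  exists_face : ∀ j a b p r, 0 < r → p ∈ P.hyp j →
    (∀ x ∈ Metric.ball p r, ∀ k, x ∈ P.hyp k → x ∈ P.hyp j) →
    (∀ x ∈ Metric.ball p r, inner ℝ (P.nrm j) x < P.lev j → x ∈ P.piece a) →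
    (∀ x ∈ Metric.ball p r, P.lev j < inner ℝ (P.nrm j) x → x ∈ P.piece b) →
    val a ≠ val b → ∃ e, P.hyp j = P.hyp (idx e) ∧ p ∈ σ e ∧ |val a - val b| ≤ Δ e ∧
      |(inner ℝ (P.nrm j) (P.vel a p) : ℝ)| ≤ v e ∧ |(inner ℝ (P.nrm j) (P.vel b p) : ℝ)| ≤ v e

/-- In a small time, a trajectory starting from a point which is not bad can only change of value
by crossing one face, and it starts in a thin prism over this face. -/
theorem Separates.exists_crossing {val : ι → ℝ} {α : Type} {σ : α → Set (Sp d)} {idx : α → κ}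
    {Δ v : α → ℝ} (hS : P.Separates val σ idx Δ v) (hB : P.Bounds M L) {ρ η : ℝ} (hρ : 0 < ρ)
    (hη : 0 < η) : ∃ h₀ > 0, ∀ h, 0 < h → h ≤ h₀ → ∀ δ γ, P.IsTraj h γ → γ 0 ∉ P.bad M δ ρ h →
      ∀ a b, γ 0 ∈ P.piece a → γ h ∈ P.piece b → val a ≠ val b →
      ∃ e, γ 0 ∈ P.prism (idx e) (σ e) (h * (v e + η)) ∧ |val a - val b| ≤ Δ e := by
  have hM := hB.M_pos
  have hLpos := hB.L_pos
  obtain ⟨h₀, ⟨e2, e3⟩, hh₀⟩ := (((eventually_mul_le M (show 0 < ρ / 16 by positivity)).and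
    (eventually_mul_le (L * (5 * M)) hη)).and self_mem_nhdsWithin).exists
  refine ⟨h₀, hh₀, fun h hh hhh δ γ hγ hbad a b ha hb hab => ?_⟩
  have hMh2 : M * h ≤ ρ / 16 := (mul_le_mul_of_nonneg_left hhh hM.le).trans e2
  have hLh : L * (5 * M) * h ≤ η := (mul_le_mul_of_nonneg_left hhh (by positivity)).trans e3
  have hMh0 : 0 < M * h := by positivity
  have h0 : (0 : ℝ) ∈ Icc 0 h := ⟨le_rfl, hh.le⟩
  have hh' : h ∈ Icc 0 h := ⟨hh.le, le_rfl⟩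
  set y := γ 0 with hy
  have hcl : ∀ t ∈ Icc 0 h, ‖γ t - y‖ ≤ M * h := fun t ht => hγ.norm_sub_le_mul hB h0 ht
  by_cases hj : ∃ j, |P.sd j y| ≤ 4 * M * h
  swap
  · push Not at hj
    have hball : ∀ x ∈ Metric.ball y (4 * M * h), ∀ j, x ∉ P.hyp j := by
      intro x hx j hxj
      have h1 := P.abs_sd_sub_le j y x
      rw [P.mem_hyp.1 hxj, sub_zero] at h1
      rw [mem_ball_iff_norm, norm_sub_rev] at hx
      linarith [hj j]
    have hsub : Metric.ball y (4 * M * h) ⊆ P.piece a :=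
      subset_piece_of_inter (convex_ball _ _).isPreconnected
        ⟨y, Metric.mem_ball_self (by positivity), ha⟩ hball
    have : γ h ∈ P.piece a := hsub (by rw [mem_ball_iff_norm]; linarith [hcl h hh'])
    exact absurd (congrArg val (piece_unique this hb)) hab
  obtain ⟨j, hj⟩ := hj
  obtain ⟨hp, hpd⟩ := P.foot_mem_hyp j y
  set p := y - P.sd j y • P.nrm j with hpdef
  have hyp : ‖y - p‖ ≤ 4 * (M * h) := by rw [hpd]; linarith
  have hiso : ∀ x ∈ Metric.ball p (ρ / 2), ∀ k, x ∈ P.hyp k → x ∈ P.hyp j := by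
    intro x hx k hxk
    refine isolated_of_notMem_bad (hγ.2.1 0 h0) hbad hj ?_ hxk
    have h1 := norm_sub_le_of_mem_ball hx
    have h3 := norm_add_le (y - p) (p - x)
    rw [sub_add_sub_cancel, norm_sub_rev p x] at h3
    change ‖y - x‖ ≤ ρ
    linarith
  have hclp : ∀ t ∈ Icc 0 h, ‖γ t - p‖ ≤ 5 * (M * h) := by
    intro t ht
    have h3 := norm_add_le (γ t - y) (y - p)
    rw [sub_add_sub_cancel] at h3
    linarith [hcl t ht]
  have hin : ∀ t ∈ Icc 0 h, γ t ∈ Metric.ball p (ρ / 2) := by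
    intro t ht
    rw [mem_ball_iff_norm]
    linarith [hclp t ht]
  rcases local_structure hiso with hone | ⟨a', b', hlow, hhigh, hpc⟩
  · exact absurd (congrArg val (hone a b _ (hin 0 h0) _ (hin h hh') ha hb)) hab
  -- the two endpoints are on both sides of the hyperplane
  have hside : ((a = a' ∧ b = b') ∨ (a = b' ∧ b = a')) ∧
      |P.sd j y| ≤ |P.sd j (γ h) - P.sd j y| := by
    rcases hpc a y (hin 0 h0) ha with ⟨h1, h2⟩ | ⟨h1, h2⟩ <;>
    rcases hpc b (γ h) (hin h hh') hb with ⟨h3, h4⟩ | ⟨h3, h4⟩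
    · exact absurd (by rw [h1, h3]) hab
    · refine ⟨Or.inl ⟨h1, h3⟩, ?_⟩
      have h5 : P.sd j y < 0 := sub_neg.2 h2
      have h6 : 0 < P.sd j (γ h) := sub_pos.2 h4
      rw [abs_of_neg h5, abs_of_pos (by linarith)]
      linarith
    · refine ⟨Or.inr ⟨h1, h3⟩, ?_⟩
      have h5 : 0 < P.sd j y := sub_pos.2 h2
      have h6 : P.sd j (γ h) < 0 := sub_neg.2 h4
      rw [abs_of_pos h5, abs_of_neg (by linarith)]
      linarith
    · exact absurd (by rw [h1, h3]) hab
  have hab' : val a' ≠ val b' := by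
    rcases hside.1 with ⟨rfl, rfl⟩ | ⟨rfl, rfl⟩
    · exact hab
    · exact hab.symm
  obtain ⟨e, he, hpe, hΔ, hva, hvb⟩ := hS.exists_face j a' b' p (ρ / 2) (half_pos hρ) hp hiso
    hlow hhigh hab'
  refine ⟨e, ?_, ?_⟩
  swap
  · rcases hside.1 with ⟨rfl, rfl⟩ | ⟨rfl, rfl⟩
    · exact hΔ
    · rw [abs_sub_comm]; exact hΔ
  rw [← prism_congr he]
  -- The foot of y on the hyperplane is p, which lies on the face. As the endpoints are on opposite
  -- sides, the distance of y to the hyperplane is at most the normal displacement during the time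
  -- h.
  refine ⟨hside.2.trans ?_, hpe⟩
  obtain ⟨hcont, -, N, hN, hd⟩ := hγ
  have key := norm_sub_le_of_hasDerivAt_off_countable (u := fun t => P.sd j (γ t))
    (C := v e + η) hh.le ((continuousOn_const.inner hcont).sub continuousOn_const) hN (by
      intro τ hτ
      have hτI := Ioo_subset_Icc_self hτ.1
      obtain ⟨k, hk, hk'⟩ := hd τ hτ
      refine ⟨inner ℝ (P.nrm j) (P.vel k (γ τ)), ?_, ?_⟩
      · exact ((innerSL ℝ (P.nrm j)).hasFDerivAt.comp_hasDerivAt τ hk').sub_const _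
      · have h1 : |(inner ℝ (P.nrm j) (P.vel k p) : ℝ)| ≤ v e := by
          rcases hpc k _ (hin τ hτI) hk with ⟨rfl, -⟩ | ⟨rfl, -⟩
          · exact hva
          · exact hvb
        have h2 := abs_inner_sub_le (P.norm_nrm j) (P.vel k (γ τ)) (P.vel k p)
        have h3 := hB.vel_lip k (γ τ) p
        have h4 := mul_le_mul_of_nonneg_left (hclp τ hτI) hLpos.le
        have h5 := abs_sub_abs_le_abs_sub (inner ℝ (P.nrm j) (P.vel k (γ τ)) : ℝ)
          (inner ℝ (P.nrm j) (P.vel k p))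
        rw [Real.norm_eq_abs]
        linarith)
  rw [Real.norm_eq_abs, sub_zero] at key
  linarith

end PiecewiseField

end EllamFlow

/-! ### The translation estimate for piecewise fields -/

namespace EllamFlow

namespace PiecewiseField

variable {d : ℕ} {ι κ : Type} {P : PiecewiseField d ι κ} {M L : ℝ}

/-- The points outside of the pieces form a negligible set. -/
theorem volume_dom_diff_pieces [Countable κ] (P : PiecewiseField d ι κ) :
    volume (P.dom \ ⋃ i, P.piece i) = 0 := by
  refine measure_mono_null (t := ⋃ j, hyperplane (P.nrm j) (P.lev j)) (fun x hx => ?_)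
    (measure_iUnion_null fun j => volume_hyperplane (P.norm_nrm j) _)
  exact (P.dom_subset hx.1).resolve_left hx.2

theorem volume_reach_le_of_le [Fintype ι] [Fintype κ] {s t c : ℝ} (ht : 0 ≤ t) (hts : t ≤ s)
    (hc : P.up / P.lo * Real.exp (P.Γ / P.lo * s) ≤ c) {A : Set (Sp d)} (hA : A ⊆ P.dom) :
    volume (P.reach t A) ≤ ENNReal.ofReal c * volume A := by
  have hΓ := P.Γ_nonneg
  have hlo := P.lo_pos
  have hup := P.up_pos
  refine (volume_reach_le ht hA).trans ?_
  gcongr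
  refine le_trans ?_ hc
  gcongr

variable [Fintype ι] [Fintype κ]

/-- Telescoping over n steps of length h = s/n. At step j the value changes by at most Δ e on the
points whose position at time jh is in the prism over the face e, and by at most S on those whose
position is bad. By compression these sets have measure at most 2ch(v e + η)m e and cηh/S, and nh =
s. -/
theorem Separates.lintegral_translation_le_add {val : ι → ℝ} {α : Type} [Fintype α]
    {σ : α → Set (Sp d)} {idx : α → κ} {Δ v m : α → ℝ} (hS : P.Separates val σ idx Δ v)
    (hm : ∀ e, 0 ≤ m e)
    (hprism : ∀ e a, 0 ≤ a → volume (P.prism (idx e) (σ e) a) ≤ ENNReal.ofReal (2 * a * m e))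
    {s c : ℝ} (hs : 0 < s) (hc : P.up / P.lo * Real.exp (P.Γ / P.lo * s) ≤ c)
    {F : ℝ → Sp d → Sp d} (hF : ∀ᵐ x ∂(volume.restrict P.dom), F 0 x = x ∧ P.IsTraj s fun t => F t x)
    {f : Sp d → ℝ} (hf : ∀ i, ∀ x ∈ P.piece i, f x = val i) {η : ℝ} (hη : 0 < η) :
    ∫⁻ x in P.dom, ENNReal.ofReal |f (F s x) - f x| ≤
      ENNReal.ofReal (c * s * (∑ e, 2 * Δ e * (v e + η) * m e + η)) := by
  obtain ⟨M, L, hB⟩ := P.exists_bounds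
  have hlo := P.lo_pos
  have hup := P.up_pos
  have hc0 : 0 < c := lt_of_lt_of_le (by positivity) hc
  -- A bound for every jump, for use at bad points, where no crossed face is identified. The summand
  -- 1 makes it positive.
  set S : ℝ := 1 + ∑ i, ∑ k, |val i - val k| with hSdef
  have hS1 : 0 < S := by positivity
  have hSle : ∀ i k, |val i - val k| ≤ S := by
    intro i k
    have h1 := Finset.single_le_sum (f := fun k => |val i - val k|) (fun _ _ => abs_nonneg _)
      (Finset.mem_univ k)
    have h2 := Finset.single_le_sum (f := fun i => ∑ k, |val i - val k|)
      (fun _ _ => Finset.sum_nonneg fun _ _ => abs_nonneg _) (Finset.mem_univ i)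
    linarith
  clear_value S
  obtain ⟨δ, hδ, ρ, hρ, h₁, hh₁, hbad⟩ := P.exists_volume_bad_le hB.M_pos
    (show 0 < η / S by positivity)
  obtain ⟨h₂, hh₂, hcross⟩ := hS.exists_crossing hB hρ hη
  obtain ⟨n, hn⟩ := exists_nat_gt (s / min h₁ h₂)
  have hmin : 0 < min h₁ h₂ := lt_min hh₁ hh₂
  have hn0 : (0 : ℝ) < n := lt_trans (by positivity) hn
  set h := s / n with hh
  have hhpos : 0 < h := by positivity
  have hnh : (n : ℝ) * h = s := by rw [hh]; field_simp
  have hle : h ≤ min h₁ h₂ := by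
    rw [hh, div_le_iff₀ hn0]
    rw [div_lt_iff₀ hmin] at hn
    linarith
  have hjs : ∀ j : ℕ, j ≤ n → (j : ℝ) * h ≤ s := by
    intro j hj
    rw [← hnh]
    exact mul_le_mul_of_nonneg_right (by exact_mod_cast hj) hhpos.le
  set A : α → Set (Sp d) := fun e => P.dom ∩ P.prism (idx e) (σ e) (h * (v e + η)) with hA
  -- The sets `reach` need not be measurable; measurable hulls of the same measure allow the
  -- indicators to be integrated.
  set E : ℕ → α → Set (Sp d) := fun j e => toMeasurable volume (P.reach (j * h) (A e)) with hE
  set B : ℕ → Set (Sp d) := fun j => toMeasurable volume (P.reach (j * h) (P.bad M δ ρ h)) with hBd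
  set g : ℕ → Sp d → ENNReal := fun j x =>
    ∑ e, (E j e).indicator (fun _ => ENNReal.ofReal (Δ e)) x +
      (B j).indicator (fun _ => ENNReal.ofReal S) x with hg
  have hbd : P.bad M δ ρ h ⊆ P.dom := fun y hy => hy.1
  -- the points whose trajectory stays in the pieces at the discrete times
  have hgood : ∀ᵐ x ∂(volume.restrict P.dom), ∀ j : ℕ, j ≤ n → F (j * h) x ∈ ⋃ i, P.piece i := by
    have hnull : ∀ j : ℕ, j ≤ n → volume (P.reach (j * h) (P.dom \ ⋃ i, P.piece i)) = 0 := by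
      intro j hj
      have := volume_reach_le_of_le (P := P) (by positivity) (hjs j hj) hc
        (A := P.dom \ ⋃ i, P.piece i) sdiff_subset
      rw [volume_dom_diff_pieces, mul_zero] at this
      exact le_antisymm this bot_le
    rw [ae_all_iff]
    intro j
    by_cases hj : j ≤ n
    swap
    · exact ae_of_all _ fun x h => absurd h hj
    have h1 : ∀ᵐ x ∂(volume.restrict P.dom), x ∉ P.reach (j * h) (P.dom \ ⋃ i, P.piece i) :=
      ae_restrict_of_ae (measure_eq_zero_iff_ae_notMem.1 (hnull j hj))
    filter_upwards [h1, hF] with x hx hxF _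
    by_contra hcon
    have hmem : (j : ℝ) * h ∈ Icc 0 s := ⟨by positivity, hjs j hj⟩
    refine hx ⟨fun t => F t x, ?_, hxF.1, hxF.2.2.1 _ hmem, hcon⟩
    have := hxF.2.shift le_rfl (b := j * h) (by linarith [hjs j hj])
    simpa using this
  have hpt : ∀ᵐ x ∂(volume.restrict P.dom),
      ENNReal.ofReal |f (F s x) - f x| ≤ ∑ j ∈ Finset.range n, g j x := by
    filter_upwards [hgood, hF] with x hx hxF
    have hstep : ∀ j : ℕ, j < n →
        ENNReal.ofReal |f (F ((j + 1 : ℕ) * h) x) - f (F (j * h) x)| ≤ g j x := by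
      intro j hj
      obtain ⟨a, ha⟩ := mem_iUnion.1 (hx j hj.le)
      obtain ⟨b, hb⟩ := mem_iUnion.1 (hx (j + 1) hj)
      rw [hf a _ ha, hf b _ hb, abs_sub_comm]
      by_cases hab : val a = val b
      · simp [hab]
      have hjn := hjs (j + 1) hj
      push_cast at hjn
      have hsh := hxF.2.shift (a := j * h) (b := h) (by positivity) (by linarith)
      have hfirst : P.IsTraj (j * h) fun t => F t x := by
        have := hxF.2.shift le_rfl (b := j * h) (by linarith)
        simpa using this
      by_cases hb' : F (j * h) x ∈ P.bad M δ ρ h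
      · have hxB : x ∈ B j := subset_toMeasurable _ _ ⟨_, hfirst, hxF.1, hb'⟩
        refine le_trans ?_ le_add_self
        rw [indicator_of_mem hxB]
        exact ENNReal.ofReal_le_ofReal (hSle a b)
      · obtain ⟨e, he, hΔ⟩ := hcross h hhpos (hle.trans (min_le_right _ _)) δ _ hsh
          (by simpa using hb') a b (by simpa using ha)
          (by convert hb using 2; push_cast; ring) hab
        simp only [add_zero] at he
        have hxE : x ∈ E j e := subset_toMeasurable _ _ ⟨_, hfirst, hxF.1, P.piece_subset a ha, he⟩
        refine le_trans ?_ le_self_add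
        refine le_trans ?_ (Finset.single_le_sum (f := fun e =>
          (E j e).indicator (fun _ => ENNReal.ofReal (Δ e)) x) (fun _ _ => bot_le)
          (Finset.mem_univ e))
        rw [indicator_of_mem hxE]
        exact ENNReal.ofReal_le_ofReal hΔ
    have hind : ∀ j : ℕ, j ≤ n →
        ENNReal.ofReal |f (F (j * h) x) - f x| ≤ ∑ i ∈ Finset.range j, g i x := by
      intro j
      induction j with
      | zero => intro _; simp [hxF.1]
      | succ j ih =>
        intro hj
        rw [Finset.sum_range_succ]
        refine le_trans ?_ (add_le_add (ih (by omega)) (hstep j hj))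
        rw [← ENNReal.ofReal_add (abs_nonneg _) (abs_nonneg _)]
        exact ENNReal.ofReal_le_ofReal ((abs_sub_le _ _ _).trans_eq (add_comm _ _))
    have := hind n le_rfl
    rwa [hnh] at this
  have hEm : ∀ j e, MeasurableSet (E j e) := fun j e => measurableSet_toMeasurable _ _
  have hBm : ∀ j, MeasurableSet (B j) := fun j => measurableSet_toMeasurable _ _
  have hgint : ∀ j ∈ Finset.range n, ∫⁻ x in P.dom, g j x ≤
      ENNReal.ofReal (c * h * (∑ e, 2 * Δ e * (v e + η) * m e + η)) := by
    intro j hj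
    have hjn := hjs j (Finset.mem_range.1 hj).le
    have hvE : ∀ e, volume (E j e) ≤ ENNReal.ofReal (c * (2 * (h * (v e + η)) * m e)) := by
      intro e
      rw [measure_toMeasurable, ENNReal.ofReal_mul hc0.le]
      refine (volume_reach_le_of_le (by positivity) hjn hc inter_subset_left).trans ?_
      refine mul_le_mul' le_rfl ((measure_mono inter_subset_right).trans (hprism e _ ?_))
      have := hS.speed_nonneg e
      positivity
    have hvB : volume (B j) ≤ ENNReal.ofReal (c * (η / S * h)) := by
      rw [measure_toMeasurable, ENNReal.ofReal_mul hc0.le]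
      exact (volume_reach_le_of_le (by positivity) hjn hc hbd).trans
        (mul_le_mul' le_rfl (hbad h hhpos (hle.trans (min_le_left _ _))))
    calc ∫⁻ x in P.dom, g j x ≤ ∫⁻ x, g j x := setLIntegral_le_lintegral _ _
      _ = ∑ e, ENNReal.ofReal (Δ e) * volume (E j e) + ENNReal.ofReal S * volume (B j) := by
          rw [hg]
          simp only
          rw [lintegral_add_right _ (measurable_const.indicator (hBm j)),
            lintegral_finsetSum _ fun e _ => measurable_const.indicator (hEm j e)]
          simp only [lintegral_indicator_const (hEm j _), lintegral_indicator_const (hBm j)]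
      _ ≤ ∑ e, ENNReal.ofReal (Δ e) * ENNReal.ofReal (c * (2 * (h * (v e + η)) * m e)) +
          ENNReal.ofReal S * ENNReal.ofReal (c * (η / S * h)) := by
          gcongr with e
          exact hvE e
      _ = ENNReal.ofReal (∑ e, Δ e * (c * (2 * (h * (v e + η)) * m e)) +
          S * (c * (η / S * h))) := by
          rw [ENNReal.ofReal_add _ (by positivity), ENNReal.ofReal_sum_of_nonneg,
            ENNReal.ofReal_mul hS1.le]
          · congr 1
            exact Finset.sum_congr rfl fun e _ => (ENNReal.ofReal_mul (hS.jump_nonneg e)).symm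
          all_goals
            first
            | refine Finset.sum_nonneg fun e _ => ?_
            | intro e _
            have := hS.jump_nonneg e
            have := hS.speed_nonneg e
            have := hm e
            positivity
      _ = _ := by
          congr 1
          have e1 : S * (c * (η / S * h)) = c * h * η := by field_simp
          rw [e1, mul_add, Finset.mul_sum]
          congr 1
          exact Finset.sum_congr rfl fun e _ => by ring
  calc ∫⁻ x in P.dom, ENNReal.ofReal |f (F s x) - f x|
      ≤ ∫⁻ x in P.dom, ∑ j ∈ Finset.range n, g j x := lintegral_mono_ae hpt
    _ = ∑ j ∈ Finset.range n, ∫⁻ x in P.dom, g j x := by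
        refine lintegral_finsetSum _ fun j _ => ?_
        exact (Finset.measurable_fun_sum _ fun e _ => measurable_const.indicator (hEm j e)).add
          (measurable_const.indicator (hBm j))
    _ ≤ ∑ j ∈ Finset.range n,
        ENNReal.ofReal (c * h * (∑ e, 2 * Δ e * (v e + η) * m e + η)) := Finset.sum_le_sum hgint
    _ = _ := by
        rw [Finset.sum_const, Finset.card_range, nsmul_eq_mul, ← ENNReal.ofReal_natCast,
          ← ENNReal.ofReal_mul hn0.le]
        congr 1
        rw [← hnh]; ring

theorem Separates.lintegral_translation_le {val : ι → ℝ} {α : Type} [Fintype α]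
    {σ : α → Set (Sp d)} {idx : α → κ} {Δ v m : α → ℝ} (hS : P.Separates val σ idx Δ v)
    (hm : ∀ e, 0 ≤ m e)
    (hprism : ∀ e a, 0 ≤ a → volume (P.prism (idx e) (σ e) a) ≤ ENNReal.ofReal (2 * a * m e))
    {s c : ℝ} (hs : 0 ≤ s) (hc : P.up / P.lo * Real.exp (P.Γ / P.lo * s) ≤ c)
    {F : ℝ → Sp d → Sp d} (hF : ∀ᵐ x ∂(volume.restrict P.dom), F 0 x = x ∧ P.IsTraj s fun t => F t x)
    {f : Sp d → ℝ} (hf : ∀ i, ∀ x ∈ P.piece i, f x = val i) :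
    ∫⁻ x in P.dom, ENNReal.ofReal |f (F s x) - f x| ≤
      ENNReal.ofReal (c * s * ∑ e, 2 * Δ e * v e * m e) := by
  rcases hs.eq_or_lt with rfl | hs
  · have : ∫⁻ x in P.dom, ENNReal.ofReal |f (F 0 x) - f x| = ∫⁻ x in P.dom, 0 :=
      lintegral_congr_ae (hF.mono fun x hx => by simp [hx.1])
    rw [this]; simp
  have hlim : Tendsto (fun η : ℝ => ENNReal.ofReal
      (c * s * (∑ e, 2 * Δ e * (v e + η) * m e + η))) (𝓝[>] 0)
      (𝓝 (ENNReal.ofReal (c * s * (∑ e, 2 * Δ e * (v e + 0) * m e + 0)))) := by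
    refine Tendsto.mono_left ?_ nhdsWithin_le_nhds
    exact (ENNReal.continuous_ofReal.comp (by fun_prop)).tendsto 0
  simp only [add_zero] at hlim
  exact ge_of_tendsto hlim (eventually_nhdsWithin_of_forall fun η hη =>
    hS.lintegral_translation_le_add hm hprism hs hc hF hf hη)

end PiecewiseField

end EllamFlow

/-! ### Cones over polytopal faces -/

namespace EllamFlow

section Cone

variable {d : ℕ} {n x₀ : Sp d} {c : ℝ} {σ : Set (Sp d)}

theorem isClosed_hyperplane (n : Sp d) (c : ℝ) : IsClosed (hyperplane n c) :=
  isClosed_eq (continuous_const.inner continuous_id) continuous_const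

/-- The open cone with vertex `x₀` and base `σ`. -/
def openCone (x₀ : Sp d) (σ : Set (Sp d)) : Set (Sp d) := ⋃ y ∈ σ, openSegment ℝ x₀ y

/-- The parameter of a point on the ray from `x₀`, equal to `1` on the hyperplane. -/
def coneParam (n : Sp d) (c : ℝ) (x₀ x : Sp d) : ℝ :=
  (inner ℝ n x - inner ℝ n x₀) / (c - inner ℝ n x₀)

/-- The central projection from `x₀` to the hyperplane. -/
def coneFoot (n : Sp d) (c : ℝ) (x₀ x : Sp d) : Sp d := x₀ + (coneParam n c x₀ x)⁻¹ • (x - x₀)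

theorem continuous_coneParam : Continuous (coneParam n c x₀) :=
  ((continuous_const.inner continuous_id).sub continuous_const).div_const _

theorem continuousAt_coneFoot {x : Sp d} (hx : coneParam n c x₀ x ≠ 0) :
    ContinuousAt (coneFoot n c x₀) x :=
  continuousAt_const.add ((continuous_coneParam.continuousAt.inv₀ hx).smul
    (continuousAt_id.sub continuousAt_const))

theorem coneParam_add_smul (hx₀ : inner ℝ n x₀ ≠ c) {y : Sp d} (hy : y ∈ hyperplane n c) (t : ℝ) :
    coneParam n c x₀ (x₀ + t • (y - x₀)) = t := by
  have hy' : inner ℝ n y = c := hy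
  have h : c - inner ℝ n x₀ ≠ 0 := sub_ne_zero.2 hx₀.symm
  rw [coneParam, inner_add_right, inner_smul_right, inner_sub_right, hy', add_sub_cancel_left,
    mul_div_cancel_right₀ _ h]

theorem coneFoot_add_smul (hx₀ : inner ℝ n x₀ ≠ c) {y : Sp d} (hy : y ∈ hyperplane n c) {t : ℝ}
    (ht : t ≠ 0) : coneFoot n c x₀ (x₀ + t • (y - x₀)) = y := by
  rw [coneFoot, coneParam_add_smul hx₀ hy, add_sub_cancel_left, smul_smul, inv_mul_cancel₀ ht,
    one_smul, add_sub_cancel]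

theorem eq_add_smul_coneFoot {x : Sp d} (hx : coneParam n c x₀ x ≠ 0) :
    x = x₀ + coneParam n c x₀ x • (coneFoot n c x₀ x - x₀) := by
  rw [coneFoot, add_sub_cancel_left, smul_smul, mul_inv_cancel₀ hx, one_smul, add_sub_cancel]

theorem coneFoot_mem (hx₀ : inner ℝ n x₀ ≠ c) {x : Sp d} (hx : coneParam n c x₀ x ≠ 0) :
    coneFoot n c x₀ x ∈ hyperplane n c := by
  have h : c - inner ℝ n x₀ ≠ 0 := sub_ne_zero.2 hx₀.symm
  have h1 : (inner ℝ n x : ℝ) - inner ℝ n x₀ = coneParam n c x₀ x * (c - inner ℝ n x₀) := by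
    rw [coneParam, div_mul_cancel₀ _ h]
  change inner ℝ n (coneFoot n c x₀ x) = c
  rw [coneFoot, inner_add_right, inner_smul_right, inner_sub_right, h1, ← mul_assoc,
    inv_mul_cancel₀ hx]
  ring

theorem mem_openCone : ∀ {x : Sp d}, x ∈ openCone x₀ σ ↔
    ∃ y ∈ σ, ∃ t : ℝ, 0 < t ∧ t < 1 ∧ x = x₀ + t • (y - x₀) := by
  intro x
  simp only [openCone, mem_iUnion, openSegment_eq_image', mem_image, mem_Ioo, exists_prop]
  constructor
  · rintro ⟨y, hy, t, ⟨h0, h1⟩, rfl⟩; exact ⟨y, hy, t, h0, h1, rfl⟩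
  · rintro ⟨y, hy, t, h0, h1, rfl⟩; exact ⟨y, hy, t, ⟨h0, h1⟩, rfl⟩

theorem mem_openCone_iff (hx₀ : inner ℝ n x₀ ≠ c) (hσ : σ ⊆ hyperplane n c) {x : Sp d} :
    x ∈ openCone x₀ σ ↔
      0 < coneParam n c x₀ x ∧ coneParam n c x₀ x < 1 ∧ coneFoot n c x₀ x ∈ σ := by
  rw [mem_openCone]
  constructor
  · rintro ⟨y, hy, t, h0, h1, rfl⟩
    rw [coneParam_add_smul hx₀ (hσ hy), coneFoot_add_smul hx₀ (hσ hy) h0.ne']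
    exact ⟨h0, h1, hy⟩
  · rintro ⟨h0, h1, h2⟩
    exact ⟨_, h2, _, h0, h1, eq_add_smul_coneFoot h0.ne'⟩

theorem eventually_coneFoot_mem (hx₀ : inner ℝ n x₀ ≠ c)
    (hopen : ∀ x ∈ σ, σ ∈ 𝓝[hyperplane n c] x) {x : Sp d} (hx : coneParam n c x₀ x ≠ 0)
    (hxσ : coneFoot n c x₀ x ∈ σ) : ∀ᶠ z in 𝓝 x, coneFoot n c x₀ z ∈ σ := by
  have h1 : Tendsto (coneFoot n c x₀) (𝓝 x) (𝓝[hyperplane n c] (coneFoot n c x₀ x)) := by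
    refine tendsto_nhdsWithin_iff.2 ⟨continuousAt_coneFoot hx, ?_⟩
    filter_upwards [continuous_coneParam.continuousAt.eventually_ne hx] with z hz
    exact coneFoot_mem hx₀ hz
  exact h1.eventually (hopen _ hxσ)

theorem isOpen_openCone (hx₀ : inner ℝ n x₀ ≠ c) (hσ : σ ⊆ hyperplane n c)
    (hopen : ∀ x ∈ σ, σ ∈ 𝓝[hyperplane n c] x) : IsOpen (openCone x₀ σ) := by
  rw [isOpen_iff_mem_nhds]
  intro x hx
  obtain ⟨h0, h1, h2⟩ := (mem_openCone_iff hx₀ hσ).1 hx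
  filter_upwards [continuous_coneParam.continuousAt.eventually (lt_mem_nhds h0),
    continuous_coneParam.continuousAt.eventually (gt_mem_nhds h1),
    eventually_coneFoot_mem hx₀ hopen h0.ne' h2] with z hz0 hz1 hz2
  exact (mem_openCone_iff hx₀ hσ).2 ⟨hz0, hz1, hz2⟩

/-- At parameter 1 the point is on the hyperplane of the base, at parameter 0 on the parallel
hyperplane through the vertex, and in between its foot is on the relative boundary of the base. The
second case is a crude enlargement of the vertex, sufficient for covering the frontier by
hyperplanes. -/
theorem mem_frontier_openCone (hx₀ : inner ℝ n x₀ ≠ c) (hσ : σ ⊆ hyperplane n c)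
    (hopen : ∀ x ∈ σ, σ ∈ 𝓝[hyperplane n c] x) {x : Sp d} (hx : x ∈ frontier (openCone x₀ σ)) :
    x ∈ hyperplane n c ∨ x ∈ hyperplane n (inner ℝ n x₀) ∨
      ∃ y ∈ closure σ \ σ, ∃ t : ℝ, x = x₀ + t • (y - x₀) := by
  have h : c - inner ℝ n x₀ ≠ 0 := sub_ne_zero.2 hx₀.symm
  rw [(isOpen_openCone hx₀ hσ hopen).frontier_eq] at hx
  have hcl : coneParam n c x₀ x ∈ Icc (0 : ℝ) 1 := by
    have : openCone x₀ σ ⊆ coneParam n c x₀ ⁻¹' Icc 0 1 := fun z hz => by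
      obtain ⟨h0, h1, -⟩ := (mem_openCone_iff hx₀ hσ).1 hz
      exact ⟨h0.le, h1.le⟩
    exact closure_minimal this (isClosed_Icc.preimage continuous_coneParam) hx.1
  rcases hcl.1.eq_or_lt with h0 | h0
  · right; left
    rw [eq_comm, coneParam, div_eq_zero_iff, or_iff_left h, sub_eq_zero] at h0
    exact h0
  rcases hcl.2.eq_or_lt with h1 | h1
  · left
    rw [coneParam, div_eq_one_iff_eq h] at h1
    exact sub_left_injective h1
  right; right
  refine ⟨coneFoot n c x₀ x, ⟨?_, fun hf => hx.2 ((mem_openCone_iff hx₀ hσ).2 ⟨h0, h1, hf⟩)⟩,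
    _, eq_add_smul_coneFoot h0.ne'⟩
  have : Tendsto (coneFoot n c x₀) (𝓝[openCone x₀ σ] x) (𝓝 (coneFoot n c x₀ x)) :=
    (continuousAt_coneFoot h0.ne').tendsto.mono_left nhdsWithin_le_nhds
  have hne : (𝓝[openCone x₀ σ] x).NeBot := mem_closure_iff_nhdsWithin_neBot.1 hx.1
  exact mem_closure_of_tendsto this (eventually_nhdsWithin_of_forall fun z hz =>
    ((mem_openCone_iff hx₀ hσ).1 hz).2.2)

/-- Near a point of the base, the cone is a half-ball. -/
theorem exists_half_ball_subset_openCone (hx₀ : inner ℝ n x₀ ≠ c) (hσ : σ ⊆ hyperplane n c)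
    (hopen : ∀ x ∈ σ, σ ∈ 𝓝[hyperplane n c] x) {p : Sp d} (hp : p ∈ σ) :
    ∃ r > 0, ∀ x ∈ Metric.ball p r,
      0 < ((inner ℝ n x : ℝ) - c) * (inner ℝ n x₀ - c) → x ∈ openCone x₀ σ := by
  have h : c - inner ℝ n x₀ ≠ 0 := sub_ne_zero.2 hx₀.symm
  have e1 : p = x₀ + (1 : ℝ) • (p - x₀) := by rw [one_smul, add_sub_cancel]
  have hp1 : coneParam n c x₀ p = 1 := by
    have := coneParam_add_smul hx₀ (hσ hp) 1
    rwa [← e1] at this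
  have hpf : coneFoot n c x₀ p = p := by
    have := coneFoot_add_smul hx₀ (hσ hp) one_ne_zero
    rwa [← e1] at this
  have hev : ∀ᶠ x in 𝓝 p, 0 < coneParam n c x₀ x ∧ coneFoot n c x₀ x ∈ σ :=
    (continuous_coneParam.continuousAt.eventually (lt_mem_nhds (by rw [hp1]; exact one_pos))).and
      (eventually_coneFoot_mem hx₀ hopen (by rw [hp1]; exact one_ne_zero) (by rwa [hpf]))
  obtain ⟨r, hr, hr'⟩ := Metric.eventually_nhds_iff_ball.1 hev
  refine ⟨r, hr, fun x hx hpos => (mem_openCone_iff hx₀ hσ).2 ⟨(hr' x hx).1, ?_, (hr' x hx).2⟩⟩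
  have h1 : 1 - coneParam n c x₀ x =
      (((inner ℝ n x : ℝ) - c) * (inner ℝ n x₀ - c)) / (c - inner ℝ n x₀) ^ 2 := by
    rw [coneParam]; field_simp; ring
  have : 0 < 1 - coneParam n c x₀ x := by rw [h1]; positivity
  linarith

end Cone

section Face

variable {d : ℕ}

theorem exists_unit_normal (s : Finset (Sp d)) (hs : s.card < d) :
    ∃ m : Sp d, ‖m‖ = 1 ∧ ∀ z ∈ s, inner ℝ m z = (0 : ℝ) := by
  set W := Submodule.span ℝ (s : Set (Sp d)) with hW
  have hW1 : Module.finrank ℝ W < d := (finrank_span_finset_le_card _).trans_lt hs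
  have hW2 : Wᗮ ≠ ⊥ := by
    rw [Ne, Submodule.orthogonal_eq_bot_iff]
    intro h
    rw [h, finrank_top, finrank_euclideanSpace_fin] at hW1
    exact lt_irrefl _ hW1
  obtain ⟨m, hm, hm0⟩ := Submodule.exists_mem_ne_zero_of_ne_bot hW2
  refine ⟨‖m‖⁻¹ • m, ?_, fun z hz => ?_⟩
  · rw [norm_smul, norm_inv, norm_norm, inv_mul_cancel₀ (norm_ne_zero_iff.2 hm0)]
  · have hzW : z ∈ W := Submodule.subset_span hz
    rw [inner_smul_left, Submodule.inner_left_of_mem_orthogonal hzW hm, mul_zero]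

theorem exists_hyperplane_through (x₀ : Sp d) (t : Finset (Sp d)) (ht : t.card < d) :
    ∃ q : Sp d × ℝ, ‖q.1‖ = 1 ∧ inner ℝ q.1 x₀ = q.2 ∧ ∀ z ∈ t, inner ℝ q.1 z = q.2 := by
  classical
  obtain ⟨m, hm, hm'⟩ := exists_unit_normal (t.image fun z => z - x₀)
    (Finset.card_image_le.trans_lt ht)
  refine ⟨(m, inner ℝ m x₀), hm, rfl, fun z hz => ?_⟩
  have h1 := hm' (z - x₀) (Finset.mem_image_of_mem _ hz)
  rw [inner_sub_right, sub_eq_zero] at h1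
  exact h1

/-- Since the hyperplane misses x₀, the vectors z i − x₀ form a basis. Positivity of all coordinates
of u − x₀ is an open condition, and on the hyperplane these coordinates sum to 1, so nearby points
are convex combinations of the z i. -/
theorem mem_nhdsWithin_convexHull {n x₀ y : Sp d} {c : ℝ} (hx₀ : inner ℝ n x₀ ≠ c) {ι : Type*}
    [Fintype ι] {z : ι → Sp d} {w : ι → ℝ} (hz : ∀ i, z i ∈ hyperplane n c)
    (hind : AffineIndependent ℝ z) (hcard : d ≤ Fintype.card ι) (hw : ∀ i, 0 < w i)
    (hw1 : ∑ i, w i = 1) (hwy : ∑ i, w i • z i = y) :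
    convexHull ℝ (range z) ∈ 𝓝[hyperplane n c] y := by
  classical
  have h : c - inner ℝ n x₀ ≠ 0 := sub_ne_zero.2 hx₀.symm
  have hinner : ∀ i, (inner ℝ n (z i - x₀) : ℝ) = c - inner ℝ n x₀ := fun i => by
    rw [inner_sub_right, show inner ℝ n (z i) = c from hz i]
  have hlin : LinearIndependent ℝ fun i => z i - x₀ := by
    rw [Fintype.linearIndependent_iff]
    intro a ha
    have h1 : ∑ i, a i = 0 := by
      have := congrArg (fun u => (inner ℝ n u : ℝ)) ha
      simp only [inner_sum, inner_smul_right, hinner, inner_zero_right, ← Finset.sum_mul] at this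
      exact (mul_eq_zero.1 this).resolve_right h
    have h2 : ∑ i, a i • z i = 0 := by
      simp only [smul_sub, Finset.sum_sub_distrib, ← Finset.sum_smul, h1, zero_smul, sub_zero] at ha
      exact ha
    exact fun i => affineIndependent_iff.1 hind Finset.univ a h1 h2 i (Finset.mem_univ i)
  have hcard' : Fintype.card ι = Module.finrank ℝ (Sp d) := by
    refine le_antisymm hlin.fintype_card_le_finrank ?_
    rwa [finrank_euclideanSpace_fin]
  rcases isEmpty_or_nonempty ι with hι | hι
  · simp at hw1
  let b := basisOfLinearIndependentOfCardEqFinrank hlin hcard'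
  have hb : ∀ i, b i = z i - x₀ := fun i => by simp [b]
  have hyb : y - x₀ = ∑ i, w i • b i := by
    simp only [hb, smul_sub, Finset.sum_sub_distrib, ← Finset.sum_smul, hw1, one_smul, hwy]
  have hev : ∀ᶠ u in 𝓝 y, ∀ i, 0 < b.repr (u - x₀) i := by
    rw [eventually_all]
    intro i
    have hc : Continuous fun u : Sp d => b.repr (u - x₀) i :=
      (LinearMap.continuous_of_finiteDimensional (b.coord i)).comp (continuous_id.sub continuous_const)
    refine hc.continuousAt.eventually (lt_mem_nhds ?_)
    simp only [hyb, b.repr_sum_self]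
    exact hw i
  filter_upwards [mem_nhdsWithin_of_mem_nhds hev, self_mem_nhdsWithin] with u hu huH
  have hu1 := b.sum_repr (u - x₀)
  simp only [hb] at hu1
  have hsum : ∑ i, b.repr (u - x₀) i = 1 := by
    have := congrArg (fun u => (inner ℝ n u : ℝ)) hu1
    simp only [inner_sum, inner_smul_right, hinner, ← Finset.sum_mul, inner_sub_right n u x₀,
      show inner ℝ n u = c from huH] at this
    exact mul_right_cancel₀ h (by rw [this, one_mul])
  have hu2 : u = ∑ i, b.repr (u - x₀) i • z i := by
    have : ∑ i, b.repr (u - x₀) i • (z i - x₀) = ∑ i, b.repr (u - x₀) i • z i - x₀ := by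
      simp only [smul_sub, Finset.sum_sub_distrib, ← Finset.sum_smul, hsum, one_smul]
    rw [this] at hu1
    exact (sub_left_injective hu1).symm
  rw [hu2]
  exact (convex_convexHull ℝ _).sum_mem (fun i _ => (hu i).le) hsum
    fun i _ => subset_convexHull ℝ _ (mem_range_self i)

theorem IsClosedPolytope.isCompact {P : Set (Sp d)} (hP : IsClosedPolytope P) : IsCompact P := by
  obtain ⟨S, rfl⟩ := hP
  exact S.isCompact_biUnion fun s _ => s.finite_toSet.isCompact_convexHull ℝ

theorem IsOpenPolytope.isOpen {U : Set (Sp d)} (hU : IsOpenPolytope U) : IsOpen U := by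
  obtain ⟨P, -, rfl⟩ := hU
  exact isOpen_interior

theorem IsOpenPolytope.isBounded {U : Set (Sp d)} (hU : IsOpenPolytope U) :
    Bornology.IsBounded U := by
  obtain ⟨P, hP, rfl⟩ := hU
  exact hP.isCompact.isBounded.subset interior_subset

theorem IsOpenPolytope.interior_closure {U : Set (Sp d)} (hU : IsOpenPolytope U) :
    interior (closure U) = U := by
  obtain ⟨P, hP, rfl⟩ := hU
  refine subset_antisymm (interior_mono ?_) (interior_maximal subset_closure isOpen_interior)
  exact closure_minimal interior_subset hP.isCompact.isClosed

/-- The hyperplane of a face, its relative openness, and finitely many hyperplanes through a given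
point which contain its relative boundary. -/
theorem IsPolytopalFace.exists_hyperplane {σ : Set (Sp d)} (hσ : IsPolytopalFace σ) :
    ∃ (n : Sp d) (c : ℝ), ‖n‖ = 1 ∧ σ ⊆ hyperplane n c ∧
      (∀ x ∈ σ, σ ∈ 𝓝[hyperplane n c] x) ∧ Bornology.IsBounded σ ∧
      ∀ x₀ : Sp d, inner ℝ n x₀ ≠ c → ∃ Q : Finset (Sp d × ℝ),
        (∀ q ∈ Q, ‖q.1‖ = 1 ∧ inner ℝ q.1 x₀ = q.2) ∧
        closure σ \ σ ⊆ ⋃ q ∈ Q, hyperplane q.1 q.2 := by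
  classical
  obtain ⟨-, n, c, P, hn, hP, hPH, hσP⟩ := hσ
  have hσsub : σ ⊆ P := by
    intro x hx
    rw [hσP] at hx
    exact mem_of_mem_nhdsWithin hx.1 hx.2
  have hσH : σ ⊆ hyperplane n c := hσsub.trans hPH
  refine ⟨n, c, hn, hσH, fun x hx => ?_, hP.isCompact.isBounded.subset hσsub, fun x₀ hx₀ => ?_⟩
  · have hx' := hx
    rw [hσP] at hx'
    have h1 : ∀ᶠ z in 𝓝[hyperplane n c] x, P ∈ 𝓝[hyperplane n c] z :=
      eventually_eventually_nhdsWithin.2 hx'.2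
    filter_upwards [h1, self_mem_nhdsWithin] with z hz hzH
    rw [hσP]
    exact ⟨hzH, hz⟩
  · have hPcl := hP.isCompact.isClosed
    obtain ⟨S, hS⟩ := hP
    have hL : ∀ t : Finset (Sp d), ∃ q : Sp d × ℝ, t.card < d → ‖q.1‖ = 1 ∧
        inner ℝ q.1 x₀ = q.2 ∧ ∀ z ∈ t, inner ℝ q.1 z = q.2 := by
      intro t
      by_cases ht : t.card < d
      · obtain ⟨q, hq⟩ := exists_hyperplane_through x₀ t ht
        exact ⟨q, fun _ => hq⟩
      · exact ⟨0, fun h => absurd h ht⟩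
    choose Lq hLq using hL
    -- By Carathéodory, a point of P is a positive combination of affinely independent vertices. For
    -- a relative boundary point there are fewer than d of them, otherwise their hull would be a
    -- neighbourhood in the hyperplane. So one hyperplane through x₀ for each set of fewer than d
    -- vertices is enough.
    refine ⟨((S.biUnion Finset.powerset).filter fun t => t.card < d).image Lq, ?_, ?_⟩
    · intro q hq
      obtain ⟨t, ht, rfl⟩ := Finset.mem_image.1 hq
      have := hLq t (Finset.mem_filter.1 ht).2
      exact ⟨this.1, this.2.1⟩
    · rintro y ⟨hyc, hyσ⟩
      have hyP : y ∈ P := closure_minimal hσsub hPcl hyc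
      have hyP' := hyP
      rw [hS] at hyP'
      obtain ⟨s, hs, hys⟩ := mem_iUnion₂.1 hyP'
      obtain ⟨ι, _, z, w, hzs, hind, hw, hw1, hwy⟩ := eq_pos_convex_span_of_mem_convexHull hys
      have hzs' : ∀ i, z i ∈ s := fun i => by exact_mod_cast hzs (mem_range_self i)
      have hsP : convexHull ℝ (s : Set (Sp d)) ⊆ P := by
        rw [hS]; exact subset_biUnion_of_mem (u := fun s : Finset (Sp d) => convexHull ℝ (s : Set (Sp d))) hs
      have hzH : ∀ i, z i ∈ hyperplane n c := fun i =>
        hPH (hsP (subset_convexHull ℝ _ (hzs' i)))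
      have hcard : Fintype.card ι < d := by
        by_contra hcon
        refine hyσ ?_
        rw [hσP]
        refine ⟨hPH hyP, mem_of_superset
          (mem_nhdsWithin_convexHull hx₀ hzH hind (not_lt.1 hcon) hw hw1 hwy) ?_⟩
        exact (convexHull_mono hzs).trans hsP
      set t : Finset (Sp d) := Finset.univ.image z with ht
      have htd : t.card < d := Finset.card_image_le.trans_lt (by simpa using hcard)
      refine mem_iUnion₂.2 ⟨Lq t, Finset.mem_image.2 ⟨t, Finset.mem_filter.2
        ⟨Finset.mem_biUnion.2 ⟨s, hs, Finset.mem_powerset.2 ?_⟩, htd⟩, rfl⟩, ?_⟩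
      · intro u hu
        obtain ⟨i, -, rfl⟩ := Finset.mem_image.1 hu
        exact hzs' i
      · change inner ℝ (Lq t).1 y = (Lq t).2
        rw [← hwy, inner_sum]
        simp only [inner_smul_right]
        have : ∀ i, (inner ℝ (Lq t).1 (z i) : ℝ) = (Lq t).2 := fun i =>
          (hLq t htd).2.2 _ (Finset.mem_image_of_mem z (Finset.mem_univ i))
        simp only [this, ← Finset.sum_mul, hw1, one_mul]

/-- Any z in the hyperplane is on the line through a point p of σ and a nearby point p + t(z − p),
which belongs to σ by relative openness. -/
theorem affineSpan_eq_hyperplane {n : Sp d} {c : ℝ} {σ : Set (Sp d)} (hne : σ.Nonempty)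
    (hσ : σ ⊆ hyperplane n c) (hopen : ∀ x ∈ σ, σ ∈ 𝓝[hyperplane n c] x) :
    (affineSpan ℝ σ : Set (Sp d)) = hyperplane n c := by
  apply subset_antisymm
  · let A : AffineSubspace ℝ (Sp d) := ⟨hyperplane n c, fun a u v w hu hv hw => by
      change inner ℝ n (a • (u - v) + w) = c
      rw [inner_add_right, inner_smul_right, inner_sub_right, show inner ℝ n u = c from hu,
        show inner ℝ n v = c from hv, show inner ℝ n w = c from hw]
      ring⟩
    exact affineSpan_le (Q := A) |>.2 hσ
  · intro z hz
    obtain ⟨p, hp⟩ := hne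
    have h1 : Tendsto (fun t : ℝ => p + t • (z - p)) (𝓝[>] 0) (𝓝[hyperplane n c] p) := by
      refine tendsto_nhdsWithin_iff.2 ⟨?_, Eventually.of_forall fun t => ?_⟩
      · have : Tendsto (fun t : ℝ => p + t • (z - p)) (𝓝 0) (𝓝 (p + (0 : ℝ) • (z - p))) :=
          Continuous.tendsto (by fun_prop) 0
        rw [zero_smul, add_zero] at this
        exact this.mono_left nhdsWithin_le_nhds
      · change inner ℝ n (p + t • (z - p)) = c
        rw [inner_add_right, inner_smul_right, inner_sub_right, show inner ℝ n z = c from hz,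
          show inner ℝ n p = c from hσ hp]
        ring
    obtain ⟨t, ht, ht0⟩ := ((h1.eventually (hopen p hp)).and self_mem_nhdsWithin).exists
    have ht0' : (t : ℝ) ≠ 0 := ne_of_gt ht0
    have h2 := AffineMap.lineMap_mem t⁻¹ (subset_affineSpan ℝ σ hp) (subset_affineSpan ℝ σ ht)
    have h3 : AffineMap.lineMap p (p + t • (z - p)) t⁻¹ = z := by
      rw [AffineMap.lineMap_apply, vsub_eq_sub, vadd_eq_add, add_sub_cancel_left, smul_smul,
        inv_mul_cancel₀ ht0', one_smul, sub_add_cancel]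
    rwa [h3] at h2

theorem infDist_hyperplane {n : Sp d} (hn : ‖n‖ = 1) (c : ℝ) (x : Sp d) :
    Metric.infDist x (hyperplane n c) = |(inner ℝ n x : ℝ) - c| := by
  have hnn : inner ℝ n n = (1 : ℝ) := by rw [real_inner_self_eq_norm_sq, hn]; norm_num
  have hmem : x - ((inner ℝ n x : ℝ) - c) • n ∈ hyperplane n c := by
    change inner ℝ n (x - ((inner ℝ n x : ℝ) - c) • n) = c
    rw [inner_sub_right, inner_smul_right, hnn]; ring
  apply le_antisymm
  · refine (Metric.infDist_le_dist_of_mem hmem).trans_eq ?_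
    rw [dist_eq_norm, sub_sub_cancel, norm_smul, hn, mul_one, Real.norm_eq_abs]
  · refine (Metric.le_infDist ⟨_, hmem⟩).2 fun y hy => ?_
    have := abs_inner_sub_le hn x y
    rwa [show inner ℝ n y = c from hy, ← dist_eq_norm] at this

end Face

end EllamFlow

/-! ### The hyperplane arrangement of a mesh and the elements it cuts out -/

namespace EllamFlow

theorem exists_mem_frontier_of_bounded {E : Type*} [NormedAddCommGroup E] [NormedSpace ℝ E]
    {K : Set E} (ho : IsOpen K) (hb : Bornology.IsBounded K) {x u : E} (hx : x ∈ K) (hu : u ≠ 0) :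
    ∃ s : ℝ, 0 < s ∧ x + s • u ∈ frontier K := by
  obtain ⟨R, hR⟩ := hb.subset_ball x
  have hu' : 0 < ‖u‖ := norm_pos_iff.2 hu
  set a : ℝ := (|R| + 1) / ‖u‖ with ha
  have ha0 : 0 < a := by positivity
  have hout : x + a • u ∉ K := by
    intro h
    have h1 := hR h
    rw [mem_ball_iff_norm, add_sub_cancel_left, norm_smul, Real.norm_eq_abs, abs_of_pos ha0, ha,
      div_mul_cancel₀ _ hu'.ne'] at h1
    linarith [le_abs_self R]
  have hconn : IsPreconnected ((fun s : ℝ => x + s • u) '' Icc 0 a) :=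
    isPreconnected_Icc.image _ (by fun_prop)
  obtain ⟨s, hs, hf⟩ : ∃ s ∈ Icc 0 a, x + s • u ∈ frontier K := by
    by_contra! hcon
    have hsub : (fun s : ℝ => x + s • u) '' Icc 0 a ⊆ K := by
      refine hconn.subset_left_of_subset_union ho isClosed_closure.isOpen_compl
        (disjoint_compl_right_iff_subset.2 subset_closure) ?_
        ⟨x, ⟨0, ⟨le_rfl, ha0.le⟩, by simp⟩, hx⟩
      rintro _ ⟨s, hs, rfl⟩
      by_contra hmem
      rw [mem_union, mem_compl_iff, not_or, not_not] at hmem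
      exact hcon s hs (by rw [ho.frontier_eq]; exact ⟨hmem.2, hmem.1⟩)
    exact hout (hsub ⟨a, ⟨ha0.le, le_rfl⟩, rfl⟩)
  refine ⟨s, lt_of_le_of_ne hs.1 ?_, hf⟩
  rintro rfl
  rw [ho.frontier_eq] at hf
  exact hf.2 (by simpa using hx)

namespace PolytopalMesh

variable {d : ℕ} {Ω : Set (Sp d)} {𝔗 : PolytopalMesh Ω}

theorem mem_facesOf {K σ : Set (Sp d)} : σ ∈ 𝔗.facesOf K ↔ σ ∈ 𝔗.faces ∧ σ ⊆ frontier K := by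
  classical
  simp [facesOf]

theorem mem_cellsOf {K σ : Set (Sp d)} : K ∈ 𝔗.cellsOf σ ↔ K ∈ 𝔗.cells ∧ σ ⊆ frontier K := by
  classical
  simp [cellsOf]

theorem mem_interiorFaces {σ : Set (Sp d)} : σ ∈ 𝔗.interiorFaces ↔ σ ∈ 𝔗.faces ∧ σ ⊆ Ω := by
  classical
  simp [interiorFaces]

theorem isOpen_cell {K : Set (Sp d)} (hK : K ∈ 𝔗.cells) : IsOpen K := (𝔗.cell_polytopal K hK).isOpen

theorem exists_face_of_mem_frontier {K : Set (Sp d)} (hK : K ∈ 𝔗.cells) {y : Sp d}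
    (hy : y ∈ frontier K) : ∃ σ ∈ 𝔗.facesOf K, y ∈ closure σ := by
  classical
  rw [𝔗.frontier_cell K hK] at hy
  obtain ⟨σ, hσ, hyσ⟩ := mem_iUnion₂.1 hy
  refine ⟨σ, ?_, hyσ⟩
  unfold facesOf
  convert hσ

open Classical in
/-- The indices of the elements `D_{K,σ}`. -/
def elements (𝔗 : PolytopalMesh Ω) : Finset (Set (Sp d) × Set (Sp d)) :=
  (𝔗.cells ×ˢ 𝔗.faces).filter fun p => p.2 ⊆ frontier p.1

theorem mem_elements {p : Set (Sp d) × Set (Sp d)} :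
    p ∈ 𝔗.elements ↔ p.1 ∈ 𝔗.cells ∧ p.2 ∈ 𝔗.facesOf p.1 := by
  classical
  simp [elements, mem_facesOf, and_assoc]

/-- A finite family of hyperplanes which contains the hyperplanes of the faces and cuts out the
elements `D_{K,σ}`. -/
structure Arrangement (𝔗 : PolytopalMesh Ω) where
  nrm : Set (Sp d) → Sp d
  lev : Set (Sp d) → ℝ
  planes : Finset (Sp d × ℝ)
  norm_plane : ∀ q ∈ planes, ‖q.1‖ = 1
  norm_nrm : ∀ σ ∈ 𝔗.faces, ‖nrm σ‖ = 1
  face_subset : ∀ σ ∈ 𝔗.faces, σ ⊆ hyperplane (nrm σ) (lev σ)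
  face_open : ∀ σ ∈ 𝔗.faces, ∀ x ∈ σ, σ ∈ 𝓝[hyperplane (nrm σ) (lev σ)] x
  face_bounded : ∀ σ ∈ 𝔗.faces, Bornology.IsBounded σ
  face_mem : ∀ σ ∈ 𝔗.faces, (nrm σ, lev σ) ∈ planes
  center_ne : ∀ K ∈ 𝔗.cells, ∀ σ ∈ 𝔗.facesOf K, inner ℝ (nrm σ) (𝔗.center K) ≠ lev σ
  parallel_mem : ∀ K ∈ 𝔗.cells, ∀ σ ∈ 𝔗.facesOf K,
    (nrm σ, (inner ℝ (nrm σ) (𝔗.center K) : ℝ)) ∈ planes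
  lateral : ∀ K ∈ 𝔗.cells, ∀ σ ∈ 𝔗.facesOf K, ∀ y ∈ closure σ \ σ, ∃ q ∈ planes,
    inner ℝ q.1 y = q.2 ∧ inner ℝ q.1 (𝔗.center K) = q.2

theorem exists_arrangement (𝔗 : PolytopalMesh Ω) : Nonempty 𝔗.Arrangement := by
  classical
  have hdata : ∀ σ, ∃ (n : Sp d) (c : ℝ), σ ∈ 𝔗.faces → ‖n‖ = 1 ∧ σ ⊆ hyperplane n c ∧
      (∀ x ∈ σ, σ ∈ 𝓝[hyperplane n c] x) ∧ Bornology.IsBounded σ ∧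
      ∀ x₀ : Sp d, inner ℝ n x₀ ≠ c → ∃ Q : Finset (Sp d × ℝ),
        (∀ q ∈ Q, ‖q.1‖ = 1 ∧ inner ℝ q.1 x₀ = q.2) ∧
        closure σ \ σ ⊆ ⋃ q ∈ Q, hyperplane q.1 q.2 := by
    intro σ
    by_cases hσ : σ ∈ 𝔗.faces
    · obtain ⟨n, c, h⟩ := (𝔗.face_polytopal σ hσ).exists_hyperplane
      exact ⟨n, c, fun _ => h⟩
    · exact ⟨0, 0, fun h => absurd h hσ⟩
  choose n c hn hsub hopen hbdd hlat using hdata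
  have hcenter : ∀ K ∈ 𝔗.cells, ∀ σ ∈ 𝔗.facesOf K, inner ℝ (n σ) (𝔗.center K) ≠ c σ := by
    intro K hK σ hσ hcon
    obtain ⟨hσf, hσK⟩ := mem_facesOf.1 hσ
    refine 𝔗.center_notMem K hK σ hσf hσK ?_
    have := affineSpan_eq_hyperplane (𝔗.face_polytopal σ hσf).1 (hsub σ hσf) (hopen σ hσf)
    rw [← SetLike.mem_coe, this]
    exact hcon
  have hQ : ∀ p : Set (Sp d) × Set (Sp d), ∃ Q : Finset (Sp d × ℝ), p ∈ 𝔗.elements →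
      (∀ q ∈ Q, ‖q.1‖ = 1 ∧ inner ℝ q.1 (𝔗.center p.1) = q.2) ∧
        closure p.2 \ p.2 ⊆ ⋃ q ∈ Q, hyperplane q.1 q.2 := by
    intro p
    by_cases hp : p ∈ 𝔗.elements
    · obtain ⟨h1, h2⟩ := mem_elements.1 hp
      obtain ⟨Q, hQ⟩ := hlat p.2 (mem_facesOf.1 h2).1 _ (hcenter p.1 h1 p.2 h2)
      exact ⟨Q, fun _ => hQ⟩
    · exact ⟨∅, fun h => absurd h hp⟩
  choose Q hQ using hQ
  refine ⟨{ nrm := n, lev := c,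
            planes := (𝔗.faces.image fun σ => (n σ, c σ)) ∪
              (𝔗.elements.image fun p => (n p.2, (inner ℝ (n p.2) (𝔗.center p.1) : ℝ))) ∪
              𝔗.elements.biUnion Q,
            norm_plane := ?_, norm_nrm := hn, face_subset := hsub, face_open := hopen,
            face_bounded := hbdd, face_mem := ?_, center_ne := hcenter, parallel_mem := ?_,
            lateral := ?_ }⟩
  · intro q hq
    rcases Finset.mem_union.1 hq with hq | hq
    · rcases Finset.mem_union.1 hq with hq | hq
      · obtain ⟨σ, hσ, rfl⟩ := Finset.mem_image.1 hq
        exact hn σ hσ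
      · obtain ⟨p, hp, rfl⟩ := Finset.mem_image.1 hq
        exact hn p.2 (mem_facesOf.1 (mem_elements.1 hp).2).1
    · obtain ⟨p, hp, hq⟩ := Finset.mem_biUnion.1 hq
      exact ((hQ p hp).1 q hq).1
  · intro σ hσ
    exact Finset.mem_union_left _ (Finset.mem_union_left _ (Finset.mem_image_of_mem _ hσ))
  · intro K hK σ hσ
    exact Finset.mem_union_left _ (Finset.mem_union_right _
      (Finset.mem_image.2 ⟨(K, σ), mem_elements.2 ⟨hK, hσ⟩, rfl⟩))
  · intro K hK σ hσ y hy
    have hp : (K, σ) ∈ 𝔗.elements := mem_elements.2 ⟨hK, hσ⟩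
    obtain ⟨q, hq, hyq⟩ := mem_iUnion₂.1 ((hQ _ hp).2 hy)
    exact ⟨q, Finset.mem_union_right _ (Finset.mem_biUnion.2 ⟨_, hp, hq⟩), hyq,
      ((hQ _ hp).1 q hq).2⟩

namespace Arrangement

variable {K L σ τ : Set (Sp d)}

theorem isOpen_diamond (A : 𝔗.Arrangement) (hK : K ∈ 𝔗.cells) (hσ : σ ∈ 𝔗.facesOf K) :
    IsOpen (𝔗.diamond K σ) :=
  isOpen_openCone (A.center_ne K hK σ hσ) (A.face_subset σ (mem_facesOf.1 hσ).1)
    (A.face_open σ (mem_facesOf.1 hσ).1)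

theorem diamond_subset_closure (hK : K ∈ 𝔗.cells) (hσ : σ ∈ 𝔗.facesOf K) :
    𝔗.diamond K σ ⊆ closure K := by
  intro x hx
  obtain ⟨y, hy, t, h0, h1, rfl⟩ := mem_openCone.1 hx
  have hstar : StarConvex ℝ (𝔗.center K) (closure K) := by
    intro z hz a b ha hb hab
    have hmaps : MapsTo (fun z => a • 𝔗.center K + b • z) K K := fun w hw =>
      𝔗.starConvex K hK hw ha hb hab
    exact hmaps.closure (by fun_prop) hz
  have hyK : y ∈ closure K := frontier_subset_closure ((mem_facesOf.1 hσ).2 hy)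
  have := hstar hyK (sub_nonneg.2 h1.le) h0.le (by ring)
  convert this using 1
  rw [smul_sub, sub_smul, one_smul]; abel

/-- The cone is an open subset of the closure of K, and an open polytopal set is the interior of its
closure. -/
theorem diamond_subset (A : 𝔗.Arrangement) (hK : K ∈ 𝔗.cells) (hσ : σ ∈ 𝔗.facesOf K) :
    𝔗.diamond K σ ⊆ K := by
  have h := interior_maximal (diamond_subset_closure hK hσ) (A.isOpen_diamond hK hσ)
  rwa [(𝔗.cell_polytopal K hK).interior_closure] at h

/-- In the same cell, a common point has base points y and y' on the same ray. If one is strictly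
nearer to the centre, it belongs to the open cone over the other face, hence to K, while faces lie
on the frontier of K. If they coincide, two faces meet. -/
theorem diamond_disjoint (A : 𝔗.Arrangement) (hK : K ∈ 𝔗.cells) (hσ : σ ∈ 𝔗.facesOf K)
    (hL : L ∈ 𝔗.cells) (hτ : τ ∈ 𝔗.facesOf L) (hne : (K, σ) ≠ (L, τ)) :
    Disjoint (𝔗.diamond K σ) (𝔗.diamond L τ) := by
  by_cases hKL : K = L
  swap
  · exact (𝔗.cell_disjoint K hK L hL hKL).mono (A.diamond_subset hK hσ) (A.diamond_subset hL hτ)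
  subst hKL
  have hst : σ ≠ τ := fun h => hne (by rw [h])
  have key : ∀ σ τ, σ ∈ 𝔗.facesOf K → τ ∈ 𝔗.facesOf K → ∀ y ∈ σ, ∀ y' ∈ τ, ∀ t t' : ℝ, 0 < t' →
      t' < t → 𝔗.center K + t • (y - 𝔗.center K) ≠ 𝔗.center K + t' • (y' - 𝔗.center K) := by
    intro σ τ hσ hτ y hy y' hy' t t' h0' htt heq
    have h0 : 0 < t := h0'.trans htt
    have h1 : y = 𝔗.center K + (t' / t) • (y' - 𝔗.center K) := by
      have h2 : y - 𝔗.center K = (t' / t) • (y' - 𝔗.center K) := by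
        have h3 := add_left_cancel heq
        rw [div_eq_inv_mul, ← smul_smul, ← h3, smul_smul, inv_mul_cancel₀ h0.ne', one_smul]
      rw [← h2, add_sub_cancel]
    have h4 : y ∈ 𝔗.diamond K τ := mem_openCone.2
      ⟨y', hy', t' / t, by positivity, (div_lt_one h0).2 htt, h1⟩
    have h5 := (mem_facesOf.1 hσ).2 hy
    rw [(isOpen_cell hK).frontier_eq] at h5
    exact h5.2 (A.diamond_subset hK hτ h4)
  rw [disjoint_left]
  intro x hx hx'
  obtain ⟨y, hy, t, h0, h1, rfl⟩ := mem_openCone.1 hx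
  obtain ⟨y', hy', t', h0', h1', heq⟩ := mem_openCone.1 hx'
  rcases lt_trichotomy t' t with htt | rfl | htt
  · exact key σ τ hσ hτ y hy y' hy' t t' h0' htt heq
  · have h2 := smul_right_injective _ h0.ne' (add_left_cancel heq)
    have h3 : y = y' := sub_left_injective h2
    exact disjoint_left.1 (𝔗.face_disjoint σ (mem_facesOf.1 hσ).1 τ (mem_facesOf.1 hτ).1 hst) hy
      (h3 ▸ hy')
  · exact key τ σ hτ hσ y' hy' y hy t' t h0 htt heq.symm

theorem frontier_diamond_subset (A : 𝔗.Arrangement) (hK : K ∈ 𝔗.cells) (hσ : σ ∈ 𝔗.facesOf K) :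
    frontier (𝔗.diamond K σ) ⊆ ⋃ q ∈ A.planes, hyperplane q.1 q.2 := by
  intro x hx
  have hσ' := (mem_facesOf.1 hσ).1
  rcases mem_frontier_openCone (A.center_ne K hK σ hσ) (A.face_subset σ hσ') (A.face_open σ hσ') hx
    with h | h | ⟨y, hy, t, rfl⟩
  · exact mem_iUnion₂.2 ⟨_, A.face_mem σ hσ', h⟩
  · exact mem_iUnion₂.2 ⟨_, A.parallel_mem K hK σ hσ, h⟩
  · obtain ⟨q, hq, h1, h2⟩ := A.lateral K hK σ hσ y hy
    refine mem_iUnion₂.2 ⟨q, hq, ?_⟩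
    change inner ℝ q.1 (𝔗.center K + t • (y - 𝔗.center K)) = q.2
    rw [inner_add_right, inner_smul_right, inner_sub_right, h1, h2]; ring

theorem frontier_cell_subset (A : 𝔗.Arrangement) (hK : K ∈ 𝔗.cells) :
    frontier K ⊆ ⋃ q ∈ A.planes, hyperplane q.1 q.2 := by
  intro x hx
  obtain ⟨σ, hσ, hxσ⟩ := exists_face_of_mem_frontier hK hx
  have hσ' := (mem_facesOf.1 hσ).1
  exact mem_iUnion₂.2 ⟨_, A.face_mem σ hσ',
    closure_minimal (A.face_subset σ hσ') (isClosed_hyperplane _ _) hxσ⟩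

/-- Frontiers of cells and centres lie on hyperplanes of the arrangement. From any other point x of
K, the ray issued from the centre leaves K at a point y of some closed face σ: either y is in σ and
x in the cone, or y is on the relative boundary and x is on a lateral hyperplane through y and the
centre. -/
theorem domain_subset (A : 𝔗.Arrangement) (hd : 1 ≤ d) :
    Ω ⊆ (⋃ p : 𝔗.elements, 𝔗.diamond p.1.1 p.1.2) ∪ ⋃ q ∈ A.planes, hyperplane q.1 q.2 := by
  intro x hx
  have hx' : x ∈ ⋃ K ∈ 𝔗.cells, closure K := 𝔗.closure_domain ▸ subset_closure hx
  obtain ⟨K, hK, hxK⟩ := mem_iUnion₂.1 hx'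
  have ho := isOpen_cell hK
  have hb := (𝔗.cell_polytopal K hK).isBounded
  by_cases hxK' : x ∈ K
  swap
  · right
    exact A.frontier_cell_subset hK (by rw [ho.frontier_eq]; exact ⟨hxK, hxK'⟩)
  by_cases hxc : x = 𝔗.center K
  · right
    have : Nonempty (Fin d) := ⟨⟨0, hd⟩⟩
    obtain ⟨u, hu⟩ := exists_ne (0 : Sp d)
    obtain ⟨s, -, hs⟩ := exists_mem_frontier_of_bounded ho hb hxK' hu
    obtain ⟨σ, hσ, -⟩ := exists_face_of_mem_frontier hK hs
    refine mem_iUnion₂.2 ⟨_, A.parallel_mem K hK σ hσ, ?_⟩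
    rw [hxc]
    rfl
  · obtain ⟨s, hs0, hs⟩ := exists_mem_frontier_of_bounded ho hb hxK' (sub_ne_zero.2 hxc)
    obtain ⟨σ, hσ, hyσ⟩ := exists_face_of_mem_frontier hK hs
    set y := x + s • (x - 𝔗.center K) with hy
    have hy1 : y - 𝔗.center K = (1 + s) • (x - 𝔗.center K) := by
      rw [hy, add_smul, one_smul]; abel
    have hx1 : x = 𝔗.center K + (1 + s)⁻¹ • (y - 𝔗.center K) := by
      rw [hy1, smul_smul, inv_mul_cancel₀ (by positivity), one_smul, add_sub_cancel]
    by_cases hyσ' : y ∈ σ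
    · left
      refine mem_iUnion.2 ⟨⟨(K, σ), mem_elements.2 ⟨hK, hσ⟩⟩, mem_openCone.2
        ⟨y, hyσ', (1 + s)⁻¹, by positivity, inv_lt_one_of_one_lt₀ (by linarith), hx1⟩⟩
    · right
      obtain ⟨q, hq, h1, h2⟩ := A.lateral K hK σ hσ y ⟨hyσ, hyσ'⟩
      refine mem_iUnion₂.2 ⟨q, hq, ?_⟩
      change inner ℝ q.1 x = q.2
      rw [hx1, inner_add_right, inner_smul_right, inner_sub_right, h1, h2]; ring

theorem half_ball_subset (A : 𝔗.Arrangement) (hK : K ∈ 𝔗.cells) (hσ : σ ∈ 𝔗.facesOf K) {p : Sp d}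
    (hp : p ∈ σ) : ∃ r > 0, ∀ x ∈ Metric.ball p r,
      0 < ((inner ℝ (A.nrm σ) x : ℝ) - A.lev σ) * (inner ℝ (A.nrm σ) (𝔗.center K) - A.lev σ) →
        x ∈ 𝔗.diamond K σ :=
  exists_half_ball_subset_openCone (A.center_ne K hK σ hσ) (A.face_subset σ (mem_facesOf.1 hσ).1)
    (A.face_open σ (mem_facesOf.1 hσ).1) hp

end Arrangement

end PolytopalMesh

end EllamFlow

/-! ### Volumes of cones and regularity of the mesh -/

namespace EllamFlow

section ConeVolume

variable {d : ℕ} {n x₀ : Sp d} {c : ℝ} {σ : Set (Sp d)}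

theorem measurableSet_of_rel_open (hσ : σ ⊆ hyperplane n c)
    (hopen : ∀ x ∈ σ, σ ∈ 𝓝[hyperplane n c] x) : MeasurableSet σ := by
  have h : σ = interior (σ ∪ (hyperplane n c)ᶜ) ∩ hyperplane n c := by
    ext x
    constructor
    · intro hx
      refine ⟨mem_interior_iff_mem_nhds.2 ?_, hσ hx⟩
      have := mem_nhdsWithin_iff_eventually.1 (hopen x hx)
      filter_upwards [this] with y hy
      by_cases hyH : y ∈ hyperplane n c
      · exact Or.inl (hy hyH)
      · exact Or.inr hyH
    · rintro ⟨hx, hxH⟩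
      exact (interior_subset hx).resolve_right (not_not.2 hxH)
  rw [h]
  exact isOpen_interior.measurableSet.inter (isClosed_hyperplane n c).measurableSet

theorem isBounded_openCone (hb : Bornology.IsBounded σ) (x₀ : Sp d) :
    Bornology.IsBounded (openCone x₀ σ) := by
  obtain ⟨R, hR⟩ := hb.subset_ball x₀
  refine (Metric.isBounded_ball (x := x₀) (r := R)).subset fun x hx => ?_
  obtain ⟨y, hy, t, h0, h1, rfl⟩ := mem_openCone.1 hx
  have := hR hy
  rw [mem_ball_iff_norm] at this ⊢
  rw [add_sub_cancel_left, norm_smul, Real.norm_eq_abs, abs_of_pos h0]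
  nlinarith [norm_nonneg (y - x₀)]

theorem norm_sub_vertex_le (hb : Bornology.IsBounded σ) {x : Sp d} (hx : x ∈ openCone x₀ σ) :
    ‖x - x₀‖ ≤ Metric.diam (openCone x₀ σ) := by
  have hx₀ : x₀ ∈ closure (openCone x₀ σ) := by
    obtain ⟨y, hy, t, h0, h1, rfl⟩ := mem_openCone.1 hx
    have h2 : Tendsto (fun s : ℝ => x₀ + s • (y - x₀)) (𝓝[>] 0) (𝓝 (x₀ + (0 : ℝ) • (y - x₀))) :=
      (Continuous.tendsto (by fun_prop) 0).mono_left nhdsWithin_le_nhds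
    rw [zero_smul, add_zero] at h2
    refine mem_closure_of_tendsto h2 ?_
    filter_upwards [Ioo_mem_nhdsGT (show (0 : ℝ) < 1 from one_pos)] with s hs
    exact mem_openCone.2 ⟨y, hy, s, hs.1, hs.2, rfl⟩
  rw [← Metric.diam_closure, ← dist_eq_norm]
  exact Metric.dist_le_diam_of_mem (isBounded_openCone hb x₀).closure (subset_closure hx) hx₀

/-- The base of a cone is controlled by its volume and its height. -/
theorem measure_base_le (hn : ‖n‖ = 1) (hx₀ : inner ℝ n x₀ ≠ c) (hσ : σ ⊆ hyperplane n c)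
    (hopen : ∀ x ∈ σ, σ ∈ 𝓝[hyperplane n c] x) (hb : Bornology.IsBounded σ) {ρ : ℝ} (hρ : 0 ≤ ρ)
    (hdiam : Metric.diam (openCone x₀ σ) ≤ ρ * |(inner ℝ n x₀ : ℝ) - c|) :
    ENNReal.ofReal (|(inner ℝ n x₀ : ℝ) - c| / 4) *
        (Measure.euclideanHausdorffMeasure (d - 1) : Measure (Sp d)) σ ≤
      ENNReal.ofReal (3 + 4 * ρ) ^ d * volume (openCone x₀ σ) := by
  set δ := |(inner ℝ n x₀ : ℝ) - c| with hδ
  have hδ0 : 0 < δ := abs_pos.2 (sub_ne_zero.2 hx₀)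
  have hnn : inner ℝ n n = (1 : ℝ) := by rw [real_inner_self_eq_norm_sq, hn]; norm_num
  set D := openCone x₀ σ with hD
  set t := coneParam n c x₀ with ht
  set f := coneFoot n c x₀ with hf
  have htt : ∀ x y, δ * |t x - t y| ≤ ‖x - y‖ := by
    intro x y
    have h1 : t x - t y = (inner ℝ n x - inner ℝ n y) / (c - inner ℝ n x₀) := by
      simp only [ht, coneParam]; ring
    rw [h1, abs_div, abs_sub_comm c, ← hδ, mul_div_cancel₀ _ hδ0.ne']
    exact abs_inner_sub_le hn x y
  -- The part of the cone with parameter t > 1/2 is mapped to a straight prism, a point being sent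
  -- to its foot moved by (t − 3/4)δ along n. Away from the vertex this map is Lipschitz with
  -- constant 3 + 4ρ, and its image contains the prism of half-height δ/8, of volume (δ/4)|σ|.
  set Rel : Set (Sp d × Sp d) :=
    {q | q.2 ∈ D ∧ 1 / 2 < t q.2 ∧ q.1 = f q.2 + ((t q.2 - 3 / 4) * δ) • n} with hRel
  have h1 := volume_fst_image_le Rel (K := 3 + 4 * ρ) (by
    rintro ⟨u, x⟩ ⟨hx, hxt, hu⟩ ⟨u', x'⟩ ⟨hx', hxt', hu'⟩
    simp only at hx hxt hu hx' hxt' hu' ⊢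
    have e1 : u - u' = ((t x)⁻¹ • (x - x') + ((t x)⁻¹ - (t x')⁻¹) • (x' - x₀)) +
        ((t x - t x') * δ) • n := by
      rw [hu, hu', hf, coneFoot, coneFoot]
      module
    have e2 : ‖(t x)⁻¹ • (x - x')‖ ≤ 2 * ‖x - x'‖ := by
      rw [norm_smul, Real.norm_eq_abs, abs_of_pos (by positivity)]
      gcongr
      exact (inv_le_comm₀ (by linarith) two_pos).2 (by linarith)
    have e3 : ‖((t x)⁻¹ - (t x')⁻¹) • (x' - x₀)‖ ≤ 4 * ρ * ‖x - x'‖ := by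
      rw [norm_smul, Real.norm_eq_abs, inv_sub_inv (by linarith) (by linarith), abs_div,
        abs_of_pos (show 0 < t x * t x' by nlinarith), abs_sub_comm]
      have h2 : |t x - t x'| / (t x * t x') ≤ 4 * |t x - t x'| := by
        rw [div_le_iff₀ (by nlinarith)]
        have : 1 ≤ 4 * (t x * t x') := by nlinarith
        nlinarith [abs_nonneg (t x - t x')]
      have h3 : ‖x' - x₀‖ ≤ ρ * δ := (norm_sub_vertex_le hb hx').trans hdiam
      calc _ ≤ 4 * |t x - t x'| * (ρ * δ) := by gcongr
        _ = 4 * ρ * (δ * |t x - t x'|) := by ring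
        _ ≤ _ := by gcongr; exact htt x x'
    have e4 : ‖((t x - t x') * δ) • n‖ ≤ ‖x - x'‖ := by
      rw [norm_smul, hn, mul_one, Real.norm_eq_abs, abs_mul, abs_of_pos hδ0, mul_comm]
      exact htt x x'
    rw [e1]
    refine (norm_add₃_le).trans ?_
    linarith)
  have h2 : {u : Sp d | |(inner ℝ n u : ℝ) - c| ≤ δ / 8 ∧ u - ((inner ℝ n u : ℝ) - c) • n ∈ σ} ⊆
      Prod.fst '' Rel := by
    rintro u ⟨hu, huσ⟩
    set a := (inner ℝ n u : ℝ) - c with ha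
    set y := u - a • n with hy
    have hq : |a / δ| ≤ 1 / 8 := by
      rw [abs_div, abs_of_pos hδ0, div_le_iff₀ hδ0]; linarith
    rw [abs_le] at hq
    have hs0 : (0 : ℝ) < 3 / 4 + a / δ := by linarith [hq.1]
    have h3 : t (x₀ + (3 / 4 + a / δ) • (y - x₀)) = 3 / 4 + a / δ :=
      coneParam_add_smul hx₀ (hσ huσ) _
    have h4 : f (x₀ + (3 / 4 + a / δ) • (y - x₀)) = y := coneFoot_add_smul hx₀ (hσ huσ) hs0.ne'
    refine ⟨(u, x₀ + (3 / 4 + a / δ) • (y - x₀)), ⟨mem_openCone.2 ⟨y, huσ, _, hs0, by linarith [hq.2],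
      rfl⟩, ?_, ?_⟩, rfl⟩
    · simp only [h3]; linarith [hq.1]
    · simp only [h3, h4]
      rw [add_sub_cancel_left, div_mul_cancel₀ _ hδ0.ne', hy, sub_add_cancel]
  have h3 : Prod.snd '' Rel ⊆ D := by
    rintro _ ⟨q, hq, rfl⟩; exact hq.1
  have h4 := volume_prism hn (measurableSet_of_rel_open hσ hopen) hσ (δ / 8)
  rw [show 2 * (δ / 8) = δ / 4 by ring] at h4
  rw [← h4]
  exact (measure_mono h2).trans (h1.trans (by gcongr))

end ConeVolume

namespace PolytopalMesh

variable {d : ℕ} {Ω : Set (Sp d)} {𝔗 : PolytopalMesh Ω} {K σ : Set (Sp d)}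

theorem diamond_nonempty (hσ : σ ∈ 𝔗.facesOf K) : (𝔗.diamond K σ).Nonempty := by
  obtain ⟨p, hp⟩ := (𝔗.face_polytopal σ (mem_facesOf.1 hσ).1).1
  exact ⟨_, mem_openCone.2 ⟨p, hp, 1 / 2, by norm_num, by norm_num, rfl⟩⟩

theorem Arrangement.cellFaceDist_eq (A : 𝔗.Arrangement) (hσ : σ ∈ 𝔗.faces) :
    𝔗.cellFaceDist K σ = |(inner ℝ (A.nrm σ) (𝔗.center K) : ℝ) - A.lev σ| := by
  rw [cellFaceDist, affineSpan_eq_hyperplane (𝔗.face_polytopal σ hσ).1 (A.face_subset σ hσ)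
    (A.face_open σ hσ), infDist_hyperplane (A.norm_nrm σ hσ)]

theorem Arrangement.cellFaceDist_pos (A : 𝔗.Arrangement) (hK : K ∈ 𝔗.cells)
    (hσ : σ ∈ 𝔗.facesOf K) : 0 < 𝔗.cellFaceDist K σ := by
  rw [A.cellFaceDist_eq (mem_facesOf.1 hσ).1]
  exact abs_pos.2 (sub_ne_zero.2 (A.center_ne K hK σ hσ))

/-- Moving by the distance d_{K,σ} along the normal changes the cone parameter by 1, whereas it
stays in (0, 1) in the cone. -/
theorem Arrangement.le_cellFaceDist_of_ball_subset (A : 𝔗.Arrangement) (hK : K ∈ 𝔗.cells)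
    (hσ : σ ∈ 𝔗.facesOf K) {x : Sp d} {r : ℝ} (hr : Metric.ball x r ⊆ 𝔗.diamond K σ) :
    r ≤ 𝔗.cellFaceDist K σ := by
  have hσ' := (mem_facesOf.1 hσ).1
  have hx₀ := A.center_ne K hK σ hσ
  set n := A.nrm σ
  have hn : ‖n‖ = 1 := A.norm_nrm σ hσ'
  have hnn : inner ℝ n n = (1 : ℝ) := by rw [real_inner_self_eq_norm_sq, hn]; norm_num
  have hδ := A.cellFaceDist_pos hK hσ
  rw [A.cellFaceDist_eq hσ'] at hδ ⊢
  rcases le_or_gt r 0 with h0 | h0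
  · linarith
  by_contra! hcon
  set a := (inner ℝ n (𝔗.center K) : ℝ) - A.lev σ with ha
  have hx := hr (Metric.mem_ball_self h0)
  have hy : x + (-a) • n ∈ Metric.ball x r := by
    rw [mem_ball_iff_norm, add_sub_cancel_left, norm_smul, hn, mul_one, norm_neg]
    exact hcon
  obtain ⟨h1, -, -⟩ := (mem_openCone_iff hx₀ (A.face_subset σ hσ')).1 hx
  obtain ⟨-, h2, -⟩ := (mem_openCone_iff hx₀ (A.face_subset σ hσ')).1 (hr hy)
  have h3 : coneParam n (A.lev σ) (𝔗.center K) (x + (-a) • n) =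
      coneParam n (A.lev σ) (𝔗.center K) x + 1 := by
    have hne : A.lev σ - inner ℝ n (𝔗.center K) ≠ 0 := sub_ne_zero.2 hx₀.symm
    rw [coneParam, coneParam, inner_add_right, inner_smul_right, hnn, ha]
    field_simp
    ring
  linarith

/-- The consequences of the regularity of the mesh for an element `D_{K,σ}`. -/
theorem Arrangement.exists_ball_of_regularity (A : 𝔗.Arrangement) {ϱ : ℝ}
    (hϱ : 𝔗.regularity ≤ ϱ) (hK : K ∈ 𝔗.cells) (hσ : σ ∈ 𝔗.facesOf K) :
    0 ≤ ϱ ∧ Metric.diam (𝔗.diamond K σ) ≤ ϱ * 𝔗.cellFaceDist K σ ∧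
      ∃ x r, 0 < r ∧ Metric.ball x r ⊆ 𝔗.diamond K σ ∧ Metric.diam (𝔗.diamond K σ) ≤ 2 * ϱ * r := by
  have hδ := A.cellFaceDist_pos hK hσ
  set D := 𝔗.diamond K σ with hD
  -- Without this bound the real supremum defining `inradius` would take its default value 0.
  have hbdd : BddAbove {r : ℝ | ∃ x, Metric.ball x r ⊆ D} :=
    ⟨𝔗.cellFaceDist K σ, fun r ⟨x, hx⟩ => A.le_cellFaceDist_of_ball_subset hK hσ hx⟩
  obtain ⟨p, hp⟩ := 𝔗.diamond_nonempty hσ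
  obtain ⟨ε, hε, hεD⟩ := Metric.isOpen_iff.1 (A.isOpen_diamond hK hσ) p hp
  have hin0 : 0 < inradius D := hε.trans_le (le_csSup hbdd ⟨p, hεD⟩)
  have hinδ : inradius D ≤ 𝔗.cellFaceDist K σ :=
    csSup_le ⟨ε, p, hεD⟩ fun r ⟨x, hx⟩ => A.le_cellFaceDist_of_ball_subset hK hσ hx
  have hq : ∀ (K : 𝔗.cells) (σ : 𝔗.facesOf K),
      0 ≤ Metric.diam (𝔗.diamond K σ) / inradius (𝔗.diamond K σ) := fun K σ =>
    div_nonneg Metric.diam_nonneg (Real.sSup_nonneg' ⟨0, ⟨0, by simp⟩, le_rfl⟩)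
  have hle : Metric.diam D / inradius D ≤ ϱ := by
    have h1 : Metric.diam D / inradius D ≤ ⨆ σ : 𝔗.facesOf K,
        Metric.diam (𝔗.diamond K σ) / inradius (𝔗.diamond K σ) :=
      le_ciSup (f := fun σ : 𝔗.facesOf K => Metric.diam (𝔗.diamond K σ) /
        inradius (𝔗.diamond K σ)) (Set.finite_range _).bddAbove ⟨σ, hσ⟩
    have h2 := le_ciSup (f := fun K : 𝔗.cells => ⨆ σ : 𝔗.facesOf K,
      Metric.diam (𝔗.diamond K σ) / inradius (𝔗.diamond K σ)) (Set.finite_range _).bddAbove ⟨K, hK⟩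
    have h3 : 0 ≤ ⨆ K : 𝔗.cells, ((𝔗.facesOf K).card : ℝ) :=
      Real.iSup_nonneg fun K => Nat.cast_nonneg _
    rw [regularity] at hϱ
    simp only at h2
    linarith
  have hϱ0 : 0 ≤ ϱ := (hq ⟨K, hK⟩ ⟨σ, hσ⟩).trans hle
  rw [div_le_iff₀ hin0] at hle
  refine ⟨hϱ0, hle.trans (mul_le_mul_of_nonneg_left hinδ hϱ0), ?_⟩
  -- The supremum need not be attained; a ball of radius more than half of it is taken, whence the
  -- factor 2.
  obtain ⟨r, ⟨x, hx⟩, hr⟩ := exists_lt_of_lt_csSup (s := {r : ℝ | ∃ x, Metric.ball x r ⊆ D})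
    ⟨ε, p, hεD⟩ (show inradius D / 2 < sSup {r : ℝ | ∃ x, Metric.ball x r ⊆ D} from
      half_lt_self hin0)
  refine ⟨x, r, by linarith, hx, hle.trans ?_⟩
  nlinarith

end PolytopalMesh

end EllamFlow

/-! ### Inverse inequality for polynomials -/

namespace EllamFlow

section Polynomial

variable (d : ℕ)

/-- The affine functions. -/
def affineFns : Submodule ℝ (Sp d → ℝ) :=
  Submodule.span ℝ (insert 1 (range fun (i : Fin d) (x : Sp d) => x i))

theorem affineFns_fg : (affineFns d).FG :=
  ⟨(finite_range fun (i : Fin d) (x : Sp d) => x i).insert 1 |>.toFinset, by simp [affineFns]⟩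

variable {d}

theorem one_mem_affineFns : (1 : Sp d → ℝ) ∈ affineFns d := Submodule.subset_span (mem_insert _ _)

theorem coord_mem_affineFns (i : Fin d) : (fun x : Sp d => x i) ∈ affineFns d :=
  Submodule.subset_span (mem_insert_of_mem _ (mem_range_self i))

/-- The power of order k of `affineFns` in the algebra of functions plays the role of the space of
polynomial functions of degree at most k. Its finite dimension and its stability under x ↦ x₀ + ru
follow from general facts on powers of submodules. -/
theorem eval_mem_affineFns_pow {k : ℕ} {q : MvPolynomial (Fin d) ℝ} (hq : q.totalDegree ≤ k) :
    (fun x : Sp d => MvPolynomial.eval (fun j => x j) q) ∈ affineFns d ^ k := by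
  classical
  have h1 : (fun x : Sp d => MvPolynomial.eval (fun j => x j) q) =
      ∑ m ∈ q.support, q.coeff m • ∏ i, (fun x : Sp d => x i) ^ m i := by
    ext x
    rw [MvPolynomial.eval_eq']
    simp [Finset.sum_apply, Finset.prod_apply]
  rw [h1]
  refine Submodule.sum_mem _ fun m hm => Submodule.smul_mem _ _ ?_
  have h2 : ∀ s : Finset (Fin d),
      (∏ i ∈ s, (fun x : Sp d => x i) ^ m i) ∈ affineFns d ^ (∑ i ∈ s, m i) := by
    intro s
    induction s using Finset.induction_on with
    | empty => simp
    | insert a s ha ih =>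
      rw [Finset.prod_insert ha, Finset.sum_insert ha, pow_add]
      exact Submodule.mul_mem_mul (Submodule.pow_mem_pow _ (coord_mem_affineFns a) _) ih
  have h3 : ∑ i, m i ≤ k := by
    refine le_trans ?_ hq
    have := MvPolynomial.le_totalDegree hm
    rwa [Finsupp.sum_fintype _ _ (fun _ => rfl)] at this
  exact pow_le_pow_right' (Submodule.one_le.2 one_mem_affineFns) h3 (h2 Finset.univ)

theorem comp_mem_affineFns_pow {k : ℕ} {f : Sp d → ℝ} (hf : f ∈ affineFns d ^ k) (x : Sp d) (r : ℝ) :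
    (fun u => f (x + r • u)) ∈ affineFns d ^ k := by
  let T : (Sp d → ℝ) →ₐ[ℝ] (Sp d → ℝ) :=
    { toFun := fun f u => f (x + r • u)
      map_one' := rfl
      map_mul' := fun _ _ => rfl
      map_zero' := rfl
      map_add' := fun _ _ => rfl
      commutes' := fun _ => rfl }
  have h1 : (affineFns d).map T.toLinearMap ≤ affineFns d := by
    rw [affineFns, Submodule.map_span_le]
    rintro g (rfl | ⟨i, rfl⟩)
    · exact one_mem_affineFns
    · have : T.toLinearMap (fun y : Sp d => y i) = x i • (1 : Sp d → ℝ) + r • fun y : Sp d => y i := by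
        ext u
        change (x + r • u) i = _
        simp
      rw [this]
      exact Submodule.add_mem _ (Submodule.smul_mem _ _ one_mem_affineFns)
        (Submodule.smul_mem _ _ (coord_mem_affineFns i))
  have h2 : (affineFns d ^ k).map T.toLinearMap ≤ affineFns d ^ k := by
    rw [Submodule.map_pow]
    exact pow_le_pow_left' h1 k
  exact h2 ⟨f, hf, rfl⟩

theorem analytic_of_mem_affineFns_pow {k : ℕ} {f : Sp d → ℝ} (hf : f ∈ affineFns d ^ k) :
    AnalyticOnNhd ℝ f univ := by
  let S : Subalgebra ℝ (Sp d → ℝ) :=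
    { carrier := {f | AnalyticOnNhd ℝ f univ}
      mul_mem' := fun ha hb => AnalyticOnNhd.mul ha hb
      add_mem' := fun ha hb => AnalyticOnNhd.add ha hb
      algebraMap_mem' := fun c => analyticOnNhd_const }
  have h1 : affineFns d ≤ Subalgebra.toSubmodule S := by
    rw [affineFns, Submodule.span_le]
    rintro g (rfl | ⟨i, rfl⟩)
    · exact S.one_mem
    · exact (EuclideanSpace.proj (𝕜 := ℝ) i : Sp d →L[ℝ] ℝ).analyticOnNhd univ
  have h2 : ∀ k, affineFns d ^ k ≤ Subalgebra.toSubmodule S := by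
    intro k
    induction k with
    | zero =>
      rw [pow_zero, Submodule.one_le]
      exact S.one_mem
    | succ k ih =>
      rw [pow_succ, Submodule.mul_le]
      exact fun a ha b hb => S.mul_mem (ih ha) (h1 hb)
  exact h2 k hf

/-- Equivalence of norms on a finite-dimensional space of analytic functions. -/
theorem exists_sq_le_integral_sq (k : ℕ) (ρ : ℝ) : ∃ C : ℝ, 0 < C ∧ ∀ f ∈ affineFns d ^ k,
    ∀ u : Sp d, ‖u‖ ≤ ρ → f u ^ 2 ≤ C * ∫ x in Metric.ball (0 : Sp d) 1, f x ^ 2 := by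
  have hfg : (affineFns d ^ k).FG := (affineFns_fg d).pow k
  have : FiniteDimensional ℝ (affineFns d ^ k : Submodule ℝ (Sp d → ℝ)) :=
    Module.Finite.iff_fg.2 hfg
  set b := Module.finBasis ℝ (affineFns d ^ k : Submodule ℝ (Sp d → ℝ)) with hb
  set N := Module.finrank ℝ (affineFns d ^ k : Submodule ℝ (Sp d → ℝ)) with hN
  have hbc : ∀ i, Continuous (b i : Sp d → ℝ) := fun i =>
    continuousOn_univ.1 (analytic_of_mem_affineFns_pow (b i).2).continuousOn
  set g : (Fin N → ℝ) → Sp d → ℝ := fun a x => ∑ i, a i * (b i : Sp d → ℝ) x with hg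
  have hgc : ∀ a, Continuous (g a) := fun a =>
    continuous_finsetSum _ fun i _ => continuous_const.mul (hbc i)
  have hgmem : ∀ a, g a ∈ affineFns d ^ k := by
    intro a
    have : g a = ((∑ i, a i • b i : (affineFns d ^ k : Submodule ℝ (Sp d → ℝ))) : Sp d → ℝ) := by
      ext x
      simp [hg, Finset.sum_apply]
    rw [this]
    exact Subtype.mem _
  have hball : IsFiniteMeasure (volume.restrict (Metric.ball (0 : Sp d) 1)) :=
    ⟨by rw [Measure.restrict_apply_univ]; exact measure_ball_lt_top⟩
  have hint : ∀ f : Sp d → ℝ, Continuous f → IntegrableOn f (Metric.ball (0 : Sp d) 1) :=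
    fun f hf => (hf.continuousOn.integrableOn_compact (isCompact_closedBall (0 : Sp d) 1)).mono_set
      Metric.ball_subset_closedBall
  -- Q is the squared L² norm on the unit ball as a quadratic form in the coefficients. It is
  -- positive definite because an analytic function that vanishes on a ball is zero, so it is
  -- bounded below by its minimum m on the unit sphere.
  set Q : (Fin N → ℝ) → ℝ := fun a => ∫ x in Metric.ball (0 : Sp d) 1, g a x ^ 2 with hQ
  have hQexp : ∀ a, Q a = ∑ i, ∑ j, a i * a j *
      ∫ x in Metric.ball (0 : Sp d) 1, (b i : Sp d → ℝ) x * (b j : Sp d → ℝ) x := by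
    intro a
    have h1 : ∀ x, g a x ^ 2 = ∑ i, ∑ j, a i * a j * ((b i : Sp d → ℝ) x * (b j : Sp d → ℝ) x) := by
      intro x
      rw [hg, sq, Finset.sum_mul_sum]
      exact Finset.sum_congr rfl fun i _ => Finset.sum_congr rfl fun j _ => by ring
    rw [hQ]
    simp only [h1]
    have hij : ∀ i j, IntegrableOn (fun x => a i * a j * ((b i : Sp d → ℝ) x * (b j : Sp d → ℝ) x))
        (Metric.ball (0 : Sp d) 1) := fun i j =>
      hint _ (continuous_const.mul ((hbc i).mul (hbc j)))
    rw [integral_finsetSum _ fun i _ => integrable_finsetSum _ fun j _ => hij i j]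
    refine Finset.sum_congr rfl fun i _ => ?_
    rw [integral_finsetSum _ fun j _ => hij i j]
    exact Finset.sum_congr rfl fun j _ => integral_const_mul _ _
  have hQc : Continuous Q := by
    have : Q = fun a => ∑ i, ∑ j, a i * a j *
      ∫ x in Metric.ball (0 : Sp d) 1, (b i : Sp d → ℝ) x * (b j : Sp d → ℝ) x := funext hQexp
    rw [this]
    fun_prop
  have hQpos : ∀ a, a ≠ 0 → 0 < Q a := by
    intro a ha
    refine lt_of_le_of_ne (integral_nonneg fun x => sq_nonneg _) fun h0 => ha ?_
    have h1 : (fun x => g a x ^ 2) =ᵐ[volume.restrict (Metric.ball (0 : Sp d) 1)] 0 :=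
      (integral_eq_zero_iff_of_nonneg (fun x => sq_nonneg _) (hint _ ((hgc a).pow 2))).1 h0.symm
    have h2 : EqOn (fun x => g a x ^ 2) 0 (Metric.ball (0 : Sp d) 1) :=
      Measure.eqOn_open_of_ae_eq h1 Metric.isOpen_ball ((hgc a).pow 2).continuousOn
        continuousOn_const
    have h3 : g a = 0 := by
      have h4 := (analytic_of_mem_affineFns_pow (hgmem a)).eqOn_zero_of_preconnected_of_eventuallyEq_zero
        isPreconnected_univ (mem_univ (0 : Sp d)) (by
          filter_upwards [Metric.ball_mem_nhds (0 : Sp d) one_pos] with x hx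
          exact pow_eq_zero_iff two_ne_zero |>.1 (h2 hx))
      exact funext fun x => h4 (mem_univ x)
    have h5 : ∑ i, a i • b i = 0 := by
      apply Subtype.ext
      ext x
      have := congrFun h3 x
      simpa [hg, Finset.sum_apply] using this
    exact funext fun i => Fintype.linearIndependent_iff.1 b.linearIndependent a h5 i
  obtain ⟨m, hm0, hm⟩ : ∃ m > 0, ∀ a, m * ‖a‖ ^ 2 ≤ Q a := by
    rcases (Metric.sphere (0 : Fin N → ℝ) 1).eq_empty_or_nonempty with he | hne
    · refine ⟨1, one_pos, fun a => ?_⟩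
      have ha : a = 0 := by
        by_contra hne
        have : ‖a‖⁻¹ • a ∈ Metric.sphere (0 : Fin N → ℝ) 1 := by
          rw [mem_sphere_zero_iff_norm, norm_smul, norm_inv, norm_norm,
            inv_mul_cancel₀ (norm_ne_zero_iff.2 hne)]
        rw [he] at this
        exact this
      rw [ha, norm_zero]
      simpa using integral_nonneg fun x => sq_nonneg (g 0 x)
    · obtain ⟨e, he, hmin⟩ := (isCompact_sphere (0 : Fin N → ℝ) 1).exists_isMinOn hne hQc.continuousOn
      have he0 : e ≠ 0 := by
        rintro rfl
        simp at he
      refine ⟨Q e, hQpos e he0, fun a => ?_⟩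
      by_cases ha : a = 0
      · rw [ha, norm_zero]
        simpa using integral_nonneg fun x => sq_nonneg (g 0 x)
      have hna : ‖a‖ ≠ 0 := norm_ne_zero_iff.2 ha
      have h1 : ‖a‖⁻¹ • a ∈ Metric.sphere (0 : Fin N → ℝ) 1 := by
        rw [mem_sphere_zero_iff_norm, norm_smul, norm_inv, norm_norm, inv_mul_cancel₀ hna]
      have h2 : Q e ≤ Q (‖a‖⁻¹ • a) := hmin h1
      have h3 : Q a = ‖a‖ ^ 2 * Q (‖a‖⁻¹ • a) := by
        rw [hQexp, hQexp, Finset.mul_sum]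
        refine Finset.sum_congr rfl fun i _ => ?_
        rw [Finset.mul_sum]
        refine Finset.sum_congr rfl fun j _ => ?_
        simp only [Pi.smul_apply, smul_eq_mul]
        field_simp
      rw [h3, mul_comm]
      gcongr
  choose B hB0 hB using fun i => show ∃ B : ℝ, 0 ≤ B ∧ ∀ u : Sp d, ‖u‖ ≤ ρ →
      |(b i : Sp d → ℝ) u| ≤ B by
    obtain ⟨B, hB⟩ := (isCompact_closedBall (0 : Sp d) ρ).exists_bound_of_continuousOn
      (hbc i).continuousOn
    exact ⟨max B 0, le_max_right _ _, fun u hu =>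
      (hB u (mem_closedBall_zero_iff.2 hu)).trans (le_max_left _ _)⟩
  have hSB : 0 ≤ ∑ i, B i := Finset.sum_nonneg fun i _ => hB0 i
  refine ⟨((∑ i, B i) ^ 2 + 1) / m, by positivity, fun f hf u hu => ?_⟩
  set a : Fin N → ℝ := fun i => b.repr ⟨f, hf⟩ i with ha
  have hfg : f = g a := by
    have h1 := b.sum_repr ⟨f, hf⟩
    have h2 := congrArg (Subtype.val) h1
    ext x
    have h3 := congrFun h2 x
    simp only [AddSubmonoidClass.coe_finsetSum, Finset.sum_apply] at h3
    rw [← h3]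
    simp [hg, ha]
  have h1 : |g a u| ≤ (∑ i, B i) * ‖a‖ := by
    rw [Finset.sum_mul]
    refine (Finset.abs_sum_le_sum_abs _ _).trans (Finset.sum_le_sum fun i _ => ?_)
    rw [abs_mul, mul_comm]
    exact mul_le_mul (hB i u hu) (norm_le_pi_norm a i) (abs_nonneg _) (hB0 i)
  rw [hfg]
  calc g a u ^ 2 = |g a u| ^ 2 := (sq_abs _).symm
    _ ≤ ((∑ i, B i) * ‖a‖) ^ 2 := by gcongr
    _ ≤ ((∑ i, B i) ^ 2 + 1) / m * (m * ‖a‖ ^ 2) := by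
        rw [← mul_assoc, div_mul_cancel₀ _ hm0.ne', mul_pow]
        gcongr
        linarith
    _ ≤ _ := by gcongr; exact hm a

/-- Inverse inequality: the pointwise values of a polynomial near a ball are controlled by its mean
square on the ball. -/
theorem exists_inverse_inequality (d k : ℕ) (ρ : ℝ) : ∃ C : ℝ, 0 < C ∧
    ∀ q : MvPolynomial (Fin d) ℝ, q.totalDegree ≤ k → ∀ (x : Sp d) (r : ℝ), 0 < r →
      ∀ z : Sp d, ‖z - x‖ ≤ ρ * r →
        MvPolynomial.eval (fun j => z j) q ^ 2 * volume.real (Metric.ball x r) ≤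
          C * ∫ y in Metric.ball x r, MvPolynomial.eval (fun j => y j) q ^ 2 := by
  obtain ⟨C, hC, hCf⟩ := exists_sq_le_integral_sq (d := d) k ρ
  refine ⟨C * (volume.real (Metric.ball (0 : Sp d) 1) + 1), by positivity,
    fun q hq x r hr z hz => ?_⟩
  set f : Sp d → ℝ := fun y => MvPolynomial.eval (fun j => y j) q with hf
  have h1 := hCf _ (comp_mem_affineFns_pow (eval_mem_affineFns_pow hq) x r) (r⁻¹ • (z - x)) (by
    rw [norm_smul, norm_inv, Real.norm_eq_abs, abs_of_pos hr, inv_mul_le_iff₀ hr, mul_comm]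
    exact hz)
  have h2 : x + r • r⁻¹ • (z - x) = z := by
    rw [smul_smul, mul_inv_cancel₀ hr.ne', one_smul, add_sub_cancel]
  have h3 : r ^ d * ∫ u in Metric.ball (0 : Sp d) 1, f (x + r • u) ^ 2 =
      ∫ y in Metric.ball x r, f y ^ 2 := by
    rw [← integral_indicator measurableSet_ball, ← integral_indicator measurableSet_ball]
    set G : Sp d → ℝ := (Metric.ball x r).indicator fun y => f y ^ 2 with hG
    have e1 : (Metric.ball (0 : Sp d) 1).indicator (fun u => f (x + r • u) ^ 2) =
        fun u => (fun w => G (x + w)) (r • u) := by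
      ext u
      simp only [hG, indicator, Metric.mem_ball, dist_eq_norm, sub_zero, add_sub_cancel_left,
        norm_smul, Real.norm_eq_abs, abs_of_pos hr]
      have : ‖u‖ < 1 ↔ r * ‖u‖ < r := by
        constructor
        · intro h; nlinarith
        · intro h; by_contra hcon; nlinarith
      simp only [this]
    rw [e1, Measure.integral_comp_smul volume (fun w => G (x + w)) r, finrank_euclideanSpace_fin,
      integral_add_left_eq_self G x, abs_of_pos (by positivity), smul_eq_mul,
      mul_inv_cancel_left₀ (by positivity)]
  have h4 : volume.real (Metric.ball x r) = r ^ d * volume.real (Metric.ball (0 : Sp d) 1) := by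
    rw [Measure.real, Measure.addHaar_ball_of_pos volume x hr, ENNReal.toReal_mul,
      finrank_euclideanSpace_fin, ENNReal.toReal_ofReal (by positivity)]
    rfl
  simp only [h2] at h1
  rw [h4, ← h3]
  have hI : 0 ≤ ∫ u in Metric.ball (0 : Sp d) 1, f (x + r • u) ^ 2 :=
    integral_nonneg fun u => sq_nonneg _
  have hV : 0 ≤ volume.real (Metric.ball (0 : Sp d) 1) := measureReal_nonneg
  calc f z ^ 2 * (r ^ d * volume.real (Metric.ball (0 : Sp d) 1))
      ≤ (C * ∫ u in Metric.ball (0 : Sp d) 1, f (x + r • u) ^ 2) *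
        (r ^ d * (volume.real (Metric.ball (0 : Sp d) 1) + 1)) := by
        gcongr
        linarith
    _ = _ := by ring

end Polynomial

end EllamFlow

/-! ### Smooth extensions and the pointwise divergence -/

namespace EllamFlow

variable {d : ℕ}

/-- A smooth cutoff function which is `1` near a compact set and vanishes near the complement of an
open neighbourhood. -/
theorem exists_cutoff {K U : Set (Sp d)} (hK : IsCompact K) (hU : IsOpen U) (hKU : K ⊆ U) :
    ∃ χ : Sp d → ℝ, ContDiff ℝ ∞ χ ∧ HasCompactSupport χ ∧ (∀ x ∈ K, χ x = 1) ∧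
      ∀ x ∉ U, χ =ᶠ[𝓝 x] 0 := by
  obtain ⟨r, hr⟩ := hK.isBounded.subset_ball 0
  have hd : Disjoint (U ∩ Metric.ball 0 r)ᶜ K := by
    rw [disjoint_compl_left_iff_subset]
    exact subset_inter hKU hr
  obtain ⟨f, hf0, hf1, -⟩ := exists_contMDiffMap_zero_one_nhds_of_isClosed (n := (⊤ : ℕ∞))
    (modelWithCornersSelf ℝ (Sp d)) (hU.inter Metric.isOpen_ball).isClosed_compl hK.isClosed hd
  rw [eventually_nhdsSet_iff_forall] at hf0
  refine ⟨f, f.contMDiff.contDiff, ?_, fun x hx => hf1.self_of_nhdsSet x hx, fun x hx => ?_⟩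
  · refine HasCompactSupport.intro (isCompact_closedBall (0 : Sp d) r) fun x hx => ?_
    exact (hf0 x fun h => hx (Metric.ball_subset_closedBall h.2)).self_of_nhds
  · exact hf0 x fun h => hx h.1

/-- Compactly supported versions of a positive function and of the quotient of a field by it. -/
theorem exists_extension {D : Set (Sp d)} (hD : Bornology.IsBounded D) {ψ : Sp d → ℝ}
    (hψ : ContDiff ℝ ∞ ψ) {lo : ℝ} (hlo : 0 < lo) (hle : ∀ x ∈ D, lo ≤ ψ x) {W : Sp d → Sp d}
    (hW : ContDiff ℝ ∞ W) : ∃ (w : Sp d → ℝ) (v : Sp d → Sp d), ContDiff ℝ 1 w ∧ ContDiff ℝ 1 v ∧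
      HasCompactSupport w ∧ HasCompactSupport v ∧
      ∀ x ∈ closure D, w x = ψ x ∧ v x = (ψ x)⁻¹ • W x ∧ w x • v x = W x := by
  have hcl : ∀ x ∈ closure D, lo ≤ ψ x := fun x hx =>
    closure_minimal (fun x hx => hle x hx) (isClosed_le continuous_const hψ.continuous) hx
  obtain ⟨χ, hχ, hχc, hχ1, hχ0⟩ := exists_cutoff hD.isCompact_closure
    (isOpen_lt continuous_const hψ.continuous : IsOpen {x | (0 : ℝ) < ψ x})
    (fun x hx => hlo.trans_le (hcl x hx))
  have h1 : (1 : WithTop ℕ∞) ≤ ∞ := by exact_mod_cast le_top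
  refine ⟨fun x => χ x * ψ x, fun x => (χ x * (ψ x)⁻¹) • W x, (hχ.mul hψ).of_le h1, ?_,
    hχc.mul_right, ?_, fun x hx => ?_⟩
  · rw [contDiff_iff_contDiffAt]
    intro x
    -- Where ψ is not positive the cutoff vanishes in a neighbourhood, so the quotient by ψ is
    -- harmless.
    by_cases hx : 0 < ψ x
    · exact (((hχ.contDiffAt).mul (hψ.contDiffAt.inv hx.ne')).smul hW.contDiffAt).of_le h1
    · refine (contDiffAt_const (c := (0 : Sp d))).congr_of_eventuallyEq ?_
      filter_upwards [hχ0 x hx] with y hy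
      simp [hy]
  · exact (hχc.mul_right (f' := fun x => (ψ x)⁻¹)).smul_right
  · have h0 : ψ x ≠ 0 := (hlo.trans_le (hcl x hx)).ne'
    simp [hχ1 x hx, smul_smul, h0]

/-- The divergence of a smooth field, as a trace, is its divergence in the sense of distributions. -/
theorem integral_fderiv_apply_eq {W : Sp d → Sp d} (hW : ContDiff ℝ ∞ W) {ψ : Sp d → ℝ}
    (hψ : ContDiff ℝ ∞ ψ) (hc : HasCompactSupport ψ) :
    ∫ x, fderiv ℝ ψ x (W x) =
      -∫ x, ψ x * LinearMap.trace ℝ (Sp d) (fderiv ℝ W x : Sp d →ₗ[ℝ] Sp d) := by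
  have hne : (∞ : WithTop ℕ∞) ≠ 0 := by simp
  have hψd := hψ.differentiable hne
  have hWd := hW.differentiable hne
  have hψ' := hψ.continuous_fderiv hne
  have hW' := hW.continuous_fderiv hne
  set b := EuclideanSpace.basisFun (Fin d) ℝ with hb
  have hWi : ∀ i, ContDiff ℝ ∞ fun x => W x i := fun i => by fun_prop
  have hdi : ∀ i x, fderiv ℝ (fun x => W x i) x (b i) = (fderiv ℝ W x (b i)) i := by
    intro i x
    have h := ((EuclideanSpace.proj (𝕜 := ℝ) i).hasFDerivAt.comp x (hWd x).hasFDerivAt)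
    have := h.fderiv
    change fderiv ℝ (fun x => W x i) x = _ at this
    rw [this]; rfl
  have e1 : ∀ x, fderiv ℝ ψ x (W x) = ∑ i, W x i * fderiv ℝ ψ x (b i) := by
    intro x
    conv_lhs => rw [← b.sum_repr (W x)]
    simp [map_sum, b]
  have e2 : ∀ x, LinearMap.trace ℝ (Sp d) (fderiv ℝ W x : Sp d →ₗ[ℝ] Sp d) =
      ∑ i, fderiv ℝ (fun x => W x i) x (b i) := by
    intro x
    rw [LinearMap.trace_eq_sum_inner _ b]
    refine Finset.sum_congr rfl fun i _ => ?_
    rw [hdi]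
    simp [b, EuclideanSpace.inner_single_left]
  have i1 : ∀ i, Integrable fun x => W x i * fderiv ℝ ψ x (b i) := fun i =>
    Continuous.integrable_of_hasCompactSupport
      ((hWi i).continuous.mul (hψ'.clm_apply continuous_const))
      (((hc.fderiv_apply ℝ (b i))).mul_left)
  have i2 : ∀ i, Integrable fun x => fderiv ℝ (fun x => W x i) x (b i) * ψ x := fun i =>
    Continuous.integrable_of_hasCompactSupport
      ((((hWi i).continuous_fderiv hne).clm_apply continuous_const).mul hψ.continuous)
      hc.mul_left
  have i3 : ∀ i, Integrable fun x => W x i * ψ x := fun i =>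
    Continuous.integrable_of_hasCompactSupport ((hWi i).continuous.mul hψ.continuous) hc.mul_left
  simp_rw [e1, e2, Finset.mul_sum]
  rw [integral_finsetSum _ fun i _ => i1 i, integral_finsetSum _ fun i _ => by
    simpa only [mul_comm] using i2 i, ← Finset.sum_neg_distrib]
  refine Finset.sum_congr rfl fun i _ => ?_
  rw [integral_mul_fderiv_eq_neg_fderiv_mul_of_integrable (i2 i) (i1 i) (i3 i)
    (fun x _ => (hWi i).differentiable hne x) (fun x _ => hψd x)]
  simp_rw [mul_comm]

theorem continuous_trace_fderiv {W : Sp d → Sp d} (hW : ContDiff ℝ ∞ W) :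
    Continuous fun x => LinearMap.trace ℝ (Sp d) (fderiv ℝ W x : Sp d →ₗ[ℝ] Sp d) := by
  have hne : (∞ : WithTop ℕ∞) ≠ 0 := by simp
  simp_rw [LinearMap.trace_eq_sum_inner _ (EuclideanSpace.basisFun (Fin d) ℝ)]
  exact continuous_finsetSum _ fun i _ =>
    continuous_const.inner ((hW.continuous_fderiv hne).clm_apply continuous_const)

/-- A bound on the distributional divergence is a bound on the trace of the derivative wherever the
field is smooth. -/
theorem IsHdivWith.abs_trace_le {Ω D : Set (Sp d)} {V W : Sp d → Sp d} {g : Sp d → ℝ} {Γ : ℝ}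
    (h : IsHdivWith Ω V g) (hg : ∀ᵐ x ∂(volume.restrict Ω), |g x| ≤ Γ) (hD : IsOpen D)
    (hDΩ : D ⊆ Ω) (hW : ContDiff ℝ ∞ W) (hVW : ∀ x ∈ D, V x = W x) : ∀ x ∈ D,
    |LinearMap.trace ℝ (Sp d) (fderiv ℝ W x : Sp d →ₗ[ℝ] Sp d)| ≤ Γ := by
  set τ : Sp d → ℝ := fun x => LinearMap.trace ℝ (Sp d) (fderiv ℝ W x : Sp d →ₗ[ℝ] Sp d) with hτ
  have hτc : Continuous τ := continuous_trace_fderiv hW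
  have hgl : LocallyIntegrableOn g D volume := by
    intro x hx
    obtain ⟨r, hr, hrD⟩ := Metric.isOpen_iff.1 hD x hx
    refine ⟨Metric.ball x r, mem_nhdsWithin_of_mem_nhds (Metric.ball_mem_nhds x hr), ?_⟩
    have h2 : MemLp g 2 (volume.restrict (Metric.ball x r)) :=
      h.2.1.mono_measure (Measure.restrict_mono_set _ (hrD.trans hDΩ))
    have : IsFiniteMeasure (volume.restrict (Metric.ball x r)) :=
      ⟨by simpa using measure_ball_lt_top⟩
    exact h2.integrable (by norm_num)
  -- On D both g and the trace τ are the distributional divergence, so they agree almost everywhere.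
  -- The bound passes from almost everywhere to everywhere because τ is continuous.
  have hae : ∀ᵐ x, x ∈ D → g x - τ x = 0 := by
    refine hD.ae_eq_zero_of_integral_contDiff_smul_eq_zero
      (hgl.sub (hτc.locallyIntegrable.locallyIntegrableOn D)) fun ψ hψ hψc hψD => ?_
    have hsupp : ∀ x ∉ D, ψ x = 0 := fun x hx =>
      image_eq_zero_of_notMem_tsupport fun h' => hx (hψD h')
    have hgψ : Integrable fun x => ψ x * g x := by
      have := (hgl.integrableOn_compact_subset hψD hψc.isCompact)
      have h3 : IntegrableOn (fun x => ψ x * g x) (tsupport ψ) :=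
        IntegrableOn.continuousOn_mul hψ.continuous.continuousOn this hψc.isCompact
      refine (integrableOn_iff_integrable_of_support_subset ?_).1 h3
      intro x hx
      exact subset_tsupport ψ fun h0 => hx (by simp [h0])
    have hτψ : Integrable fun x => ψ x * τ x :=
      (hψ.continuous.mul hτc).integrable_of_hasCompactSupport hψc.mul_right
    have e1 := h.2.2 ψ hψ hψc (hψD.trans hDΩ)
    have e2 := integral_fderiv_apply_eq hW hψ hψc
    have e3 : ∫ x in Ω, ψ x * g x = ∫ x, ψ x * g x :=
      setIntegral_eq_integral_of_forall_compl_eq_zero fun x hx => by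
        simp [hsupp x fun h' => hx (hDΩ h')]
    have e4 : ∫ x in Ω, fderiv ℝ ψ x (V x) = ∫ x, fderiv ℝ ψ x (W x) := by
      rw [setIntegral_eq_integral_of_forall_compl_eq_zero]
      · refine integral_congr_ae (Eventually.of_forall fun x => ?_)
        by_cases hx : x ∈ D
        · simp [hVW x hx]
        · have : fderiv ℝ ψ x = 0 := fderiv_of_notMem_tsupport ℝ fun h' => hx (hψD h')
          simp [this]
      · intro x hx
        have : fderiv ℝ ψ x = 0 := fderiv_of_notMem_tsupport ℝ fun h' => hx (hDΩ (hψD h'))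
        simp [this]
    simp only [smul_eq_mul, mul_sub]
    rw [integral_sub hgψ hτψ]
    rw [e3, e4, e2] at e1
    linarith
  have hbad : volume (D ∩ {x | Γ < |τ x|}) = 0 := by
    have hg' := ae_restrict_of_ae_restrict_of_subset hDΩ hg
    rw [ae_restrict_iff' hD.measurableSet] at hg'
    refine measure_mono_null (t := {x | ¬ ((x ∈ D → g x - τ x = 0) ∧ (x ∈ D → |g x| ≤ Γ))})
      ?_ (hae.and hg')
    rintro x ⟨hx, hx'⟩ ⟨h1, h2⟩
    have h3 := h2 hx
    rw [sub_eq_zero.1 (h1 hx)] at h3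
    exact absurd h3 (not_le.2 hx')
  intro x hx
  by_contra hcon
  have hopen : IsOpen (D ∩ {x | Γ < |τ x|}) := hD.inter (isOpen_lt continuous_const hτc.abs)
  exact (hopen.measure_pos volume ⟨x, hx, not_le.1 hcon⟩).ne' hbad

end EllamFlow

/-! ### Continuity of the normal flux across an interface -/

namespace EllamFlow

variable {d : ℕ}

/-- A radial, radially decreasing, smooth bump function. -/
theorem exists_radial_bump (d : ℕ) : ∃ (ψ : Sp d → ℝ) (η : ℝ → ℝ), ContDiff ℝ ∞ ψ ∧
    (∀ u, 1 ≤ ‖u‖ → ψ u = 0) ∧ Continuous η ∧ (∀ t, 0 ≤ η t) ∧ (∀ t, 1 ≤ t → η t = 0) ∧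
    (∃ t, 0 < t ∧ 0 < η t) ∧
    ∀ u w, fderiv ℝ ψ u w = -(η (‖u‖ ^ 2) * inner ℝ u w) := by
  have hS : ContDiff ℝ ∞ Real.smoothTransition := Real.smoothTransition.contDiff
  have hSd : Differentiable ℝ Real.smoothTransition := hS.differentiable (by simp)
  refine ⟨fun u => Real.smoothTransition (1 - ‖u‖ ^ 2),
    fun t => 2 * deriv Real.smoothTransition (1 - t), ?_, ?_, ?_, ?_, ?_, ?_, ?_⟩
  · exact hS.comp (contDiff_const.sub (contDiff_norm_sq ℝ))
  · intro u hu
    exact Real.smoothTransition.zero_of_nonpos (by nlinarith)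
  · exact continuous_const.mul ((hS.continuous_deriv (by simp)).comp (by fun_prop))
  · intro t
    exact mul_nonneg zero_le_two Real.smoothTransition.monotone.deriv_nonneg
  · intro t ht
    have : IsLocalMin Real.smoothTransition (1 - t) := Eventually.of_forall fun s => by
      rw [Real.smoothTransition.zero_of_nonpos (by linarith : 1 - t ≤ 0)]
      exact Real.smoothTransition.nonneg s
    simp only [this.deriv_eq_zero, mul_zero]
  · obtain ⟨c, hc, hc'⟩ := exists_deriv_eq_slope Real.smoothTransition zero_lt_one
      hSd.continuous.continuousOn hSd.differentiableOn
    refine ⟨1 - c, by linarith [hc.2], ?_⟩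
    simp [hc']
  · intro u w
    have h1 : HasFDerivAt (fun u : Sp d => 1 - ‖u‖ ^ 2) (-(2 • innerSL ℝ u)) u :=
      (hasStrictFDerivAt_norm_sq u).hasFDerivAt.const_sub 1
    have h2 := (hSd (1 - ‖u‖ ^ 2)).hasDerivAt.comp_hasFDerivAt u h1
    have h3 : fderiv ℝ (fun u : Sp d => Real.smoothTransition (1 - ‖u‖ ^ 2)) u = _ := h2.fderiv
    rw [h3]
    simp
    ring

/-- A field which is constant on both sides of a hyperplane and is divergence-free against a radial
test function has a continuous normal component. -/
theorem inner_eq_of_integral_step_eq_zero {n : Sp d} (hn : ‖n‖ = 1) (A B : Sp d) {η : ℝ → ℝ}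
    (hη : Continuous η) (h0 : ∀ t, 0 ≤ η t) (h1 : ∀ t, 1 ≤ t → η t = 0)
    (hpos : ∃ t, 0 < t ∧ 0 < η t)
    (hint : ∫ u : Sp d, η (‖u‖ ^ 2) * inner ℝ u (if inner ℝ n u < 0 then A else B) = 0) :
    inner ℝ n A = (inner ℝ n B : ℝ) := by
  classical
  set f : Sp d → ℝ := fun u => η (‖u‖ ^ 2) * inner ℝ u (if inner ℝ n u < 0 then A else B) with hf
  have hηc : Continuous fun u : Sp d => η (‖u‖ ^ 2) := hη.comp (by fun_prop)
  have hηs : HasCompactSupport fun u : Sp d => η (‖u‖ ^ 2) := by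
    refine HasCompactSupport.intro (isCompact_closedBall (0 : Sp d) 1) fun u hu => ?_
    refine h1 _ ?_
    rw [mem_closedBall_zero_iff, not_le] at hu
    nlinarith
  have hi : ∀ C : Sp d, Integrable fun u : Sp d => η (‖u‖ ^ 2) * (inner ℝ u C : ℝ) := fun C =>
    (hηc.mul (by fun_prop)).integrable_of_hasCompactSupport hηs.mul_right
  have hmeas : MeasurableSet {u : Sp d | (inner ℝ n u : ℝ) < 0} :=
    measurableSet_lt (by fun_prop) measurable_const
  have hfi : Integrable f := by
    refine (Integrable.piecewise hmeas (hi A).integrableOn (hi B).integrableOn).congr ?_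
    refine Eventually.of_forall fun u => ?_
    simp only [hf, piecewise, mem_ofPred_eq]
    split_ifs <;> rfl
  -- S fixes n·u and reverses the component of u orthogonal to n. Summing over u, Su, −u and −Su
  -- cancels the tangential parts and leaves n·(B − A) times a nonnegative weight of positive
  -- integral.
  let S : Sp d ≃ₗᵢ[ℝ] Sp d := (ℝ ∙ n).reflection
  have hS : ∀ u, S u = (2 * inner ℝ n u : ℝ) • n - u := by
    intro u
    simp only [S, Submodule.reflection_apply, Submodule.starProjection_unit_singleton ℝ hn,
      two_smul, two_mul, add_smul]
  have hnS : ∀ u, (inner ℝ n (S u) : ℝ) = inner ℝ n u := by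
    intro u
    rw [hS, inner_sub_right, inner_smul_right, real_inner_self_eq_norm_sq, hn]
    ring
  have iS : ∀ g : Sp d → ℝ, ∫ u, g (S u) = ∫ u, g u := fun g =>
    S.measurePreserving.integral_comp' (f := S.toMeasurableEquiv) g
  have hfS : Integrable fun u => f (S u) :=
    (S.measurePreserving.integrable_comp_emb S.toMeasurableEquiv.measurableEmbedding).2 hfi
  have hsum : ∀ u, (f u + f (S u)) + (f (-u) + f (S (-u))) =
      2 * (inner ℝ n B - inner ℝ n A) * (η (‖u‖ ^ 2) * |(inner ℝ n u : ℝ)|) := by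
    intro u
    simp only [hf, hnS, S.norm_map, norm_neg, map_neg, inner_neg_right, inner_neg_left]
    simp only [hS, inner_sub_left, inner_smul_left, RCLike.conj_to_real]
    rcases lt_trichotomy (inner ℝ n u : ℝ) 0 with h | h | h
    · rw [if_pos h, if_neg (by linarith), abs_of_neg h]; ring
    · rw [h]; simp
    · rw [if_neg (by linarith), if_pos (by linarith), abs_of_pos h]; ring
  have hI : (0 : ℝ) = 2 * (inner ℝ n B - inner ℝ n A) *
      ∫ u : Sp d, η (‖u‖ ^ 2) * |(inner ℝ n u : ℝ)| := by
    rw [← integral_const_mul]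
    simp_rw [← hsum]
    have hg : Integrable fun u => f u + f (S u) := hfi.add hfS
    have e2 : ∫ u, (f u + f (S u)) = 0 := by
      rw [integral_add hfi hfS, iS f, hint, add_zero]
    rw [integral_add hg hg.comp_neg, integral_neg_eq_self fun u => f u + f (S u), e2, add_zero]
  have hP : 0 < ∫ u : Sp d, η (‖u‖ ^ 2) * |(inner ℝ n u : ℝ)| := by
    obtain ⟨t, ht, htη⟩ := hpos
    have hc : Continuous fun u : Sp d => η (‖u‖ ^ 2) * |(inner ℝ n u : ℝ)| :=
      hηc.mul (by fun_prop)
    refine hc.integral_pos_of_hasCompactSupport_nonneg_nonzero (x := Real.sqrt t • n)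
      hηs.mul_right (fun u => mul_nonneg (h0 _) (abs_nonneg _)) ?_
    rw [norm_smul, hn, mul_one, inner_smul_right, real_inner_self_eq_norm_sq, hn, Real.norm_eq_abs,
      sq_abs, Real.sq_sqrt ht.le]
    have := Real.sqrt_pos.2 ht
    positivity
  have := (mul_eq_zero.1 hI.symm).resolve_right hP.ne'
  linarith

/-- The normal trace of a field in `H_div` is continuous across a flat interface on both sides of
which the field is continuous. -/
theorem HasZeroNormalTrace.inner_eq {Ω : Set (Sp d)} {V Wa Wb : Sp d → Sp d} {g : Sp d → ℝ}
    {Γ : ℝ} (h : HasZeroNormalTrace Ω V g) (hg : ∀ᵐ x ∂(volume.restrict Ω), |g x| ≤ Γ)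
    (hΩ : MeasurableSet Ω)
    (hWa : Continuous Wa) (hWb : Continuous Wb) {n p : Sp d} {c r : ℝ} (hn : ‖n‖ = 1)
    (hp : p ∈ hyperplane n c) (hr : 0 < r)
    (ha : ∀ x ∈ Metric.ball p r, inner ℝ n x < c → x ∈ Ω ∧ V x = Wa x)
    (hb : ∀ x ∈ Metric.ball p r, c < inner ℝ n x → x ∈ Ω ∧ V x = Wb x) :
    inner ℝ n (Wa p) = (inner ℝ n (Wb p) : ℝ) := by
  classical
  obtain ⟨ψ, η, hψ, hψ1, hη, hη0, hη1, hηp, hD⟩ := exists_radial_bump d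
  refine inner_eq_of_integral_step_eq_zero hn (Wa p) (Wb p) hη hη0 hη1 hηp ?_
  have hψd : Differentiable ℝ ψ := hψ.differentiable (by simp)
  have hψc : HasCompactSupport ψ := by
    refine HasCompactSupport.intro (isCompact_closedBall (0 : Sp d) 1) fun u hu => hψ1 u ?_
    rw [mem_closedBall_zero_iff, not_le] at hu
    exact hu.le
  have hmeas : MeasurableSet {u : Sp d | (inner ℝ n u : ℝ) < 0} :=
    measurableSet_lt (by fun_prop) measurable_const
  let W : ℝ → Sp d → Sp d := fun l u => if (inner ℝ n u : ℝ) < 0 then Wa (p + l • u) else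
    Wb (p + l • u)
  -- Blow-up at p with the test functions ψ((x − p)/l). The gradient term of Green's formula has
  -- absolute value l^(d−1)|J l|, while the divergence term is O(l^d). Hence J l = O(l), and its
  -- limit J 0 vanishes.
  let J : ℝ → ℝ := fun l => ∫ u : Sp d, η (‖u‖ ^ 2) * (inner ℝ u (W l u) : ℝ)
  have hJ0 : Tendsto J (𝓝[>] 0) (𝓝 (J 0)) := by
    obtain ⟨Ma, hMa⟩ := (isCompact_closedBall p 1).exists_bound_of_continuousOn hWa.continuousOn
    obtain ⟨Mb, hMb⟩ := (isCompact_closedBall p 1).exists_bound_of_continuousOn hWb.continuousOn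
    have hηc : Continuous fun u : Sp d => η (‖u‖ ^ 2) := hη.comp (by fun_prop)
    have hηs : HasCompactSupport fun u : Sp d => η (‖u‖ ^ 2) := by
      refine HasCompactSupport.intro (isCompact_closedBall (0 : Sp d) 1) fun u hu => ?_
      refine hη1 _ ?_
      rw [mem_closedBall_zero_iff, not_le] at hu
      nlinarith
    refine tendsto_integral_filter_of_dominated_convergence
      (fun u => η (‖u‖ ^ 2) * max Ma Mb) ?_ ?_
      ((hηc.integrable_of_hasCompactSupport hηs).mul_const _) ?_
    · refine Eventually.of_forall fun l => ?_
      have hWm : Measurable (W l) :=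
        Measurable.ite hmeas (hWa.comp (by fun_prop)).measurable (hWb.comp (by fun_prop)).measurable
      exact (hηc.measurable.mul (measurable_id.inner hWm)).aestronglyMeasurable
    · filter_upwards [Ioc_mem_nhdsGT (zero_lt_one (α := ℝ))] with l hl
      refine Eventually.of_forall fun u => ?_
      rw [norm_mul, Real.norm_of_nonneg (hη0 _)]
      by_cases hu : 1 ≤ ‖u‖
      · rw [hη1 _ (by nlinarith)]; simp
      · push Not at hu
        refine mul_le_mul_of_nonneg_left ?_ (hη0 _)
        have hmem : p + l • u ∈ Metric.closedBall p 1 := by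
          rw [mem_closedBall_iff_norm, add_sub_cancel_left, norm_smul, Real.norm_of_nonneg hl.1.le]
          nlinarith [norm_nonneg u, hl.1, hl.2]
        have hW : ‖W l u‖ ≤ max Ma Mb := by
          simp only [W]
          split_ifs
          · exact (hMa _ hmem).trans (le_max_left _ _)
          · exact (hMb _ hmem).trans (le_max_right _ _)
        refine (norm_inner_le_norm _ _).trans ?_
        nlinarith [norm_nonneg u, norm_nonneg (W l u)]
    · refine Eventually.of_forall fun u => ?_
      have hl : Tendsto (fun l : ℝ => W l u) (𝓝[>] 0) (𝓝 (W 0 u)) := by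
        have hc : Continuous fun l : ℝ => W l u := by
          simp only [W]
          split_ifs
          · exact hWa.comp (by fun_prop)
          · exact hWb.comp (by fun_prop)
        exact hc.continuousAt.tendsto.mono_left nhdsWithin_le_nhds
      exact (tendsto_const_nhds.inner hl).const_mul _
  have hJle : ∀ᶠ l in 𝓝[>] (0 : ℝ), |J l| ≤ l * (|Γ| * ∫ u, |ψ u|) := by
    filter_upwards [Ioo_mem_nhdsGT hr] with l hl
    have hl0 : l ≠ 0 := hl.1.ne'
    let ψl : Sp d → ℝ := fun x => ψ (l⁻¹ • (x - p))
    have hψl : ContDiff ℝ ∞ ψl := hψ.comp (by fun_prop)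
    have hout : ∀ x ∉ Metric.ball p r, 1 < ‖l⁻¹ • (x - p)‖ := by
      intro x hx
      rw [mem_ball_iff_norm, not_lt] at hx
      rw [norm_smul, norm_inv, Real.norm_of_nonneg hl.1.le, inv_mul_eq_div, lt_div_iff₀ hl.1]
      linarith [hl.2]
    have hψlc : HasCompactSupport ψl := by
      refine HasCompactSupport.intro (isCompact_closedBall p r) fun x hx => ?_
      exact hψ1 _ (hout x fun h' => hx (Metric.ball_subset_closedBall h')).le
    have hder : ∀ x w, fderiv ℝ ψl x w =
        l⁻¹ * -(η (‖l⁻¹ • (x - p)‖ ^ 2) * inner ℝ (l⁻¹ • (x - p)) w) := by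
      intro x w
      have h1 : HasFDerivAt (fun x : Sp d => l⁻¹ • (x - p)) (l⁻¹ • ContinuousLinearMap.id ℝ _) x :=
        ((hasFDerivAt_id x).sub_const p).const_smul l⁻¹
      have h2 : HasFDerivAt ψl _ x := (hψd _).hasFDerivAt.comp x h1
      rw [h2.fderiv]
      simp only [ContinuousLinearMap.comp_apply, _root_.smul_apply,
        ContinuousLinearMap.id_apply, hD, inner_smul_right]
      ring
    have e1 : ∫ x in Ω, fderiv ℝ ψl x (V x) = |l ^ d| * (-l⁻¹ * J l) := by
      have hae : (fun x => Ω.indicator (fun x => fderiv ℝ ψl x (V x)) x) =ᵐ[volume]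
          fun x => (fun u => -l⁻¹ * (η (‖u‖ ^ 2) * inner ℝ u (W l u))) (l⁻¹ • (x - p)) := by
        have hnull := volume_hyperplane hn c
        rw [measure_eq_zero_iff_ae_notMem] at hnull
        filter_upwards [hnull] with x hx
        have hW : W l (l⁻¹ • (x - p)) = if (inner ℝ n x : ℝ) < c then Wa x else Wb x := by
          have h1 : p + l • l⁻¹ • (x - p) = x := by rw [smul_inv_smul₀ hl0]; abel
          have h2 : (inner ℝ n (l⁻¹ • (x - p)) : ℝ) < 0 ↔ (inner ℝ n x : ℝ) < c := by
            have hp' : (inner ℝ n p : ℝ) = c := hp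
            rw [inner_smul_right, inner_sub_right, hp', inv_mul_eq_div, div_neg_iff]
            constructor
            · rintro (⟨-, h'⟩ | ⟨h', -⟩)
              · exact absurd hl.1 h'.not_gt
              · linarith
            · exact fun h' => Or.inr ⟨by linarith, hl.1⟩
          simp only [W, h1, h2]
        simp only [hW]
        by_cases hxb : x ∈ Metric.ball p r
        · rcases lt_or_gt_of_ne (show (inner ℝ n x : ℝ) ≠ c from hx) with hlt | hgt
          · obtain ⟨hxΩ, hV⟩ := ha x hxb hlt
            rw [indicator_of_mem hxΩ, hder, hV, if_pos hlt]; ring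
          · obtain ⟨hxΩ, hV⟩ := hb x hxb hgt
            rw [indicator_of_mem hxΩ, hder, hV, if_neg hgt.not_gt]; ring
        · have hz : η (‖l⁻¹ • (x - p)‖ ^ 2) = 0 := hη1 _ (by nlinarith [hout x hxb])
          rw [hz]
          by_cases hxΩ : x ∈ Ω
          · rw [indicator_of_mem hxΩ, hder, hz]; ring
          · rw [indicator_of_notMem hxΩ]; ring
      rw [← integral_indicator hΩ, integral_congr_ae hae,
        integral_sub_right_eq_self
          (fun x => (fun u => -l⁻¹ * (η (‖u‖ ^ 2) * inner ℝ u (W l u))) (l⁻¹ • x)) p,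
        Measure.integral_comp_inv_smul volume
          (fun u : Sp d => -l⁻¹ * (η (‖u‖ ^ 2) * inner ℝ u (W l u))), integral_const_mul,
        finrank_euclideanSpace_fin, smul_eq_mul]
    have e2 : |∫ x in Ω, ψl x * g x| ≤ |l ^ d| * (|Γ| * ∫ u, |ψ u|) := by
      have hint : Integrable fun x => |ψl x| * |Γ| :=
        ((hψl.continuous.integrable_of_hasCompactSupport hψlc).abs).mul_const |Γ|
      have s1 : ‖∫ x in Ω, ψl x * g x‖ ≤ ∫ x in Ω, |ψl x| * |Γ| := by
        refine norm_integral_le_of_norm_le hint.integrableOn ?_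
        filter_upwards [hg] with x hx
        rw [Real.norm_eq_abs, abs_mul]
        exact mul_le_mul_of_nonneg_left (hx.trans (le_abs_self _)) (abs_nonneg _)
      refine s1.trans ((setIntegral_le_integral hint (Eventually.of_forall fun x =>
        mul_nonneg (abs_nonneg _) (abs_nonneg _))).trans_eq ?_)
      rw [integral_mul_const, integral_sub_right_eq_self (fun x => |ψ (l⁻¹ • x)|) p,
        Measure.integral_comp_inv_smul volume (fun u : Sp d => |ψ u|),
        finrank_euclideanSpace_fin, smul_eq_mul]
      ring
    have e3 := h ψl hψl hψlc
    rw [e1] at e3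
    rw [eq_neg_of_add_eq_zero_right e3, abs_neg, abs_mul, abs_abs] at e2
    have hld : 0 < |l ^ d| := abs_pos.2 (pow_ne_zero _ hl0)
    have e4 := le_of_mul_le_mul_left e2 hld
    rwa [abs_mul, abs_neg, abs_of_pos (inv_pos.2 hl.1), inv_mul_eq_div, div_le_iff₀ hl.1,
      mul_comm] at e4
  have hJ : J 0 = 0 := by
    have hz : Tendsto (fun l : ℝ => l * (|Γ| * ∫ u, |ψ u|)) (𝓝[>] 0) (𝓝 (0 * (|Γ| * ∫ u, |ψ u|))) :=
      (tendsto_id.mono_left nhdsWithin_le_nhds).mul_const _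
    rw [zero_mul] at hz
    have := le_of_tendsto_of_tendsto hJ0.abs hz hJle
    exact abs_eq_zero.1 (le_antisymm this (abs_nonneg _))
  have : J 0 = ∫ u : Sp d, η (‖u‖ ^ 2) * (inner ℝ u (if inner ℝ n u < 0 then Wa p else Wb p) : ℝ) := by
    simp only [J, W, zero_smul, add_zero]
  rw [← this, hJ]

end EllamFlow

/-! ### The piecewise field of a mesh -/

namespace EllamFlow

variable {d : ℕ}

/-- The sign of ε selects the half-ball, and p is approached along the normal from that side. -/
theorem mem_closure_of_half_ball {n p : Sp d} {c r ε : ℝ} {S : Set (Sp d)} (hn : ‖n‖ = 1)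
    (hp : p ∈ hyperplane n c) (hr : 0 < r) (hε : ε ≠ 0)
    (h : ∀ x ∈ Metric.ball p r, 0 < ((inner ℝ n x : ℝ) - c) * ε → x ∈ S) : p ∈ closure S := by
  have ht : Tendsto (fun t : ℝ => p + (t * ε) • n) (𝓝[>] 0) (𝓝 (p + ((0 : ℝ) * ε) • n)) :=
    (Continuous.tendsto (by fun_prop) 0).mono_left nhdsWithin_le_nhds
  rw [zero_mul, zero_smul, add_zero] at ht
  refine mem_closure_of_tendsto ht ?_
  filter_upwards [ht (Metric.ball_mem_nhds p hr), self_mem_nhdsWithin] with t h1 h2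
  refine h _ h1 ?_
  have hp' : (inner ℝ n p : ℝ) = c := hp
  rw [inner_add_right, inner_smul_right, hp', real_inner_self_eq_norm_sq, hn, add_sub_cancel_left]
  have : 0 < ε * ε := mul_self_pos.2 hε
  have h2' : 0 < t := h2
  nlinarith

theorem trace_fderiv_smul {w : Sp d → ℝ} {v : Sp d → Sp d} {x : Sp d} (hw : DifferentiableAt ℝ w x)
    (hv : DifferentiableAt ℝ v x) :
    LinearMap.trace ℝ (Sp d) (fderiv ℝ (fun y => w y • v y) x : Sp d →ₗ[ℝ] Sp d) =
      fderiv ℝ w x (v x) + w x * LinearMap.trace ℝ (Sp d) (fderiv ℝ v x : Sp d →ₗ[ℝ] Sp d) := by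
  rw [fderiv_fun_smul hw hv]
  have h1 : ((w x • fderiv ℝ v x + (fderiv ℝ w x).smulRight (v x) : Sp d →L[ℝ] Sp d) :
      Sp d →ₗ[ℝ] Sp d) = w x • (fderiv ℝ v x : Sp d →ₗ[ℝ] Sp d) +
        (fderiv ℝ w x : Sp d →ₗ[ℝ] ℝ).smulRight (v x) := rfl
  rw [h1, map_add, map_smul, smul_eq_mul, add_comm]
  congr 1
  simp [LinearMap.trace_smulRight]

namespace PolytopalMesh

variable {Ω : Set (Sp d)} {𝔗 : PolytopalMesh Ω}

/-- Smooth, compactly supported extensions of the restrictions to the elements of the mesh of a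
density `φ` and of a velocity `V / φ`. -/
structure Extension (𝔗 : PolytopalMesh Ω) (k : ℕ) (φlow : ℝ) (φ : Sp d → ℝ) (V : Sp d → Sp d) where
  poly : 𝔗.elements → Fin d → MvPolynomial (Fin d) ℝ
  flux : 𝔗.elements → Sp d → Sp d
  wt : 𝔗.elements → Sp d → ℝ
  vel : 𝔗.elements → Sp d → Sp d
  degree_le : ∀ p i, (poly p i).totalDegree ≤ k
  flux_apply : ∀ p x i, flux p x i = MvPolynomial.eval (fun j => x j) (poly p i)
  flux_contDiff : ∀ p, ContDiff ℝ ∞ (flux p)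
  flux_eq : ∀ p, ∀ x ∈ 𝔗.diamond p.1.1 p.1.2, V x = flux p x
  wt_contDiff : ∀ p, ContDiff ℝ 1 (wt p)
  vel_contDiff : ∀ p, ContDiff ℝ 1 (vel p)
  wt_compact : ∀ p, HasCompactSupport (wt p)
  vel_compact : ∀ p, HasCompactSupport (vel p)
  wt_eq : ∀ p, ∀ x ∈ 𝔗.diamond p.1.1 p.1.2, wt p x = φ x
  vel_eq : ∀ p, ∀ x ∈ 𝔗.diamond p.1.1 p.1.2, vel p x = (φ x)⁻¹ • V x
  le_wt : ∀ p, ∀ x ∈ closure (𝔗.diamond p.1.1 p.1.2), φlow ≤ wt p x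
  smul_eq : ∀ p, ∀ x ∈ closure (𝔗.diamond p.1.1 p.1.2), wt p x • vel p x = flux p x

theorem _root_.EllamFlow.contDiff_mvPolynomial_eval (q : MvPolynomial (Fin d) ℝ) :
    ContDiff ℝ ∞ fun x : Sp d => MvPolynomial.eval (fun j => x j) q := by
  induction q using MvPolynomial.induction_on with
  | C a => simpa using contDiff_const
  | add p q hp hq => simpa using hp.add hq
  | mul_X p i hp =>
    simp only [map_mul, MvPolynomial.eval_X]
    exact hp.mul (by fun_prop)

theorem Arrangement.isBounded_diamond (A : 𝔗.Arrangement) {K σ : Set (Sp d)} (hσ : σ ∈ 𝔗.faces) :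
    Bornology.IsBounded (𝔗.diamond K σ) :=
  isBounded_openCone (A.face_bounded σ hσ) _

theorem Arrangement.diamond_subset_domain (A : 𝔗.Arrangement) {K σ : Set (Sp d)}
    (hK : K ∈ 𝔗.cells) (hσ : σ ∈ 𝔗.facesOf K) : 𝔗.diamond K σ ⊆ Ω :=
  (A.diamond_subset hK hσ).trans (𝔗.cell_subset K hK)

theorem Arrangement.exists_extension (A : 𝔗.Arrangement) {k : ℕ} {φlow φup Γ : ℝ} {φ : Sp d → ℝ}
    {V : Sp d → Sp d} (h : IsAdmissible 𝔗 k φlow φup Γ φ V) :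
    Nonempty (Extension 𝔗 k φlow φ V) := by
  have key : ∀ p : 𝔗.elements, ∃ (q : Fin d → MvPolynomial (Fin d) ℝ) (W : Sp d → Sp d)
      (w : Sp d → ℝ) (v : Sp d → Sp d), (∀ i, (q i).totalDegree ≤ k) ∧
      (∀ x i, W x i = MvPolynomial.eval (fun j => x j) (q i)) ∧ ContDiff ℝ ∞ W ∧
      (∀ x ∈ 𝔗.diamond p.1.1 p.1.2, V x = W x) ∧ ContDiff ℝ 1 w ∧ ContDiff ℝ 1 v ∧
      HasCompactSupport w ∧ HasCompactSupport v ∧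
      (∀ x ∈ 𝔗.diamond p.1.1 p.1.2, w x = φ x) ∧
      (∀ x ∈ 𝔗.diamond p.1.1 p.1.2, v x = (φ x)⁻¹ • V x) ∧
      (∀ x ∈ closure (𝔗.diamond p.1.1 p.1.2), φlow ≤ w x) ∧
      ∀ x ∈ closure (𝔗.diamond p.1.1 p.1.2), w x • v x = W x := by
    rintro ⟨⟨K, σ⟩, hp⟩
    obtain ⟨hK, hσ⟩ := mem_elements.1 hp
    obtain ⟨q, hq, hVq⟩ := h.polynomial K hK σ hσ
    obtain ⟨ψ, hψ, hφψ⟩ := h.smooth K hK σ hσ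
    have hW : ContDiff ℝ ∞ fun x : Sp d =>
        WithLp.toLp 2 fun i => MvPolynomial.eval (fun j => x j) (q i) := by
      rw [contDiff_euclidean]
      exact fun i => contDiff_mvPolynomial_eval (q i)
    have hle : ∀ x ∈ 𝔗.diamond K σ, φlow ≤ ψ x := fun x hx => by
      rw [← hφψ hx]
      exact (h.bounds x (A.diamond_subset_domain hK hσ hx)).1
    obtain ⟨w, v, hw, hv, hwc, hvc, hwv⟩ := EllamFlow.exists_extension
      (A.isBounded_diamond (mem_facesOf.1 hσ).1) hψ h.low_pos hle hW
    have hVW : ∀ x ∈ 𝔗.diamond K σ, V x =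
        WithLp.toLp 2 fun i => MvPolynomial.eval (fun j => x j) (q i) := by
      intro x hx
      ext i
      exact hVq x hx i
    refine ⟨q, _, w, v, hq, fun x i => rfl, hW, hVW, hw, hv, hwc, hvc, fun x hx => ?_,
      fun x hx => ?_, fun x hx => ?_, fun x hx => (hwv x hx).2.2⟩
    · rw [(hwv x (subset_closure hx)).1, hφψ hx]
    · rw [(hwv x (subset_closure hx)).2.1, hφψ hx, hVW x hx]
    · rw [(hwv x hx).1]
      exact closure_minimal (fun x hx => hle x hx) (isClosed_le continuous_const hψ.continuous) hx
  choose q W w v h1 h2 h3 h4 h5 h6 h7 h8 h9 h10 h11 h12 using key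
  exact ⟨⟨q, W, w, v, h1, h2, h3, h4, h5, h6, h7, h8, h9, h10, h11, h12⟩⟩

/-- The piecewise field `V / φ` on the elements of the mesh. -/
def Arrangement.field (A : 𝔗.Arrangement) (hd : 1 ≤ d) {k : ℕ} {φlow φup Γ : ℝ} {φ : Sp d → ℝ}
    {V : Sp d → Sp d} (h : IsAdmissible 𝔗 k φlow φup Γ φ V) (hΓ : 0 ≤ Γ)
    (X : Extension 𝔗 k φlow φ V) : PiecewiseField d 𝔗.elements A.planes where
  dom := Ω
  piece p := 𝔗.diamond p.1.1 p.1.2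
  vel := X.vel
  wt := X.wt
  nrm q := q.1.1
  lev q := q.1.2
  lo := φlow
  up := φup
  Γ := Γ
  dom_bounded := 𝔗.domain_polytopal.isBounded
  piece_open p := A.isOpen_diamond (mem_elements.1 p.2).1 (mem_elements.1 p.2).2
  piece_subset p := A.diamond_subset_domain (mem_elements.1 p.2).1 (mem_elements.1 p.2).2
  piece_disjoint p q hpq := A.diamond_disjoint (mem_elements.1 p.2).1 (mem_elements.1 p.2).2
    (mem_elements.1 q.2).1 (mem_elements.1 q.2).2 fun he => hpq (Subtype.ext he)
  frontier_piece p := by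
    refine (A.frontier_diamond_subset (mem_elements.1 p.2).1 (mem_elements.1 p.2).2).trans ?_
    exact iUnion₂_subset fun q hq => subset_iUnion
      (fun q : A.planes => hyperplane q.1.1 q.1.2) ⟨q, hq⟩
  dom_subset := (A.domain_subset hd).trans (union_subset_union_right _ (iUnion₂_subset fun q hq =>
    subset_iUnion (fun q : A.planes => hyperplane q.1.1 q.1.2) ⟨q, hq⟩))
  norm_nrm q := A.norm_plane q.1 q.2
  vel_contDiff := X.vel_contDiff
  vel_compact := X.vel_compact
  wt_contDiff := X.wt_contDiff
  wt_compact := X.wt_compact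
  lo_pos := h.low_pos
  up_pos := h.up_pos
  Γ_nonneg := hΓ
  wt_mem p x hx := by
    rw [X.wt_eq p x hx]
    exact h.bounds x (A.diamond_subset_domain (mem_elements.1 p.2).1 (mem_elements.1 p.2).2 hx)
  -- On the element `wt • vel` is the polynomial field V, so by the product rule the weighted
  -- divergence is the divergence of V; only its lower bound −Γ is used.
  div_ge p x hx := by
    obtain ⟨hK, hσ⟩ := mem_elements.1 p.2
    have ho := A.isOpen_diamond hK hσ
    obtain ⟨g, hg, hgΓ, -⟩ := h.div
    have h1 := hg.abs_trace_le hgΓ ho (A.diamond_subset_domain hK hσ) (X.flux_contDiff p)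
      (X.flux_eq p) x hx
    have h2 : (fun y => X.wt p y • X.vel p y) =ᶠ[𝓝 x] X.flux p := by
      filter_upwards [ho.mem_nhds hx] with y hy using X.smul_eq p y (subset_closure hy)
    rw [← trace_fderiv_smul ((X.wt_contDiff p).differentiable one_ne_zero x)
      ((X.vel_contDiff p).differentiable one_ne_zero x), h2.fderiv_eq]
    exact (abs_le.1 h1).1
  flux_eq q a b p r hr hp ha hb := by
    have hn := A.norm_plane q.1 q.2
    obtain ⟨g, hg, hgΓ, hz⟩ := h.div
    have hpa : p ∈ closure (𝔗.diamond a.1.1 a.1.2) :=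
      mem_closure_of_half_ball hn hp hr (neg_ne_zero.2 one_ne_zero) fun x hx h' =>
        ha x hx (by linarith)
    have hpb : p ∈ closure (𝔗.diamond b.1.1 b.1.2) :=
      mem_closure_of_half_ball hn hp hr one_ne_zero fun x hx h' => hb x hx (by linarith)
    rw [← inner_smul_right, ← inner_smul_right, X.smul_eq a p hpa, X.smul_eq b p hpb]
    refine hz.inner_eq hgΓ 𝔗.domain_polytopal.isOpen.measurableSet (X.flux_contDiff a).continuous
      (X.flux_contDiff b).continuous hn hp hr (fun x hx h' => ?_) fun x hx h' => ?_
    · have := ha x hx h'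
      exact ⟨A.diamond_subset_domain (mem_elements.1 a.2).1 (mem_elements.1 a.2).2 this,
        X.flux_eq a x this⟩
    · have := hb x hx h'
      exact ⟨A.diamond_subset_domain (mem_elements.1 b.2).1 (mem_elements.1 b.2).2 this,
        X.flux_eq b x this⟩

end PolytopalMesh

end EllamFlow

/-! ### Faces as interfaces between cells -/

namespace EllamFlow

variable {d : ℕ}

/-- A hyperplane which is contained in another one near a point is equal to it. -/
theorem hyperplane_eq_of_local {n m p : Sp d} {c e r : ℝ} (hn : ‖n‖ = 1) (hm : ‖m‖ = 1)
    (hp : p ∈ hyperplane n c) (hp' : p ∈ hyperplane m e) (hr : 0 < r)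
    (h : ∀ x ∈ Metric.ball p r, x ∈ hyperplane n c → x ∈ hyperplane m e) :
    hyperplane n c = hyperplane m e := by
  have hpc : (inner ℝ n p : ℝ) = c := hp
  have hpe : (inner ℝ m p : ℝ) = e := hp'
  have hnn : (inner ℝ n n : ℝ) = 1 := by rw [real_inner_self_eq_norm_sq, hn, one_pow]
  have hmm : (inner ℝ m m : ℝ) = 1 := by rw [real_inner_self_eq_norm_sq, hm, one_pow]
  have hperp : ∀ v : Sp d, (inner ℝ n v : ℝ) = 0 → (inner ℝ m v : ℝ) = 0 := by
    intro v hv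
    set t := r / (2 * (‖v‖ + 1)) with ht
    have ht0 : 0 < t := by positivity
    have hmem : p + t • v ∈ Metric.ball p r := by
      rw [mem_ball_iff_norm, add_sub_cancel_left, norm_smul, Real.norm_of_nonneg ht0.le, ht,
        div_mul_eq_mul_div, div_lt_iff₀ (by positivity)]
      nlinarith [norm_nonneg v]
    have h1 : (inner ℝ m (p + t • v) : ℝ) = e := h _ hmem (by
      change (inner ℝ n (p + t • v) : ℝ) = c
      rw [inner_add_right, inner_smul_right, hv, hpc, mul_zero, add_zero])
    rw [inner_add_right, inner_smul_right, hpe] at h1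
    have h2 : t * (inner ℝ m v : ℝ) = 0 := by linarith
    exact (mul_eq_zero.1 h2).resolve_left ht0.ne'
  set s : ℝ := inner ℝ n m with hs
  have hw : (inner ℝ n (m - s • n) : ℝ) = 0 := by
    rw [inner_sub_right, inner_smul_right, hnn, ← hs]; ring
  have hw' := hperp _ hw
  have hwz : m = s • n := by
    rw [← sub_eq_zero, ← inner_self_eq_zero (𝕜 := ℝ), inner_sub_left, inner_smul_left, hw, hw']
    simp
  have hs0 : s ≠ 0 := by
    rintro h0
    rw [h0, zero_smul] at hwz
    rw [hwz] at hm
    simp at hm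
  ext x
  change (inner ℝ n x : ℝ) = c ↔ (inner ℝ m x : ℝ) = e
  rw [← hpe, ← hpc, hwz, inner_smul_left, inner_smul_left]
  simp [hs0]

namespace PolytopalMesh

variable {Ω : Set (Sp d)} {𝔗 : PolytopalMesh Ω}

theorem mem_interiorFaces_of_ne {K L σ : Set (Sp d)} (hσ : σ ∈ 𝔗.faces) (hK : K ∈ 𝔗.cellsOf σ)
    (hL : L ∈ 𝔗.cellsOf σ) (hKL : K ≠ L) : σ ∈ 𝔗.interiorFaces := by
  refine mem_interiorFaces.2 ⟨hσ, ?_⟩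
  rcases 𝔗.face_location σ hσ with h | h
  · exact h.1
  · have : (𝔗.cellsOf σ).card = 1 := by
      unfold cellsOf
      convert h.2
    exact absurd (Finset.card_le_one.1 this.le K hK L hL) hKL

theorem card_cellsOf {σ : Set (Sp d)} (hσ : σ ∈ 𝔗.interiorFaces) : (𝔗.cellsOf σ).card = 2 := by
  obtain ⟨hσ, hσΩ⟩ := mem_interiorFaces.1 hσ
  rcases 𝔗.face_location σ hσ with h | h
  · unfold cellsOf
    convert h.2
  · obtain ⟨p, hp⟩ := (𝔗.face_polytopal σ hσ).1
    have h1 := h.1 hp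
    rw [𝔗.domain_polytopal.isOpen.frontier_eq] at h1
    exact absurd (hσΩ hp) h1.2

theorem eq_pair_of_ne {K L σ : Set (Sp d)} (hσ : σ ∈ 𝔗.interiorFaces) (hK : K ∈ 𝔗.cellsOf σ)
    (hL : L ∈ 𝔗.cellsOf σ) (hKL : K ≠ L) : ∀ M ∈ 𝔗.cellsOf σ, M = K ∨ M = L := by
  classical
  have h : ({K, L} : Finset (Set (Sp d))) = 𝔗.cellsOf σ := by
    refine Finset.eq_of_subset_of_card_le ?_ ?_
    · intro M hM
      rcases Finset.mem_insert.1 hM with rfl | hM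
      · exact hK
      · rwa [Finset.mem_singleton.1 hM]
    · rw [card_cellsOf hσ, Finset.card_pair hKL]
  intro M hM
  rw [← h] at hM
  simpa using hM

theorem mem_cellsOf_iff {K σ : Set (Sp d)} (hσ : σ ∈ 𝔗.faces) :
    K ∈ 𝔗.cellsOf σ ↔ K ∈ 𝔗.cells ∧ σ ∈ 𝔗.facesOf K := by
  rw [mem_cellsOf, mem_facesOf]; tauto

namespace Arrangement

/-- At a point of the boundary of a cell which lies on only one hyperplane of the arrangement, this
hyperplane is the hyperplane of a face through this point. -/
theorem exists_face_of_isolated (A : 𝔗.Arrangement) {K : Set (Sp d)} (hK : K ∈ 𝔗.cells) {p m : Sp d}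
    {e r : ℝ} (hm : ‖m‖ = 1) (hr : 0 < r) (hp : p ∈ hyperplane m e) (hpK : p ∈ frontier K)
    (hiso : ∀ x ∈ Metric.ball p r, ∀ q ∈ A.planes, x ∈ hyperplane q.1 q.2 → x ∈ hyperplane m e) :
    ∃ σ ∈ 𝔗.facesOf K, p ∈ σ ∧ hyperplane (A.nrm σ) (A.lev σ) = hyperplane m e := by
  obtain ⟨σ, hσ, hpσ⟩ := exists_face_of_mem_frontier hK hpK
  have hσ' := (mem_facesOf.1 hσ).1
  have hpH : p ∈ hyperplane (A.nrm σ) (A.lev σ) :=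
    closure_minimal (A.face_subset σ hσ') (isClosed_hyperplane _ _) hpσ
  have heq := hyperplane_eq_of_local (A.norm_nrm σ hσ') hm hpH hp hr
    fun x hx => hiso x hx _ (A.face_mem σ hσ')
  refine ⟨σ, hσ, ?_, heq⟩
  -- Were p on the relative boundary of σ, a lateral hyperplane through p and the centre would
  -- coincide with the hyperplane of σ, which avoids the centre.
  by_contra hcon
  obtain ⟨q, hq, h1, h2⟩ := A.lateral K hK σ hσ p ⟨hpσ, hcon⟩
  have heq' := hyperplane_eq_of_local (A.norm_plane q hq) hm (show p ∈ hyperplane q.1 q.2 from h1)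
    hp hr fun x hx => hiso x hx q hq
  have h3 : 𝔗.center K ∈ hyperplane q.1 q.2 := h2
  rw [heq', ← heq] at h3
  exact A.center_ne K hK σ hσ h3

/-- Two elements of different cells which are separated by a hyperplane near a point lie on both
sides of an internal face. -/
theorem exists_interface (A : 𝔗.Arrangement) {m p : Sp d} {e r : ℝ} (hm : ‖m‖ = 1) (hr : 0 < r)
    (hp : p ∈ hyperplane m e)
    (hiso : ∀ x ∈ Metric.ball p r, ∀ q ∈ A.planes, x ∈ hyperplane q.1 q.2 → x ∈ hyperplane m e)
    {a b : 𝔗.elements} (hab : a.1.1 ≠ b.1.1)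
    (ha : ∀ x ∈ Metric.ball p r, inner ℝ m x < e → x ∈ 𝔗.diamond a.1.1 a.1.2)
    (hb : ∀ x ∈ Metric.ball p r, e < inner ℝ m x → x ∈ 𝔗.diamond b.1.1 b.1.2) :
    p ∈ a.1.2 ∧ a.1.2 = b.1.2 ∧ a.1.2 ∈ 𝔗.interiorFaces ∧
      hyperplane m e = hyperplane (A.nrm a.1.2) (A.lev a.1.2) := by
  obtain ⟨⟨K, σa⟩, hae⟩ := a
  obtain ⟨⟨L, σb⟩, hbe⟩ := b
  obtain ⟨hK, hσa⟩ := mem_elements.1 hae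
  obtain ⟨hL, hσb⟩ := mem_elements.1 hbe
  simp only at hab ha hb hK hL hσa hσb ⊢
  have hKL := 𝔗.cell_disjoint K hK L hL hab
  have hpK : p ∈ closure K := closure_mono (A.diamond_subset hK hσa)
    (mem_closure_of_half_ball hm hp hr (neg_ne_zero.2 one_ne_zero) fun x hx h' =>
      ha x hx (by linarith))
  have hpL : p ∈ closure L := closure_mono (A.diamond_subset hL hσb)
    (mem_closure_of_half_ball hm hp hr one_ne_zero fun x hx h' => hb x hx (by linarith))
  have hpK' : p ∈ frontier K := by
    rw [(isOpen_cell hK).frontier_eq]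
    exact ⟨hpK, fun h' => disjoint_left.1 (hKL.closure_right (isOpen_cell hK)) h' hpL⟩
  have hpL' : p ∈ frontier L := by
    rw [(isOpen_cell hL).frontier_eq]
    exact ⟨hpL, fun h' => disjoint_left.1 (hKL.closure_left (isOpen_cell hL)) hpK h'⟩
  -- Near p, the cone over a face through p that lies in the given hyperplane fills a half-ball, so
  -- it meets one of the two given elements and, elements being disjoint, equals it.
  have key : ∀ M ∈ 𝔗.cells, ∀ σ ∈ 𝔗.facesOf M, p ∈ σ →
      hyperplane (A.nrm σ) (A.lev σ) = hyperplane m e →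
      (M, σ) = (K, σa) ∨ (M, σ) = (L, σb) := by
    intro M hM σ hσ hpσ heq
    have hσ' := (mem_facesOf.1 hσ).1
    obtain ⟨t, ht, htD⟩ := A.half_ball_subset hM hσ hpσ
    have hcl := mem_closure_of_half_ball (A.norm_nrm σ hσ') (A.face_subset σ hσ' hpσ) ht
      (sub_ne_zero.2 (A.center_ne M hM σ hσ)) (S := 𝔗.diamond M σ \ hyperplane m e)
      fun x hx hpos => ⟨htD x hx hpos, fun hxm => by
        rw [← heq] at hxm
        rw [show (inner ℝ (A.nrm σ) x : ℝ) = A.lev σ from hxm, sub_self, zero_mul] at hpos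
        exact lt_irrefl _ hpos⟩
    obtain ⟨x, hx, hxD, hxm⟩ := mem_closure_iff_nhds.1 hcl _ (Metric.ball_mem_nhds p hr)
    rcases lt_or_gt_of_ne (show (inner ℝ m x : ℝ) ≠ e from hxm) with hlt | hgt
    · left
      by_contra hne
      exact disjoint_left.1 (A.diamond_disjoint hM hσ hK hσa hne) hxD (ha x hx hlt)
    · right
      by_contra hne
      exact disjoint_left.1 (A.diamond_disjoint hM hσ hL hσb hne) hxD (hb x hx hgt)
  obtain ⟨σ, hσ, hpσ, heqσ⟩ := A.exists_face_of_isolated hK hm hr hp hpK' hiso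
  obtain ⟨τ, hτ, hpτ, heqτ⟩ := A.exists_face_of_isolated hL hm hr hp hpL' hiso
  have h1 : σ = σa := by
    rcases key K hK σ hσ hpσ heqσ with h | h
    · exact (Prod.mk.inj h).2
    · exact absurd (Prod.mk.inj h).1 hab
  have h2 : τ = σb := by
    rcases key L hL τ hτ hpτ heqτ with h | h
    · exact absurd (Prod.mk.inj h).1.symm hab
    · exact (Prod.mk.inj h).2
  subst h1 h2
  have hσ' := (mem_facesOf.1 hσ).1
  have hστ : σ = τ := by
    by_contra hne
    exact disjoint_left.1 (𝔗.face_disjoint σ hσ' τ (mem_facesOf.1 hτ).1 hne) hpσ hpτ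
  subst hστ
  exact ⟨hpσ, rfl, mem_interiorFaces_of_ne hσ' ((mem_cellsOf_iff hσ').2 ⟨hK, hσ⟩)
    ((mem_cellsOf_iff hσ').2 ⟨hL, hτ⟩) hab, heqσ.symm⟩

end Arrangement

/-- A bound on the normal flux of `V` through a face, in terms of the `L²` norm of `V` on the
elements with this face. -/
def fluxBound (𝔗 : PolytopalMesh Ω) (C : ℝ) (V : Sp d → Sp d) (σ : Set (Sp d)) : ℝ :=
  Real.sqrt ((C * ∑ K ∈ 𝔗.cellsOf σ, ∫ x in 𝔗.diamond K σ, ‖V x‖ ^ 2) /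
    ∑ K ∈ 𝔗.cellsOf σ, volume.real (𝔗.diamond K σ))

theorem Arrangement.volume_diamond_pos (A : 𝔗.Arrangement) {K σ : Set (Sp d)} (hK : K ∈ 𝔗.cells)
    (hσ : σ ∈ 𝔗.facesOf K) : 0 < volume.real (𝔗.diamond K σ) := by
  refine ENNReal.toReal_pos ((A.isOpen_diamond hK hσ).measure_pos volume (diamond_nonempty hσ)).ne' ?_
  exact (A.isBounded_diamond (mem_facesOf.1 hσ).1).measure_lt_top.ne

theorem Arrangement.sum_volume_pos (A : 𝔗.Arrangement) {σ : Set (Sp d)} (hσ : σ ∈ 𝔗.interiorFaces) :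
    0 < ∑ K ∈ 𝔗.cellsOf σ, volume.real (𝔗.diamond K σ) := by
  have hσ' := (mem_interiorFaces.1 hσ).1
  refine Finset.sum_pos (fun K hK => ?_) (Finset.card_pos.1 (by rw [card_cellsOf hσ]; norm_num))
  obtain ⟨h1, h2⟩ := (mem_cellsOf_iff hσ').1 hK
  exact A.volume_diamond_pos h1 h2

/-- The faces of a mesh separate the values of a piecewise-constant function. -/
theorem Arrangement.separates (A : 𝔗.Arrangement) (hd : 1 ≤ d) {k : ℕ} {φlow φup Γ : ℝ}
    {φ : Sp d → ℝ} {V : Sp d → Sp d} (h : IsAdmissible 𝔗 k φlow φup Γ φ V) (hΓ : 0 ≤ Γ)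
    (X : Extension 𝔗 k φlow φ V) {C : ℝ}
    (hX : ∀ a : 𝔗.elements, ∀ z ∈ a.1.2, (inner ℝ (A.nrm a.1.2) (X.flux a z) : ℝ) ^ 2 *
      volume.real (𝔗.diamond a.1.1 a.1.2) ≤ C * ∫ x in 𝔗.diamond a.1.1 a.1.2, ‖V x‖ ^ 2)
    (val : Set (Sp d) → ℝ) (Δ : Set (Sp d) → ℝ) (hΔ0 : ∀ σ, 0 ≤ Δ σ)
    (hΔ : ∀ σ ∈ 𝔗.interiorFaces, ∀ K ∈ 𝔗.cellsOf σ, ∀ L ∈ 𝔗.cellsOf σ, |val K - val L| ≤ Δ σ) :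
    (A.field hd h hΓ X).Separates (fun a => val a.1.1) (α := 𝔗.interiorFaces) (fun e => e.1)
      (fun e => ⟨(A.nrm e.1, A.lev e.1), A.face_mem e.1 (mem_interiorFaces.1 e.2).1⟩)
      (fun e => Δ e.1) (fun e => 𝔗.fluxBound C V e.1 / φlow) where
  jump_nonneg e := hΔ0 e.1
  speed_nonneg e := div_nonneg (Real.sqrt_nonneg _) h.low_pos.le
  exists_face := by
    intro j a b p r hr hp hiso ha hb hval
    have hm := A.norm_plane j.1 j.2
    have hab : a.1.1 ≠ b.1.1 := fun h' => hval (by simp only [h'])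
    obtain ⟨hpa, hσ, hint, heq⟩ := A.exists_interface hm hr hp
      (fun x hx q hq hxq => hiso x hx ⟨q, hq⟩ hxq) hab ha hb
    have hσ' := (mem_interiorFaces.1 hint).1
    have hKa : a.1.1 ∈ 𝔗.cellsOf a.1.2 := (mem_cellsOf_iff hσ').2 (mem_elements.1 a.2)
    have hKb : b.1.1 ∈ 𝔗.cellsOf a.1.2 := by
      rw [mem_cellsOf_iff hσ', hσ]
      exact mem_elements.1 b.2
    have hpcl : ∀ c : 𝔗.elements, c.1.2 = a.1.2 → p ∈ closure (𝔗.diamond c.1.1 c.1.2) := by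
      intro c hc
      obtain ⟨hL, hσc⟩ := mem_elements.1 c.2
      have hpc : p ∈ c.1.2 := hc ▸ hpa
      obtain ⟨t, ht, htD⟩ := A.half_ball_subset hL hσc hpc
      exact mem_closure_of_half_ball (A.norm_nrm _ (mem_facesOf.1 hσc).1)
        (A.face_subset _ (mem_facesOf.1 hσc).1 hpc) ht
        (sub_ne_zero.2 (A.center_ne _ hL _ hσc)) htD
    have hflux : (inner ℝ j.1.1 (X.flux a p) : ℝ) = inner ℝ j.1.1 (X.flux b p) := by
      have h1 := (A.field hd h hΓ X).flux_eq j a b p r hr hp ha hb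
      have h2 : X.wt a p * inner ℝ j.1.1 (X.vel a p) = X.wt b p * inner ℝ j.1.1 (X.vel b p) := h1
      rwa [← inner_smul_right, ← inner_smul_right, X.smul_eq a p (hpcl a rfl),
        X.smul_eq b p (hpcl b hσ.symm)] at h2
    have hsq : ∀ c : 𝔗.elements, (inner ℝ j.1.1 (X.flux c p) : ℝ) ^ 2 =
        inner ℝ (A.nrm a.1.2) (X.flux c p) ^ 2 := by
      intro c
      rcases eq_or_eq_neg_of_hyperplane_eq hm (A.norm_nrm _ hσ') heq with h' | h'
      · rw [h'.1]
      · rw [h'.1, inner_neg_left, neg_sq]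
    set q : ℝ := inner ℝ j.1.1 (X.flux a p) with hq
    -- Both elements see the same normal flux q up to sign, so the two inequalities `hX` can be
    -- added. Dividing by the total volume of the two cones matches the later bound of |σ| d_σ by
    -- that same volume.
    have hqle : |q| ≤ 𝔗.fluxBound C V a.1.2 := by
      refine Real.abs_le_sqrt ?_
      rw [le_div_iff₀ (A.sum_volume_pos hint), Finset.mul_sum, Finset.mul_sum]
      refine Finset.sum_le_sum fun M hM => ?_
      rcases eq_pair_of_ne hint hKa hKb hab M hM with rfl | rfl
      · rw [hq, hsq]
        exact hX a p hpa
      · have h3 := hX b p (hσ ▸ hpa)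
        rw [hflux, hsq, hσ]
        exact h3
    have hspeed : ∀ c : 𝔗.elements, c.1.2 = a.1.2 → (inner ℝ j.1.1 (X.flux c p) : ℝ) = q →
        |(inner ℝ j.1.1 (X.vel c p) : ℝ)| ≤ 𝔗.fluxBound C V a.1.2 / φlow := by
      intro c hc hcq
      rw [le_div_iff₀ h.low_pos]
      refine le_trans ?_ hqle
      have h1 := X.le_wt c p (hpcl c hc)
      rw [← hcq, ← X.smul_eq c p (hpcl c hc), inner_smul_right, abs_mul,
        abs_of_pos (h.low_pos.trans_le h1), mul_comm]
      gcongr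
    exact ⟨⟨a.1.2, hint⟩, heq, hpa, hΔ _ hint _ hKa _ hKb, hspeed a rfl rfl,
      hspeed b hσ.symm hflux.symm⟩

end PolytopalMesh

end EllamFlow

/-! ### Flux bounds, geometry of the faces and the Cauchy–Schwarz inequality -/

namespace EllamFlow

namespace PolytopalMesh

variable {d : ℕ} {Ω : Set (Sp d)} {𝔗 : PolytopalMesh Ω}

/-- The pointwise bound of the normal flux by the `L²` norm of `V` on an element, with a constant
which depends only on the degree, the dimension and the regularity of the mesh. -/
theorem exists_flux_bound (d k : ℕ) (ϱ : ℝ) : ∃ C : ℝ, 0 < C ∧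
    ∀ (Ω : Set (Sp d)) (𝔗 : PolytopalMesh Ω) (A : 𝔗.Arrangement), 𝔗.regularity ≤ ϱ →
    ∀ (φlow : ℝ) (φ : Sp d → ℝ) (V : Sp d → Sp d) (X : Extension 𝔗 k φlow φ V),
      MemLp V 2 (volume.restrict Ω) → ∀ a : 𝔗.elements, ∀ z ∈ a.1.2,
        (inner ℝ (A.nrm a.1.2) (X.flux a z) : ℝ) ^ 2 * volume.real (𝔗.diamond a.1.1 a.1.2) ≤
          C * ∫ x in 𝔗.diamond a.1.1 a.1.2, ‖V x‖ ^ 2 := by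
  -- An element has diameter at most 2ϱr with r the radius of an inscribed ball, so its closure is
  -- within this multiple of r from the centre of the ball. The absolute value and the 1 keep the
  -- constant positive for every real ϱ.
  obtain ⟨C, hC, hCq⟩ := exists_inverse_inequality d k (2 * |ϱ| + 1)
  refine ⟨C * (2 * |ϱ| + 1) ^ d, by positivity, fun Ω 𝔗 A hϱ φlow φ V X hV a z hz => ?_⟩
  obtain ⟨hK, hσ⟩ := mem_elements.1 a.2
  have hσ' := (mem_facesOf.1 hσ).1
  obtain ⟨-, -, x, r, hr, hball, hdiam⟩ := A.exists_ball_of_regularity hϱ hK hσ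
  set D := 𝔗.diamond a.1.1 a.1.2 with hD
  set n := A.nrm a.1.2 with hn
  have hn1 : ‖n‖ = 1 := A.norm_nrm _ hσ'
  have hbdd : Bornology.IsBounded D := A.isBounded_diamond hσ'
  have hdiam' : Metric.diam D ≤ (2 * |ϱ| + 1) * r := by
    refine hdiam.trans (mul_le_mul_of_nonneg_right ?_ hr.le)
    linarith [le_abs_self ϱ]
  have hxD : x ∈ D := hball (Metric.mem_ball_self hr)
  have hclose : ∀ y ∈ closure D, ‖y - x‖ ≤ (2 * |ϱ| + 1) * r := by
    intro y hy
    rw [← dist_eq_norm]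
    refine (Metric.dist_le_diam_of_mem hbdd.closure hy (subset_closure hxD)).trans ?_
    rwa [Metric.diam_closure]
  have hzD : z ∈ closure D := by
    obtain ⟨t, ht, htD⟩ := A.half_ball_subset hK hσ hz
    exact mem_closure_of_half_ball hn1 (A.face_subset _ hσ' hz) ht
      (sub_ne_zero.2 (A.center_ne _ hK _ hσ)) htD
  set q : MvPolynomial (Fin d) ℝ := ∑ i, MvPolynomial.C (n i) * X.poly a i with hq
  have hqd : q.totalDegree ≤ k := by
    refine MvPolynomial.totalDegree_finsetSum_le fun i _ => ?_
    refine (MvPolynomial.totalDegree_mul _ _).trans ?_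
    rw [MvPolynomial.totalDegree_C, zero_add]
    exact X.degree_le a i
  have hqe : ∀ y : Sp d, MvPolynomial.eval (fun j => y j) q = inner ℝ n (X.flux a y) := by
    intro y
    rw [hq, map_sum, PiLp.inner_apply]
    refine Finset.sum_congr rfl fun i _ => ?_
    rw [map_mul, MvPolynomial.eval_C, ← X.flux_apply a y i]
    simp [mul_comm]
  have h1 := hCq q hqd x r hr z (hclose z hzD)
  simp only [hqe] at h1
  have hint : IntegrableOn (fun x => ‖V x‖ ^ 2) D :=
    (hV.integrable_norm_pow two_ne_zero).mono_measure
      (Measure.restrict_mono_set _ (A.diamond_subset_domain hK hσ))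
  have h2 : ∫ y in Metric.ball x r, (inner ℝ n (X.flux a y) : ℝ) ^ 2 ≤ ∫ y in D, ‖V y‖ ^ 2 := by
    refine le_trans (setIntegral_mono_on ?_ (hint.mono_set hball) measurableSet_ball fun y hy => ?_)
      (setIntegral_mono_set hint (Eventually.of_forall fun y => sq_nonneg _)
        (LE.le.eventuallyLE hball))
    · have hc : Continuous fun y => (inner ℝ n (X.flux a y) : ℝ) ^ 2 :=
        (continuous_const.inner (X.flux_contDiff a).continuous).pow 2
      exact (hc.continuousOn.integrableOn_compact (isCompact_closedBall x r)).mono_set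
        Metric.ball_subset_closedBall
    · rw [X.flux_eq a y (hball hy), ← sq_abs]
      have := abs_real_inner_le_norm n (X.flux a y)
      rw [hn1, one_mul] at this
      gcongr
  have h3 : volume.real D ≤ (2 * |ϱ| + 1) ^ d * volume.real (Metric.ball x r) := by
    have hsub : D ⊆ Metric.closedBall x ((2 * |ϱ| + 1) * r) := fun y hy => by
      rw [mem_closedBall_iff_norm]
      exact hclose y (subset_closure hy)
    refine (measureReal_mono hsub measure_closedBall_lt_top.ne).trans_eq ?_
    rw [measureReal_def, measureReal_def, Measure.addHaar_closedBall _ _ (by positivity),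
      Measure.addHaar_ball_of_pos _ _ hr, ENNReal.toReal_mul, ENNReal.toReal_mul,
      ENNReal.toReal_ofReal (by positivity), ENNReal.toReal_ofReal (by positivity),
      finrank_euclideanSpace_fin, mul_pow, mul_assoc]
  calc (inner ℝ n (X.flux a z) : ℝ) ^ 2 * volume.real D
      ≤ (inner ℝ n (X.flux a z) : ℝ) ^ 2 * ((2 * |ϱ| + 1) ^ d * volume.real (Metric.ball x r)) := by
        gcongr
    _ = (2 * |ϱ| + 1) ^ d * ((inner ℝ n (X.flux a z) : ℝ) ^ 2 * volume.real (Metric.ball x r)) := by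
        ring
    _ ≤ (2 * |ϱ| + 1) ^ d * (C * ∫ y in D, ‖V y‖ ^ 2) := by
        exact mul_le_mul_of_nonneg_left (h1.trans (mul_le_mul_of_nonneg_left h2 hC.le)) (by positivity)
    _ = _ := by ring

namespace Arrangement

variable {K σ : Set (Sp d)}

/-- The area is controlled by the finite volume of the cone, with the regularity of the mesh itself
as parameter. Finiteness is needed because `faceMeasure` would be 0 for a face of infinite measure.
-/
theorem measure_face_lt_top (A : 𝔗.Arrangement) (hK : K ∈ 𝔗.cells) (hσ : σ ∈ 𝔗.facesOf K) :
    (Measure.euclideanHausdorffMeasure (d - 1) : Measure (Sp d)) σ < ⊤ := by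
  have hσ' := (mem_facesOf.1 hσ).1
  obtain ⟨h0, h1, -⟩ := A.exists_ball_of_regularity le_rfl hK hσ
  rw [A.cellFaceDist_eq hσ'] at h1
  have h := measure_base_le (A.norm_nrm σ hσ') (A.center_ne K hK σ hσ) (A.face_subset σ hσ')
    (A.face_open σ hσ') (A.face_bounded σ hσ') h0 h1
  have hfin : volume (openCone (𝔗.center K) σ) < ⊤ := (A.isBounded_diamond hσ').measure_lt_top
  have hδ : 0 < |(inner ℝ (A.nrm σ) (𝔗.center K) : ℝ) - A.lev σ| / 4 :=
    div_pos (abs_pos.2 (sub_ne_zero.2 (A.center_ne K hK σ hσ))) four_pos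
  have h2 := h.trans_lt (ENNReal.mul_lt_top (ENNReal.pow_lt_top ENNReal.ofReal_lt_top) hfin)
  by_contra hcon
  rw [not_lt, top_le_iff] at hcon
  rw [hcon, ENNReal.mul_top (ENNReal.ofReal_pos.2 hδ).ne'] at h2
  exact lt_irrefl _ h2

/-- The area of a face times its distance to the center is controlled by the volume of the cone. -/
theorem faceMeasure_mul_le (A : 𝔗.Arrangement) {ϱ : ℝ} (hϱ : 𝔗.regularity ≤ ϱ) (hK : K ∈ 𝔗.cells)
    (hσ : σ ∈ 𝔗.facesOf K) :
    faceMeasure σ * 𝔗.cellFaceDist K σ ≤ 4 * (3 + 4 * ϱ) ^ d * volume.real (𝔗.diamond K σ) := by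
  have hσ' := (mem_facesOf.1 hσ).1
  obtain ⟨h0, h1, -⟩ := A.exists_ball_of_regularity hϱ hK hσ
  rw [A.cellFaceDist_eq hσ'] at h1 ⊢
  have h := measure_base_le (A.norm_nrm σ hσ') (A.center_ne K hK σ hσ) (A.face_subset σ hσ')
    (A.face_open σ hσ') (A.face_bounded σ hσ') h0 h1
  have hfin : volume (openCone (𝔗.center K) σ) < ⊤ := (A.isBounded_diamond hσ').measure_lt_top
  have h2 := ENNReal.toReal_mono
    (ENNReal.mul_lt_top (ENNReal.pow_lt_top ENNReal.ofReal_lt_top) hfin).ne h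
  rw [ENNReal.toReal_mul, ENNReal.toReal_mul, ENNReal.toReal_pow,
    ENNReal.toReal_ofReal (by positivity), ENNReal.toReal_ofReal (by positivity)] at h2
  change |(inner ℝ (A.nrm σ) (𝔗.center K) : ℝ) - A.lev σ| / 4 * faceMeasure σ ≤
    (3 + 4 * ϱ) ^ d * volume.real (𝔗.diamond K σ) at h2
  linarith

theorem faceMeasure_mul_faceDist_le (A : 𝔗.Arrangement) {ϱ : ℝ} (hϱ : 𝔗.regularity ≤ ϱ)
    (hσ : σ ∈ 𝔗.faces) : faceMeasure σ * 𝔗.faceDist σ ≤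
      4 * (3 + 4 * ϱ) ^ d * ∑ K ∈ 𝔗.cellsOf σ, volume.real (𝔗.diamond K σ) := by
  rw [faceDist, Finset.mul_sum, Finset.mul_sum]
  refine Finset.sum_le_sum fun K hK => ?_
  obtain ⟨h1, h2⟩ := (mem_cellsOf_iff hσ).1 hK
  exact A.faceMeasure_mul_le hϱ h1 h2

theorem faceDist_pos (A : 𝔗.Arrangement) (hσ : σ ∈ 𝔗.interiorFaces) : 0 < 𝔗.faceDist σ := by
  have hσ' := (mem_interiorFaces.1 hσ).1
  refine Finset.sum_pos (fun K hK => ?_) (Finset.card_pos.1 (by rw [card_cellsOf hσ]; norm_num))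
  obtain ⟨h1, h2⟩ := (mem_cellsOf_iff hσ').1 hK
  exact A.cellFaceDist_pos h1 h2

theorem sum_setIntegral_le (A : 𝔗.Arrangement) {g : Sp d → ℝ} (hg : IntegrableOn g Ω)
    (h0 : ∀ x, 0 ≤ g x) :
    ∑ σ ∈ 𝔗.interiorFaces, ∑ K ∈ 𝔗.cellsOf σ, ∫ x in 𝔗.diamond K σ, g x ≤ ∫ x in Ω, g x := by
  have hle : ∑ σ ∈ 𝔗.interiorFaces, ∑ K ∈ 𝔗.cellsOf σ, ∫ x in 𝔗.diamond K σ, g x ≤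
      ∑ σ ∈ 𝔗.faces, ∑ K ∈ 𝔗.cellsOf σ, ∫ x in 𝔗.diamond K σ, g x :=
    Finset.sum_le_sum_of_subset_of_nonneg (fun σ hσ => (mem_interiorFaces.1 hσ).1) fun σ _ _ =>
      Finset.sum_nonneg fun K _ => setIntegral_nonneg_of_ae (Eventually.of_forall h0)
  refine hle.trans ?_
  rw [← Finset.sum_finset_product_right' 𝔗.elements 𝔗.faces 𝔗.cellsOf fun p => by
    rw [mem_elements, mem_facesOf, mem_cellsOf]; tauto]
  rw [← integral_biUnion_finset]
  · refine setIntegral_mono_set hg (Eventually.of_forall h0) (LE.le.eventuallyLE ?_)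
    exact iUnion₂_subset fun p hp => A.diamond_subset_domain (mem_elements.1 hp).1
      (mem_elements.1 hp).2
  · exact fun p hp => (A.isOpen_diamond (mem_elements.1 hp).1 (mem_elements.1 hp).2).measurableSet
  · exact fun p hp q hq hpq => A.diamond_disjoint (mem_elements.1 hp).1 (mem_elements.1 hp).2
      (mem_elements.1 hq).1 (mem_elements.1 hq).2 hpq
  · exact fun p hp => hg.mono_set (A.diamond_subset_domain (mem_elements.1 hp).1
      (mem_elements.1 hp).2)

end Arrangement

/-- The jump of a piecewise-constant function across a face. -/
def jump (𝔗 : PolytopalMesh Ω) (f : Sp d → ℝ) (σ : Set (Sp d)) : ℝ :=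
  Real.sqrt (1 / 2 * ∑ K ∈ 𝔗.cellsOf σ, ∑ L ∈ 𝔗.cellsOf σ, (𝔗.cellValue f K - 𝔗.cellValue f L) ^ 2)

theorem abs_sub_le_jump (f : Sp d → ℝ) {K L σ : Set (Sp d)} (hK : K ∈ 𝔗.cellsOf σ)
    (hL : L ∈ 𝔗.cellsOf σ) : |𝔗.cellValue f K - 𝔗.cellValue f L| ≤ 𝔗.jump f σ := by
  classical
  refine Real.abs_le_sqrt ?_
  by_cases hKL : K = L
  · rw [hKL, sub_self]
    have := Finset.sum_nonneg fun K (_ : K ∈ 𝔗.cellsOf σ) => Finset.sum_nonneg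
      fun L (_ : L ∈ 𝔗.cellsOf σ) => sq_nonneg (𝔗.cellValue f K - 𝔗.cellValue f L)
    linarith
  · rw [← Finset.sum_product' (𝔗.cellsOf σ) (𝔗.cellsOf σ)
      fun K L => (𝔗.cellValue f K - 𝔗.cellValue f L) ^ 2]
    have hsub : ({(K, L), (L, K)} : Finset (Set (Sp d) × Set (Sp d))) ⊆
        𝔗.cellsOf σ ×ˢ 𝔗.cellsOf σ := by
      intro p hp
      rcases Finset.mem_insert.1 hp with rfl | hp
      · exact Finset.mk_mem_product hK hL
      · rw [Finset.mem_singleton.1 hp]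
        exact Finset.mk_mem_product hL hK
    have h := Finset.sum_le_sum_of_subset_of_nonneg
      (f := fun p : Set (Sp d) × Set (Sp d) => (𝔗.cellValue f p.1 - 𝔗.cellValue f p.2) ^ 2) hsub
      fun p _ _ => sq_nonneg _
    rw [Finset.sum_pair fun h' => hKL (Prod.mk.inj h').1] at h
    simp only at h
    have e : (𝔗.cellValue f L - 𝔗.cellValue f K) ^ 2 = (𝔗.cellValue f K - 𝔗.cellValue f L) ^ 2 := by
      ring
    linarith

theorem seminorm_eq (A : 𝔗.Arrangement) (f : Sp d → ℝ) :
    𝔗.seminorm f = Real.sqrt (∑ σ ∈ 𝔗.interiorFaces,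
      faceMeasure σ / 𝔗.faceDist σ * 𝔗.jump f σ ^ 2) := by
  unfold seminorm
  congr 1
  refine Finset.sum_congr rfl fun σ hσ => ?_
  have hd := A.faceDist_pos hσ
  rw [jump, Real.sq_sqrt]
  · simp only [Finset.mul_sum]
    refine Finset.sum_congr rfl fun K _ => Finset.sum_congr rfl fun L _ => ?_
    rw [sq_abs]
    field_simp
  · exact mul_nonneg (by norm_num) (Finset.sum_nonneg fun K _ => Finset.sum_nonneg fun L _ =>
      sq_nonneg _)

/-- The sum over the faces of the jumps times the bounds on the fluxes. -/
theorem sum_jump_mul_flux_le (A : 𝔗.Arrangement) {ϱ C : ℝ} (hϱ : 𝔗.regularity ≤ ϱ) (hC : 0 ≤ C)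
    {V : Sp d → Sp d} (hV : MemLp V 2 (volume.restrict Ω)) (f : Sp d → ℝ) :
    ∑ σ ∈ 𝔗.interiorFaces, 𝔗.jump f σ * 𝔗.fluxBound C V σ * faceMeasure σ ≤
      Real.sqrt (C * (4 * (3 + 4 * |ϱ|) ^ d)) * (eLpNorm V 2 (volume.restrict Ω)).toReal *
        𝔗.seminorm f := by
  have hm : ∀ σ : Set (Sp d), 0 ≤ faceMeasure σ := fun σ => measureReal_nonneg
  have hint : IntegrableOn (fun x => ‖V x‖ ^ 2) Ω := hV.integrable_norm_pow two_ne_zero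
  have hnorm : (eLpNorm V 2 (volume.restrict Ω)).toReal = Real.sqrt (∫ x in Ω, ‖V x‖ ^ 2) := by
    rw [hV.eLpNorm_eq_integral_rpow_norm two_ne_zero ENNReal.ofNat_ne_top,
      ENNReal.toReal_ofReal (by positivity), Real.sqrt_eq_rpow]
    norm_num
  have hCS : ∑ σ ∈ 𝔗.interiorFaces, 𝔗.jump f σ * 𝔗.fluxBound C V σ * faceMeasure σ ≤
      Real.sqrt (∑ σ ∈ 𝔗.interiorFaces, faceMeasure σ / 𝔗.faceDist σ * 𝔗.jump f σ ^ 2) *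
      Real.sqrt (∑ σ ∈ 𝔗.interiorFaces,
        faceMeasure σ * 𝔗.faceDist σ * 𝔗.fluxBound C V σ ^ 2) := by
    -- The weights |σ|/d_σ for the jumps and |σ| d_σ for the fluxes have geometric mean |σ|; the
    -- first sum is the squared seminorm.
    have h := Real.sum_mul_le_sqrt_mul_sqrt 𝔗.interiorFaces
      (fun σ => Real.sqrt (faceMeasure σ / 𝔗.faceDist σ) * 𝔗.jump f σ)
      (fun σ => Real.sqrt (faceMeasure σ * 𝔗.faceDist σ) * 𝔗.fluxBound C V σ)
    convert h using 1
    · refine Finset.sum_congr rfl fun σ hσ => ?_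
      have hd := A.faceDist_pos hσ
      have e : Real.sqrt (faceMeasure σ / 𝔗.faceDist σ) *
          Real.sqrt (faceMeasure σ * 𝔗.faceDist σ) = faceMeasure σ := by
        rw [← Real.sqrt_mul (div_nonneg (hm σ) hd.le)]
        have : faceMeasure σ / 𝔗.faceDist σ * (faceMeasure σ * 𝔗.faceDist σ) =
          faceMeasure σ ^ 2 := by field_simp
        rw [this, Real.sqrt_sq (hm σ)]
      conv_lhs => rw [← e]
      ring
    · congr 2
      · refine Finset.sum_congr rfl fun σ hσ => ?_
        rw [mul_pow, Real.sq_sqrt (div_nonneg (hm σ) (A.faceDist_pos hσ).le)]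
      · refine Finset.sum_congr rfl fun σ hσ => ?_
        rw [mul_pow, Real.sq_sqrt (mul_nonneg (hm σ) (A.faceDist_pos hσ).le)]
  have hflux : ∑ σ ∈ 𝔗.interiorFaces, faceMeasure σ * 𝔗.faceDist σ * 𝔗.fluxBound C V σ ^ 2 ≤
      C * (4 * (3 + 4 * |ϱ|) ^ d) * ∫ x in Ω, ‖V x‖ ^ 2 := by
    refine le_trans ?_ (mul_le_mul_of_nonneg_left
      (A.sum_setIntegral_le hint fun x => sq_nonneg _) (by positivity))
    rw [Finset.mul_sum]
    refine Finset.sum_le_sum fun σ hσ => ?_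
    have hS := A.sum_volume_pos hσ
    have h1 := A.faceMeasure_mul_faceDist_le (hϱ.trans (le_abs_self ϱ)) (mem_interiorFaces.1 hσ).1
    set S := ∑ K ∈ 𝔗.cellsOf σ, volume.real (𝔗.diamond K σ) with hSd
    have hN : 0 ≤ ∑ K ∈ 𝔗.cellsOf σ, ∫ x in 𝔗.diamond K σ, ‖V x‖ ^ 2 :=
      Finset.sum_nonneg fun K _ => setIntegral_nonneg_of_ae (Eventually.of_forall fun x =>
        sq_nonneg _)
    rw [fluxBound, Real.sq_sqrt (div_nonneg (mul_nonneg hC hN) hS.le)]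
    refine (mul_le_mul_of_nonneg_right h1 (div_nonneg (mul_nonneg hC hN) hS.le)).trans_eq ?_
    field_simp
  rw [seminorm_eq A, hnorm, ← Real.sqrt_mul (by positivity)]
  refine hCS.trans ?_
  rw [mul_comm]
  gcongr

end PolytopalMesh

end EllamFlow

/-! ### Time reversal and conclusion -/

namespace EllamFlow

variable {d : ℕ}

/-- A flow of a piecewise field maps almost every point into the pieces. -/
theorem PiecewiseField.ae_flow_mem_piece {ι κ : Type} [Fintype ι] [Fintype κ]
    (P : PiecewiseField d ι κ) {s : ℝ} (hs : 0 ≤ s) {F : ℝ → Sp d → Sp d}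
    (hF : ∀ᵐ x ∂(volume.restrict P.dom), F 0 x = x ∧ P.IsTraj s fun t => F t x) :
    ∀ᵐ x ∂(volume.restrict P.dom), ∃ i, F s x ∈ P.piece i := by
  have hnull : volume (P.reach s (P.dom \ ⋃ i, P.piece i)) = 0 := by
    have := P.volume_reach_le hs (A := P.dom \ ⋃ i, P.piece i) sdiff_subset
    rw [P.volume_dom_diff_pieces, mul_zero] at this
    exact le_antisymm this bot_le
  filter_upwards [hF, ae_restrict_of_ae (measure_eq_zero_iff_ae_notMem.1 hnull)] with x hx hx'
  by_contra hcon
  refine hx' ⟨fun t => F t x, hx.2, hx.1, hx.2.2.1 s ⟨hs, le_rfl⟩, fun h => hcon ?_⟩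
  exact mem_iUnion.1 h

/-- A piecewise-constant function is measurable along a flow. -/
theorem PiecewiseField.aemeasurable_comp_flow {ι κ : Type} [Fintype ι] [Fintype κ]
    (P : PiecewiseField d ι κ) {s : ℝ} (hs : 0 ≤ s) {F : ℝ → Sp d → Sp d}
    (hF : ∀ᵐ x ∂(volume.restrict P.dom), F 0 x = x ∧ P.IsTraj s fun t => F t x)
    {val : ι → ℝ} {f : Sp d → ℝ} (hf : ∀ i, ∀ x ∈ P.piece i, f x = val i) :
    AEMeasurable (fun x => f (F s x)) (volume.restrict P.dom) := by
  classical
  let g : Sp d → ℝ := fun x => ∑ i, (P.piece i).indicator (fun _ => val i) x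
  have hg : Measurable g := Finset.measurable_sum _ fun i _ =>
    measurable_const.indicator (P.piece_open i).measurableSet
  refine (hg.comp_aemeasurable (P.aemeasurable_flow hs F hF)).congr ?_
  filter_upwards [P.ae_flow_mem_piece hs hF] with x hx
  obtain ⟨i, hi⟩ := hx
  change g (F s x) = f (F s x)
  simp only [g]
  rw [hf i _ hi, Finset.sum_eq_single i]
  · exact indicator_of_mem hi _
  · intro j _ hji
    exact indicator_of_notMem (fun hj => disjoint_left.1 (P.piece_disjoint hji) hj hi) _
  · exact fun h => absurd (Finset.mem_univ i) h

/-- The assumptions are symmetric under V ↦ −V, and t ↦ F(−t) is a flow of −V/φ; this reduces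
negative times to positive ones. -/
theorem IsAdmissible.neg {Ω : Set (Sp d)} {𝔗 : PolytopalMesh Ω} {k : ℕ} {φlow φup Γ : ℝ}
    {φ : Sp d → ℝ} {V : Sp d → Sp d} (h : IsAdmissible 𝔗 k φlow φup Γ φ V) :
    IsAdmissible 𝔗 k φlow φup Γ φ (-V) where
  low_pos := h.low_pos
  up_pos := h.up_pos
  bounds := h.bounds
  smooth := h.smooth
  polynomial K hK σ hσ := by
    obtain ⟨p, hp, hV⟩ := h.polynomial K hK σ hσ
    refine ⟨-p, fun i => ?_, fun x hx i => ?_⟩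
    · rw [Pi.neg_apply, MvPolynomial.totalDegree_neg]
      exact hp i
    · rw [Pi.neg_apply, Pi.neg_apply, map_neg, ← hV x hx i]
      rfl
  div := by
    obtain ⟨g, ⟨h1, h2, h3⟩, h4, h5⟩ := h.div
    refine ⟨-g, ⟨h1.neg, h2.neg, fun ψ a b c => ?_⟩, ?_, fun ψ a b => ?_⟩
    · have := h3 ψ a b c
      simp only [Pi.neg_apply, map_neg, mul_neg, integral_neg]
      rw [this]
    · filter_upwards [h4] with x hx
      rwa [Pi.neg_apply, abs_neg]
    · have := h5 ψ a b
      simp only [Pi.neg_apply, map_neg, mul_neg, integral_neg]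
      linarith

theorem IsFlow.neg {Ω G : Set (Sp d)} {φ : Sp d → ℝ} {V : Sp d → Sp d} {T : ℝ}
    {F : ℝ → Sp d → Sp d} (h : IsFlow Ω G φ V T F) :
    IsFlow Ω G φ (-V) T fun t => F (-t) := by
  filter_upwards [h] with x hx
  obtain ⟨h0, h1, ⟨L, hL⟩, N, hN, hd⟩ := hx
  have hmem : ∀ t ∈ Icc (-T) T, -t ∈ Icc (-T) T := fun t ht => ⟨by linarith [ht.2], by
    linarith [ht.1]⟩
  refine ⟨by rwa [neg_zero], fun t ht => h1 _ (hmem t ht), ⟨L, fun s hs t ht => ?_⟩,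
    Neg.neg ⁻¹' N, hN.preimage neg_injective, fun t ht => ?_⟩
  · simpa using hL (hmem s hs) (hmem t ht)
  · obtain ⟨h2, h3⟩ := hd (-t) ⟨⟨by linarith [ht.1.2], by linarith [ht.1.1]⟩, ht.2⟩
    refine ⟨h2, ?_⟩
    have := h3.scomp t (hasDerivAt_neg t)
    simpa [Function.comp_def] using this

namespace PolytopalMesh

variable {Ω : Set (Sp d)} {𝔗 : PolytopalMesh Ω}

theorem Arrangement.isTraj_of_isFlow (A : 𝔗.Arrangement) (hd : 1 ≤ d) {k : ℕ} {φlow φup Γ : ℝ}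
    {φ : Sp d → ℝ} {V : Sp d → Sp d} (h : IsAdmissible 𝔗 k φlow φup Γ φ V) (hΓ : 0 ≤ Γ)
    (X : Extension 𝔗 k φlow φ V) {T : ℝ} {F : ℝ → Sp d → Sp d}
    (hF : IsFlow Ω 𝔗.diamondUnion φ V T F) {s : ℝ} (hs0 : 0 ≤ s) (hsT : s ≤ T) :
    ∀ᵐ x ∂(volume.restrict Ω), F 0 x = x ∧ (A.field hd h hΓ X).IsTraj s fun t => F t x := by
  filter_upwards [hF] with x hx
  obtain ⟨h0, h1, ⟨L, hL⟩, N, hN, hder⟩ := hx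
  have hsub : Icc 0 s ⊆ Icc (-T) T := Icc_subset_Icc (by linarith) hsT
  refine ⟨h0, hL.continuousOn.mono hsub, fun t ht => h1 t (hsub ht), N, hN, fun t ht => ?_⟩
  obtain ⟨h2, h3⟩ := hder t ⟨⟨by linarith [ht.1.1], ht.1.2.trans_le hsT⟩, ht.2⟩
  obtain ⟨K, hK, h2⟩ := mem_iUnion₂.1 h2
  obtain ⟨σ, hσ, h2⟩ := mem_iUnion₂.1 h2
  refine ⟨⟨(K, σ), mem_elements.2 ⟨hK, hσ⟩⟩, h2, ?_⟩
  change HasDerivAt _ (X.vel ⟨(K, σ), _⟩ (F t x)) t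
  rwa [X.vel_eq _ _ h2]

theorem Arrangement.volume_prism_eq (A : 𝔗.Arrangement) {K σ : Set (Sp d)} (hK : K ∈ 𝔗.cells)
    (hσ : σ ∈ 𝔗.facesOf K) {a : ℝ} (ha : 0 ≤ a) :
    volume {x : Sp d | |inner ℝ (A.nrm σ) x - A.lev σ| ≤ a ∧
      x - (inner ℝ (A.nrm σ) x - A.lev σ) • A.nrm σ ∈ σ} =
      ENNReal.ofReal (2 * a * faceMeasure σ) := by
  have hσ' := (mem_facesOf.1 hσ).1
  rw [volume_prism (A.norm_nrm σ hσ')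
    (measurableSet_of_rel_open (A.face_subset σ hσ') (A.face_open σ hσ')) (A.face_subset σ hσ'),
    ENNReal.ofReal_mul (show 0 ≤ 2 * a by positivity), faceMeasure, measureReal_def,
    ENNReal.ofReal_toReal (A.measure_face_lt_top hK hσ).ne]

/-- The translation estimate for nonnegative times. -/
theorem exists_translation_bound (d : ℕ) (hd : 1 ≤ d) (k : ℕ) (ϱ : ℝ) : ∃ R : ℝ, 0 < R ∧
    ∀ (Ω : Set (Sp d)) (𝔗 : PolytopalMesh Ω), 𝔗.regularity ≤ ϱ →
    ∀ (φlow φup Γ : ℝ) (φ : Sp d → ℝ) (V : Sp d → Sp d), IsAdmissible 𝔗 k φlow φup Γ φ V →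
    ∀ (T : ℝ) (F : ℝ → Sp d → Sp d), IsFlow Ω 𝔗.diamondUnion φ V T F →
    ∀ s, 0 ≤ s → s ≤ T → ∀ f : Sp d → ℝ, 𝔗.IsPiecewiseConstant f →
      IntegrableOn (fun x => f (F s x) - f x) Ω ∧
      ∫ x in Ω, |f (F s x) - f x| ≤ R * (flowConst φlow φup Γ T / φlow) * s *
        (eLpNorm V 2 (volume.restrict Ω)).toReal * 𝔗.seminorm f := by
  obtain ⟨C, hC, hCb⟩ := exists_flux_bound d k ϱ
  -- The factor 2 is that of the two-sided prisms; the root collects the flux constant and the bound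
  -- of |σ| d_σ by the volume of the cones.
  set R : ℝ := 2 * Real.sqrt (C * (4 * (3 + 4 * |ϱ|) ^ d)) with hR
  refine ⟨R, by positivity, fun Ω 𝔗 hϱ φlow φup Γ φ V h T F hF s hs0 hsT f hf => ?_⟩
  obtain ⟨A⟩ := exists_arrangement 𝔗
  obtain ⟨X⟩ := A.exists_extension h
  obtain ⟨g, ⟨hV, -, -⟩, hgΓ, -⟩ := h.div
  have hlo := h.low_pos
  have hup := h.up_pos
  -- Γ ≥ 0 is not assumed and can be deduced only from a point of Ω, so the empty domain is treated
  -- apart.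
  rcases Ω.eq_empty_or_nonempty with rfl | hΩ
  · simp only [integrableOn_empty, Measure.restrict_empty, integral_zero_measure, true_and]
    refine mul_nonneg (mul_nonneg (mul_nonneg (mul_nonneg (by positivity) ?_) hs0)
      ENNReal.toReal_nonneg) (Real.sqrt_nonneg _)
    exact div_nonneg (mul_nonneg (div_nonneg hup.le hlo.le) (Real.exp_pos _).le) hlo.le
  have hΓ : 0 ≤ Γ := by
    have : NeZero (volume.restrict Ω) := ⟨by
      rw [Ne, Measure.restrict_eq_zero]
      exact (𝔗.domain_polytopal.isOpen.measure_pos volume hΩ).ne'⟩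
    obtain ⟨x, hx⟩ := hgΓ.exists
    exact (abs_nonneg _).trans hx
  set P := A.field hd h hΓ X with hP
  have htraj : ∀ᵐ x ∂(volume.restrict P.dom), F 0 x = x ∧ P.IsTraj s fun t => F t x :=
    A.isTraj_of_isFlow hd h hΓ X hF hs0 hsT
  have hval : ∀ a : 𝔗.elements, ∀ x ∈ P.piece a, f x = 𝔗.cellValue f a.1.1 := by
    intro a x hx
    obtain ⟨hK, hσ⟩ := mem_elements.1 a.2
    obtain ⟨c, hc⟩ := hf a.1.1 hK
    rw [hc x (A.diamond_subset hK hσ hx), cellValue, hc _ (𝔗.center_mem _ hK)]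
  have hS := A.separates hd h hΓ X (hCb Ω 𝔗 A hϱ φlow φ V X hV) (𝔗.cellValue f) (𝔗.jump f)
    (fun σ => Real.sqrt_nonneg _) fun σ _ K hK L hL => abs_sub_le_jump f hK hL
  have hc : P.up / P.lo * Real.exp (P.Γ / P.lo * s) ≤ flowConst φlow φup Γ T := by
    change φup / φlow * Real.exp (Γ / φlow * s) ≤ φup / φlow * Real.exp (Γ * T / φlow)
    gcongr
    rw [div_mul_eq_mul_div]
    gcongr
  have hc0 : 0 ≤ flowConst φlow φup Γ T :=
    mul_nonneg (div_nonneg hup.le hlo.le) (Real.exp_pos _).le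
  have hlint := hS.lintegral_translation_le (m := fun e => faceMeasure e.1)
    (fun e => measureReal_nonneg) (fun e a ha => by
      have hcard := card_cellsOf e.2
      obtain ⟨K, hK⟩ := Finset.card_pos.1 (hcard ▸ two_pos)
      obtain ⟨h1, h2⟩ := (mem_cellsOf_iff (mem_interiorFaces.1 e.2).1).1 hK
      exact (A.volume_prism_eq h1 h2 ha).le) hs0 hc htraj hval
  have hsum : ∑ e : 𝔗.interiorFaces, 2 * 𝔗.jump f e.1 * (𝔗.fluxBound C V e.1 / φlow) *
      faceMeasure e.1 ≤ R / φlow * (eLpNorm V 2 (volume.restrict Ω)).toReal * 𝔗.seminorm f := by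
    rw [Finset.sum_coe_sort 𝔗.interiorFaces fun σ =>
      2 * 𝔗.jump f σ * (𝔗.fluxBound C V σ / φlow) * faceMeasure σ]
    have h1 := sum_jump_mul_flux_le A hϱ hC.le hV f
    have e1 : ∑ σ ∈ 𝔗.interiorFaces, 2 * 𝔗.jump f σ * (𝔗.fluxBound C V σ / φlow) * faceMeasure σ =
        2 / φlow * ∑ σ ∈ 𝔗.interiorFaces, 𝔗.jump f σ * 𝔗.fluxBound C V σ * faceMeasure σ := by
      rw [Finset.mul_sum]
      refine Finset.sum_congr rfl fun σ _ => ?_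
      ring
    rw [e1]
    refine (mul_le_mul_of_nonneg_left h1 (by positivity)).trans_eq ?_
    rw [hR]
    ring
  have hmeas : AEStronglyMeasurable (fun x => f (F s x) - f x) (volume.restrict Ω) := by
    refine ((P.aemeasurable_comp_flow hs0 htraj hval).sub ?_).aestronglyMeasurable
    -- Measurability of f itself comes from its composition with the time-0 map, which is almost
    -- everywhere the identity.
    refine (P.aemeasurable_comp_flow le_rfl (F := F) ?_ hval).congr ?_
    · exact A.isTraj_of_isFlow hd h hΓ X hF le_rfl (hs0.trans hsT)
    · filter_upwards [htraj] with x hx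
      rw [hx.1]
  have hB : 0 ≤ R * (flowConst φlow φup Γ T / φlow) * s *
      (eLpNorm V 2 (volume.restrict Ω)).toReal * 𝔗.seminorm f :=
    mul_nonneg (mul_nonneg (mul_nonneg (mul_nonneg (by positivity) (div_nonneg hc0 hlo.le)) hs0)
      ENNReal.toReal_nonneg) (Real.sqrt_nonneg _)
  have hfin : ∫⁻ x in Ω, ENNReal.ofReal |f (F s x) - f x| ≤
      ENNReal.ofReal (R * (flowConst φlow φup Γ T / φlow) * s *
        (eLpNorm V 2 (volume.restrict Ω)).toReal * 𝔗.seminorm f) := by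
    refine hlint.trans (ENNReal.ofReal_le_ofReal ?_)
    refine (mul_le_mul_of_nonneg_left hsum (mul_nonneg hc0 hs0)).trans_eq ?_
    ring
  refine ⟨⟨hmeas, ?_⟩, ?_⟩
  · rw [hasFiniteIntegral_iff_norm]
    exact hfin.trans_lt ENNReal.ofReal_lt_top
  · rw [integral_eq_lintegral_of_nonneg_ae (Eventually.of_forall fun x => abs_nonneg _)
      hmeas.norm]
    exact ENNReal.toReal_le_of_le_ofReal hB hfin

end PolytopalMesh

end EllamFlow

end

theorem lemma5p5 (d : ℕ) (hd : 1 ≤ d) (k : ℕ) (ϱ : ℝ) :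
    ∃ R : ℝ, 0 < R ∧
      ∀ (Ω : Set (EllamFlow.Sp d)) (𝔗 : EllamFlow.PolytopalMesh Ω), 𝔗.regularity ≤ ϱ →
      ∀ (φlow φup Γ : ℝ) (φ : EllamFlow.Sp d → ℝ) (V : EllamFlow.Sp d → EllamFlow.Sp d),
        EllamFlow.IsAdmissible 𝔗 k φlow φup Γ φ V →
      ∀ (T : ℝ), 0 < T →
      ∀ (F : ℝ → EllamFlow.Sp d → EllamFlow.Sp d),
        EllamFlow.IsFlow Ω 𝔗.diamondUnion φ V T F →
      ∀ s ∈ Set.Icc (-T) T, ∀ f : EllamFlow.Sp d → ℝ, 𝔗.IsPiecewiseConstant f →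
        MeasureTheory.IntegrableOn (fun x => f (F s x) - f x) Ω ∧
        ∫ x in Ω, |f (F s x) - f x| ≤
          R * (EllamFlow.flowConst φlow φup Γ T / φlow) * |s| *
            (MeasureTheory.eLpNorm V 2 (MeasureTheory.volume.restrict Ω)).toReal *
            𝔗.seminorm f := by
  obtain ⟨R, hR, hb⟩ := EllamFlow.PolytopalMesh.exists_translation_bound d hd k ϱ
  refine ⟨R, hR, fun Ω 𝔗 hϱ φlow φup Γ φ V h T _ F hF s hs f hf => ?_⟩
  rcases le_total 0 s with h0 | h0
  · rw [abs_of_nonneg h0]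
    exact hb Ω 𝔗 hϱ φlow φup Γ φ V h T F hF s h0 hs.2 f hf
  · have := hb Ω 𝔗 hϱ φlow φup Γ φ (-V) h.neg T _ hF.neg (-s) (by linarith) (by linarith [hs.1]) f hf
    rw [MeasureTheory.eLpNorm_neg] at this
    simpa only [neg_neg, abs_of_nonpos h0] using this
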